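/- **Conventions.** A logarithmic scheme $S$ is a scheme with a sheaf of commutative monoids $M_S$ on its small étale site and a homomorphism $\varepsilon : M_S \to (\mathcal O_S,\cdot)$ inducing an isomorphism $\varepsilon^{-1}(\mathcal O_S^\ast) \to \mathcal O_S^\ast$; a morphism $f : T\to S$ is a morphism of schemes with a compatible homomorphism $f^{-1}M_S \to M_T$. It is fs if étale-locally $M_S$ is the logarithmic structure associated to a finitely generated, integral, saturated monoid. $M_S^{\mathrm{gp}}$ is the sheaf of abelian groups on the small étale site associated to $U \mapsto M_S(U)^{\mathrm{gp}}$. All functors below are considered on the category of fs logarithmic schemes. The logarithmic multiplicative group is the functor $$\mathbf G_{\log}(S) = \Gamma(S, M_S^{\mathrm{gp}}).$$ Toric varieties are taken over $\mathbf Z$ and carry their toric logarithmic structures (the subsheaf of $\mathcal O$ generated étale-locally by the units and the monomial functions). In particular $\mathbf A^2 = \operatorname{Spec}\mathbf Z[x,y]$, its blowup $Y \to \mathbf A^2$ at the origin (the ideal $(x,y)$), and $\mathbf P^1 = \operatorname{Proj}\mathbf Z[x,y]$ are logarithmic schemes. There is a unique global section $x^{-1}y$ of $M_{\mathbf P^1}^{\mathrm{gp}}$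 which is the class of $y/x \in M_{\mathbf P^1}$ on the chart $x \neq 0$ and the inverse of the class of $x/y\in M_{\mathbf P^1}$ on the chart $y \ne 0$; pulling it back defines a map $\mathbf P^1 \to \mathbf G_{\log}$, $(x,y)\mapsto x^{-1}y$. A toric modification is a proper toric morphism $W\to A$ from a toric variety $W$ to an affine toric variety $A = \operatorname{Spec}\mathbf Z[P]$ (with $P$ a finitely generated saturated submonoid of $\mathbf Z^n$ generating $\mathbf Z^n$), such that $W$ is covered by finitely many affine toric open subvarieties $\operatorname{Spec} \mathbf Z[Q_i]$ with the same torus $\operatorname{Spec}\mathbf Z[\mathbf Z^n]$, on which the morphism is induced by inclusions $P\subseteq Q_i \subseteq \mathbf Z^n$ (that is, $W \to A$ is given by a subdivision of the cone of $A$). A morphism $X\to S$ of fs logarithmic schemes is a logarithmic modification if, strict étale-locally on $S$, it is the base change, in the category of fs logarithmic schemes, of a toric modification $W\to A$ along some morphism from (a strict étale neighbourhood in) $S$ to $A$. **Proposition.** The map $\mathbf P^1\to\mathbf G_{\log}$, $(x,y)\mapsto x^{-1}y$, is a logarithmic modification: for every fs logarithmic scheme $S$ and every map $S\to\mathbf G_{\log}$,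 the fibre product $\mathbf P^1\times_{\mathbf G_{\log}} S$ is representable by an fs logarithmic scheme, and its projection to $S$ is a logarithmic modification. Concretely, let $S$ be an fs logarithmic scheme. 1. For every $\alpha\in\Gamma(S,M_S^{\mathrm{gp}})$ and every point $s \in S$ there are an fs logarithmic scheme $U$, a strict étale map $U\to S$ whose image contains $s$, and $\beta,\gamma\in\Gamma(U,M_U)$ with $\alpha|_U=\beta^{-1}\gamma$. 2. For all $\beta,\gamma\in\Gamma(S,M_S)$ there is a unique morphism $(\beta,\gamma) : S\to\mathbf A^2$ of logarithmic schemes under which the coordinates $x,y\in\Gamma(\mathbf A^2,M_{\mathbf A^2})$ pull back to $\beta,\gamma$. 3. If $h : S\to \mathbf A^2$ is the morphism $(\beta,\gamma)$ and $\alpha=\beta^{-1}\gamma \in \Gamma(S, M_S^{\mathrm{gp}})$, then $$\mathbf P^1\times_{\mathbf G_{\log},\,\alpha} S\;\simeq\; Y\times_{\mathbf A^2,\,h} S$$ as functors over $S$ on fs logarithmic schemes. -/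

import Mathlib

open CategoryTheory AlgebraicGeometry Opposite Limits

universe u

namespace LogGeometry

noncomputable section

/-! ### The small étale site of a scheme and its structure sheaf -/

/-- The structure presheaf `U ↦ Γ(U, 𝒪_U)` on the small étale site of `X`. -/
abbrev structurePresheaf (X : Scheme.{u}) : X.Etaleᵒᵖ ⥤ CommRingCat.{u} :=
  (Scheme.Etale.forget X ⋙ Over.forget X).op ⋙ Scheme.Γ

/-- The multiplicative monoids `U ↦ (Γ(U, 𝒪_U), ·)` on the small étale site of `X`. -/
abbrev multStructure (X : Scheme.{u}) : X.Etaleᵒᵖ ⥤ CommMonCat.{u} :=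
  structurePresheaf X ⋙ forget₂ CommRingCat CommMonCat

theorem mem_smallEtale_iff {X : Scheme.{u}} {U : X.Etale} (R : Sieve U) :
    R ∈ X.smallEtaleTopology U ↔
      ∀ x : U.left, ∃ (V : X.Etale) (f : V ⟶ U) (y : V.left), R f ∧ f.left y = x := by
  have hR : R = Sieve.ofArrows (fun i : Σ V : X.Etale, {f : V ⟶ U // R f} => i.1)
      (fun i => i.2.1) := by
    ext V f
    constructor
    · intro hf
      exact (Sieve.mem_ofArrows_iff _ _ _).2 ⟨⟨V, f, hf⟩, 𝟙 _, by simp⟩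
    · intro hf
      obtain ⟨i, a, rfl⟩ := (Sieve.mem_ofArrows_iff _ _ _).1 hf
      exact R.downward_closed i.2.2 a
  rw [hR, Scheme.ofArrows_mem_smallEtaleTopology_iff, ← hR, Set.eq_univ_iff_forall]
  refine forall_congr' fun x => ?_
  simp only [Set.mem_iUnion, Set.mem_range]
  constructor
  · rintro ⟨⟨V, f, hf⟩, y, hy⟩
    exact ⟨V, f, y, hf, hy⟩
  · rintro ⟨V, f, y, hf, hy⟩
    exact ⟨⟨V, f, hf⟩, y, hy⟩

theorem coverPreserving_etaleForget (X : Scheme.{u}) :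
    CoverPreserving X.smallEtaleTopology (Scheme.etaleTopology.over X)
      (Scheme.Etale.forget X) where
  cover_preserve {U R} hR := by
    rw [mem_smallEtale_iff] at hR
    rw [GrothendieckTopology.mem_over_iff]
    choose V f y hf hy using hR
    let 𝒰 : Scheme.Cover (Scheme.precoverage @Etale) U.left :=
      Scheme.Cover.mkOfCovers U.left (fun x => (V x).left) (fun x => (f x).left)
        (fun x => ⟨x, y x, hy x⟩) (fun x => inferInstanceAs (Etale (f x).left))
    refine GrothendieckTopology.superset_covering _ ?_
      (Precoverage.generate_mem_toGrothendieck 𝒰.mem₀)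
    refine (Sieve.generate_le_iff _ _).2 ?_
    rintro _ _ ⟨x⟩
    refine (Sieve.overEquiv_iff _ _).2 ⟨V x, f x, Over.homMk (𝟙 (V x).left) ?_, hf x, ?_⟩
    · exact (Category.id_comp _).trans (Over.w ((Scheme.Etale.forget X).map (f x))).symm
    · exact Over.OverMorphism.ext (Category.id_comp _).symm

instance etaleForget_flat (X : Scheme.{u}) : RepresentablyFlat (Scheme.Etale.forget X) :=
  flat_of_preservesFiniteLimits _

instance etaleForget_continuous (X : Scheme.{u}) :
    (Scheme.Etale.forget X).IsContinuous X.smallEtaleTopology (Scheme.etaleTopology.over X) := by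
  rw [Functor.isContinuous_iff_coverPreserving]
  exact coverPreserving_etaleForget X

instance etaleForget_forget_continuous (X : Scheme.{u}) :
    (Scheme.Etale.forget X ⋙ Over.forget X).IsContinuous X.smallEtaleTopology
      Scheme.etaleTopology :=
  Functor.isContinuous_comp _ _ _ (Scheme.etaleTopology.over X) _

theorem etaleTopology_le_fppfTopology : Scheme.etaleTopology.{u} ≤ Scheme.fppfTopology := by
  apply Precoverage.toGrothendieck_mono
  apply Scheme.precoverage_mono
  intro X Y f hf
  have : Etale f := hf
  exact ⟨inferInstance, inferInstance⟩

theorem toSpecMvPoly_natural {X Y : Scheme.{u}} (f : Y ⟶ X) (s : PUnit.{u + 1} → Γ(X, ⊤)) :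
    (AffineSpace.toSpecMvPolyIntEquiv PUnit.{u + 1}).symm (fun i => f.appTop (s i)) =
      f ≫ (AffineSpace.toSpecMvPolyIntEquiv PUnit.{u + 1}).symm s := by
  apply (AffineSpace.toSpecMvPolyIntEquiv PUnit.{u + 1}).injective
  ext i
  rw [AffineSpace.toSpecMvPolyIntEquiv_comp]
  simp

/-- Global sections are represented by the affine line. -/
def globalSectionsIso : Scheme.Γ.{u} ⋙ forget CommRingCat ≅
    yoneda.obj (Spec (.of (MvPolynomial PUnit.{u + 1} (ULift.{u} ℤ)))) :=
  NatIso.ofComponents (fun X => Equiv.toIso ((Equiv.funUnique PUnit.{u + 1} Γ(X.unop, ⊤)).symm.trans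
    (AffineSpace.toSpecMvPolyIntEquiv PUnit.{u + 1}).symm)) (by
      intro X Y f
      ext s
      exact toSpecMvPoly_natural f.unop (fun _ => s))

theorem isSheaf_structurePresheaf (X : Scheme.{u}) :
    Presieve.IsSheaf X.smallEtaleTopology (structurePresheaf X ⋙ forget CommRingCat.{u}) := by
  have : Presheaf.IsSheaf Scheme.etaleTopology.{u} (Scheme.Γ.{u} ⋙ forget CommRingCat) := by
    rw [Presheaf.isSheaf_of_iso_iff globalSectionsIso, isSheaf_iff_isSheaf_of_type]
    exact Presieve.isSheaf_of_le _ etaleTopology_le_fppfTopology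
      (GrothendieckTopology.Subcanonical.isSheaf_of_isRepresentable _)
  rw [← isSheaf_iff_isSheaf_of_type]
  exact (Scheme.Etale.forget X ⋙ Over.forget X).op_comp_isSheaf_of_isSheaf _ _ _ this

/-- A morphism over `X` between schemes étale over `X`, as a morphism of the small étale site. -/
def etaleHomMk {X : Scheme.{u}} {U V : X.Etale} (f : U.left ⟶ V.left)
    (w : f ≫ V.hom = U.hom) : U ⟶ V :=
  (Scheme.Etale.forgetFullyFaithful X).preimage
    (Over.homMk f w : (Scheme.Etale.forget X).obj U ⟶ (Scheme.Etale.forget X).obj V)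

theorem etaleHomMk_left {X : Scheme.{u}} {U V : X.Etale} (f : U.left ⟶ V.left)
    (w : f ≫ V.hom = U.hom) : (etaleHomMk f w).left = f :=
  congrArg CommaMorphism.left ((Scheme.Etale.forgetFullyFaithful X).map_preimage
    (Over.homMk f w : (Scheme.Etale.forget X).obj U ⟶ (Scheme.Etale.forget X).obj V))

theorem etaleHom_w {X : Scheme.{u}} {U V : X.Etale} (a : U ⟶ V) : a.left ≫ V.hom = U.hom :=
  Over.w ((Scheme.Etale.forget X).map a)

theorem etaleHom_ext {X : Scheme.{u}} {U V : X.Etale} {a b : U ⟶ V} (h : a.left = b.left) :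
    a = b :=
  (Scheme.Etale.forgetFullyFaithful X).map_injective (Over.OverMorphism.ext h)

theorem etale_comp_left {X : Scheme.{u}} {U V W : X.Etale} (a : U ⟶ V) (b : V ⟶ W) :
    (a ≫ b).left = a.left ≫ b.left := rfl

theorem etale_id_left {X : Scheme.{u}} (U : X.Etale) : (𝟙 U : U ⟶ U).left = 𝟙 U.left := rfl

/-! ### Logarithmic schemes -/

/-- A logarithmic scheme: a scheme with a sheaf of commutative monoids `M` on its small étale site
and a homomorphism `exp : M → (𝒪, ·)` which restricts to an isomorphism `exp⁻¹(𝒪ˣ) → 𝒪ˣ`. -/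
structure LogScheme where
  scheme : Scheme.{u}
  M : scheme.Etaleᵒᵖ ⥤ CommMonCat.{u}
  isSheaf : Presieve.IsSheaf scheme.smallEtaleTopology (M ⋙ forget CommMonCat)
  exp : M ⟶ multStructure scheme
  existsUnique_unit : ∀ (U : scheme.Etale) (f : Γ(U.left, ⊤)), IsUnit f →
    ∃! m : M.obj (op U), exp.app (op U) m = f

namespace LogScheme

/-- The monoid of sections `M(U)`. -/
abbrev sec (X : LogScheme.{u}) (U : X.scheme.Etale) : Type u := X.M.obj (op U)

/-- Restriction of sections of `M`. -/
def res (X : LogScheme.{u}) {U V : X.scheme.Etale} (a : U ⟶ V) : X.sec V →* X.sec U :=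
  (X.M.map a.op).hom

/-- The homomorphism `M(U) → Γ(U, 𝒪_U)`. -/
def expSec (X : LogScheme.{u}) (U : X.scheme.Etale) : X.sec U →* Γ(U.left, ⊤) :=
  (X.exp.app (op U)).hom

theorem res_id (X : LogScheme.{u}) {U : X.scheme.Etale} (m : X.sec U) : X.res (𝟙 U) m = m := by
  simp [res]

theorem res_comp (X : LogScheme.{u}) {U V W : X.scheme.Etale} (a : U ⟶ V) (b : V ⟶ W)
    (m : X.sec W) : X.res (a ≫ b) m = X.res a (X.res b m) := by
  simp [res]

theorem expSec_res (X : LogScheme.{u}) {U V : X.scheme.Etale} (a : U ⟶ V) (m : X.sec V) :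
    X.expSec U (X.res a m) = a.left.appTop (X.expSec V m) :=
  ConcreteCategory.congr_hom (X.exp.naturality a.op) m

/-- A morphism of logarithmic schemes `X → Y`: a morphism `f` of schemes together with a
homomorphism `f⁻¹ M_Y → M_X` of sheaves of monoids compatible with the maps to the structure
sheaves.  The homomorphism is given by maps `M_Y(V) → M_X(U)`, one for each commutative square with
étale vertical maps `U → X`, `V → Y` and horizontal maps `g : U → V`, `f : X → Y`, compatible with
restriction in `U` and in `V`. -/
@[ext]
structure Hom (X Y : LogScheme.{u}) where
  f : X.scheme ⟶ Y.scheme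
  pull : ∀ {U : X.scheme.Etale} {V : Y.scheme.Etale} (g : U.left ⟶ V.left),
    g ≫ V.hom = U.hom ≫ f → (Y.sec V →* X.sec U)
  pull_res : ∀ {U U' : X.scheme.Etale} {V V' : Y.scheme.Etale} (a : U' ⟶ U) (b : V ⟶ V')
    (g : U.left ⟶ V.left) (w : g ≫ V.hom = U.hom ≫ f) (g' : U'.left ⟶ V'.left)
    (w' : g' ≫ V'.hom = U'.hom ≫ f), g' = a.left ≫ g ≫ b.left →
    ∀ m : Y.sec V', pull g' w' m = X.res a (pull g w (Y.res b m))
  expSec_pull : ∀ {U : X.scheme.Etale} {V : Y.scheme.Etale} (g : U.left ⟶ V.left)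
    (w : g ≫ V.hom = U.hom ≫ f) (m : Y.sec V),
    X.expSec U (pull g w m) = g.appTop (Y.expSec V m)


namespace Hom

/-- The identity morphism. -/
def id (X : LogScheme.{u}) : Hom X X where
  f := 𝟙 _
  pull g w := X.res (etaleHomMk g (w.trans (Category.comp_id _)))
  pull_res a b g w g' w' h m := by
    rw [← res_comp, ← res_comp]
    congr 2
    apply etaleHom_ext
    simp only [etale_comp_left, etaleHomMk_left, h, Category.assoc]
  expSec_pull g w m := by
    rw [expSec_res, etaleHomMk_left]

variable {X Y Z : LogScheme.{u}}

/-- The base change of an étale `W → Z` along a morphism to `Z`. -/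
def pullbackEtale {S T : Scheme.{u}} (f : S ⟶ T) (W : T.Etale) : S.Etale :=
  Scheme.Etale.mk (pullback.fst f (W.hom : W.left ⟶ T))

/-- The projection of the base change to `W`. -/
def pullbackEtaleSnd {S T : Scheme.{u}} (f : S ⟶ T) (W : T.Etale) :
    (pullbackEtale f W).left ⟶ W.left :=
  pullback.snd f (W.hom : W.left ⟶ T)

theorem pullbackEtale_w {S T : Scheme.{u}} (f : S ⟶ T) (W : T.Etale) :
    pullbackEtaleSnd f W ≫ W.hom = (pullbackEtale f W).hom ≫ f :=
  pullback.condition.symm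

/-- The universal property of the base change. -/
def pullbackEtaleLift {S T U : Scheme.{u}} (f : S ⟶ T) (W : T.Etale) (p : U ⟶ S)
    (q : U ⟶ W.left) (w : q ≫ W.hom = p ≫ f) : U ⟶ (pullbackEtale f W).left :=
  pullback.lift p q w.symm

theorem pullbackEtaleLift_hom {S T U : Scheme.{u}} (f : S ⟶ T) (W : T.Etale) (p : U ⟶ S)
    (q : U ⟶ W.left) (w : q ≫ W.hom = p ≫ f) :
    pullbackEtaleLift f W p q w ≫ (pullbackEtale f W).hom = p :=
  pullback.lift_fst _ _ _

theorem pullbackEtaleLift_snd {S T U : Scheme.{u}} (f : S ⟶ T) (W : T.Etale) (p : U ⟶ S)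
    (q : U ⟶ W.left) (w : q ≫ W.hom = p ≫ f) :
    pullbackEtaleLift f W p q w ≫ pullbackEtaleSnd f W = q :=
  pullback.lift_snd _ _ _

theorem pullbackEtale_hom_ext {S T U : Scheme.{u}} {f : S ⟶ T} {W : T.Etale}
    {a b : U ⟶ (pullbackEtale f W).left}
    (h : a ≫ (pullbackEtale f W).hom = b ≫ (pullbackEtale f W).hom)
    (h' : a ≫ pullbackEtaleSnd f W = b ≫ pullbackEtaleSnd f W) : a = b :=
  pullback.hom_ext h h'

/-- Pulling back sections along `F` and `G` successively. -/
def compPull (F : Hom X Y) (G : Hom Y Z) {U : X.scheme.Etale} {W : Z.scheme.Etale}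
    (g : U.left ⟶ W.left) (w : g ≫ W.hom = U.hom ≫ F.f ≫ G.f) : Z.sec W →* X.sec U :=
  (F.pull (pullbackEtaleLift G.f W (U.hom ≫ F.f) g (w.trans (Category.assoc _ _ _).symm))
    (pullbackEtaleLift_hom _ _ _ _ _)).comp
    (G.pull (pullbackEtaleSnd G.f W) (pullbackEtale_w G.f W))

theorem compPull_eq (F : Hom X Y) (G : Hom Y Z) {U : X.scheme.Etale} {V : Y.scheme.Etale}
    {W : Z.scheme.Etale} (g₁ : U.left ⟶ V.left) (w₁ : g₁ ≫ V.hom = U.hom ≫ F.f)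
    (g₂ : V.left ⟶ W.left) (w₂ : g₂ ≫ W.hom = V.hom ≫ G.f)
    (g : U.left ⟶ W.left) (w : g ≫ W.hom = U.hom ≫ F.f ≫ G.f) (hg : g = g₁ ≫ g₂)
    (m : Z.sec W) : compPull F G g w m = F.pull g₁ w₁ (G.pull g₂ w₂ m) := by
  let c : V.left ⟶ (pullbackEtale G.f W).left := pullbackEtaleLift G.f W V.hom g₂ w₂
  have hc : c ≫ (pullbackEtale G.f W).hom = V.hom := pullbackEtaleLift_hom _ _ _ _ _
  have hc' : c ≫ pullbackEtaleSnd G.f W = g₂ := pullbackEtaleLift_snd _ _ _ _ _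
  have hgc : pullbackEtaleLift G.f W (U.hom ≫ F.f) g (w.trans (Category.assoc _ _ _).symm) =
      g₁ ≫ c := by
    refine pullbackEtale_hom_ext ?_ ?_
    · exact (pullbackEtaleLift_hom _ _ _ _ _).trans (w₁.symm.trans
        ((congrArg (g₁ ≫ ·) hc.symm).trans (Category.assoc _ _ _).symm))
    · exact (pullbackEtaleLift_snd _ _ _ _ _).trans (hg.trans
        ((congrArg (g₁ ≫ ·) hc'.symm).trans (Category.assoc _ _ _).symm))
  have e₁ := F.pull_res (𝟙 U) (etaleHomMk c hc) g₁ w₁ _ (pullbackEtaleLift_hom G.f W _ g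
      (w.trans (Category.assoc _ _ _).symm))
    (by rw [etaleHomMk_left, etale_id_left, Category.id_comp]; exact hgc)
    (G.pull (pullbackEtaleSnd G.f W) (pullbackEtale_w G.f W) m)
  have e₂ := G.pull_res (etaleHomMk c hc) (𝟙 W) (pullbackEtaleSnd G.f W) (pullbackEtale_w G.f W)
    g₂ w₂ (by rw [etaleHomMk_left, etale_id_left, Category.comp_id]; exact hc'.symm) m
  rw [res_id] at e₁ e₂
  rw [e₂, ← e₁]
  rfl

/-- Composition of morphisms of logarithmic schemes. -/
def comp (F : Hom X Y) (G : Hom Y Z) : Hom X Z where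
  f := F.f ≫ G.f
  pull g w := compPull F G g w
  pull_res {U U' W W'} a b g w g' w' h m := by
    have hw := w.trans (Category.assoc _ _ _).symm
    let g₁ := pullbackEtaleLift G.f W (U.hom ≫ F.f) g hw
    have w₁ : g₁ ≫ (pullbackEtale G.f W).hom = U.hom ≫ F.f := pullbackEtaleLift_hom _ _ _ _ _
    have hg : g₁ ≫ pullbackEtaleSnd G.f W = g := pullbackEtaleLift_snd _ _ _ _ _
    have w₁' : (a.left ≫ g₁) ≫ (pullbackEtale G.f W).hom = U'.hom ≫ F.f :=
      (Category.assoc _ _ _).trans ((congrArg (a.left ≫ ·) w₁).trans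
        ((Category.assoc _ _ _).symm.trans (congrArg (· ≫ F.f) (etaleHom_w a))))
    have w₂' : (pullbackEtaleSnd G.f W ≫ b.left) ≫ W'.hom = (pullbackEtale G.f W).hom ≫ G.f :=
      (Category.assoc _ _ _).trans ((congrArg (_ ≫ ·) (etaleHom_w b)).trans
        (pullbackEtale_w G.f W))
    have e₀ : g' = (a.left ≫ g₁) ≫ pullbackEtaleSnd G.f W ≫ b.left := by
      rw [h, ← hg]
      simp only [Category.assoc]
    rw [compPull_eq F G g₁ w₁ _ (pullbackEtale_w G.f W) g w hg.symm,
      compPull_eq F G (a.left ≫ g₁) w₁' _ w₂' g' w' e₀,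
      G.pull_res (𝟙 _) b _ (pullbackEtale_w G.f W) _ w₂'
        (by rw [etale_id_left, Category.id_comp]) m, res_id,
      F.pull_res a (𝟙 _) g₁ w₁ _ w₁' (by rw [etale_id_left, Category.comp_id]) _, res_id]
  expSec_pull {U W} g w m := by
    have hw := w.trans (Category.assoc _ _ _).symm
    let g₁ := pullbackEtaleLift G.f W (U.hom ≫ F.f) g hw
    have w₁ : g₁ ≫ (pullbackEtale G.f W).hom = U.hom ≫ F.f := pullbackEtaleLift_hom _ _ _ _ _
    have hg : g₁ ≫ pullbackEtaleSnd G.f W = g := pullbackEtaleLift_snd _ _ _ _ _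
    rw [compPull_eq F G g₁ w₁ _ (pullbackEtale_w G.f W) g w hg.symm, F.expSec_pull, G.expSec_pull,
      ← hg]
    exact (ConcreteCategory.congr_hom (Scheme.Hom.comp_appTop g₁ _) _).symm

theorem pull_congr (F : Hom X Y) {U : X.scheme.Etale} {V : Y.scheme.Etale}
    {g g' : U.left ⟶ V.left} (h : g = g') (w : g ≫ V.hom = U.hom ≫ F.f)
    (w' : g' ≫ V.hom = U.hom ≫ F.f) (m : Y.sec V) : F.pull g w m = F.pull g' w' m := by
  subst h
  rfl

theorem ext' {F G : Hom X Y} (h : F.f = G.f)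
    (h' : ∀ {U : X.scheme.Etale} {V : Y.scheme.Etale} (g : U.left ⟶ V.left)
      (w : g ≫ V.hom = U.hom ≫ F.f) (w' : g ≫ V.hom = U.hom ≫ G.f) (m : Y.sec V),
      F.pull g w m = G.pull g w' m) : F = G := by
  obtain ⟨f, p, hp, hp'⟩ := F
  obtain ⟨f', q, hq, hq'⟩ := G
  obtain rfl : f = f' := h
  congr 1
  funext U V g w
  exact MonoidHom.ext (h' g w w)

end Hom

instance : Category.{u + 1} LogScheme.{u} where
  Hom := Hom
  id := Hom.id
  comp := Hom.comp
  id_comp {X Y} F := by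
    refine Hom.ext' (Category.id_comp _) fun {U V} g w w' m => ?_
    refine (Hom.compPull_eq (Hom.id X) F (𝟙 U.left)
      ((Category.id_comp _).trans (Category.comp_id _).symm) g w' g w
      (Category.id_comp _).symm m).trans ?_
    refine Eq.trans ?_ (res_id X _)
    exact congrArg (fun a => X.res a (F.pull g w' m)) (etaleHom_ext (etaleHomMk_left _ _))
  comp_id {X Y} F := by
    refine Hom.ext' (Category.comp_id _) fun {U V} g w w' m => ?_
    refine (Hom.compPull_eq F (Hom.id Y) g w' (𝟙 V.left)
      ((Category.id_comp _).trans (Category.comp_id _).symm) g w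
      (Category.comp_id _).symm m).trans ?_
    refine congrArg (F.pull g w') (Eq.trans ?_ (res_id Y _))
    exact congrArg (fun a => Y.res a m) (etaleHom_ext (etaleHomMk_left _ _))
  assoc {W X Y Z} F G H := by
    refine Hom.ext' (Category.assoc _ _ _) fun {U T} g w w' m => ?_
    have hw : g ≫ T.hom = (U.hom ≫ F.f ≫ G.f) ≫ H.f :=
      w.trans (Category.assoc _ _ _).symm
    let V := Hom.pullbackEtale H.f T
    let p : U.left ⟶ V.left := Hom.pullbackEtaleLift H.f T (U.hom ≫ F.f ≫ G.f) g hw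
    have hp : p ≫ V.hom = U.hom ≫ F.f ≫ G.f := Hom.pullbackEtaleLift_hom _ _ _ _ _
    have hp' : p ≫ Hom.pullbackEtaleSnd H.f T = g := Hom.pullbackEtaleLift_snd _ _ _ _ _
    have hq := hp.trans (Category.assoc _ _ _).symm
    let V' := Hom.pullbackEtale G.f V
    let q : U.left ⟶ V'.left := Hom.pullbackEtaleLift G.f V (U.hom ≫ F.f) p hq
    have hq₁ : q ≫ V'.hom = U.hom ≫ F.f := Hom.pullbackEtaleLift_hom _ _ _ _ _
    have hq₂ : q ≫ Hom.pullbackEtaleSnd G.f V = p := Hom.pullbackEtaleLift_snd _ _ _ _ _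
    have wGH : (Hom.pullbackEtaleSnd G.f V ≫ Hom.pullbackEtaleSnd H.f T) ≫ T.hom =
        V'.hom ≫ G.f ≫ H.f :=
      (Category.assoc _ _ _).trans ((congrArg (_ ≫ ·) (Hom.pullbackEtale_w H.f T)).trans
        ((Category.assoc _ _ _).symm.trans
          ((congrArg (· ≫ H.f) (Hom.pullbackEtale_w G.f V)).trans (Category.assoc _ _ _))))
    refine (Hom.compPull_eq (Hom.comp F G) H p hp _ (Hom.pullbackEtale_w H.f T) g w
      hp'.symm m).trans ?_
    refine (Hom.compPull_eq F G q hq₁ _ (Hom.pullbackEtale_w G.f V) p hp hq₂.symm _).trans ?_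
    refine Eq.trans ?_ (Hom.compPull_eq F (Hom.comp G H) q hq₁ _ wGH g w'
      (by rw [← hp', ← hq₂]; exact Category.assoc _ _ _) m).symm
    exact congrArg _ (Hom.compPull_eq G H _ (Hom.pullbackEtale_w G.f V) _
      (Hom.pullbackEtale_w H.f T) _ wGH rfl m).symm

@[simp] theorem id_f (X : LogScheme.{u}) : Hom.f (𝟙 X) = 𝟙 X.scheme := rfl

@[simp] theorem comp_f {X Y Z : LogScheme.{u}} (F : X ⟶ Y) (G : Y ⟶ Z) :
    Hom.f (F ≫ G) = F.f ≫ G.f := rfl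

theorem id_pull (X : LogScheme.{u}) {U V : X.scheme.Etale} (g : U.left ⟶ V.left)
    (w : g ≫ V.hom = U.hom ≫ 𝟙 X.scheme) (m : X.sec V) :
    Hom.pull (𝟙 X) g w m = X.res (etaleHomMk g (w.trans (Category.comp_id _))) m := rfl

theorem comp_pull {X Y Z : LogScheme.{u}} (F : X ⟶ Y) (G : Y ⟶ Z) {U : X.scheme.Etale}
    {V : Y.scheme.Etale} {W : Z.scheme.Etale} (g₁ : U.left ⟶ V.left)
    (w₁ : g₁ ≫ V.hom = U.hom ≫ F.f) (g₂ : V.left ⟶ W.left) (w₂ : g₂ ≫ W.hom = V.hom ≫ G.f)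
    (g : U.left ⟶ W.left) (w : g ≫ W.hom = U.hom ≫ F.f ≫ G.f) (hg : g = g₁ ≫ g₂)
    (m : Z.sec W) : Hom.pull (F ≫ G) g w m = F.pull g₁ w₁ (G.pull g₂ w₂ m) :=
  Hom.compPull_eq F G g₁ w₁ g₂ w₂ g w hg m

/-! ### The sheaf of groups associated to `M` and the logarithmic multiplicative group -/

/-- The functoriality of the group completion of commutative monoids. -/
def gpMap {M N : Type u} [CommMonoid M] [CommMonoid N] (f : M →* N) :
    Algebra.GrothendieckGroup M →* Algebra.GrothendieckGroup N :=
  Algebra.GrothendieckGroup.lift (Algebra.GrothendieckGroup.of.comp f)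

theorem gpMap_of {M N : Type u} [CommMonoid M] [CommMonoid N] (f : M →* N) (m : M) :
    gpMap f (Algebra.GrothendieckGroup.of m) = Algebra.GrothendieckGroup.of (f m) :=
  (Localization.monoidOf (⊤ : Submonoid M)).lift_eq _ m

theorem gp_hom_ext {M G : Type u} [CommMonoid M] [CommGroup G]
    {f g : Algebra.GrothendieckGroup M →* G}
    (h : ∀ m, f (Algebra.GrothendieckGroup.of m) = g (Algebra.GrothendieckGroup.of m)) : f = g :=
  Algebra.GrothendieckGroup.lift.symm.injective (MonoidHom.ext h)

theorem gpMap_id {M : Type u} [CommMonoid M] (a : Algebra.GrothendieckGroup M) :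
    gpMap (MonoidHom.id M) a = a :=
  DFunLike.congr_fun (gp_hom_ext (f := gpMap (MonoidHom.id M)) (g := MonoidHom.id _)
    fun m => gpMap_of _ m) a

theorem gpMap_comp {M N P : Type u} [CommMonoid M] [CommMonoid N] [CommMonoid P] (f : M →* N)
    (g : N →* P) (a : Algebra.GrothendieckGroup M) : gpMap (g.comp f) a = gpMap g (gpMap f a) :=
  DFunLike.congr_fun (gp_hom_ext (f := gpMap (g.comp f)) (g := (gpMap g).comp (gpMap f))
    fun m => by simp only [gpMap_of, MonoidHom.comp_apply]) a

/-- Group completion as a functor. -/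
def gpFunctor : CommMonCat.{u} ⥤ CommGrpCat.{u} where
  obj M := CommGrpCat.of (Algebra.GrothendieckGroup M)
  map f := CommGrpCat.ofHom (gpMap f.hom)
  map_id M := by
    ext a
    exact gpMap_id a
  map_comp f g := by
    ext a
    exact gpMap_comp f.hom g.hom a

instance hasColimits_commGrpCat : HasColimits CommGrpCat.{u} :=
  Adjunction.has_colimits_of_equivalence commGroupAddCommGroupEquivalence.functor

variable (X : LogScheme.{u})

/-- The presheaf `U ↦ M(U)ᵍᵖ`. -/
abbrev preGp : X.scheme.Etaleᵒᵖ ⥤ CommGrpCat.{u} := X.M ⋙ gpFunctor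

/-- The sheaf of abelian groups `Mᵍᵖ` on the small étale site, associated to `U ↦ M(U)ᵍᵖ`. -/
def Mgp : Sheaf X.scheme.smallEtaleTopology CommGrpCat.{u} :=
  (presheafToSheaf _ _).obj X.preGp

/-- The group of sections `Γ(U, Mᵍᵖ)`. -/
abbrev gpSec (U : X.scheme.Etale) : Type u := X.Mgp.obj.obj (op U)

/-- Restriction of sections of `Mᵍᵖ`. -/
def gpRes {U V : X.scheme.Etale} (a : U ⟶ V) : X.gpSec V →* X.gpSec U :=
  (X.Mgp.obj.map a.op).hom

/-- The canonical map `M(U)ᵍᵖ → Γ(U, Mᵍᵖ)`. -/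
def toGp (U : X.scheme.Etale) : Algebra.GrothendieckGroup (X.sec U) →* X.gpSec U :=
  ((toSheafify X.scheme.smallEtaleTopology X.preGp).app (op U)).hom

/-- The canonical map `M(U) → Γ(U, Mᵍᵖ)`. -/
def secToGp (U : X.scheme.Etale) : X.sec U →* X.gpSec U :=
  (X.toGp U).comp Algebra.GrothendieckGroup.of

theorem gpRes_id {U : X.scheme.Etale} (s : X.gpSec U) : X.gpRes (𝟙 U) s = s := by
  simp [gpRes]

theorem gpRes_comp {U V W : X.scheme.Etale} (a : U ⟶ V) (b : V ⟶ W)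
    (s : X.gpSec W) : X.gpRes (a ≫ b) s = X.gpRes a (X.gpRes b s) := by
  simp [gpRes]

theorem gpRes_toGp {U V : X.scheme.Etale} (a : U ⟶ V)
    (x : Algebra.GrothendieckGroup (X.sec V)) :
    X.gpRes a (X.toGp V x) = X.toGp U (gpMap (X.res a) x) :=
  (ConcreteCategory.congr_hom
    ((toSheafify X.scheme.smallEtaleTopology X.preGp).naturality a.op) x).symm

theorem isSheaf_gp :
    Presieve.IsSheaf X.scheme.smallEtaleTopology (X.Mgp.obj ⋙ forget CommGrpCat) := by
  rw [← isSheaf_iff_isSheaf_of_type]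
  exact ((sheafCompose X.scheme.smallEtaleTopology (forget CommGrpCat.{u})).obj X.Mgp).property

/-- The final object of the small étale site. -/
abbrev top : X.scheme.Etale := Scheme.Etale.mk (𝟙 X.scheme)

/-- The structure morphism, as a morphism of the small étale site. -/
def toTop (U : X.scheme.Etale) : U ⟶ X.top :=
  etaleHomMk (V := X.top) U.hom (Category.comp_id _)

theorem toTop_comp {U V : X.scheme.Etale} (a : U ⟶ V) : a ≫ X.toTop V = X.toTop U := by
  apply etaleHom_ext
  rw [etale_comp_left]
  exact (congrArg (a.left ≫ ·) (etaleHomMk_left (V := X.top) V.hom (Category.comp_id _))).trans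
    ((etaleHom_w a).trans (etaleHomMk_left (V := X.top) U.hom (Category.comp_id _)).symm)

theorem toTop_eq {U : X.scheme.Etale} (a : U ⟶ X.top) : a = X.toTop U := by
  apply etaleHom_ext
  refine Eq.trans ?_ (etaleHomMk_left (V := X.top) U.hom (Category.comp_id _)).symm
  exact (Category.comp_id _).symm.trans (etaleHom_w a)

theorem exists_toGp {V : X.scheme.Etale} (s : X.gpSec V) (v : V.left) :
    ∃ (W : X.scheme.Etale) (a : W ⟶ V) (y : W.left) (x : Algebra.GrothendieckGroup (X.sec W)),
      a.left y = v ∧ X.gpRes a s = X.toGp W x := by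
  have : Presheaf.IsLocallySurjective X.scheme.smallEtaleTopology
    (toSheafify X.scheme.smallEtaleTopology X.preGp) := inferInstance
  have h := Presheaf.imageSieve_mem X.scheme.smallEtaleTopology
    (toSheafify X.scheme.smallEtaleTopology X.preGp) (U := op V) s
  obtain ⟨W, a, y, ⟨x, hx⟩, hy⟩ := (mem_smallEtale_iff _).1 h v
  exact ⟨W, a, y, x, hy, hx.symm⟩

theorem toGp_eq {V : X.scheme.Etale} {x y : Algebra.GrothendieckGroup (X.sec V)}
    (h : X.toGp V x = X.toGp V y) (v : V.left) :
    ∃ (W : X.scheme.Etale) (a : W ⟶ V) (w : W.left),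
      a.left w = v ∧ gpMap (X.res a) x = gpMap (X.res a) y := by
  have : Presheaf.IsLocallyInjective X.scheme.smallEtaleTopology
    (toSheafify X.scheme.smallEtaleTopology X.preGp) := inferInstance
  have h := Presheaf.equalizerSieve_mem X.scheme.smallEtaleTopology
    (toSheafify X.scheme.smallEtaleTopology X.preGp) (X := op V) x y h
  obtain ⟨W, a, w, hx, hy⟩ := (mem_smallEtale_iff _).1 h v
  exact ⟨W, a, w, hy, hx⟩

theorem gpSec_ext {V : X.scheme.Etale} {s t : X.gpSec V}
    (h : ∀ v : V.left, ∃ (W : X.scheme.Etale) (a : W ⟶ V) (w : W.left),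
      a.left w = v ∧ X.gpRes a s = X.gpRes a t) : s = t := by
  let R : Sieve V :=
    { arrows := fun W a => X.gpRes a s = X.gpRes a t
      downward_closed := by
        intro W W' a ha b
        rw [gpRes_comp, ha, gpRes_comp] }
  have hR : R ∈ X.scheme.smallEtaleTopology V := (mem_smallEtale_iff _).2 fun v => by
    obtain ⟨W, a, w, hw, e⟩ := h v
    exact ⟨W, a, w, e, hw⟩
  exact (X.isSheaf_gp R hR).isSeparatedFor.ext fun W a ha => ha

variable {X}
variable {Y : LogScheme.{u}}

/-- `t` is the pullback of the global section `s` of `M_Yᵍᵖ` under `F : X → Y`: wherever `s` is the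
image of a quotient of two sections of `M_Y`, `t` is the image of the pulled back quotient. -/
def IsGpPullback (F : X ⟶ Y) (s : Y.gpSec Y.top) (t : X.gpSec X.top) : Prop :=
  ∀ {U : X.scheme.Etale} {V : Y.scheme.Etale} (g : U.left ⟶ V.left) (w : g ≫ V.hom = U.hom ≫ F.f)
    (x : Algebra.GrothendieckGroup (Y.sec V)), Y.gpRes (Y.toTop V) s = Y.toGp V x →
    X.gpRes (X.toTop U) t = X.toGp U (gpMap (F.pull g w) x)

theorem exists_point_pullbackEtale {S T : Scheme.{u}} (f : S ⟶ T) (W : T.Etale) (s : S)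
    (w : W.left) (h : f s = (W.hom : W.left ⟶ T) w) :
    ∃ z : (Hom.pullbackEtale f W).left, ((Hom.pullbackEtale f W).hom : _ ⟶ S) z = s := by
  obtain ⟨z, hz, -⟩ := Scheme.Pullback.exists_preimage_pullback s w h
  exact ⟨z, hz⟩

theorem Hom.pull_res' (F : X ⟶ Y) {U : X.scheme.Etale} {V V' : Y.scheme.Etale}
    (g : U.left ⟶ V.left) (w : g ≫ V.hom = U.hom ≫ F.f) (b : V ⟶ V') (g' : U.left ⟶ V'.left)
    (w' : g' ≫ V'.hom = U.hom ≫ F.f) (h : g' = g ≫ b.left) (m : Y.sec V') :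
    F.pull g' w' m = F.pull g w (Y.res b m) := by
  rw [F.pull_res (𝟙 U) b g w g' w' (by rw [h, etale_id_left, Category.id_comp]), res_id]

theorem Hom.res_pull (F : X ⟶ Y) {U U' : X.scheme.Etale} {V : Y.scheme.Etale}
    (g : U.left ⟶ V.left) (w : g ≫ V.hom = U.hom ≫ F.f) (a : U' ⟶ U) (g' : U'.left ⟶ V.left)
    (w' : g' ≫ V.hom = U'.hom ≫ F.f) (h : g' = a.left ≫ g) (m : Y.sec V) :
    X.res a (F.pull g w m) = F.pull g' w' m := by
  rw [F.pull_res a (𝟙 V) g w g' w' (by rw [h, etale_id_left, Category.comp_id]), res_id]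


theorem gpMap_pull_res' (F : X ⟶ Y) {U : X.scheme.Etale} {V V' : Y.scheme.Etale}
    (g : U.left ⟶ V.left) (w : g ≫ V.hom = U.hom ≫ F.f) (b : V ⟶ V') (g' : U.left ⟶ V'.left)
    (w' : g' ≫ V'.hom = U.hom ≫ F.f) (h : g' = g ≫ b.left)
    (x : Algebra.GrothendieckGroup (Y.sec V')) :
    gpMap (F.pull g' w') x = gpMap (F.pull g w) (gpMap (Y.res b) x) := by
  rw [← gpMap_comp]
  exact congrArg (fun f => gpMap f x) (MonoidHom.ext (F.pull_res' g w b g' w' h))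

theorem gpMap_res_pull (F : X ⟶ Y) {U U' : X.scheme.Etale} {V : Y.scheme.Etale}
    (g : U.left ⟶ V.left) (w : g ≫ V.hom = U.hom ≫ F.f) (a : U' ⟶ U) (g' : U'.left ⟶ V.left)
    (w' : g' ≫ V.hom = U'.hom ≫ F.f) (h : g' = a.left ≫ g)
    (x : Algebra.GrothendieckGroup (Y.sec V)) :
    gpMap (X.res a) (gpMap (F.pull g w) x) = gpMap (F.pull g' w') x := by
  rw [← gpMap_comp]
  exact congrArg (fun f => gpMap f x) (MonoidHom.ext (F.res_pull g w a g' w' h))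

theorem square_comp {F : X ⟶ Y} {U U' : X.scheme.Etale} {V : Y.scheme.Etale}
    (a : U' ⟶ U) {g : U.left ⟶ V.left} (w : g ≫ V.hom = U.hom ≫ F.f) :
    (a.left ≫ g) ≫ V.hom = U'.hom ≫ F.f :=
  (Category.assoc _ _ _).trans ((congrArg (a.left ≫ ·) w).trans
    ((Category.assoc _ _ _).symm.trans (congrArg (· ≫ F.f) (etaleHom_w a))))

/-- An étale cover of a member of the étale site, at a point. -/
theorem exists_etale_lift {S : Scheme.{u}} {T : Scheme.{u}} {U : S.Etale} {V W : T.Etale}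
    (c : U.left ⟶ V.left) (a : W ⟶ V) (u : U.left) (w : W.left) (h : c u = a.left w) :
    ∃ (U' : S.Etale) (b : U' ⟶ U) (d : U'.left ⟶ W.left) (z : U'.left),
      b.left ≫ c = d ≫ a.left ∧ b.left z = u := by
  obtain ⟨z, hz, -⟩ := Scheme.Pullback.exists_preimage_pullback u w h
  have : Etale (pullback.fst c a.left ≫ (U.hom : U.left ⟶ S)) := inferInstance
  let U' : S.Etale := Scheme.Etale.mk (pullback.fst c a.left ≫ (U.hom : U.left ⟶ S))
  let b : U' ⟶ U := etaleHomMk (U := U') (pullback.fst c a.left) rfl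
  have hb : b.left = pullback.fst c a.left := etaleHomMk_left (U := U') _ _
  refine ⟨U', b, pullback.snd c a.left, z, ?_, ?_⟩
  · rw [hb]
    exact pullback.condition
  · rw [hb]
    exact hz

theorem gpPullback_wd (F : X ⟶ Y) (s : Y.gpSec Y.top) {U : X.scheme.Etale}
    {V₁ V₂ : Y.scheme.Etale} (g₁ : U.left ⟶ V₁.left) (w₁ : g₁ ≫ V₁.hom = U.hom ≫ F.f)
    (g₂ : U.left ⟶ V₂.left) (w₂ : g₂ ≫ V₂.hom = U.hom ≫ F.f)
    (x₁ : Algebra.GrothendieckGroup (Y.sec V₁)) (x₂ : Algebra.GrothendieckGroup (Y.sec V₂))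
    (h₁ : Y.gpRes (Y.toTop V₁) s = Y.toGp V₁ x₁) (h₂ : Y.gpRes (Y.toTop V₂) s = Y.toGp V₂ x₂) :
    X.toGp U (gpMap (F.pull g₁ w₁) x₁) = X.toGp U (gpMap (F.pull g₂ w₂) x₂) := by
  let V : Y.scheme.Etale := Scheme.Etale.mk
    (pullback.fst (V₁.hom : V₁.left ⟶ Y.scheme) (V₂.hom : V₂.left ⟶ Y.scheme) ≫
      (V₁.hom : V₁.left ⟶ Y.scheme))
  let b₁ : V ⟶ V₁ := etaleHomMk (U := V) (pullback.fst _ _) rfl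
  let b₂ : V ⟶ V₂ := etaleHomMk (U := V) (pullback.snd _ _) pullback.condition.symm
  let c : U.left ⟶ V.left := pullback.lift g₁ g₂ (w₁.trans w₂.symm)
  have hc₁ : g₁ = c ≫ b₁.left := (pullback.lift_fst _ _ _).symm.trans
    (congrArg (c ≫ ·) (etaleHomMk_left (U := V) _ _).symm)
  have hc₂ : g₂ = c ≫ b₂.left := (pullback.lift_snd _ _ _).symm.trans
    (congrArg (c ≫ ·) (etaleHomMk_left (U := V) _ _).symm)
  have w : c ≫ V.hom = U.hom ≫ F.f := by
    refine Eq.trans ?_ w₁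
    refine (Category.assoc _ _ _).symm.trans (congrArg (· ≫ V₁.hom) ?_)
    exact pullback.lift_fst _ _ _
  rw [gpMap_pull_res' F c w b₁ g₁ w₁ hc₁, gpMap_pull_res' F c w b₂ g₂ w₂ hc₂]
  have e : Y.toGp V (gpMap (Y.res b₁) x₁) = Y.toGp V (gpMap (Y.res b₂) x₂) := by
    rw [← gpRes_toGp, ← gpRes_toGp, ← h₁, ← h₂, ← gpRes_comp, ← gpRes_comp, toTop_comp, toTop_comp]
  refine X.gpSec_ext fun u => ?_
  obtain ⟨W, a, y, hy, hxy⟩ := Y.toGp_eq e (c u)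
  obtain ⟨U', b, d, z, hd, hz⟩ := exists_etale_lift c a u y hy.symm
  have wd : d ≫ W.hom = U'.hom ≫ F.f := by
    have e₁ : d ≫ W.hom = (d ≫ a.left) ≫ V.hom :=
      (congrArg (d ≫ ·) (etaleHom_w a).symm).trans (Category.assoc _ _ _).symm
    rw [e₁, ← hd]
    exact square_comp b w
  refine ⟨U', b, z, hz, ?_⟩
  rw [gpRes_toGp, gpRes_toGp, gpMap_res_pull F c w b _ (square_comp b w) rfl,
    gpMap_res_pull F c w b _ (square_comp b w) rfl,
    gpMap_pull_res' F d wd a _ (square_comp b w) hd,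
    gpMap_pull_res' F d wd a _ (square_comp b w) hd, hxy]

theorem existsUnique_gpPullback (F : X ⟶ Y) (s : Y.gpSec Y.top) :
    ∃! t : X.gpSec X.top, IsGpPullback F s t := by
  let R : Sieve X.top :=
    { arrows := fun U _ => ∃ (V : Y.scheme.Etale) (g : U.left ⟶ V.left)
        (_ : g ≫ V.hom = U.hom ≫ F.f) (x : Algebra.GrothendieckGroup (Y.sec V)),
        Y.gpRes (Y.toTop V) s = Y.toGp V x
      downward_closed := by
        rintro U U' a ⟨V, g, w, x, h⟩ b
        exact ⟨V, b.left ≫ g, square_comp b w, x, h⟩ }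
  have hR : R ∈ X.scheme.smallEtaleTopology X.top := (mem_smallEtale_iff _).2 fun p => by
    obtain ⟨W, a, y, x, hy, hx⟩ := Y.exists_toGp s (F.f p)
    obtain rfl := Y.toTop_eq a
    have hy' : F.f p = (W.hom : W.left ⟶ Y.scheme) y := by
      rw [← hy]
      exact congrArg (fun k : W.left ⟶ Y.scheme => k y)
        (etaleHomMk_left (V := Y.top) W.hom (Category.comp_id _))
    obtain ⟨z, hz⟩ := exists_point_pullbackEtale F.f W p y hy'
    refine ⟨Hom.pullbackEtale F.f W, X.toTop _, z,
      ⟨W, Hom.pullbackEtaleSnd F.f W, Hom.pullbackEtale_w F.f W, x, hx⟩, ?_⟩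
    rw [← hz]
    exact congrArg (fun k : (Hom.pullbackEtale F.f W).left ⟶ X.scheme => k z)
      (etaleHomMk_left (V := X.top) (Hom.pullbackEtale F.f W).hom (Category.comp_id _))
  have hR' : ∀ (U : X.scheme.Etale) (f : U ⟶ X.top), R f → ∃ (V : Y.scheme.Etale)
      (g : U.left ⟶ V.left) (_ : g ≫ V.hom = U.hom ≫ F.f)
      (x : Algebra.GrothendieckGroup (Y.sec V)), Y.gpRes (Y.toTop V) s = Y.toGp V x :=
    fun U f hf => hf
  choose V g w x hx using hR'
  have key : ∀ t : X.gpSec X.top, IsGpPullback F s t ↔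
      ∀ (U : X.scheme.Etale) (f : U ⟶ X.top) (hf : R f),
        X.gpRes f t = X.toGp U (gpMap (F.pull (g U f hf) (w U f hf)) (x U f hf)) := by
    intro t
    constructor
    · intro ht U f hf
      rw [X.toTop_eq f]
      exact ht _ _ _ (hx _ _ _)
    · intro ht U V g w x hx'
      rw [ht U (X.toTop U) ⟨V, g, w, x, hx'⟩]
      exact gpPullback_wd F s _ _ _ _ _ _ (hx _ _ _) hx'
  let fam : Presieve.FamilyOfElements (X.Mgp.obj ⋙ forget CommGrpCat) R.arrows :=
    fun U f hf => X.toGp U (gpMap (F.pull (g U f hf) (w U f hf)) (x U f hf))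
  have hfam : fam.Compatible := by
    intro U₁ U₂ U a₁ a₂ f₁ f₂ hf₁ hf₂ _
    refine (X.gpRes_toGp a₁ _).trans (Eq.trans ?_ (X.gpRes_toGp a₂ _).symm)
    rw [gpMap_res_pull F _ _ a₁ _ (square_comp a₁ (w _ _ hf₁)) rfl,
      gpMap_res_pull F _ _ a₂ _ (square_comp a₂ (w _ _ hf₂)) rfl]
    exact gpPullback_wd F s _ _ _ _ _ _ (hx _ _ _) (hx _ _ _)
  obtain ⟨t, ht, huniq⟩ := X.isSheaf_gp R hR fam hfam
  refine ⟨t, (key t).2 fun U f hf => ht f hf, fun t' ht' => huniq t' fun U f hf => ?_⟩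
  exact (key t').1 ht' U f hf

/-- The pullback `Γ(Y, M_Yᵍᵖ) → Γ(X, M_Xᵍᵖ)` along a morphism `X → Y`. -/
def gpPullback (F : X ⟶ Y) (s : Y.gpSec Y.top) : X.gpSec X.top :=
  (existsUnique_gpPullback F s).choose

theorem gpPullback_spec (F : X ⟶ Y) (s : Y.gpSec Y.top) : IsGpPullback F s (gpPullback F s) :=
  (existsUnique_gpPullback F s).choose_spec.1

theorem gpPullback_eq {F : X ⟶ Y} {s : Y.gpSec Y.top} {t : X.gpSec X.top}
    (h : IsGpPullback F s t) : gpPullback F s = t :=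
  ((existsUnique_gpPullback F s).choose_spec.2 t h).symm

/-- The logarithmic multiplicative group `S ↦ Γ(S, M_Sᵍᵖ)`, a contravariant functor on logarithmic
schemes. -/
def Glog : LogScheme.{u}ᵒᵖ ⥤ Type u where
  obj X := X.unop.gpSec X.unop.top
  map F := TypeCat.ofHom (gpPullback F.unop)
  map_id X := by
    ext s
    refine gpPullback_eq (F := 𝟙 X.unop) fun {U V} g w x h => ?_
    have hw := w.trans (Category.comp_id _)
    change X.unop.gpRes (X.unop.toTop U) s = _
    rw [← X.unop.toTop_comp (etaleHomMk g hw), gpRes_comp, h, gpRes_toGp]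
    rfl
  map_comp {X Y Z} F G := by
    ext s
    refine gpPullback_eq (F := G.unop ≫ F.unop) fun {U W} g w x h => ?_
    have hw := w.trans (Category.assoc _ _ _).symm
    let V := Hom.pullbackEtale F.unop.f W
    let g₁ := Hom.pullbackEtaleLift F.unop.f W (U.hom ≫ G.unop.f) g hw
    have w₁ : g₁ ≫ V.hom = U.hom ≫ G.unop.f := Hom.pullbackEtaleLift_hom _ _ _ _ _
    have hg : g = g₁ ≫ Hom.pullbackEtaleSnd F.unop.f W :=
      (Hom.pullbackEtaleLift_snd _ _ _ _ _).symm
    have e₁ := gpPullback_spec F.unop s _ (Hom.pullbackEtale_w F.unop.f W) x h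
    have e₂ := gpPullback_spec G.unop _ g₁ w₁ _ e₁
    refine e₂.trans (congrArg (Z.unop.toGp U) ?_)
    rw [← gpMap_comp]
    exact congrArg (fun f => gpMap f x) (MonoidHom.ext fun m =>
      (comp_pull G.unop F.unop g₁ w₁ _ (Hom.pullbackEtale_w F.unop.f W) g w hg m).symm)

/-! ### Fine and saturated logarithmic schemes -/

/-- The étale `Y`-scheme underlying an étale `X`-scheme, for `X` étale over `Y`. -/
def etaleComp {S T : Scheme.{u}} (f : S ⟶ T) [Etale f] (V : S.Etale) : T.Etale :=
  Scheme.Etale.mk ((V.hom : V.left ⟶ S) ≫ f)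

/-- A morphism `X → Y` is strict étale if it is étale on underlying schemes and `M_X` is the
restriction of `M_Y` to the étale site of `X`. -/
def IsStrictEtale (F : X ⟶ Y) : Prop :=
  ∃ _ : Etale F.f, ∀ V : X.scheme.Etale,
    Function.Bijective (F.pull (U := V) (V := etaleComp F.f V) (𝟙 V.left) (Category.id_comp _))

/-- A strict open immersion of logarithmic schemes. -/
def IsStrictOpenImmersion (F : X ⟶ Y) : Prop :=
  IsOpenImmersion F.f ∧ IsStrictEtale F

/-- A homomorphism `θ : P → M(U)` is a chart over `U` if the logarithmic structure associated to `P`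
is `M|_U`: sections of `M|_U` are locally of the form `u · θ(p)` with `u` invertible, and two such
expressions agree precisely when they agree in the amalgamated sum of `P` and the sheaf of
units over the submonoid of those elements of `P` that become invertible. -/
def IsChart (X : LogScheme.{u}) {P : Type u} [CommMonoid P] (U : X.scheme.Etale)
    (θ : P →* X.sec U) : Prop :=
  (∀ (V : X.scheme.Etale) (a : V ⟶ U) (m : X.sec V) (v : V.left),
    ∃ (W : X.scheme.Etale) (b : W ⟶ V) (w : W.left) (p : P) (e : (X.sec W)ˣ),
      b.left w = v ∧ X.res b m = e * X.res (b ≫ a) (θ p)) ∧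
  (∀ (V : X.scheme.Etale) (a : V ⟶ U) (p p' : P) (e : (X.sec V)ˣ) (v : V.left),
    X.res a (θ p) = e * X.res a (θ p') →
    ∃ (W : X.scheme.Etale) (b : W ⟶ V) (w : W.left) (n n' : P),
      b.left w = v ∧ IsUnit (X.res (b ≫ a) (θ n)) ∧ IsUnit (X.res (b ≫ a) (θ n')) ∧
      p * n = p' * n' ∧ X.res (b ≫ a) (θ n') = X.res b e * X.res (b ≫ a) (θ n))

/-- A commutative monoid is saturated if it contains each element of its group completion having a
positive power in it.  (Phrased for a cancellative monoid: the element is `a / b`.) -/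
def IsSaturatedMonoid (P : Type u) [CommMonoid P] : Prop :=
  ∀ (a b c : P) (n : ℕ), 0 < n → a ^ n = b ^ n * c → ∃ d, a = b * d

/-- A logarithmic scheme is fs if, étale locally, it has a chart by a finitely generated, integral
(that is, cancellative) and saturated monoid. -/
def IsFs : ObjectProperty LogScheme.{u} := fun X =>
  ∀ x : X.scheme, ∃ (U : X.scheme.Etale) (y : U.left) (P : Type u) (_ : CommMonoid P)
    (θ : P →* X.sec U), (U.hom : U.left ⟶ X.scheme) y = x ∧ Monoid.FG P ∧ IsCancelMul P ∧
      IsSaturatedMonoid P ∧ X.IsChart U θ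

/-! ### Logarithmic structures generated by functions -/

section Generated

variable (S : Scheme.{u})

/-- A set of functions on étale `S`-schemes. -/
abbrev Generators := Set (Σ U : S.Etale, Γ(U.left, ⊤))

variable {S}
variable (G : Generators S)

/-- The functions on `U` which are products of units and restrictions of generators. -/
def monomials (U : S.Etale) : Submonoid Γ(U.left, ⊤) :=
  Submonoid.closure ({f | IsUnit f} ∪ {f | ∃ γ ∈ G, ∃ a : U ⟶ γ.1, f = a.left.appTop γ.2})

theorem appTop_comp_apply {A B C : Scheme.{u}} (a : A ⟶ B) (b : B ⟶ C) (f : Γ(C, ⊤)) :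
    (a ≫ b).appTop f = a.appTop (b.appTop f) :=
  ConcreteCategory.congr_hom (Scheme.Hom.comp_appTop a b) f

theorem appTop_id_apply {A : Scheme.{u}} (f : Γ(A, ⊤)) : (𝟙 A : A ⟶ A).appTop f = f := by
  simp

theorem monomials_res {U V : S.Etale} (a : U ⟶ V) {f : Γ(V.left, ⊤)} (hf : f ∈ monomials G V) :
    a.left.appTop f ∈ monomials G U := by
  induction hf using Submonoid.closure_induction with
  | mem f hf =>
    rcases hf with hf | ⟨γ, hγ, b, rfl⟩
    · exact Submonoid.subset_closure (Or.inl (hf.map a.left.appTop.hom))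
    · exact Submonoid.subset_closure (Or.inr ⟨γ, hγ, a ≫ b, (appTop_comp_apply _ _ _).symm⟩)
  | one =>
    rw [map_one]
    exact one_mem _
  | mul f g _ _ hf hg =>
    rw [map_mul]
    exact mul_mem hf hg

/-- The functions on `U` which are, étale locally, products of units and restrictions of
generators. -/
def genSections (U : S.Etale) : Submonoid Γ(U.left, ⊤) where
  carrier := {f | ∀ u : U.left, ∃ (V : S.Etale) (a : V ⟶ U) (v : V.left),
    a.left v = u ∧ a.left.appTop f ∈ monomials G V}
  one_mem' u := ⟨U, 𝟙 U, u, rfl, by rw [map_one]; exact one_mem _⟩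
  mul_mem' {f g} hf hg u := by
    obtain ⟨V, a, v, hv, h⟩ := hf u
    obtain ⟨V', a', v', hv', h'⟩ := hg u
    obtain ⟨W, b, d, w, hd, hw⟩ := exists_etale_lift a.left a' v v' (hv.trans hv'.symm)
    have hd' : d ≫ V'.hom = W.hom := by
      rw [← etaleHom_w b, ← etaleHom_w a, ← etaleHom_w a']
      exact (Category.assoc _ _ _).symm.trans
        ((congrArg (· ≫ U.hom) hd.symm).trans (Category.assoc _ _ _))
    refine ⟨W, b ≫ a, w, ?_, ?_⟩
    · rw [← hv, ← hw]
      rfl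
    · rw [map_mul]
      refine mul_mem ?_ ?_
      · rw [etale_comp_left, appTop_comp_apply]
        exact monomials_res G b h
      · have e : (b ≫ a).left = (etaleHomMk d hd').left ≫ a'.left := by
          rw [etaleHomMk_left]
          exact hd
        rw [e, appTop_comp_apply]
        exact monomials_res G _ h'

theorem monomials_le_genSections (U : S.Etale) : monomials G U ≤ genSections G U :=
  fun f hf u => ⟨U, 𝟙 U, u, rfl, by rw [etale_id_left, appTop_id_apply]; exact hf⟩

theorem isUnit_mem_genSections (U : S.Etale) {f : Γ(U.left, ⊤)} (hf : IsUnit f) :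
    f ∈ genSections G U :=
  monomials_le_genSections G U (Submonoid.subset_closure (Or.inl hf))

theorem generator_mem_genSections {U : S.Etale} {γ : Σ U : S.Etale, Γ(U.left, ⊤)} (hγ : γ ∈ G)
    (a : U ⟶ γ.1) : a.left.appTop γ.2 ∈ genSections G U :=
  monomials_le_genSections G U (Submonoid.subset_closure (Or.inr ⟨γ, hγ, a, rfl⟩))

theorem genSections_local {U : S.Etale} {f : Γ(U.left, ⊤)}
    (h : ∀ u : U.left, ∃ (V : S.Etale) (a : V ⟶ U) (v : V.left),
      a.left v = u ∧ a.left.appTop f ∈ genSections G V) : f ∈ genSections G U := by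
  intro u
  obtain ⟨V, a, v, hv, hf⟩ := h u
  obtain ⟨W, b, w, hw, hf'⟩ := hf v
  refine ⟨W, b ≫ a, w, ?_, ?_⟩
  · rw [← hv, ← hw]
    rfl
  · rw [etale_comp_left, appTop_comp_apply]
    exact hf'

theorem genSections_res {U V : S.Etale} (a : U ⟶ V) {f : Γ(V.left, ⊤)}
    (hf : f ∈ genSections G V) : a.left.appTop f ∈ genSections G U := by
  intro u
  obtain ⟨W, b, w, hw, h⟩ := hf (a.left u)
  obtain ⟨U', c, d, z, hd, hz⟩ := exists_etale_lift a.left b u w hw.symm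
  have hd' : d ≫ W.hom = U'.hom := by
    rw [← etaleHom_w c, ← etaleHom_w a, ← etaleHom_w b]
    exact (Category.assoc _ _ _).symm.trans
      ((congrArg (· ≫ V.hom) hd.symm).trans (Category.assoc _ _ _))
  refine ⟨U', c, z, hz, ?_⟩
  have e : c.left ≫ a.left = (etaleHomMk d hd').left ≫ b.left := by
    rw [etaleHomMk_left]
    exact hd
  rw [← appTop_comp_apply, e, appTop_comp_apply]
  exact monomials_res G _ h

/-- Restriction of functions in `genSections`. -/
def genRes {U V : S.Etale} (a : U ⟶ V) : genSections G V →* genSections G U :=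
  ((a.left.appTop.hom : Γ(V.left, ⊤) →* Γ(U.left, ⊤)).comp
    (genSections G V).subtype).codRestrict (genSections G U) fun f => genSections_res G a f.2

theorem genRes_coe {U V : S.Etale} (a : U ⟶ V) (f : genSections G V) :
    (genRes G a f : Γ(U.left, ⊤)) = a.left.appTop f.1 := rfl

theorem genRes_id {U : S.Etale} : genRes G (𝟙 U) = MonoidHom.id _ :=
  MonoidHom.ext fun f => Subtype.ext (appTop_id_apply f.1)

theorem genRes_comp {U V W : S.Etale} (a : U ⟶ V) (b : V ⟶ W) :
    genRes G (a ≫ b) = (genRes G a).comp (genRes G b) :=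
  MonoidHom.ext fun f => Subtype.ext (appTop_comp_apply a.left b.left f.1)

/-- The monoid presheaf `U ↦ genSections G U`. -/
def genPresheaf : S.Etaleᵒᵖ ⥤ CommMonCat.{u} where
  obj U := CommMonCat.of (genSections G U.unop)
  map a := CommMonCat.ofHom (genRes G a.unop)
  map_id _ := congrArg CommMonCat.ofHom (genRes_id G)
  map_comp a b := congrArg CommMonCat.ofHom (genRes_comp G b.unop a.unop)

theorem isSheaf_genPresheaf :
    Presieve.IsSheaf S.smallEtaleTopology (genPresheaf G ⋙ forget CommMonCat) := by
  intro U R hR x hx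
  let y : Presieve.FamilyOfElements (structurePresheaf S ⋙ forget CommRingCat) R.arrows :=
    fun V a ha => (x a ha).1
  have hy : y.Compatible := fun V₁ V₂ W a₁ a₂ f₁ f₂ h₁ h₂ h =>
    congrArg Subtype.val (hx a₁ a₂ h₁ h₂ h)
  obtain ⟨f, hf, huniq⟩ := isSheaf_structurePresheaf S R hR y hy
  have hmem : (show Γ(U.left, ⊤) from f) ∈ genSections G U := by
    refine genSections_local G fun u => ?_
    obtain ⟨V, a, v, ha, hv⟩ := (mem_smallEtale_iff R).1 hR u
    refine ⟨V, a, v, hv, ?_⟩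
    have e : a.left.appTop (show Γ(U.left, ⊤) from f) = (x a ha).1 := hf a ha
    rw [e]
    exact (x a ha).2
  refine ⟨⟨f, hmem⟩, fun V a ha => Subtype.ext (hf a ha), fun g hg => Subtype.ext ?_⟩
  exact huniq g.1 fun V a ha => congrArg Subtype.val (hg a ha)

/-- The logarithmic scheme `(S, M)` where `M ⊆ 𝒪_S` is the sheaf of submonoids generated by the units
and the set `G` of functions. -/
def ofGenerators : LogScheme.{u} where
  scheme := S
  M := genPresheaf G
  isSheaf := isSheaf_genPresheaf G
  exp :=
    { app U := CommMonCat.ofHom (genSections G U.unop).subtype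
      naturality := by
        intro U V a
        rfl }
  existsUnique_unit U f hf := ⟨⟨f, isUnit_mem_genSections G U hf⟩, rfl, fun _ h => Subtype.ext h⟩

/-- A function in `genSections G U` as a section of the logarithmic structure. -/
def ofGeneratorsSec {U : S.Etale} (f : Γ(U.left, ⊤)) (hf : f ∈ genSections G U) :
    (ofGenerators G).sec (U : (ofGenerators G).scheme.Etale) :=
  (⟨f, hf⟩ : genSections G U)

/-- The generators given by functions on `S` itself. -/
def globalGenerators (T : Set Γ(S, ⊤)) : Generators S :=
  {γ | ∃ f ∈ T, γ = ⟨Scheme.Etale.mk (𝟙 S), f⟩}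

theorem genSections_pullback {S' : Scheme.{u}} (G' : Generators S') {T : Set Γ(S, ⊤)}
    (f : S' ⟶ S) (h : ∀ s ∈ T, f.appTop s ∈ genSections G' (Scheme.Etale.mk (𝟙 S')))
    {U : S'.Etale} {V : S.Etale} (g : U.left ⟶ V.left) (w : g ≫ V.hom = U.hom ≫ f)
    {m : Γ(V.left, ⊤)} (hm : m ∈ genSections (globalGenerators T) V) :
    g.appTop m ∈ genSections G' U := by
  refine genSections_local G' fun u => ?_
  obtain ⟨W, b, y, hy, hb⟩ := hm (g u)
  obtain ⟨U', c, d, z, hd, hz⟩ := exists_etale_lift g b u y hy.symm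
  refine ⟨U', c, z, hz, ?_⟩
  have wd : d ≫ W.hom = U'.hom ≫ f := by
    rw [← etaleHom_w b, ← etaleHom_w c]
    exact (Category.assoc _ _ _).symm.trans ((congrArg (· ≫ V.hom) hd.symm).trans
      ((Category.assoc _ _ _).trans ((congrArg (c.left ≫ ·) w).trans (Category.assoc _ _ _).symm)))
  rw [← appTop_comp_apply, hd, appTop_comp_apply]
  generalize b.left.appTop m = m' at hb
  induction hb using Submonoid.closure_induction with
  | mem m' hm' =>
    rcases hm' with hm' | ⟨γ, ⟨s, hs, rfl⟩, a, rfl⟩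
    · exact isUnit_mem_genSections G' _ (hm'.map d.appTop.hom)
    · let k : U' ⟶ Scheme.Etale.mk (𝟙 S') := etaleHomMk U'.hom (Category.comp_id _)
      have hk : k.left = U'.hom := etaleHomMk_left _ _
      have e : d ≫ a.left = k.left ≫ f := by
        refine Eq.trans ?_ ((wd).trans (congrArg (· ≫ f) hk.symm))
        exact congrArg (d ≫ ·) ((Category.comp_id _).symm.trans (etaleHom_w a))
      have e' : d.appTop (a.left.appTop s) = k.left.appTop (f.appTop s) := by
        exact (appTop_comp_apply d a.left s).symm.trans
          ((congrArg (fun q : U'.left ⟶ S => q.appTop s) e).trans (appTop_comp_apply k.left f s))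
      rw [e']
      exact genSections_res G' k (h s hs)
  | one =>
    rw [map_one]
    exact one_mem _
  | mul f g _ _ hf hg =>
    rw [map_mul]
    exact mul_mem hf hg

/-- A morphism of schemes which pulls back the (global) generators of the target to sections of the
logarithmic structure of the source is a morphism of logarithmic schemes. -/
def homOfGenerators {S' : Scheme.{u}} (G' : Generators S') {T : Set Γ(S, ⊤)}
    (f : S' ⟶ S) (h : ∀ s ∈ T, f.appTop s ∈ genSections G' (Scheme.Etale.mk (𝟙 S'))) :
    ofGenerators G' ⟶ ofGenerators (globalGenerators T) where
  f := f
  pull {U V} g w :=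
    ((g.appTop.hom : Γ(V.left, ⊤) →* Γ(U.left, ⊤)).comp
      (genSections (globalGenerators T) V).subtype).codRestrict (genSections G' U)
      fun m => genSections_pullback G' f h g w m.2
  pull_res {U U' V V'} a b g w g' w' e m := by
    refine Subtype.ext ?_
    change g'.appTop m.1 = a.left.appTop (g.appTop (b.left.appTop m.1))
    rw [e, appTop_comp_apply, appTop_comp_apply]
  expSec_pull g w m := rfl

end Generated


/-! ### Affine toric varieties and the affine plane -/

/-- The global function on `Spec R` given by an element of `R`. -/
def specFun {R : Type u} [CommRing R] (r : R) : Γ(Spec (.of R), ⊤) :=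
  (Scheme.ΓSpecIso (.of R)).inv r

theorem specFun_map {R R' : Type u} [CommRing R] [CommRing R'] (φ : R →+* R') (r : R) :
    (Spec.map (CommRingCat.ofHom φ)).appTop (specFun r) = specFun (φ r) :=
  (ConcreteCategory.congr_hom (Scheme.ΓSpecIso_inv_naturality (CommRingCat.ofHom φ)) r).symm

theorem mem_genSections_self {S : Scheme.{u}} {G : Generators S} {U : S.Etale}
    {f : Γ(U.left, ⊤)} (h : ⟨U, f⟩ ∈ G) : f ∈ genSections G U := by
  have h' := generator_mem_genSections G h (𝟙 U)
  rwa [etale_id_left, appTop_id_apply] at h'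

theorem mem_genSections_global {S : Scheme.{u}} {T : Set Γ(S, ⊤)} {s : Γ(S, ⊤)} (hs : s ∈ T) :
    s ∈ genSections (globalGenerators T) (Scheme.Etale.mk (𝟙 S)) :=
  mem_genSections_self ⟨s, hs, rfl⟩

/-- The monomial `χᵖ` in the monoid algebra `ℤ[P]`. -/
def chi {P : Type} [AddCommMonoid P] (p : P) : AddMonoidAlgebra (ULift.{u} ℤ) P :=
  AddMonoidAlgebra.single p 1

/-- The affine logarithmic scheme `Spec ℤ[P]` with its toric logarithmic structure, generated by the
units and the monomials.  This is used for submonoids `P` of lattices. -/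
def affineToric (P : Type) [AddCommMonoid P] : LogScheme.{u} :=
  ofGenerators (S := Spec (.of (AddMonoidAlgebra (ULift.{u} ℤ) P)))
    (globalGenerators (Set.range fun p : P => specFun (chi p)))

/-- The toric morphism `Spec ℤ[Q] → Spec ℤ[P]` induced by `P → Q`. -/
def affineToricMap {P Q : Type} [AddCommMonoid P] [AddCommMonoid Q] (φ : P →+ Q) :
    affineToric.{u} Q ⟶ affineToric.{u} P :=
  homOfGenerators _ (Spec.map (CommRingCat.ofHom
    (AddMonoidAlgebra.mapDomainRingHom (ULift.{u} ℤ) φ))) (by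
    rintro _ ⟨p, rfl⟩
    rw [specFun_map]
    refine mem_genSections_global ⟨φ p, congrArg specFun ?_⟩
    simp [chi])

/-- The coordinate ring `ℤ[x₀, x₁]` of the affine plane. -/
abbrev PlaneRing : Type u := MvPolynomial (Fin 2) (ULift.{u} ℤ)

/-- The affine plane `Spec ℤ[x₀, x₁]` with its toric logarithmic structure, generated by the units
and the coordinate functions. -/
def A2 : LogScheme.{u} :=
  ofGenerators (S := Spec (.of PlaneRing.{u}))
    (globalGenerators (Set.range fun i : Fin 2 => specFun (MvPolynomial.X i : PlaneRing.{u})))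

/-- The coordinates of the affine plane, as sections of its logarithmic structure. -/
def A2.coord (i : Fin 2) : A2.{u}.sec A2.top :=
  ofGeneratorsSec _ (specFun (MvPolynomial.X i : PlaneRing.{u})) (mem_genSections_global ⟨i, rfl⟩)

/-! ### Standard charts of `Proj` -/

section ProjCharts

variable {A σ : Type u} [CommRing A] [SetLike σ A] [AddSubgroupClass σ A] (𝒜 : ℕ → σ) [GradedRing 𝒜]
variable {a b : A} (ha : a ∈ 𝒜 1) (hb : b ∈ 𝒜 1)

/-- The standard chart `D₊(a)` of `Proj`, for `a` of degree `1`. -/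
def projChart : (Proj 𝒜).Etale := Scheme.Etale.mk (Proj.awayι 𝒜 a ha one_pos)

/-- The function `b / a` on `D₊(a)`, for `a` and `b` of degree `1`. -/
def projRatio : Γ((projChart 𝒜 ha).left, ⊤) :=
  specFun (HomogeneousLocalization.Away.mk 𝒜 ha 1 b (by rwa [one_smul]))

theorem projChart_hom_ext {U : (Proj 𝒜).Etale} (p q : U ⟶ projChart 𝒜 ha) : p = q := by
  apply etaleHom_ext
  have h : p.left ≫ Proj.awayι 𝒜 a ha one_pos = q.left ≫ Proj.awayι 𝒜 a ha one_pos :=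
    (etaleHom_w p).trans (etaleHom_w q).symm
  have : Mono (Proj.awayι 𝒜 a ha one_pos) := IsOpenImmersion.mono _
  exact (cancel_mono (Proj.awayι 𝒜 a ha one_pos)).1 h

theorem awayMap_mul :
    HomogeneousLocalization.awayMap 𝒜 hb rfl
        (HomogeneousLocalization.Away.mk 𝒜 ha 1 b (by rwa [one_smul])) *
      HomogeneousLocalization.awayMap 𝒜 ha (mul_comm a b)
        (HomogeneousLocalization.Away.mk 𝒜 hb 1 a (by rwa [one_smul])) = 1 := by
  apply HomogeneousLocalization.val_injective
  rw [HomogeneousLocalization.awayMap_mk, HomogeneousLocalization.awayMap_mk,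
    HomogeneousLocalization.val_mul, HomogeneousLocalization.Away.val_mk,
    HomogeneousLocalization.Away.val_mk, HomogeneousLocalization.val_one, Localization.mk_mul,
    ← Localization.mk_one, Localization.mk_eq_mk_iff, Localization.r_iff_exists]
  refine ⟨1, ?_⟩
  simp
  ring

theorem specFun_mul {R : Type u} [CommRing R] (r r' : R) :
    specFun (r * r') = specFun r * specFun r' :=
  map_mul (Scheme.ΓSpecIso (.of R)).inv.hom r r'

theorem specFun_one {R : Type u} [CommRing R] : specFun (1 : R) = 1 :=
  map_one (Scheme.ΓSpecIso (.of R)).inv.hom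

theorem away_ratio_mul {U : Scheme.{u}} (p : U ⟶ Spec (.of (HomogeneousLocalization.Away 𝒜 a)))
    (q : U ⟶ Spec (.of (HomogeneousLocalization.Away 𝒜 b)))
    (h : p ≫ Proj.awayι 𝒜 a ha one_pos = q ≫ Proj.awayι 𝒜 b hb one_pos) :
    p.appTop (specFun (HomogeneousLocalization.Away.mk 𝒜 ha 1 b (by rwa [one_smul]))) *
      q.appTop (specFun (HomogeneousLocalization.Away.mk 𝒜 hb 1 a (by rwa [one_smul]))) = 1 := by
  let c := pullback.lift p q h ≫ (Proj.pullbackAwayιIso 𝒜 ha one_pos hb one_pos rfl).hom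
  have hp : p = c ≫ Spec.map (CommRingCat.ofHom
      (HomogeneousLocalization.awayMap 𝒜 hb rfl)) := by
    rw [Category.assoc, Proj.pullbackAwayιIso_hom_SpecMap_awayMap_left, pullback.lift_fst]
  have hq : q = c ≫ Spec.map (CommRingCat.ofHom
      (HomogeneousLocalization.awayMap 𝒜 ha (mul_comm a b))) := by
    rw [Category.assoc]
    refine (pullback.lift_snd p q h).symm.trans (congrArg (pullback.lift _ _ h ≫ ·) ?_)
    exact (Proj.pullbackAwayιIso_hom_SpecMap_awayMap_right 𝒜 ha one_pos hb one_pos rfl).symm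
  clear_value c
  rw [hp, hq, appTop_comp_apply, appTop_comp_apply, specFun_map, specFun_map, ← map_mul,
    ← specFun_mul, awayMap_mul 𝒜 ha hb, specFun_one, map_one]

theorem projRatio_mul {U : (Proj 𝒜).Etale} (p : U ⟶ projChart 𝒜 ha) (q : U ⟶ projChart 𝒜 hb) :
    p.left.appTop (projRatio 𝒜 ha hb) * q.left.appTop (projRatio 𝒜 hb ha) = 1 :=
  away_ratio_mul 𝒜 ha hb p.left q.left ((etaleHom_w p).trans (etaleHom_w q).symm)

end ProjCharts
/-! ### The projective line and its coordinate -/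

attribute [local instance] MvPolynomial.gradedAlgebra

/-- The grading of `ℤ[x₀, x₁]` by degree. -/
abbrev planeGrading : ℕ → Submodule (ULift.{u} ℤ) PlaneRing.{u} :=
  MvPolynomial.homogeneousSubmodule (Fin 2) (ULift.{u} ℤ)

theorem X_mem_planeGrading (i : Fin 2) : (MvPolynomial.X i : PlaneRing.{u}) ∈ planeGrading 1 :=
  MvPolynomial.isHomogeneous_X _ i

/-- The chart `D₊(xᵢ)` of the projective line `Proj ℤ[x₀, x₁]`. -/
abbrev lineChart (i : Fin 2) : (Proj planeGrading.{u}).Etale :=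
  projChart planeGrading (X_mem_planeGrading i)

/-- The function `xⱼ / xᵢ` on `D₊(xᵢ)`. -/
abbrev lineRatio (i j : Fin 2) : Γ((lineChart.{u} i).left, ⊤) :=
  projRatio planeGrading (X_mem_planeGrading i) (X_mem_planeGrading j)

/-- The generators of the toric logarithmic structure of the projective line: the function `x₁ / x₀`
on `D₊(x₀)` and the function `x₀ / x₁` on `D₊(x₁)`. -/
def lineGenerators : Generators (Proj planeGrading.{u}) :=
  {⟨lineChart 0, lineRatio 0 1⟩, ⟨lineChart 1, lineRatio 1 0⟩}

/-- The projective line `Proj ℤ[x₀, x₁]` with its toric logarithmic structure. -/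
def P1 : LogScheme.{u} := ofGenerators lineGenerators.{u}

/-- The chart `D₊(xᵢ)`, in the étale site of the logarithmic scheme `P1`. -/
def P1.chart (i : Fin 2) : P1.{u}.scheme.Etale := lineChart.{u} i

/-- The section `x₁ / x₀` of the logarithmic structure over `D₊(x₀)`. -/
def P1.ratio : P1.{u}.sec (P1.chart 0) :=
  ofGeneratorsSec lineGenerators.{u} (U := lineChart 0) (lineRatio 0 1)
    (mem_genSections_self (Or.inl rfl))

/-- The section `x₀ / x₁` of the logarithmic structure over `D₊(x₁)`. -/
def P1.ratio' : P1.{u}.sec (P1.chart 1) :=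
  ofGeneratorsSec lineGenerators.{u} (U := lineChart 1) (lineRatio 1 0)
    (mem_genSections_self (Or.inr rfl))

theorem gpRes_secToGp (X : LogScheme.{u}) {U V : X.scheme.Etale} (a : U ⟶ V) (m : X.sec V) :
    X.gpRes a (X.secToGp V m) = X.secToGp U (X.res a m) :=
  (X.gpRes_toGp a _).trans (congrArg (X.toGp U) (gpMap_of _ m))

theorem P1.ratio_mul {U : P1.{u}.scheme.Etale} (p : U ⟶ P1.chart 0) (q : U ⟶ P1.chart 1) :
    P1.gpRes p (P1.secToGp _ P1.ratio) * P1.gpRes q (P1.secToGp _ P1.ratio') = 1 := by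
  have e : P1.res p P1.ratio * P1.res q P1.ratio' = 1 := Subtype.ext
    (projRatio_mul planeGrading (X_mem_planeGrading 0) (X_mem_planeGrading 1) p q)
  rw [gpRes_secToGp, gpRes_secToGp, ← map_mul, e, map_one]

theorem P1.chart_hom_ext {U : P1.{u}.scheme.Etale} {i : Fin 2} (p q : U ⟶ P1.chart i) : p = q :=
  projChart_hom_ext planeGrading (X_mem_planeGrading i) p q

theorem P1.charts_cover (x : P1.{u}.scheme) :
    ∃ (i : Fin 2) (y : (P1.chart.{u} i).left), (P1.toTop (P1.chart i)).left y = x := by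
  have h := Proj.iSup_basicOpen_eq_top' planeGrading.{u}
    (fun i : Fin 2 => (MvPolynomial.X i : PlaneRing.{u})) (fun i => ⟨1, X_mem_planeGrading i⟩) (by
      refine top_le_iff.1 fun f _ => ?_
      induction f using MvPolynomial.induction_on with
      | C r =>
        exact Subalgebra.algebraMap_mem _ (⟨MvPolynomial.C r, MvPolynomial.isHomogeneous_C _ r⟩ :
          planeGrading.{u} 0)
      | add f g hf hg => exact add_mem (hf trivial) (hg trivial)
      | mul_X f i hf => exact mul_mem (hf trivial) (Algebra.subset_adjoin ⟨i, rfl⟩))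
  obtain ⟨i, hi⟩ := TopologicalSpace.Opens.mem_iSup.1 (h.ge (show x ∈ ⊤ from trivial))
  rw [← Proj.opensRange_awayι planeGrading.{u} _ (X_mem_planeGrading i) one_pos] at hi
  obtain ⟨y, hy⟩ := hi
  refine ⟨i, y, Eq.trans ?_ hy⟩
  exact congrArg (fun k : (P1.chart.{u} i).left ⟶ P1.{u}.scheme => k y)
    (etaleHomMk_left (V := P1.{u}.top) (P1.chart i).hom (Category.comp_id _))

/-- There is a unique global section of `Mᵍᵖ` on the projective line which is `x₁ / x₀` on `D₊(x₀)`
and the inverse of `x₀ / x₁` on `D₊(x₁)`. -/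
theorem P1.existsUnique_coord : ∃! t : P1.{u}.gpSec P1.top,
    P1.gpRes (P1.toTop (P1.chart 0)) t = P1.secToGp _ P1.ratio ∧
    P1.gpRes (P1.toTop (P1.chart 1)) t = (P1.secToGp _ P1.ratio')⁻¹ := by
  let Rel : ∀ U : P1.{u}.scheme.Etale, P1.{u}.gpSec U → Prop := fun U s =>
    (∃ p : U ⟶ P1.chart 0, s = P1.gpRes p (P1.secToGp _ P1.ratio)) ∨
    (∃ q : U ⟶ P1.chart 1, s = (P1.gpRes q (P1.secToGp _ P1.ratio'))⁻¹)
  have huniq : ∀ (U : P1.{u}.scheme.Etale) (s s' : P1.{u}.gpSec U), Rel U s → Rel U s' → s = s' := by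
    rintro U _ _ (⟨p, rfl⟩ | ⟨q, rfl⟩) (⟨p', rfl⟩ | ⟨q', rfl⟩)
    · rw [P1.chart_hom_ext p p']
    · exact eq_inv_of_mul_eq_one_left (P1.ratio_mul p q')
    · exact (eq_inv_of_mul_eq_one_left (P1.ratio_mul p' q)).symm
    · rw [P1.chart_hom_ext q q']
  have hres : ∀ (U V : P1.{u}.scheme.Etale) (a : U ⟶ V) (s : P1.{u}.gpSec V), Rel V s →
      Rel U (P1.gpRes a s) := by
    rintro U V a _ (⟨p, rfl⟩ | ⟨q, rfl⟩)
    · exact Or.inl ⟨a ≫ p, (gpRes_comp _ _ _ _).symm⟩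
    · exact Or.inr ⟨a ≫ q, by rw [map_inv, gpRes_comp]⟩
  let R : Sieve P1.{u}.top :=
    { arrows := fun U _ => ∃ s, Rel U s
      downward_closed := by
        rintro U U' a ⟨s, hs⟩ b
        exact ⟨P1.gpRes b s, hres _ _ b s hs⟩ }
  have hchart : ∀ i, R (P1.toTop (P1.chart i)) := by
    intro i
    match i with
    | 0 => exact ⟨_, Or.inl ⟨𝟙 _, rfl⟩⟩
    | 1 => exact ⟨_, Or.inr ⟨𝟙 _, rfl⟩⟩
  have hR : R ∈ P1.{u}.scheme.smallEtaleTopology P1.top := (mem_smallEtale_iff _).2 fun x => by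
    obtain ⟨i, y, hy⟩ := P1.charts_cover x
    exact ⟨P1.chart i, P1.toTop _, y, hchart i, hy⟩
  have hR' : ∀ (U : P1.{u}.scheme.Etale) (f : U ⟶ P1.top), R f → ∃ s, Rel U s := fun U f hf => hf
  choose s hs using hR'
  have hs' : ∀ (U : P1.{u}.scheme.Etale) (f : U ⟶ P1.top) (hf : R f) (s' : P1.{u}.gpSec U),
      Rel U s' → s U f hf = s' := fun U f hf s' h => huniq U _ _ (hs U f hf) h
  let fam : Presieve.FamilyOfElements (P1.{u}.Mgp.obj ⋙ forget CommGrpCat) R.arrows := s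
  have hfam : fam.Compatible := by
    intro U₁ U₂ U a₁ a₂ f₁ f₂ hf₁ hf₂ _
    exact huniq U _ _ (hres _ _ a₁ _ (hs _ _ hf₁)) (hres _ _ a₂ _ (hs _ _ hf₂))
  obtain ⟨t, ht, htu⟩ := P1.{u}.isSheaf_gp R hR fam hfam
  have r₀ : Rel (P1.chart 0) (P1.secToGp _ P1.ratio) := Or.inl ⟨𝟙 _, (gpRes_id _ _).symm⟩
  have r₁ : Rel (P1.chart 1) (P1.secToGp _ P1.ratio')⁻¹ :=
    Or.inr ⟨𝟙 _, congrArg _ (gpRes_id _ _).symm⟩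
  refine ⟨t, ⟨(ht _ (hchart 0)).trans (hs' _ _ _ _ r₀), (ht _ (hchart 1)).trans (hs' _ _ _ _ r₁)⟩,
    fun t' ht' => htu t' fun U f hf => (hs' U f hf _ ?_).symm⟩
  obtain ⟨s', ⟨p, -⟩ | ⟨q, -⟩⟩ := hf
  · refine Or.inl ⟨p, ?_⟩
    rw [← ht'.1, ← gpRes_comp, P1.toTop_comp]
    exact congrArg (fun f => P1.gpRes f t') (P1.toTop_eq f)
  · refine Or.inr ⟨q, ?_⟩
    rw [← map_inv, ← ht'.2, ← gpRes_comp, P1.toTop_comp]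
    exact congrArg (fun f => P1.gpRes f t') (P1.toTop_eq f)

/-- The coordinate `x₀⁻¹ x₁` of the projective line, a global section of `Mᵍᵖ`. -/
def P1.coord : P1.{u}.gpSec P1.top := P1.existsUnique_coord.choose

theorem P1.coord_spec : P1.gpRes (P1.toTop (P1.chart.{u} 0)) P1.coord = P1.secToGp _ P1.ratio ∧
    P1.gpRes (P1.toTop (P1.chart.{u} 1)) P1.coord = (P1.secToGp _ P1.ratio')⁻¹ :=
  P1.existsUnique_coord.choose_spec.1

/-! ### The blowup of the affine plane at the origin -/

section Rees

variable {R : Type u} [CommRing R] (I : Ideal R)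

/-- The grading of the Rees algebra `⨁ Iⁿ Tⁿ ⊆ R[T]` by the degree in `T`. -/
def reesGrading (n : ℕ) : Submodule R (reesAlgebra I) where
  carrier := {f | ∀ i, i ≠ n → (f : Polynomial R).coeff i = 0}
  zero_mem' _ _ := Polynomial.coeff_zero _
  add_mem' {f g} hf hg i hi := by
    change ((f : Polynomial R) + g).coeff i = 0
    rw [Polynomial.coeff_add, hf i hi, hg i hi, add_zero]
  smul_mem' r f hf i hi := by
    change (r • (f : Polynomial R)).coeff i = 0
    rw [Polynomial.coeff_smul, hf i hi, smul_zero]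

/-- The component of degree `n` of an element of the Rees algebra. -/
def reesComponent (f : reesAlgebra I) (n : ℕ) : reesGrading I n :=
  ⟨⟨Polynomial.monomial n ((f : Polynomial R).coeff n), reesAlgebra.monomial_mem.2 (f.2 n)⟩,
    fun _ hi => Polynomial.coeff_monomial_of_ne _ hi⟩

theorem coeff_coeAddMonoidHom (x : DirectSum ℕ fun n => reesGrading I n) (n : ℕ) :
    ((DirectSum.coeAddMonoidHom (reesGrading I) x : reesAlgebra I) : Polynomial R).coeff n =
      ((x n : reesAlgebra I) : Polynomial R).coeff n := by
  induction x using DirectSum.induction_on with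
  | zero => simp
  | of i y =>
    rw [DirectSum.coeAddMonoidHom_of]
    by_cases h : n = i
    · subst h
      rw [DirectSum.of_eq_same]
    · rw [DirectSum.of_eq_of_ne _ _ _ h]
      exact (y.2 n h).trans (Polynomial.coeff_zero n).symm
  | add x y hx hy =>
    rw [map_add, DirectSum.add_apply]
    change ((_ : Polynomial R) + _).coeff n = ((_ : Polynomial R) + _).coeff n
    rw [Polynomial.coeff_add, Polynomial.coeff_add, hx, hy]

instance reesGradedRing : GradedAlgebra (reesGrading I) where
  one_mem i hi := by
    change (1 : Polynomial R).coeff i = 0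
    rw [Polynomial.coeff_one, if_neg hi]
  mul_mem m n f g hf hg i hi := by
    change ((f : Polynomial R) * (g : Polynomial R)).coeff i = 0
    rw [Polynomial.coeff_mul]
    refine Finset.sum_eq_zero fun p hp => ?_
    by_cases h : p.1 = m
    · have h' : p.2 ≠ n := fun h' => hi (by rw [← Finset.HasAntidiagonal.mem_antidiagonal.1 hp, h, h'])
      rw [hg _ h', mul_zero]
    · rw [hf _ h, zero_mul]
  decompose' f := ∑ n ∈ (f : Polynomial R).support,
    DirectSum.of (fun n => reesGrading I n) n (reesComponent I f n)
  left_inv f := by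
    rw [map_sum]
    simp only [DirectSum.coeAddMonoidHom_of]
    apply Subtype.ext
    rw [AddSubmonoidClass.coe_finsetSum]
    exact ((f : Polynomial R).sum_monomial_eq)
  right_inv x := by
    have hinj : Function.Injective (DirectSum.coeAddMonoidHom (reesGrading I)) := by
      intro x y h
      refine DFinsupp.ext fun n => Subtype.ext (Subtype.ext (Polynomial.ext fun i => ?_))
      by_cases hi : i = n
      · subst hi
        exact (coeff_coeAddMonoidHom I x i).symm.trans
          ((congrArg (fun f : reesAlgebra I => (f : Polynomial R).coeff i) h).trans
            (coeff_coeAddMonoidHom I y i))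
      · exact ((x n).2 i hi).trans ((y n).2 i hi).symm
    apply hinj
    rw [map_sum]
    simp only [DirectSum.coeAddMonoidHom_of]
    apply Subtype.ext
    rw [AddSubmonoidClass.coe_finsetSum]
    exact (Polynomial.sum_monomial_eq _)

/-- The element `r T` of degree one of the Rees algebra, for `r ∈ I`. -/
def reesT {r : R} (hr : r ∈ I) : reesAlgebra I :=
  ⟨Polynomial.monomial 1 r, reesAlgebra.monomial_mem.2 (by rwa [pow_one])⟩

theorem reesT_mem {r : R} (hr : r ∈ I) : reesT I hr ∈ reesGrading I 1 :=
  fun _ hi => Polynomial.coeff_monomial_of_ne _ hi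

/-- The blowup of `Spec R` along the ideal `I`. -/
def blowup : Scheme.{u} := Proj (reesGrading I)

/-- The projection of the blowup to `Spec R`. -/
def blowupToSpec : blowup I ⟶ Spec (.of R) :=
  Proj.toSpecZero (reesGrading I) ≫
    Spec.map (CommRingCat.ofHom (algebraMap R (reesGrading I 0)))

end Rees

/-- The ideal `(x₀, x₁)` of the origin of the affine plane. -/
def originIdeal : Ideal PlaneRing.{u} := Ideal.span (Set.range MvPolynomial.X)

theorem X_mem_originIdeal (i : Fin 2) : (MvPolynomial.X i : PlaneRing.{u}) ∈ originIdeal :=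
  Ideal.subset_span ⟨i, rfl⟩

/-- The chart `D₊(xᵢ T)` of the blowup of the affine plane at the origin. -/
def blowupChart (i : Fin 2) : (blowup originIdeal.{u}).Etale :=
  projChart (reesGrading originIdeal) (reesT_mem _ (X_mem_originIdeal i))

/-- The function `xⱼ / xᵢ = xⱼ T / xᵢ T` on `D₊(xᵢ T)`. -/
def blowupRatio (i j : Fin 2) : Γ((blowupChart.{u} i).left, ⊤) :=
  projRatio (reesGrading originIdeal) (reesT_mem _ (X_mem_originIdeal i))
    (reesT_mem _ (X_mem_originIdeal j))

/-- The generators of the toric logarithmic structure of the blowup: the pullbacks of the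
coordinates of the plane, the function `x₁ / x₀` on `D₊(x₀ T)` and the function `x₀ / x₁` on
`D₊(x₁ T)`. -/
def blowupGenerators : Generators (blowup originIdeal.{u}) :=
  globalGenerators (Set.range fun i : Fin 2 =>
    (blowupToSpec originIdeal.{u}).appTop (specFun (MvPolynomial.X i : PlaneRing.{u}))) ∪
  {⟨blowupChart 0, blowupRatio 0 1⟩, ⟨blowupChart 1, blowupRatio 1 0⟩}

/-- The blowup of the affine plane at the origin with its toric logarithmic structure. -/
def Bl : LogScheme.{u} := ofGenerators blowupGenerators.{u}

/-- The blowup of the affine plane at the origin. -/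
def blowupMap : Bl.{u} ⟶ A2.{u} :=
  homOfGenerators blowupGenerators.{u} (blowupToSpec originIdeal) (by
    rintro _ ⟨i, rfl⟩
    exact mem_genSections_self (Or.inl ⟨_, ⟨i, rfl⟩, rfl⟩))

/-! ### Presheaves on fs logarithmic schemes -/

/-- The pullback `Γ(Y, M_Y) → Γ(X, M_X)` along a morphism `X → Y`. -/
def pullSec (F : X ⟶ Y) : Y.sec Y.top →* X.sec X.top :=
  F.pull (U := X.top) (V := Y.top) F.f ((Category.comp_id _).trans (Category.id_comp _).symm)

/-- The category of fs logarithmic schemes. -/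
abbrev FsLogScheme := IsFs.{u}.FullSubcategory

/-- The functor of points of a logarithmic scheme, on fs logarithmic schemes. -/
def points (X : LogScheme.{u}) : FsLogScheme.{u}ᵒᵖ ⥤ Type (u + 1) :=
  IsFs.ι.op ⋙ yoneda.obj X

/-- The map on functors of points induced by a morphism. -/
def pointsMap (F : X ⟶ Y) : points X ⟶ points Y :=
  Functor.whiskerLeft IsFs.ι.op (yoneda.map F)

/-- The logarithmic multiplicative group `S ↦ Γ(S, M_Sᵍᵖ)` on fs logarithmic schemes. -/
def GlogFs : FsLogScheme.{u}ᵒᵖ ⥤ Type (u + 1) :=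
  IsFs.ι.op ⋙ Glog.{u} ⋙ uliftFunctor.{u + 1}

/-- The map `P¹ → G_log` given by the coordinate `x₀⁻¹ x₁`: it sends `h : S → P¹` to the pullback of
the coordinate along `h`. -/
def p1ToGlog : points P1.{u} ⟶ GlogFs.{u} where
  app S := TypeCat.ofHom fun h : S.unop.obj ⟶ P1.{u} => ULift.up (gpPullback h P1.coord)
  naturality S T a := by
    ext h
    exact congrArg ULift.up (ConcreteCategory.congr_hom
      (Glog.{u}.map_comp (Quiver.Hom.op h) a.unop.hom.op) P1.coord)

/-- The map `S → G_log` given by a section of `M_Sᵍᵖ`. -/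
def toGlog (S : FsLogScheme.{u}) (α : S.obj.gpSec S.obj.top) : yoneda.obj S ⟶ GlogFs.{u} :=
  yonedaEquiv.symm (ULift.up α)

/-- The map from (the functor represented by) `S` to the functor of points of `X` given by a
morphism `S → X`. -/
def toPoints (S : FsLogScheme.{u}) (h : S.obj ⟶ X) : yoneda.obj S ⟶ points X :=
  yonedaEquiv.symm h

/-! ### Logarithmic modifications -/

/-- A submonoid of the lattice `ℤⁿ` is toric if it is finitely generated, saturated and generates
`ℤⁿ` as a group. -/
structure IsToricMonoid {n : ℕ} (P : AddSubmonoid (Fin n → ℤ)) : Prop where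
  fg : P.FG
  saturated : ∀ (k : ℕ) (m : Fin n → ℤ), 0 < k → k • m ∈ P → m ∈ P
  closure_eq_top : AddSubgroup.closure (P : Set (Fin n → ℤ)) = ⊤

/-- A toric modification of an affine toric variety: a proper toric morphism `π : W → A` where
`A = Spec ℤ[P]`, and the toric variety `W` is covered by affine open toric subvarieties
`Spec ℤ[Qᵢ]`, with the same torus `Spec ℤ[ℤⁿ]`, on which `π` is given by inclusions `P ⊆ Qᵢ`. -/
def IsToricModification {W A : LogScheme.{u}} (π : W ⟶ A) : Prop :=
  ∃ (n : ℕ) (P : AddSubmonoid (Fin n → ℤ)) (_ : IsToricMonoid P) (e : A ≅ affineToric.{u} P)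
    (k : ℕ) (Q : Fin (k + 1) → AddSubmonoid (Fin n → ℤ)) (_ : ∀ i, IsToricMonoid (Q i))
    (hPQ : ∀ i, P ≤ Q i) (j : ∀ i, affineToric.{u} (Q i) ⟶ W),
    (∀ i, IsStrictOpenImmersion (j i)) ∧
    (∀ w : W.scheme, ∃ (i : Fin (k + 1)) (y : (affineToric.{u} (Q i)).scheme), (j i).f y = w) ∧
    (∀ i, j i ≫ π ≫ e.hom = affineToricMap (AddSubmonoid.inclusion (hPQ i))) ∧
    (∀ i i', affineToricMap (Q i).subtype ≫ j i = affineToricMap (Q i').subtype ≫ j i') ∧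
    IsProper π.f

/-- A morphism `X → S` of fs logarithmic schemes is a logarithmic modification if, strict étale
locally on `S`, it is the base change, in the category of fs logarithmic schemes, of a toric
modification of an affine toric variety. -/
def IsLogModification : MorphismProperty FsLogScheme.{u} := fun X S p =>
  ∀ s : S.obj.scheme, ∃ (U : FsLogScheme.{u}) (a : U ⟶ S) (y : U.obj.scheme)
    (W A : FsLogScheme.{u}) (π : W ⟶ A) (h : U ⟶ A) (V : FsLogScheme.{u}) (b : V ⟶ X) (q : V ⟶ U)
    (r : V ⟶ W),
    IsStrictEtale a.hom ∧ a.hom.f y = s ∧ IsToricModification π.hom ∧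
    IsPullback b q p a ∧ IsPullback r q π h

end LogScheme

end

end LogGeometry

open LogGeometry LogGeometry.LogScheme

/-!
The fibre product of `P¹` and `S` over `G_log` along `α` is the functor of those morphisms `T ⟶ S` from
fs logarithmic schemes along which `α` is *comparable* to `1`: étale locally on `T`, the pullback of
`α` or of `α⁻¹` is (the class of) a section of the logarithmic structure (`LocComparable`). Indeed the
two charts of `P¹` are the functors of sections of the logarithmic structure, so a morphism to `P¹` with
coordinate `α` exists étale locally exactly under this condition; it is unique, because fs logarithmic
structures are integral, and hence it glues (`exists_P1_hom`, `P1_hom_ext`). The charts of the blowup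
`Y` of the plane are planes with coordinates `xᵢ` and `xⱼ / xᵢ`, so the same argument shows that a
morphism `(β, γ)` to the plane lifts to `Y`, uniquely, exactly when `β⁻¹ γ` is comparable
(`exists_blowup_lift`, `blowup_hom_ext`). This gives the isomorphism of fibre products
(`nonempty_pullback_iso`). It also shows that any fs logarithmic scheme over `S` which represents the
comparable locus of `α` is a logarithmic modification (`isLogModification_of_isComparableLocus`): étale
locally `α = β⁻¹ γ`, the comparable locus is the base change of `Y`, and `Y` is a toric modification
of the plane, subdividing the quadrant into two cones (`isToricModification_blowupMap`).

The remaining point is that the comparable locus is representable over all of `S`, where `α` need not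
be a quotient of global sections (`exists_isComparableLocus`). Étale locally, `α` is up to a unit an
element `x` of the group completion of a chart `P`, and the locus where `α` becomes a section of the
logarithmic structure is represented by the base change of `Spec ℤ[Q] ⟶ Spec ℤ[P]`, where `Q` is the
saturation of `P[x]` (`exists_isEffectiveLocus`); here `Q` is finitely generated (`fg_adjoinSat`). These
local models have to be descended to `S`. To do so, consider pairs of a morphism to `S` and a morphism to
`P¹` with coordinate `α`, as a sheaf over the scheme `S × P¹` (`lineSheaf`). Over the products of an
affine étale `S`-scheme with one of the two standard charts of `P¹`, it is represented by a local
model, which is affine. For affine representing objects étale descent is effective: the underlying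
schemes descend by flat descent of algebras (`bijective_invariantsMap`, `Rep.descend_spec`), and the
logarithmic structures are glued by defining a section as a compatible family of sections over all fs
logarithmic schemes mapping to members of the cover (`EtaleGluing`, `Rep.glue`). Finally, the objects
representing the sheaf over open subschemes of `S × P¹` glue (`exists_rep_of_opens`).

Throughout, morphisms are constructed from charts: a morphism to a logarithmic scheme with a global
chart by `P` is a morphism of schemes with a compatible homomorphism from `P` to the global sections of
the logarithmic structure of the source (`exists_hom_of_chart`, `hom_ext_of_chart`). That the monomial
logarithmic structures on the plane, on `P¹` and on the blowup have such charts follows from the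
regularity of the coordinate functions, which is preserved by étale localization
(`chartAt_ofGenerators`).
-/

namespace LogGeometry

namespace LogScheme

noncomputable section

/-! ### Gluing on the small étale site -/

theorem sheaf_ext {S : Scheme.{u}} {F : S.Etaleᵒᵖ ⥤ Type u}
    (hF : Presieve.IsSheaf S.smallEtaleTopology F) {V : S.Etale} {s t : F.obj (op V)}
    (h : ∀ v : V.left, ∃ (W : S.Etale) (a : W ⟶ V) (w : W.left), a.left w = v ∧
      F.map a.op s = F.map a.op t) : s = t := by
  let R : Sieve V :=
    { arrows := fun W a => F.map a.op s = F.map a.op t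
      downward_closed := by
        intro W W' a ha b
        rw [op_comp, Functor.map_comp_apply, Functor.map_comp_apply, ha] }
  have hR : R ∈ S.smallEtaleTopology V := (mem_smallEtale_iff _).2 fun v => by
    obtain ⟨W, a, w, hw, e⟩ := h v
    exact ⟨W, a, w, e, hw⟩
  exact (hF R hR).isSeparatedFor.ext fun W a ha => ha

/-- A section of an étale sheaf can be constructed by prescribing, by a relation which is compatible
with restriction and determines its second argument, what its restrictions are. -/
theorem sheaf_glue {S : Scheme.{u}} {F : S.Etaleᵒᵖ ⥤ Type u}
    (hF : Presieve.IsSheaf S.smallEtaleTopology F) {V : S.Etale}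
    (P : ∀ {W : S.Etale}, (W ⟶ V) → F.obj (op W) → Prop)
    (hres : ∀ {W W' : S.Etale} (a : W ⟶ V) (b : W' ⟶ W) (s : F.obj (op W)), P a s →
      P (b ≫ a) (F.map b.op s))
    (huniq : ∀ {W : S.Etale} (a : W ⟶ V) (s t : F.obj (op W)), P a s → P a t → s = t)
    (hex : ∀ v : V.left, ∃ (W : S.Etale) (a : W ⟶ V) (w : W.left) (s : F.obj (op W)),
      a.left w = v ∧ P a s) :
    ∃ s : F.obj (op V), ∀ (W : S.Etale) (a : W ⟶ V) (t : F.obj (op W)), P a t →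
      F.map a.op s = t := by
  let R : Sieve V :=
    { arrows := fun W a => ∃ s, P a s
      downward_closed := by
        rintro W W' a ⟨s, hs⟩ b
        exact ⟨_, hres a b s hs⟩ }
  have hR : R ∈ S.smallEtaleTopology V := (mem_smallEtale_iff _).2 fun v => by
    obtain ⟨W, a, w, s, hw, e⟩ := hex v
    exact ⟨W, a, w, ⟨s, e⟩, hw⟩
  have hR' : ∀ (W : S.Etale) (a : W ⟶ V), R a → ∃ s, P a s := fun W a h => h
  choose s hs using hR'
  obtain ⟨t, ht, -⟩ := hF R hR (fun W a h => s W a h) (by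
    intro W₁ W₂ W a₁ a₂ f₁ f₂ h₁ h₂ e
    refine huniq (a₁ ≫ f₁) _ _ (hres _ _ _ (hs _ _ h₁)) ?_
    rw [e]
    exact hres _ _ _ (hs _ _ h₂))
  exact ⟨t, fun W a t' h' => (ht a ⟨t', h'⟩).trans (huniq a _ _ (hs _ _ _) h')⟩

/-- The presheaf of morphisms to a fixed scheme on the small étale site. -/
def homPresheaf (S Y : Scheme.{u}) : S.Etaleᵒᵖ ⥤ Type u :=
  (Scheme.Etale.forget S ⋙ Over.forget S).op ⋙ yoneda.obj Y

theorem isSheaf_homPresheaf (S Y : Scheme.{u}) :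
    Presieve.IsSheaf S.smallEtaleTopology (homPresheaf S Y) := by
  have : Presheaf.IsSheaf Scheme.etaleTopology.{u} (yoneda.obj Y) := by
    rw [isSheaf_iff_isSheaf_of_type]
    exact Presieve.isSheaf_of_le _ etaleTopology_le_fppfTopology
      (GrothendieckTopology.Subcanonical.isSheaf_of_isRepresentable _)
  rw [← isSheaf_iff_isSheaf_of_type]
  exact (Scheme.Etale.forget S ⋙ Over.forget S).op_comp_isSheaf_of_isSheaf _ _ _ this


/-- Every étale morphism to a member of the étale site is a morphism of the site. -/
def etaleOver {S U V : Scheme.{u}} {u : U ⟶ S} {v : V ⟶ S} [Etale u] [Etale v] (a : U ⟶ V)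
    (w : a ≫ v = u) : Scheme.Etale.mk u ⟶ Scheme.Etale.mk v :=
  etaleHomMk (U := Scheme.Etale.mk u) (V := Scheme.Etale.mk v) a w

theorem etaleOver_left {S U V : Scheme.{u}} {u : U ⟶ S} {v : V ⟶ S} [Etale u] [Etale v] (a : U ⟶ V)
    (w : a ≫ v = u) : (etaleOver a w).left = a :=
  etaleHomMk_left (U := Scheme.Etale.mk u) (V := Scheme.Etale.mk v) a w

theorem eq_etaleOver {S : Scheme.{u}} {U V : S.Etale} (a : U ⟶ V) :
    a = etaleOver (u := U.hom) (v := V.hom) a.left (etaleHom_w a) :=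
  etaleHom_ext (etaleOver_left (u := U.hom) (v := V.hom) a.left (etaleHom_w a)).symm

theorem etale_hom_ext {T Y : Scheme.{u}} {f g : T ⟶ Y}
    (h : ∀ t : T, ∃ (U : Scheme.{u}) (a : U ⟶ T) (_ : Etale a) (x : U), a x = t ∧ a ≫ f = a ≫ g) :
    f = g := by
  refine sheaf_ext (isSheaf_homPresheaf T Y) (V := Scheme.Etale.mk (𝟙 T)) (s := f) (t := g)
    fun t => ?_
  obtain ⟨U, a, _, x, hx, e⟩ := h t
  have hl := etaleOver_left a (Category.comp_id a)
  refine ⟨_, etaleOver a (Category.comp_id a), x, (congrArg (fun k : U ⟶ T => k x) hl).trans hx, ?_⟩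
  exact (congrArg (· ≫ f) hl).trans (e.trans (congrArg (· ≫ g) hl).symm)

theorem etale_hom_glue {T Y : Scheme.{u}}
    (P : ∀ {U : Scheme.{u}} (a : U ⟶ T), Etale a → (U ⟶ Y) → Prop)
    (hres : ∀ {U U' : Scheme.{u}} (a : U ⟶ T) (ha : Etale a) (b : U' ⟶ U) (_ : Etale b)
      (a' : U' ⟶ T) (ha' : Etale a') (_ : b ≫ a = a') (k : U ⟶ Y), P a ha k → P a' ha' (b ≫ k))
    (huniq : ∀ {U : Scheme.{u}} (a : U ⟶ T) (ha : Etale a) (k k' : U ⟶ Y), P a ha k → P a ha k' →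
      k = k')
    (hex : ∀ t : T, ∃ (U : Scheme.{u}) (a : U ⟶ T) (ha : Etale a) (x : U) (k : U ⟶ Y),
      a x = t ∧ P a ha k) :
    ∃ f : T ⟶ Y, ∀ {U : Scheme.{u}} (a : U ⟶ T) (ha : Etale a) (k : U ⟶ Y), P a ha k →
      a ≫ f = k := by
  obtain ⟨f, hf⟩ := sheaf_glue (isSheaf_homPresheaf T Y) (V := Scheme.Etale.mk (𝟙 T))
    (fun {W} a k => P (W.hom : W.left ⟶ T) inferInstance k)
    (fun {W W'} a b s h => hres _ _ b.left inferInstance _ inferInstance (etaleHom_w b) s h)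
    (fun {W} a s t => huniq _ _ s t) (by
      intro t
      obtain ⟨U, a, ha, x, k, hx, hk⟩ := hex t
      refine ⟨Scheme.Etale.mk a, etaleOver a (Category.comp_id a), x, k, ?_, hk⟩
      exact (congrArg (fun k : U ⟶ T => k x) (etaleOver_left a (Category.comp_id a))).trans hx)
  refine ⟨f, fun {U} a ha k hk => ?_⟩
  exact (congrArg (· ≫ f) (etaleOver_left a (Category.comp_id a)).symm).trans
    (hf (Scheme.Etale.mk a) (etaleOver a (Category.comp_id a)) k hk)

theorem appTop_etale_ext {T : Scheme.{u}} {f g : Γ(T, ⊤)}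
    (h : ∀ t : T, ∃ (U : Scheme.{u}) (a : U ⟶ T) (_ : Etale a) (x : U),
      a x = t ∧ a.appTop f = a.appTop g) : f = g := by
  refine sheaf_ext (isSheaf_structurePresheaf T) (V := Scheme.Etale.mk (𝟙 T)) (s := f) (t := g)
    fun t => ?_
  obtain ⟨U, a, _, x, hx, e⟩ := h t
  have hl := etaleOver_left a (Category.comp_id a)
  refine ⟨_, etaleOver a (Category.comp_id a), x, (congrArg (fun k : U ⟶ T => k x) hl).trans hx, ?_⟩
  exact (congrArg (fun k : U ⟶ T => k.appTop f) hl).trans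
    (e.trans (congrArg (fun k : U ⟶ T => k.appTop g) hl).symm)

theorem appTop_etale_glue {T : Scheme.{u}}
    (P : ∀ {U : Scheme.{u}} (a : U ⟶ T), Etale a → Γ(U, ⊤) → Prop)
    (hres : ∀ {U U' : Scheme.{u}} (a : U ⟶ T) (ha : Etale a) (b : U' ⟶ U) (_ : Etale b)
      (a' : U' ⟶ T) (ha' : Etale a') (_ : b ≫ a = a') (k : Γ(U, ⊤)), P a ha k →
      P a' ha' (b.appTop k))
    (huniq : ∀ {U : Scheme.{u}} (a : U ⟶ T) (ha : Etale a) (k k' : Γ(U, ⊤)), P a ha k → P a ha k' →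
      k = k')
    (hex : ∀ t : T, ∃ (U : Scheme.{u}) (a : U ⟶ T) (ha : Etale a) (x : U) (k : Γ(U, ⊤)),
      a x = t ∧ P a ha k) :
    ∃ f : Γ(T, ⊤), ∀ {U : Scheme.{u}} (a : U ⟶ T) (ha : Etale a) (k : Γ(U, ⊤)), P a ha k →
      a.appTop f = k := by
  obtain ⟨f, hf⟩ := sheaf_glue (isSheaf_structurePresheaf T) (V := Scheme.Etale.mk (𝟙 T))
    (fun {W} a k => P (W.hom : W.left ⟶ T) inferInstance k)
    (fun {W W'} a b s h => hres _ _ b.left inferInstance _ inferInstance (etaleHom_w b) s h)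
    (fun {W} a s t => huniq _ _ s t) (by
      intro t
      obtain ⟨U, a, ha, x, k, hx, hk⟩ := hex t
      refine ⟨Scheme.Etale.mk a, etaleOver a (Category.comp_id a), x, k, ?_, hk⟩
      exact (congrArg (fun k : U ⟶ T => k x) (etaleOver_left a (Category.comp_id a))).trans hx)
  refine ⟨f, fun {U} a ha k hk => ?_⟩
  exact (congrArg (fun k : U ⟶ T => k.appTop f) (etaleOver_left a (Category.comp_id a)).symm).trans
    (hf (Scheme.Etale.mk a) (etaleOver a (Category.comp_id a)) k hk)

/-! ### Sections over étale schemes -/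

variable (X : LogScheme.{u})

section Sec

variable {U V W : Scheme.{u}} {u : U ⟶ X.scheme} {v : V ⟶ X.scheme} {w : W ⟶ X.scheme}
  [Etale u] [Etale v] [Etale w]

/-- The monoid of sections of `M` over a scheme étale over `X`. -/
def Sec {U : Scheme.{u}} (u : U ⟶ X.scheme) [Etale u] : Type u := X.sec (Scheme.Etale.mk u)

instance {U : Scheme.{u}} (u : U ⟶ X.scheme) [Etale u] : CommMonoid (X.Sec u) :=
  inferInstanceAs (CommMonoid (X.sec (Scheme.Etale.mk u)))

/-- Restriction of sections along a morphism of schemes étale over `X`. -/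
def rs (a : U ⟶ V) (h : a ≫ v = u) : X.Sec v →* X.Sec u :=
  X.res (etaleOver a h)

/-- The function given by a section. -/
def ex {U : Scheme.{u}} {u : U ⟶ X.scheme} [Etale u] : X.Sec u →* Γ(U, ⊤) :=
  X.expSec (Scheme.Etale.mk u)

theorem rs_id (h : 𝟙 U ≫ u = u) (m : X.Sec u) : X.rs (𝟙 U) h m = m := by
  refine Eq.trans ?_ (X.res_id m)
  exact congrArg (fun a => X.res a m) (etaleHom_ext (etaleOver_left _ _))

theorem rs_rs (a : U ⟶ V) (b : V ⟶ W) (c : U ⟶ W) (ha : a ≫ v = u) (hb : b ≫ w = v)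
    (hc : c ≫ w = u) (e : c = a ≫ b) (m : X.Sec w) :
    X.rs a ha (X.rs b hb m) = X.rs c hc m := by
  refine (X.res_comp _ _ m).symm.trans ?_
  refine congrArg (fun a => X.res a m) (etaleHom_ext ?_)
  subst e
  refine Eq.trans ?_ (etaleOver_left _ hc).symm
  refine (etale_comp_left _ _).trans ?_
  exact congrArg₂ (· ≫ ·) (etaleOver_left _ ha) (etaleOver_left _ hb)

theorem ex_rs (a : U ⟶ V) (ha : a ≫ v = u) (m : X.Sec v) :
    X.ex (X.rs a ha m) = a.appTop (X.ex m) :=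
  (X.expSec_res _ m).trans (congrArg (fun k : U ⟶ V => k.appTop (X.ex m)) (etaleOver_left _ ha))

variable {X}

theorem Sec_ext {m n : X.Sec v} (h : ∀ x : V, ∃ (U : Scheme.{u}) (u : U ⟶ X.scheme) (_ : Etale u)
    (a : U ⟶ V) (ha : a ≫ v = u) (y : U), a y = x ∧ X.rs a ha m = X.rs a ha n) : m = n := by
  refine sheaf_ext X.isSheaf (V := Scheme.Etale.mk v) (s := m) (t := n) fun x => ?_
  obtain ⟨U, u, _, a, ha, y, hy, e⟩ := h x
  exact ⟨_, etaleOver a ha, y, (congrArg (fun k : U ⟶ V => k y) (etaleOver_left a ha)).trans hy, e⟩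

theorem Sec_glue
    (P : ∀ {U : Scheme.{u}} (u : U ⟶ X.scheme) [Etale u] (a : U ⟶ V), a ≫ v = u → X.Sec u → Prop)
    (hres : ∀ {U U' : Scheme.{u}} (u : U ⟶ X.scheme) [Etale u] (a : U ⟶ V) (ha : a ≫ v = u)
      (u' : U' ⟶ X.scheme) [Etale u'] (b : U' ⟶ U) (hb : b ≫ u = u') (a' : U' ⟶ V)
      (ha' : a' ≫ v = u') (_ : a' = b ≫ a) (m : X.Sec u), P u a ha m → P u' a' ha' (X.rs b hb m))
    (huniq : ∀ {U : Scheme.{u}} (u : U ⟶ X.scheme) [Etale u] (a : U ⟶ V) (ha : a ≫ v = u)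
      (m n : X.Sec u), P u a ha m → P u a ha n → m = n)
    (hex : ∀ x : V, ∃ (U : Scheme.{u}) (u : U ⟶ X.scheme) (_ : Etale u) (a : U ⟶ V)
      (ha : a ≫ v = u) (y : U) (m : X.Sec u), a y = x ∧ P u a ha m) :
    ∃ m : X.Sec v, ∀ {U : Scheme.{u}} (u : U ⟶ X.scheme) [Etale u] (a : U ⟶ V) (ha : a ≫ v = u)
      (n : X.Sec u), P u a ha n → X.rs a ha m = n := by
  obtain ⟨m, hm⟩ := sheaf_glue X.isSheaf (V := Scheme.Etale.mk v)
    (fun {W} a n => P (W.hom : W.left ⟶ X.scheme) a.left (etaleHom_w a) n)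
    (fun {W W'} a b s h => by
      have e := eq_etaleOver b
      have := hres (W.hom : W.left ⟶ X.scheme) a.left (etaleHom_w a)
        (W'.hom : W'.left ⟶ X.scheme) b.left (etaleHom_w b) (b ≫ a).left (etaleHom_w (b ≫ a))
        (etale_comp_left _ _) s h
      have e' : X.res b s = X.rs (u := W'.hom) (v := W.hom) b.left (etaleHom_w b) s :=
        congrArg (fun k => X.res k s) e
      exact e' ▸ this)
    (fun {W} a s t => huniq _ _ _ s t) (by
      intro x
      obtain ⟨U, u, _, a, ha, y, m, hy, hm⟩ := hex x
      refine ⟨Scheme.Etale.mk u, etaleOver a ha, y, m, ?_, ?_⟩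
      · exact (congrArg (fun k : U ⟶ V => k y) (etaleOver_left a ha)).trans hy
      · have := hres u a ha u (𝟙 U) (Category.id_comp _) (etaleOver a ha).left (etaleHom_w _)
          ((etaleOver_left a ha).trans (Category.id_comp _).symm) m hm
        rwa [rs_id] at this)
  refine ⟨m, fun {U} u _ a ha n hn => ?_⟩
  refine hm (Scheme.Etale.mk u) (etaleOver a ha) n ?_
  have := hres u a ha u (𝟙 U) (Category.id_comp _) (etaleOver a ha).left (etaleHom_w _)
    ((etaleOver_left a ha).trans (Category.id_comp _).symm) n hn
  rwa [rs_id] at this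

variable (X)

theorem existsUnique_ex {f : Γ(U, ⊤)} (hf : IsUnit f) : ∃! m : X.Sec u, X.ex m = f :=
  X.existsUnique_unit (Scheme.Etale.mk u) f hf

end Sec

end

end LogScheme

end LogGeometry

namespace LogGeometry

namespace LogScheme

noncomputable section

/-! ### Morphisms in terms of sections over étale schemes -/

section HomSec

variable {X Y Z : LogScheme.{u}}

section

variable {U V W U' V' : Scheme.{u}} {u : U ⟶ X.scheme} {u' : U' ⟶ X.scheme} {v : V ⟶ Y.scheme}
  {v' : V' ⟶ Y.scheme} [Etale u] [Etale u'] [Etale v] [Etale v']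

/-- The pullback of sections along a morphism of logarithmic schemes. -/
def Hom.pl (F : X ⟶ Y) {U V : Scheme.{u}} {u : U ⟶ X.scheme} {v : V ⟶ Y.scheme} [Etale u] [Etale v]
    (g : U ⟶ V) (h : g ≫ v = u ≫ F.f) : Y.Sec v →* X.Sec u :=
  F.pull (U := Scheme.Etale.mk u) (V := Scheme.Etale.mk v) g h

theorem Hom.rs_pl_rs (F : X ⟶ Y) (a : U' ⟶ U) (ha : a ≫ u = u') (g : U ⟶ V)
    (h : g ≫ v = u ≫ F.f) (b : V ⟶ V') (hb : b ≫ v' = v) (g' : U' ⟶ V')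
    (h' : g' ≫ v' = u' ≫ F.f) (e : g' = a ≫ g ≫ b) (m : Y.Sec v') :
    X.rs a ha (F.pl g h (Y.rs b hb m)) = F.pl g' h' m :=
  (F.pull_res (etaleOver a ha) (etaleOver b hb) g h g' h' (e.trans (by
    have h₁ := etaleOver_left a ha
    have h₂ := etaleOver_left b hb
    exact congrArg₂ (fun (i : U' ⟶ U) (j : V ⟶ V') => i ≫ g ≫ j) h₁.symm h₂.symm)) m).symm

theorem Hom.rs_pl (F : X ⟶ Y) (a : U' ⟶ U) (ha : a ≫ u = u') (g : U ⟶ V)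
    (h : g ≫ v = u ≫ F.f) (g' : U' ⟶ V) (h' : g' ≫ v = u' ≫ F.f) (e : g' = a ≫ g) (m : Y.Sec v) :
    X.rs a ha (F.pl g h m) = F.pl g' h' m := by
  have := F.rs_pl_rs a ha g h (𝟙 V) (Category.id_comp v) g' h' (by rw [e, Category.comp_id]) m
  rwa [rs_id] at this

theorem Hom.pl_rs (F : X ⟶ Y) (g : U ⟶ V) (h : g ≫ v = u ≫ F.f) (b : V ⟶ V') (hb : b ≫ v' = v)
    (g' : U ⟶ V') (h' : g' ≫ v' = u ≫ F.f) (e : g' = g ≫ b) (m : Y.Sec v') :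
    F.pl g h (Y.rs b hb m) = F.pl g' h' m := by
  have := F.rs_pl_rs (𝟙 U) (Category.id_comp u) g h b hb g' h' (by rw [e, Category.id_comp]) m
  rwa [rs_id] at this

theorem Hom.ex_pl (F : X ⟶ Y) (g : U ⟶ V) (h : g ≫ v = u ≫ F.f) (m : Y.Sec v) :
    X.ex (F.pl g h m) = g.appTop (Y.ex m) :=
  F.expSec_pull (U := Scheme.Etale.mk u) (V := Scheme.Etale.mk v) g h m

theorem id_pl {v : V ⟶ X.scheme} [Etale v] (g : U ⟶ V) (h : g ≫ v = u ≫ 𝟙 X.scheme)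
    (h' : g ≫ v = u) (m : X.Sec v) : Hom.pl (𝟙 X) g h m = X.rs g h' m := rfl

theorem comp_pl {w : W ⟶ Z.scheme} [Etale w] (F : X ⟶ Y) (G : Y ⟶ Z) (g₁ : U ⟶ V)
    (h₁ : g₁ ≫ v = u ≫ F.f) (g₂ : V ⟶ W) (h₂ : g₂ ≫ w = v ≫ G.f) (g : U ⟶ W)
    (h : g ≫ w = u ≫ F.f ≫ G.f) (e : g = g₁ ≫ g₂) (m : Z.Sec w) :
    Hom.pl (F ≫ G) g h m = F.pl g₁ h₁ (G.pl g₂ h₂ m) :=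
  Hom.compPull_eq F G (U := Scheme.Etale.mk u) (V := Scheme.Etale.mk v) (W := Scheme.Etale.mk w)
    g₁ h₁ g₂ h₂ g h e m

/-- The pullback along a composition, for the pullback of an étale morphism. -/
theorem comp_pl' {w : W ⟶ Z.scheme} [Etale w] (F : X ⟶ Y) (G : Y ⟶ Z) (g : U ⟶ W)
    (h : g ≫ w = u ≫ F.f ≫ G.f) (m : Z.Sec w) :
    Hom.pl (F ≫ G) g h m =
      F.pl (v := pullback.fst G.f w) (pullback.lift (u ≫ F.f) g (by rw [h, Category.assoc]))
        (pullback.lift_fst _ _ _) (G.pl (pullback.snd G.f w) pullback.condition.symm m) :=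
  comp_pl F G _ _ _ _ _ _ (pullback.lift_snd _ _ _).symm m

end

theorem Hom_ext {F G : X ⟶ Y} (h : F.f = G.f)
    (h' : ∀ {U V : Scheme.{u}} (u : U ⟶ X.scheme) (v : V ⟶ Y.scheme) [Etale u] [Etale v]
      (g : U ⟶ V) (w : g ≫ v = u ≫ F.f) (w' : g ≫ v = u ≫ G.f) (m : Y.Sec v),
      F.pl g w m = G.pl g w' m) : F = G :=
  Hom.ext' h fun {U V} g w w' m => h' (U.hom : U.left ⟶ X.scheme) (V.hom : V.left ⟶ Y.scheme) g w w' m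

/-- A morphism of logarithmic schemes, from its action on sections over étale schemes. -/
def mkHom (f : X.scheme ⟶ Y.scheme)
    (p : ∀ {U V : Scheme.{u}} {u : U ⟶ X.scheme} {v : V ⟶ Y.scheme} [Etale u] [Etale v]
      (g : U ⟶ V), g ≫ v = u ≫ f → (Y.Sec v →* X.Sec u))
    (hp : ∀ {U V U' V' : Scheme.{u}} {u : U ⟶ X.scheme} {v : V ⟶ Y.scheme} [Etale u] [Etale v]
      {u' : U' ⟶ X.scheme} {v' : V' ⟶ Y.scheme} [Etale u'] [Etale v'] (a : U' ⟶ U)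
      (ha : a ≫ u = u') (g : U ⟶ V) (h : g ≫ v = u ≫ f) (b : V ⟶ V') (hb : b ≫ v' = v)
      (g' : U' ⟶ V') (h' : g' ≫ v' = u' ≫ f) (_ : g' = a ≫ g ≫ b) (m : Y.Sec v'),
      X.rs a ha (p g h (Y.rs b hb m)) = p g' h' m)
    (hex : ∀ {U V : Scheme.{u}} {u : U ⟶ X.scheme} {v : V ⟶ Y.scheme} [Etale u] [Etale v]
      (g : U ⟶ V) (h : g ≫ v = u ≫ f) (m : Y.Sec v), X.ex (p g h m) = g.appTop (Y.ex m)) :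
    X ⟶ Y where
  f := f
  pull {U V} g w := p (u := U.hom) (v := V.hom) g w
  pull_res {U U' V V'} a b g w g' w' e m := by
    have h := hp (u := U.hom) (u' := U'.hom) (v := V.hom) (v' := V'.hom) a.left (etaleHom_w a) g w
      b.left (etaleHom_w b) g' w' e m
    refine h.symm.trans ?_
    exact congrArg₂ (fun i j => X.res i (p (u := U.hom) (v := V.hom) g w (Y.res j m)))
      (eq_etaleOver a).symm (eq_etaleOver b).symm
  expSec_pull {U V} g w m := hex (u := U.hom) (v := V.hom) g w m

end HomSec

/-! ### Constructing logarithmic schemes from sections over étale schemes -/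

/-- The data of a logarithmic structure on a scheme, as a system of monoids of sections over all
schemes étale over it. -/
structure LogData (S : Scheme.{u}) where
  Sec : ∀ {U : Scheme.{u}} (u : U ⟶ S) [Etale u], Type u
  mon : ∀ {U : Scheme.{u}} (u : U ⟶ S) [Etale u], CommMonoid (Sec u)
  rs : ∀ {U V : Scheme.{u}} {u : U ⟶ S} {v : V ⟶ S} [Etale u] [Etale v] (a : U ⟶ V),
    a ≫ v = u → (Sec v →* Sec u)
  ex : ∀ {U : Scheme.{u}} (u : U ⟶ S) [Etale u], Sec u →* Γ(U, ⊤)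
  rs_id : ∀ {U : Scheme.{u}} (u : U ⟶ S) [Etale u] (h : 𝟙 U ≫ u = u) (m : Sec u), rs (𝟙 U) h m = m
  rs_rs : ∀ {U V W : Scheme.{u}} {u : U ⟶ S} {v : V ⟶ S} {w : W ⟶ S} [Etale u] [Etale v] [Etale w]
    (a : U ⟶ V) (b : V ⟶ W) (ha : a ≫ v = u) (hb : b ≫ w = v) (hc : (a ≫ b) ≫ w = u) (m : Sec w),
    rs a ha (rs b hb m) = rs (a ≫ b) hc m
  ex_rs : ∀ {U V : Scheme.{u}} {u : U ⟶ S} {v : V ⟶ S} [Etale u] [Etale v] (a : U ⟶ V)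
    (h : a ≫ v = u) (m : Sec v), ex u (rs a h m) = a.appTop (ex v m)
  ext : ∀ {V : Scheme.{u}} (v : V ⟶ S) [Etale v] (m n : Sec v), (∀ x : V, ∃ (U : Scheme.{u})
    (u : U ⟶ S) (_ : Etale u) (a : U ⟶ V) (ha : a ≫ v = u) (y : U), a y = x ∧
      rs a ha m = rs a ha n) → m = n
  glue : ∀ {V : Scheme.{u}} (v : V ⟶ S) [Etale v]
    (P : ∀ {U : Scheme.{u}} (u : U ⟶ S) [Etale u] (a : U ⟶ V), a ≫ v = u → Sec u → Prop)
    (_ : ∀ {U U' : Scheme.{u}} (u : U ⟶ S) [Etale u] (a : U ⟶ V) (ha : a ≫ v = u)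
      (u' : U' ⟶ S) [Etale u'] (b : U' ⟶ U) (hb : b ≫ u = u') (a' : U' ⟶ V)
      (ha' : a' ≫ v = u') (_ : a' = b ≫ a) (m : Sec u), P u a ha m → P u' a' ha' (rs b hb m))
    (_ : ∀ {U : Scheme.{u}} (u : U ⟶ S) [Etale u] (a : U ⟶ V) (ha : a ≫ v = u)
      (m n : Sec u), P u a ha m → P u a ha n → m = n)
    (_ : ∀ x : V, ∃ (U : Scheme.{u}) (u : U ⟶ S) (_ : Etale u) (a : U ⟶ V)
      (ha : a ≫ v = u) (y : U) (m : Sec u), a y = x ∧ P u a ha m),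
    ∃ m : Sec v, ∀ {U : Scheme.{u}} (u : U ⟶ S) [Etale u] (a : U ⟶ V) (ha : a ≫ v = u)
      (n : Sec u), P u a ha n → rs a ha m = n
  unit : ∀ {U : Scheme.{u}} (u : U ⟶ S) [Etale u] (f : Γ(U, ⊤)), IsUnit f → ∃! m : Sec u, ex u m = f

namespace LogData

variable {S : Scheme.{u}} (D : LogData S)

instance {U : Scheme.{u}} (u : U ⟶ S) [Etale u] : CommMonoid (D.Sec u) := D.mon u

theorem rs_congr {U V : Scheme.{u}} {u : U ⟶ S} {v : V ⟶ S} [Etale u] [Etale v] {a a' : U ⟶ V}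
    (e : a = a') (h : a ≫ v = u) (h' : a' ≫ v = u) (m : D.Sec v) : D.rs a h m = D.rs a' h' m := by
  subst e
  rfl

/-- The presheaf of monoids of a system of monoids. -/
def presheaf : S.Etaleᵒᵖ ⥤ CommMonCat.{u} where
  obj U := CommMonCat.of (D.Sec (U.unop.hom : U.unop.left ⟶ S))
  map {U V} a := CommMonCat.ofHom (D.rs (u := V.unop.hom) (v := U.unop.hom) a.unop.left
    (etaleHom_w a.unop))
  map_id U := by
    ext m
    exact D.rs_id (U.unop.hom : U.unop.left ⟶ S) (Category.id_comp _) m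
  map_comp {U V W} a b := by
    ext m
    exact (D.rs_rs (u := W.unop.hom) (v := V.unop.hom) (w := U.unop.hom) b.unop.left a.unop.left
      (etaleHom_w b.unop) (etaleHom_w a.unop) (etaleHom_w (b.unop ≫ a.unop)) m).symm

theorem isSheaf_presheaf :
    Presieve.IsSheaf S.smallEtaleTopology (D.presheaf ⋙ forget CommMonCat) := by
  intro V R hR x hx
  have hmem := (mem_smallEtale_iff R).1 hR
  obtain ⟨m, hm⟩ := D.glue (V.hom : V.left ⟶ S)
    (fun {U} u _ a ha n => ∃ h : R (etaleOver (v := V.hom) a ha), n = x _ h)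
    (by
      rintro U U' u _ a ha u' _ b hb a' ha' rfl _ ⟨h, rfl⟩
      have e : etaleOver b hb ≫ etaleOver (v := V.hom) a ha = etaleOver (v := V.hom) (b ≫ a) ha' :=
        etaleHom_ext ((congrArg₂ (· ≫ ·) (etaleOver_left b hb)
          (etaleOver_left (v := V.hom) a ha)).trans (etaleOver_left (v := V.hom) (b ≫ a) ha').symm)
      have h' : R (etaleOver (v := V.hom) (b ≫ a) ha') := e ▸ R.downward_closed h (etaleOver b hb)
      refine ⟨h', ?_⟩
      have := hx (etaleOver b hb) (𝟙 _) h h' (e.trans (Category.id_comp _).symm)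
      rw [op_id, Functor.map_id_apply] at this
      refine Eq.trans ?_ this
      exact D.rs_congr (u := u') (v := u) (etaleOver_left b hb).symm _ _ _)
    (by
      rintro U u _ a ha _ _ ⟨h, rfl⟩ ⟨h', rfl⟩
      rfl)
    (by
      intro y
      obtain ⟨U, a, z, ha, hz⟩ := hmem y
      have e := eq_etaleOver a
      exact ⟨U.left, U.hom, inferInstance, a.left, etaleHom_w a, z, x _ (e ▸ ha), hz, e ▸ ha, rfl⟩)
  refine ⟨m, fun U a ha => ?_, fun m' hm' => ?_⟩
  · have e := eq_etaleOver a
    have := hm (U.hom : U.left ⟶ S) a.left (etaleHom_w a) (x _ (e ▸ ha)) ⟨e ▸ ha, rfl⟩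
    refine Eq.trans this ?_
    congr 1
  · refine D.ext (V.hom : V.left ⟶ S) _ _ fun y => ?_
    obtain ⟨U, a, z, ha, hz⟩ := hmem y
    refine ⟨U.left, U.hom, inferInstance, a.left, etaleHom_w a, z, hz, ?_⟩
    have e := eq_etaleOver a
    have := hm (U.hom : U.left ⟶ S) a.left (etaleHom_w a) (x _ (e ▸ ha)) ⟨e ▸ ha, rfl⟩
    exact Eq.trans (hm' a ha) this.symm

/-- The logarithmic scheme of a system of monoids. -/
abbrev toLog : LogScheme.{u} where
  scheme := S
  M := D.presheaf
  isSheaf := D.isSheaf_presheaf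
  exp :=
    { app U := CommMonCat.ofHom (D.ex (U.unop.hom : U.unop.left ⟶ S))
      naturality U V a := by
        ext m
        exact D.ex_rs (u := V.unop.hom) (v := U.unop.hom) a.unop.left (etaleHom_w a.unop) m }
  existsUnique_unit U f hf := D.unit (U.hom : U.left ⟶ S) f hf

theorem toLog_rs {U V : Scheme.{u}} {u : U ⟶ D.toLog.scheme} {v : V ⟶ D.toLog.scheme}
    [i : Etale u] [j : Etale v] (a : U ⟶ V) (h : a ≫ v = u) (m : D.toLog.Sec v) :
    D.toLog.rs a h m = @LogData.rs S D U V u v i j a h m :=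
  D.rs_congr (u := u) (v := v) (etaleOver_left a h) _ _ _

end LogData

/-! ### The logarithmic structure induced on an étale scheme -/

/-- The logarithmic structure induced on an étale `X`-scheme. -/
def inducedData (X : LogScheme.{u}) {S : Scheme.{u}} (f : S ⟶ X.scheme) [Etale f] : LogData S where
  Sec := fun {_} u [Etale u] => X.Sec (u ≫ f)
  mon := fun {_} u [Etale u] => inferInstance
  rs := fun {_ _ u v} [Etale u] [Etale v] a h =>
    X.rs (u := u ≫ f) (v := v ≫ f) a (by rw [← h, Category.assoc])
  ex := fun {_} u [Etale u] => X.ex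
  rs_id := fun {_} u [Etale u] h m => X.rs_id _ m
  rs_rs a b ha hb hc m := X.rs_rs _ _ _ _ _ _ rfl m
  ex_rs a h m := X.ex_rs a _ m
  ext := fun {_} v [Etale v] m n h => Sec_ext fun x => by
    obtain ⟨U, u, _, a, ha, y, hy, e⟩ := h x
    exact ⟨U, u ≫ f, inferInstance, a, _, y, hy, e⟩
  glue := fun {V} v [Etale v] P hres huniq hex => by
    obtain ⟨m, hm⟩ := Sec_glue (X := X) (v := v ≫ f)
      (fun {U} u' _ a ha n => ∃ (_ : Etale (a ≫ v)) (n' : X.Sec ((a ≫ v) ≫ f)), P (a ≫ v) a rfl n' ∧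
        X.rs (u := u') (𝟙 U) (by rw [← ha, Category.id_comp, Category.assoc]) n' = n) (by
        rintro U U' u _ a ha u' _ b hb a' ha' rfl _ ⟨i, n, hn, rfl⟩
        have hb' : b ≫ (a ≫ v) ≫ f = u' := by rw [← hb, ← ha, Category.assoc]
        have : Etale ((b ≫ a) ≫ v) := by
          have h1 : Etale (((b ≫ a) ≫ v) ≫ f) := by
            have : ((b ≫ a) ≫ v) ≫ f = u' := by rw [← hb', Category.assoc, Category.assoc]; simp
            rw [this]
            infer_instance
          exact MorphismProperty.of_postcomp @Etale _ f ‹Etale f› h1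
        refine ⟨this, _, hres (a ≫ v) a rfl ((b ≫ a) ≫ v) b (by simp) (b ≫ a) rfl rfl n hn, ?_⟩
        rw [X.rs_rs _ _ b _ _ (by simpa using hb') (by simp),
          X.rs_rs _ _ b _ _ (by simpa using hb') (by simp)]) (by
        rintro U u _ a ha _ _ ⟨i, n, hn, rfl⟩ ⟨i', n', hn', rfl⟩
        rw [huniq _ _ _ _ _ hn hn']) (by
        intro x
        obtain ⟨U, u, _, a, rfl, y, m, hy, hm⟩ := hex x
        exact ⟨U, (a ≫ v) ≫ f, inferInstance, a, (Category.assoc _ _ _).symm, y, m, hy,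
          inferInstance, m, hm, X.rs_id _ m⟩)
    refine ⟨m, ?_⟩
    rintro U _ _ a rfl n hn
    exact hm _ a _ n ⟨inferInstance, n, hn, X.rs_id _ n⟩
  unit := fun {_} u [Etale u] g hg => X.existsUnique_ex hg

/-- The logarithmic scheme with the structure induced from an étale morphism. -/
abbrev induced (X : LogScheme.{u}) {S : Scheme.{u}} (f : S ⟶ X.scheme) [Etale f] : LogScheme.{u} :=
  (X.inducedData f).toLog

theorem bijective_rs_id (X : LogScheme.{u}) {U : Scheme.{u}} (u v : U ⟶ X.scheme) [Etale u]
    [Etale v] (h : 𝟙 U ≫ v = u) : Function.Bijective (X.rs (𝟙 U) h) := by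
  obtain rfl : v = u := (Category.id_comp _).symm.trans h
  have e : ⇑(X.rs (𝟙 U) h) = id := funext fun m => X.rs_id h m
  rw [e]
  exact Function.bijective_id

/-- The projection from the induced logarithmic scheme. -/
def inducedMap (X : LogScheme.{u}) {S : Scheme.{u}} (f : S ⟶ X.scheme) [Etale f] :
    X.induced f ⟶ X :=
  mkHom (X := X.induced f) f
    (fun {U V u v} [Etale u] [Etale v] g h => X.rs (u := (u : U ⟶ S) ≫ f) g h)
    (by
      intro U V U' V' u v _ _ u' v' _ _ a ha g h b hb g' h' e m
      refine (LogData.toLog_rs _ _ _ _).trans ?_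
      refine (X.rs_rs _ _ (a ≫ g) _ _ ?_ rfl _).trans ?_
      · rw [Category.assoc, h, ← ha]
        exact (Category.assoc _ _ _).symm
      · exact X.rs_rs _ _ _ _ _ _ (by rw [e, Category.assoc]) m)
    (by
      intro U V u v _ _ g h m
      exact X.ex_rs (u := (u : U ⟶ S) ≫ f) (v := v) g h m)

/-! ### Strict étale morphisms -/

section StrictEtale

variable {X Y Z : LogScheme.{u}}

theorem IsStrictEtale.etale {F : X ⟶ Y} (h : IsStrictEtale F) : Etale F.f := h.1

theorem isStrictEtale_iff {F : X ⟶ Y} : IsStrictEtale F ↔ ∃ _ : Etale F.f,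
    ∀ {U : Scheme.{u}} (u : U ⟶ X.scheme) [Etale u] (v : U ⟶ Y.scheme) [Etale v]
      (h : 𝟙 U ≫ v = u ≫ F.f), Function.Bijective (F.pl (𝟙 U) h) := by
  constructor
  · rintro ⟨hf, h⟩
    refine ⟨hf, fun {U} u _ v _ e => ?_⟩
    obtain rfl : v = u ≫ F.f := (Category.id_comp _).symm.trans e
    exact h (Scheme.Etale.mk u)
  · rintro ⟨hf, h⟩
    exact ⟨hf, fun V => h (V.hom : V.left ⟶ X.scheme) (V.hom ≫ F.f) (Category.id_comp _)⟩

theorem IsStrictEtale.bijective {F : X ⟶ Y} (hF : IsStrictEtale F) {U : Scheme.{u}}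
    (u : U ⟶ X.scheme) [Etale u] (v : U ⟶ Y.scheme) [Etale v] (h : 𝟙 U ≫ v = u ≫ F.f) :
    Function.Bijective (F.pl (𝟙 U) h) :=
  (isStrictEtale_iff.1 hF).2 u v h

theorem isStrictEtale_inducedMap (X : LogScheme.{u}) {S : Scheme.{u}} (f : S ⟶ X.scheme)
    [Etale f] : IsStrictEtale (X.inducedMap f) := by
  refine isStrictEtale_iff.2 ⟨inferInstanceAs (Etale f), fun {U} u _ v _ h => ?_⟩
  exact X.bijective_rs_id ((u : U ⟶ S) ≫ f) v h

/-- The universal property of a strict étale morphism `s : X → Y`: a morphism `T → Y` lifts to `X`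
as soon as the underlying morphism of schemes does. -/
theorem IsStrictEtale.existsUnique_lift {s : X ⟶ Y} (hs : IsStrictEtale s) (H : Z ⟶ Y)
    (f : Z.scheme ⟶ X.scheme) (hf : f ≫ s.f = H.f) : ∃! F : Z ⟶ X, F ≫ s = H ∧ F.f = f := by
  have := hs.etale
  have key : ∀ {U : Scheme.{u}} (u : U ⟶ X.scheme) [Etale u],
      𝟙 U ≫ u ≫ s.f = u ≫ s.f := fun u _ => Category.id_comp _
  let e : ∀ {U : Scheme.{u}} (u : U ⟶ X.scheme) [Etale u], Y.Sec (u ≫ s.f) ≃* X.Sec u :=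
    fun u _ => MulEquiv.ofBijective (s.pl (𝟙 _) (key u)) (hs.bijective u _ (key u))
  have he : ∀ {U V : Scheme.{u}} (u : U ⟶ X.scheme) (v : V ⟶ X.scheme) [Etale u] [Etale v]
      (a : U ⟶ V) (ha : a ≫ v = u) (m : X.Sec v),
      (e u).symm (X.rs a ha m) = Y.rs a (by rw [← ha, Category.assoc]) ((e v).symm m) := by
    intro U V u v _ _ a ha m
    rw [MulEquiv.symm_apply_eq]
    obtain ⟨n, rfl⟩ := (e v).surjective m
    rw [MulEquiv.symm_apply_apply]
    exact s.rs_pl a ha (𝟙 _) (key v) a (by rw [← ha, Category.assoc]) (Category.comp_id _).symm n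
      |>.trans (s.pl_rs (𝟙 _) (key u) a _ _ _ (Category.id_comp _).symm n).symm
  have hee : ∀ {U : Scheme.{u}} (u : U ⟶ X.scheme) [Etale u] (m : X.Sec u),
      Y.ex ((e u).symm m) = X.ex m := by
    intro U u _ m
    obtain ⟨n, rfl⟩ := (e u).surjective m
    rw [MulEquiv.symm_apply_apply]
    refine Eq.symm ((s.ex_pl (𝟙 _) (key u) n).trans ?_)
    exact appTop_id_apply _
  have hw : ∀ {U V : Scheme.{u}} {u : U ⟶ Z.scheme} {v : V ⟶ X.scheme} (g : U ⟶ V),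
      g ≫ v = u ≫ f → g ≫ v ≫ s.f = u ≫ H.f := by
    intro U V u v g h
    rw [← hf, ← Category.assoc, h, Category.assoc]
  let F : Z ⟶ X := mkHom (X := Z) (Y := X) f
    (fun {U V u v} [Etale u] [Etale v] g h => (H.pl (v := v ≫ s.f) g (hw g h)).comp
      (e v).symm.toMonoidHom)
    (by
      intro U V U' V' u v _ _ u' v' _ _ a ha g h b hb g' h' eq m
      change Z.rs a ha (H.pl g _ ((e v).symm _)) = H.pl g' _ ((e v').symm m)
      rw [he v v' b hb m]
      exact H.rs_pl_rs a ha g _ b _ g' _ eq _)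
    (by
      intro U V u v _ _ g h m
      change Z.ex (H.pl g _ ((e v).symm m)) = _
      rw [H.ex_pl, hee])
  have hpull : ∀ (F' : Z ⟶ X), F' ≫ s = H → ∀ {U V : Scheme.{u}} {u : U ⟶ Z.scheme}
      {v : V ⟶ X.scheme} [Etale u] [Etale v] (g : U ⟶ V) (h : g ≫ v = u ≫ F'.f)
      (h' : g ≫ v ≫ s.f = u ≫ H.f) (m : X.Sec v), F'.pl g h m = H.pl g h' ((e v).symm m) := by
    rintro F' rfl U V u v _ _ g h h' m
    obtain ⟨n, rfl⟩ := (e v).surjective m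
    rw [MulEquiv.symm_apply_apply]
    exact (comp_pl F' s g h (𝟙 V) (key v) g h' (Category.comp_id _).symm n).symm
  refine ⟨F, ⟨?_, rfl⟩, ?_⟩
  · refine Hom_ext hf ?_
    intro U V u v _ _ g w w' m
    rw [comp_pl' F s g w m]
    change H.pl _ _ ((e _).symm _) = _
    have h₁ : 𝟙 (pullback s.f v) ≫ pullback.fst s.f v ≫ s.f = pullback.fst s.f v ≫ s.f := key _
    have h₂ : (e (pullback.fst s.f v)).symm (s.pl (pullback.snd s.f v) pullback.condition.symm m) =
        Y.rs (pullback.snd s.f v) pullback.condition.symm m := by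
      rw [MulEquiv.symm_apply_eq]
      exact (s.pl_rs (𝟙 _) (key _) (pullback.snd s.f v) _ _ _ (Category.id_comp _).symm m).symm
    refine (congrArg (H.pl _ _) h₂).trans ?_
    exact H.pl_rs _ _ _ _ _ _ (pullback.lift_snd _ _ _).symm m
  · rintro F' ⟨h₁, rfl⟩
    refine Hom_ext rfl ?_
    intro U V u v _ _ g w w' m
    rw [hpull F' h₁ g w (hw g w) m]
    rfl

theorem IsStrictEtale.hom_ext {s : X ⟶ Y} (hs : IsStrictEtale s) {F G : Z ⟶ X}
    (h : F ≫ s = G ≫ s) (h' : F.f = G.f) : F = G :=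
  (hs.existsUnique_lift (G ≫ s) G.f rfl).unique ⟨h, h'⟩ ⟨rfl, rfl⟩

theorem IsStrictEtale.comp {F : X ⟶ Y} {G : Y ⟶ Z} (hF : IsStrictEtale F) (hG : IsStrictEtale G) :
    IsStrictEtale (F ≫ G) := by
  have := hF.etale
  have := hG.etale
  refine isStrictEtale_iff.2 ⟨inferInstanceAs (Etale (F.f ≫ G.f)), fun {U} u _ v _ h => ?_⟩
  have h₂ : 𝟙 U ≫ v = (u ≫ F.f) ≫ G.f := h.trans (Category.assoc _ _ _).symm
  have h₁ : 𝟙 U ≫ u ≫ F.f = u ≫ F.f := Category.id_comp _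
  have e : ⇑(Hom.pl (F ≫ G) (𝟙 U) h) = F.pl (𝟙 U) h₁ ∘ G.pl (𝟙 U) h₂ := by
    funext m
    exact comp_pl F G (𝟙 U) h₁ (𝟙 U) h₂ (𝟙 U) h (Category.comp_id _).symm m
  rw [e]
  exact (hF.bijective u _ h₁).comp (hG.bijective _ v h₂)

end StrictEtale

end

end LogScheme

end LogGeometry

namespace LogGeometry

namespace LogScheme

noncomputable section

/-! ### Gluing morphisms of logarithmic schemes -/

section Glue

variable {X Y Z T : LogScheme.{u}}

theorem etale_of_comp {A B C : Scheme.{u}} {f : A ⟶ B} {g : B ⟶ C} (hg : Etale g) {h : A ⟶ C}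
    (hh : Etale h) (e : f ≫ g = h) : Etale f := by
  subst e
  exact MorphismProperty.of_postcomp @Etale f g hg hh

/-- A morphism of logarithmic schemes can be constructed from a relation between sections of the
target and sections of the source which étale locally is a function. -/
theorem exists_hom_of_rel (f : T.scheme ⟶ X.scheme)
    (R : ∀ {U V : Scheme.{u}} (u : U ⟶ T.scheme) (v : V ⟶ X.scheme) [Etale u] [Etale v] (g : U ⟶ V),
      g ≫ v = u ≫ f → X.Sec v → T.Sec u → Prop)
    (hres : ∀ {U U' V : Scheme.{u}} (u : U ⟶ T.scheme) (v : V ⟶ X.scheme) [Etale u] [Etale v]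
      (g : U ⟶ V) (h : g ≫ v = u ≫ f) (u' : U' ⟶ T.scheme) [Etale u'] (a : U' ⟶ U) (ha : a ≫ u = u')
      (h' : (a ≫ g) ≫ v = u' ≫ f) (m : X.Sec v) (t : T.Sec u), R u v g h m t →
      R u' v (a ≫ g) h' m (T.rs a ha t))
    (hpl : ∀ {U V V' : Scheme.{u}} (u : U ⟶ T.scheme) (v : V ⟶ X.scheme) [Etale u] [Etale v]
      (g : U ⟶ V) (h : g ≫ v = u ≫ f) (v' : V' ⟶ X.scheme) [Etale v'] (b : V ⟶ V') (hb : b ≫ v' = v)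
      (h' : (g ≫ b) ≫ v' = u ≫ f) (m : X.Sec v') (t : T.Sec u), R u v g h (X.rs b hb m) t →
      R u v' (g ≫ b) h' m t)
    (huniq : ∀ {U V : Scheme.{u}} (u : U ⟶ T.scheme) (v : V ⟶ X.scheme) [Etale u] [Etale v]
      (g : U ⟶ V) (h : g ≫ v = u ≫ f) (m : X.Sec v) (t t' : T.Sec u), R u v g h m t →
      R u v g h m t' → t = t')
    (hone : ∀ {U V : Scheme.{u}} (u : U ⟶ T.scheme) (v : V ⟶ X.scheme) [Etale u] [Etale v]
      (g : U ⟶ V) (h : g ≫ v = u ≫ f) (m : X.Sec v) (t : T.Sec u), R u v g h m t →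
      R u v g h 1 1)
    (hmul : ∀ {U V : Scheme.{u}} (u : U ⟶ T.scheme) (v : V ⟶ X.scheme) [Etale u] [Etale v]
      (g : U ⟶ V) (h : g ≫ v = u ≫ f) (m m' : X.Sec v) (t t' : T.Sec u), R u v g h m t →
      R u v g h m' t' → R u v g h (m * m') (t * t'))
    (hex : ∀ {U V : Scheme.{u}} (u : U ⟶ T.scheme) (v : V ⟶ X.scheme) [Etale u] [Etale v]
      (g : U ⟶ V) (_ : g ≫ v = u ≫ f) (m : X.Sec v) (x : U), ∃ (U' : Scheme.{u})
      (u' : U' ⟶ T.scheme) (_ : Etale u') (a : U' ⟶ U) (_ : a ≫ u = u') (y : U')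
      (h' : (a ≫ g) ≫ v = u' ≫ f) (t : T.Sec u'), a y = x ∧ R u' v (a ≫ g) h' m t)
    (hexp : ∀ {U V : Scheme.{u}} (u : U ⟶ T.scheme) (v : V ⟶ X.scheme) [Etale u] [Etale v]
      (g : U ⟶ V) (h : g ≫ v = u ≫ f) (m : X.Sec v) (t : T.Sec u), R u v g h m t →
      T.ex t = g.appTop (X.ex m)) :
    ∃ F : T ⟶ X, ∃ hf : F.f = f, ∀ {U V : Scheme.{u}} (u : U ⟶ T.scheme) (v : V ⟶ X.scheme)
      [Etale u] [Etale v] (g : U ⟶ V) (h : g ≫ v = u ≫ f) (m : X.Sec v) (t : T.Sec u),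
      R u v g h m t → F.pl g (hf ▸ h) m = t := by
  have hw : ∀ {U U' V : Scheme.{u}} {u : U ⟶ T.scheme} {v : V ⟶ X.scheme} {g : U ⟶ V}
      (_ : g ≫ v = u ≫ f) {u' : U' ⟶ T.scheme} {a : U' ⟶ U} (_ : a ≫ u = u'),
      (a ≫ g) ≫ v = u' ≫ f := by
    intro U U' V u v g h u' a ha
    rw [Category.assoc, h, ← Category.assoc, ha]
  -- The value at `m` is glued from the local values related to restrictions of `m`.
  have key : ∀ {U V : Scheme.{u}} (u : U ⟶ T.scheme) (v : V ⟶ X.scheme) [Etale u] [Etale v]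
      (g : U ⟶ V) (h : g ≫ v = u ≫ f) (m : X.Sec v), ∃ t : T.Sec u, ∀ {U' : Scheme.{u}}
      (u' : U' ⟶ T.scheme) [Etale u'] (a : U' ⟶ U) (ha : a ≫ u = u') (t' : T.Sec u'),
      R u' v (a ≫ g) (hw h ha) m t' → T.rs a ha t = t' := by
    intro U V u v _ _ g h m
    refine Sec_glue (fun {U'} u' _ a ha t' => R u' v (a ≫ g) (hw h ha) m t') ?_ ?_ ?_
    · rintro U' U'' u' _ a ha u'' _ b hb a' ha' rfl t' ht'
      have := hres u' v _ _ u'' b hb (hw (hw h ha) hb) m t' ht'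
      simpa only [Category.assoc] using this
    · intro U' u' _ a ha t t'
      exact huniq _ _ _ _ _ _ _
    · intro x
      obtain ⟨U', u', _, a, ha, y, h', t, hy, ht⟩ := hex u v g h m x
      exact ⟨U', u', inferInstance, a, ha, y, t, hy, ht⟩
  choose p hp using @key
  -- A section with the restrictions prescribed by `R` is the glued one: this is how all identities
  -- between glued sections are proved.
  have huniq' : ∀ {U V : Scheme.{u}} (u : U ⟶ T.scheme) (v : V ⟶ X.scheme) [Etale u] [Etale v]
      (g : U ⟶ V) (h : g ≫ v = u ≫ f) (m : X.Sec v) (t : T.Sec u),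
      (∀ {U' : Scheme.{u}} (u' : U' ⟶ T.scheme) [Etale u'] (a : U' ⟶ U) (ha : a ≫ u = u')
        (t' : T.Sec u'), R u' v (a ≫ g) (hw h ha) m t' → T.rs a ha t = t') → t = p u v g h m := by
    intro U V u v _ _ g h m t ht
    refine Sec_ext fun x => ?_
    obtain ⟨U', u', _, a, ha, y, h', t', hy, ht'⟩ := hex u v g h m x
    exact ⟨U', u', inferInstance, a, ha, y, hy, (ht u' a ha t' ht').trans
      (hp u v g h m u' a ha t' ht').symm⟩
  have hR : ∀ {U V : Scheme.{u}} (u : U ⟶ T.scheme) (v : V ⟶ X.scheme) [Etale u] [Etale v]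
      (g : U ⟶ V) (h : g ≫ v = u ≫ f) (m : X.Sec v) (t : T.Sec u), R u v g h m t →
      p u v g h m = t := by
    intro U V u v _ _ g h m t ht
    refine (huniq' u v g h m t ?_).symm
    intro U' u' _ a ha t' ht'
    exact huniq _ _ _ _ _ _ _ (hres _ _ _ _ _ _ ha _ _ _ ht) ht'
  let P : ∀ {U V : Scheme.{u}} {u : U ⟶ T.scheme} {v : V ⟶ X.scheme} [Etale u] [Etale v]
      (g : U ⟶ V), g ≫ v = u ≫ f → (X.Sec v →* T.Sec u) := fun {U V u v} _ _ g h =>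
    { toFun := p u v g h
      map_one' := by
        refine (huniq' u v g h 1 1 ?_).symm
        intro U' u' _ a ha t' ht'
        rw [map_one]
        exact huniq _ _ _ _ _ _ _ (hone _ _ _ _ _ _ ht') ht'
      map_mul' := by
        intro m m'
        refine (huniq' u v g h (m * m') _ ?_).symm
        intro U' u' _ a ha t' ht'
        rw [map_mul]
        refine Sec_ext fun x => ?_
        -- Pass to a common neighbourhood on which both factors have local values.
        obtain ⟨U₁, u₁, _, a₁, ha₁, y₁, h₁, t₁, hy₁, ht₁⟩ := hex u' v (a ≫ g) (hw h ha) m x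
        obtain ⟨U₂, u₂, _, a₂, ha₂, y₂, h₂, t₂, hy₂, ht₂⟩ := hex u₁ v (a₁ ≫ a ≫ g) h₁ m' y₁
        have ha' : (a₂ ≫ a₁) ≫ u' = u₂ := by rw [Category.assoc, ha₁, ha₂]
        have ha'' : ((a₂ ≫ a₁) ≫ a) ≫ u = u₂ := by rw [Category.assoc, ha, ha']
        refine ⟨U₂, u₂, inferInstance, a₂ ≫ a₁, ha', y₂, by simp [hy₂, hy₁], ?_⟩
        have e₁ := hres _ _ _ _ u₂ a₂ ha₂ (hw h₁ ha₂) _ _ ht₁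
        have e₂ := hmul _ _ _ _ _ _ _ _ e₁ ht₂
        have e₃ := hres _ _ _ _ u₂ (a₂ ≫ a₁) ha' (hw (hw h ha) ha') _ _ ht'
        simp only [Category.assoc] at e₁ e₂ e₃ ht₂
        rw [huniq _ _ _ _ _ _ _ e₃ e₂, map_mul,
          T.rs_rs _ _ ((a₂ ≫ a₁) ≫ a) _ _ ha'' rfl, T.rs_rs _ _ ((a₂ ≫ a₁) ≫ a) _ _ ha'' rfl]
        rw [hp u v g h m u₂ ((a₂ ≫ a₁) ≫ a) ha'' _ (by simpa only [Category.assoc] using e₁),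
          hp u v g h m' u₂ ((a₂ ≫ a₁) ≫ a) ha'' _ (by simpa only [Category.assoc] using ht₂)] }
  refine ⟨mkHom f P ?_ ?_, rfl, ?_⟩
  · intro U V U' V' u v _ _ u' v' _ _ a ha g h b hb g' h' e m
    subst e
    refine huniq' u' v' _ h' m _ ?_
    intro U₁ u₁ _ a₁ ha₁ t ht
    have h₁ : (a₁ ≫ a ≫ g) ≫ v = u₁ ≫ f := by
      rw [← ha₁, ← ha]; simp only [Category.assoc, h]
    have haa : (a₁ ≫ a) ≫ u = u₁ := by rw [Category.assoc, ha, ha₁]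
    rw [T.rs_rs a₁ a (a₁ ≫ a) ha₁ ha haa rfl]
    refine Sec_ext fun x => ?_
    obtain ⟨U₂, u₂, _, a₂, ha₂, y₂, h₂, t₂, hy₂, ht₂⟩ := hex u₁ v (a₁ ≫ a ≫ g) h₁ (X.rs b hb m) x
    refine ⟨U₂, u₂, inferInstance, a₂, ha₂, y₂, hy₂, ?_⟩
    rw [T.rs_rs a₂ _ (a₂ ≫ a₁ ≫ a) _ _ (by rw [Category.assoc, Category.assoc, ha, ha₁, ha₂]) rfl]
    have e₁ := hpl _ _ _ _ v' b hb (by rw [Category.assoc, hb, h₂]) m t₂ ht₂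
    have e₂ := hres _ _ _ _ u₂ a₂ ha₂ (hw (hw h' ha₁) ha₂) _ _ ht
    simp only [Category.assoc] at e₁ e₂ ht₂
    refine Eq.trans ?_ (huniq _ _ _ _ _ _ _ e₁ e₂)
    exact hp u v g h (X.rs b hb m) u₂ (a₂ ≫ a₁ ≫ a) _ _ (by simpa only [Category.assoc] using ht₂)
  · intro U V u v _ _ g h m
    refine appTop_etale_ext fun x => ?_
    obtain ⟨U', u', _, a, ha, y, h', t, hy, ht⟩ := hex u v g h m x
    refine ⟨U', a, etale_of_comp (g := u) inferInstance (h := u') inferInstance ha, y, hy, ?_⟩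
    rw [← T.ex_rs a ha, ← appTop_comp_apply, ← hexp _ _ _ _ _ _ ht]
    exact congrArg _ (hp u v g h m u' a ha t ht)
  · intro U V u v _ _ g h m t ht
    exact hR u v g h m t ht

theorem IsStrictEtale.of_comp {F : X ⟶ Y} {G : Y ⟶ Z} (hG : IsStrictEtale G) {H : X ⟶ Z}
    (hH : IsStrictEtale H) (e : F ≫ G = H) : IsStrictEtale F := by
  subst e
  have := hG.etale
  have := hH.etale
  have : Etale F.f := etale_of_comp hG.etale hH.etale rfl
  refine isStrictEtale_iff.2 ⟨this, fun {U} u _ v _ h => ?_⟩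
  have h₂ : 𝟙 U ≫ v ≫ G.f = v ≫ G.f := Category.id_comp _
  have h₁ : 𝟙 U ≫ v ≫ G.f = u ≫ F.f ≫ G.f := by
    rw [← Category.assoc, h, Category.assoc]
  have e : ⇑(Hom.pl (F ≫ G) (𝟙 U) h₁) = F.pl (𝟙 U) h ∘ G.pl (𝟙 U) h₂ := by
    funext m
    exact comp_pl F G (𝟙 U) h (𝟙 U) h₂ (𝟙 U) h₁ (Category.comp_id _).symm m
  have b := hH.bijective u (v ≫ G.f) h₁
  rw [e] at b
  exact (Function.Bijective.of_comp_iff _ (hG.bijective v (v ≫ G.f) h₂)).1 b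

theorem isStrictEtale_id (X : LogScheme.{u}) : IsStrictEtale (𝟙 X) := by
  refine isStrictEtale_iff.2 ⟨inferInstanceAs (Etale (𝟙 X.scheme)), fun {U} u _ v _ h => ?_⟩
  exact X.bijective_rs_id u v (h.trans (Category.comp_id _))

/-- The lift of the projection from an induced logarithmic scheme along a strict étale morphism. -/
theorem exists_induced_lift {s : Z ⟶ T} (hs : IsStrictEtale s) {U : Scheme.{u}} (u : U ⟶ T.scheme)
    [Etale u] (c : U ⟶ Z.scheme) (hc : c ≫ s.f = u) :
    ∃ a : T.induced u ⟶ Z, a ≫ s = T.inducedMap u ∧ a.f = c ∧ IsStrictEtale a := by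
  obtain ⟨a, ⟨h₁, h₂⟩, -⟩ := hs.existsUnique_lift (T.inducedMap u) c hc
  exact ⟨a, h₁, h₂, hs.of_comp (isStrictEtale_inducedMap T u) h₁⟩

variable {K : Type*} {C : K → LogScheme.{u}}

/-- Morphisms which agree on a strict étale cover of the source agree. -/
theorem hom_ext_of_cover {s : ∀ k, C k ⟶ T} (hs : ∀ k, IsStrictEtale (s k))
    (hcov : ∀ t : T.scheme, ∃ k, ∃ y : (C k).scheme, (s k).f y = t) {F G : T ⟶ X}
    (h : ∀ k, s k ≫ F = s k ≫ G) : F = G := by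
  have hf : F.f = G.f := etale_hom_ext fun t => by
    obtain ⟨k, y, hy⟩ := hcov t
    exact ⟨_, (s k).f, (hs k).etale, y, hy, congrArg Hom.f (h k)⟩
  refine Hom_ext hf fun {U V} u v _ _ g w w' m => ?_
  refine Sec_ext fun x => ?_
  obtain ⟨k, y, hy⟩ := hcov (u x)
  have := (hs k).etale
  obtain ⟨z, hz, -⟩ := Scheme.Pullback.exists_preimage_pullback x y hy.symm
  let U' := pullback u (s k).f
  let c : U' ⟶ (C k).scheme := pullback.snd u (s k).f
  have e : pullback.fst u (s k).f ≫ u = c ≫ (s k).f := pullback.condition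
  refine ⟨U', c ≫ (s k).f, inferInstance, pullback.fst u (s k).f, e, z, hz, ?_⟩
  have hi : 𝟙 U' ≫ c ≫ (s k).f = c ≫ (s k).f := Category.id_comp _
  apply ((hs k).bijective c (c ≫ (s k).f) hi).1
  have hwF : (pullback.fst u (s k).f ≫ g) ≫ v = (c ≫ (s k).f) ≫ F.f := by
    rw [Category.assoc, w, ← e, Category.assoc]
  have hwG : (pullback.fst u (s k).f ≫ g) ≫ v = (c ≫ (s k).f) ≫ G.f := by
    rw [Category.assoc, w', ← e, Category.assoc]
  rw [F.rs_pl _ e g w _ hwF rfl, G.rs_pl _ e g w' _ hwG rfl]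
  have h₁ := comp_pl (s k) F (𝟙 U') hi _ hwF _ (hwF.trans (Category.assoc _ _ _))
    (Category.id_comp _).symm m
  have h₂ := comp_pl (s k) G (𝟙 U') hi _ hwG _ (hwG.trans (Category.assoc _ _ _))
    (Category.id_comp _).symm m
  refine h₁.symm.trans (Eq.trans ?_ h₂)
  have : ∀ {P Q : C k ⟶ X} (_ : P = Q) (p : (pullback.fst u (s k).f ≫ g) ≫ v = c ≫ P.f)
      (q : (pullback.fst u (s k).f ≫ g) ≫ v = c ≫ Q.f), P.pl _ p m = Q.pl _ q m := by
    rintro P _ rfl p q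
    rfl
  exact this (h k) _ _

/-- Morphisms of logarithmic schemes can be glued along a strict étale cover of the source. -/
theorem exists_hom_of_cover {s : ∀ k, C k ⟶ T} (hs : ∀ k, IsStrictEtale (s k))
    (hcov : ∀ t : T.scheme, ∃ k, ∃ y : (C k).scheme, (s k).f y = t) (F : ∀ k, C k ⟶ X)
    (hF : ∀ (k l : K) (Z : LogScheme.{u}) (a : Z ⟶ C k) (b : Z ⟶ C l), IsStrictEtale a →
      IsStrictEtale b → a ≫ s k = b ≫ s l → a ≫ F k = b ≫ F l) :
    ∃ G : T ⟶ X, ∀ k, s k ≫ G = F k := by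
  -- An étale scheme over `T` which maps to two members of the cover carries a logarithmic structure
  -- with strict étale morphisms to both, so that `hF` applies to it.
  have hF' : ∀ {U : Scheme.{u}} (u : U ⟶ T.scheme) (_ : Etale u) (k l : K) (c : U ⟶ (C k).scheme)
      (d : U ⟶ (C l).scheme) (_ : c ≫ (s k).f = u) (_ : d ≫ (s l).f = u),
      ∃ (a : T.induced u ⟶ C k) (b : T.induced u ⟶ C l), a ≫ s k = T.inducedMap u ∧
        b ≫ s l = T.inducedMap u ∧ a.f = c ∧ b.f = d ∧ a ≫ F k = b ≫ F l := by
    intro U u _ k l c d hc hd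
    obtain ⟨a, ha, ha', ha''⟩ := exists_induced_lift (hs k) u c hc
    obtain ⟨b, hb, hb', hb''⟩ := exists_induced_lift (hs l) u d hd
    exact ⟨a, b, ha, hb, ha', hb', hF k l _ a b ha'' hb'' (ha.trans hb.symm)⟩
  obtain ⟨f, hf⟩ := etale_hom_glue (T := T.scheme) (Y := X.scheme)
    (fun {U} u _ r => ∃ (k : K) (c : U ⟶ (C k).scheme), c ≫ (s k).f = u ∧ r = c ≫ (F k).f)
    (by
      rintro U U' u _ b _ u' _ rfl _ ⟨k, c, hc, rfl⟩
      exact ⟨k, b ≫ c, by rw [Category.assoc, hc], (Category.assoc _ _ _).symm⟩)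
    (by
      rintro U u _ _ _ ⟨k, c, hc, rfl⟩ ⟨l, d, hd, rfl⟩
      obtain ⟨a, b, -, -, rfl, rfl, e⟩ := hF' u inferInstance k l c d hc hd
      exact congrArg Hom.f e)
    (by
      intro t
      obtain ⟨k, y, hy⟩ := hcov t
      exact ⟨_, (s k).f, (hs k).etale, y, (F k).f, hy, k, 𝟙 _, Category.id_comp _,
        (Category.id_comp _).symm⟩)
  have hfk : ∀ k, (s k).f ≫ f = (F k).f := fun k =>
    hf (s k).f (hs k).etale (F k).f ⟨k, 𝟙 _, Category.id_comp _, (Category.id_comp _).symm⟩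
  have hw : ∀ {k : K} {U V : Scheme.{u}} {u : U ⟶ T.scheme} {v : V ⟶ X.scheme} {g : U ⟶ V}
      {c : U ⟶ (C k).scheme} (_ : c ≫ (s k).f = u) (_ : g ≫ v = u ≫ f), g ≫ v = c ≫ (F k).f := by
    intro k U V u v g c hc h
    rw [h, ← hc, Category.assoc, hfk]
  -- The section of `M_T` pulling back to the value of `F k` at `m` does not depend on `k`.
  have huniq : ∀ {U V : Scheme.{u}} (u : U ⟶ T.scheme) (v : V ⟶ X.scheme) [Etale u] [Etale v]
      (g : U ⟶ V) (h : g ≫ v = u ≫ f) (m : X.Sec v) (t t' : T.Sec u)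
      (k : K) (c : U ⟶ (C k).scheme) (hc : c ≫ (s k).f = u) (_ : Etale c)
      (_ : (s k).pl (𝟙 U) ((Category.id_comp _).trans hc.symm) t = (F k).pl g (hw hc h) m)
      (l : K) (d : U ⟶ (C l).scheme) (hd : d ≫ (s l).f = u) (_ : Etale d)
      (_ : (s l).pl (𝟙 U) ((Category.id_comp _).trans hd.symm) t' = (F l).pl g (hw hd h) m),
      t = t' := by
    intro U V u v _ _ g h m t t' k c hc i e l d hd j e'
    obtain ⟨a, b, ha, hb, rfl, rfl, hab⟩ := hF' u inferInstance k l c d hc hd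
    have hi : ∀ {w : U ⟶ (T.induced u).scheme}, 𝟙 U ≫ w = 𝟙 U ≫ w := fun {w} => rfl
    have ea : ∀ {P : T.induced u ⟶ T} (_ : P = T.inducedMap u) (p : 𝟙 U ≫ u = 𝟙 U ≫ P.f) t,
        P.pl (v := u) (u := 𝟙 U) (𝟙 U) p t = (T.inducedMap u).pl (v := u) (u := 𝟙 U) (𝟙 U) rfl t := by
      rintro P rfl p t
      rfl
    have ef : ∀ {P Q : T.induced u ⟶ X} (_ : P = Q) (p : g ≫ v = 𝟙 U ≫ P.f)
        (q : g ≫ v = 𝟙 U ≫ Q.f), P.pl (u := 𝟙 U) g p m = Q.pl (u := 𝟙 U) g q m := by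
      rintro P _ rfl p q
      rfl
    apply ((isStrictEtale_inducedMap T u).bijective (𝟙 U) u rfl).1
    have hu : ∀ {k : K} {a : T.induced u ⟶ C k} (hc : a.f ≫ (s k).f = u),
      𝟙 U ≫ u = 𝟙 U ≫ a.f ≫ (s k).f := fun hc => by rw [hc]
    have hu' : ∀ {k : K} {a : T.induced u ⟶ C k} (hc : a.f ≫ (s k).f = u),
      g ≫ v = 𝟙 U ≫ a.f ≫ (F k).f := fun hc => by rw [Category.id_comp, hw hc h]
    refine (ea ha (hu hc) t).symm.trans (Eq.trans ?_ (ea hb (hu hd) t'))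
    rw [comp_pl a (s k) (u := 𝟙 U) (v := a.f) (𝟙 U) rfl (𝟙 U)
      ((Category.id_comp _).trans hc.symm) (𝟙 U) _ (Category.comp_id _).symm t,
      comp_pl b (s l) (u := 𝟙 U) (v := b.f) (𝟙 U) rfl (𝟙 U)
      ((Category.id_comp _).trans hd.symm) (𝟙 U) _ (Category.comp_id _).symm t', e, e',
      ← comp_pl a (F k) (u := 𝟙 U) (v := a.f) (𝟙 U) rfl g (hw hc h) g (hu' hc)
        (Category.id_comp _).symm m,
      ← comp_pl b (F l) (u := 𝟙 U) (v := b.f) (𝟙 U) rfl g (hw hd h) g (hu' hd)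
        (Category.id_comp _).symm m]
    exact ef hab _ _
  obtain ⟨G, rfl, hG⟩ := exists_hom_of_rel (T := T) (X := X) f
    (fun {U V} u v _ _ g h m t => ∃ (k : K) (c : U ⟶ (C k).scheme) (hc : c ≫ (s k).f = u)
      (_ : Etale c), (s k).pl (𝟙 U) ((Category.id_comp _).trans hc.symm) t =
        (F k).pl g (hw hc h) m)
    (by
      rintro U U' V u v _ _ g h u' _ a ha h' m t ⟨k, c, hc, i, e⟩
      have hc' : (a ≫ c) ≫ (s k).f = u' := by rw [Category.assoc, hc, ha]
      have i' : Etale (a ≫ c) := etale_of_comp (hs k).etale (h := u') inferInstance hc'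
      refine ⟨k, a ≫ c, hc', i', ?_⟩
      rw [(s k).pl_rs (𝟙 U') _ a ha a (by rw [Category.assoc, hc, ha]) (Category.id_comp _).symm t,
        ← (F k).rs_pl a rfl g (hw hc h) _ _ rfl, ← e]
      exact ((s k).rs_pl a rfl (𝟙 U) _ a _ (Category.comp_id _).symm t).symm)
    (by
      rintro U V V' u v _ _ g h v' _ b hb h' m t ⟨k, c, hc, i, e⟩
      exact ⟨k, c, hc, i, e.trans ((F k).pl_rs g _ b hb _ _ rfl m)⟩)
    (by
      rintro U V u v _ _ g h m t t' ⟨k, c, hc, i, e⟩ ⟨l, d, hd, j, e'⟩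
      exact huniq u v g h m t t' k c hc i e l d hd j e')
    (by
      rintro U V u v _ _ g h m t ⟨k, c, hc, i, e⟩
      exact ⟨k, c, hc, i, by rw [map_one, map_one]⟩)
    (by
      rintro U V u v _ _ g h m m' t t' ⟨k, c, hc, i, e⟩ ⟨l, d, hd, j, e'⟩
      obtain ⟨t'', ht⟩ := ((hs k).bijective c u ((Category.id_comp _).trans hc.symm)).2
        ((F k).pl g (hw hc h) m')
      obtain rfl := huniq u v g h m' t'' t' k c hc i ht l d hd j e'
      exact ⟨k, c, hc, i, by rw [map_mul, map_mul, e, ht]⟩)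
    (by
      intro U V u v _ _ g h m x
      obtain ⟨k, y, hy⟩ := hcov (u x)
      have := (hs k).etale
      obtain ⟨z, hz, -⟩ := Scheme.Pullback.exists_preimage_pullback x y hy.symm
      let U' := pullback u (s k).f
      let c : U' ⟶ (C k).scheme := pullback.snd u (s k).f
      have e : pullback.fst u (s k).f ≫ u = c ≫ (s k).f := pullback.condition
      have hw' : (pullback.fst u (s k).f ≫ g) ≫ v = (c ≫ (s k).f) ≫ f := by
        rw [Category.assoc, h, ← e, Category.assoc]
      obtain ⟨t, ht⟩ := ((hs k).bijective c (c ≫ (s k).f) (Category.id_comp _)).2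
        ((F k).pl (pullback.fst u (s k).f ≫ g) (hw rfl hw') m)
      exact ⟨U', c ≫ (s k).f, inferInstance, pullback.fst u (s k).f, e, z, hw', t, hz,
        k, c, rfl, inferInstance, ht⟩)
    (by
      rintro U V u v _ _ g h m t ⟨k, c, hc, i, e⟩
      have h₁ := (s k).ex_pl (u := c) (v := u) (𝟙 U) ((Category.id_comp _).trans hc.symm) t
      rw [appTop_id_apply, e] at h₁
      rw [← h₁]
      exact (F k).ex_pl g _ m)
  refine ⟨G, fun k => Hom_ext (hfk k) fun {U V} u v _ _ g w w' m => ?_⟩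
  have := (hs k).etale
  obtain ⟨t, ht⟩ := ((hs k).bijective u (u ≫ (s k).f) (Category.id_comp _)).2 ((F k).pl g w' m)
  have e := hG (u ≫ (s k).f) v g (w.trans (Category.assoc _ _ _).symm) m t
    ⟨k, u, rfl, inferInstance, ht⟩
  rw [comp_pl (s k) G (𝟙 U) (Category.id_comp _) g (w.trans (Category.assoc _ _ _).symm) g w
    (Category.id_comp _).symm m, e, ht]

end Glue

end

end LogScheme

end LogGeometry

namespace LogGeometry

namespace LogScheme

noncomputable section

/-! ### Sections of the sheaf of groups over étale schemes -/

section GSec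

variable (X : LogScheme.{u}) {Y : LogScheme.{u}}

/-- The group of sections of `Mᵍᵖ` over a scheme étale over `X`. -/
def GSec {U : Scheme.{u}} (u : U ⟶ X.scheme) [Etale u] : Type u := X.gpSec (Scheme.Etale.mk u)

instance {U : Scheme.{u}} (u : U ⟶ X.scheme) [Etale u] : CommGroup (X.GSec u) :=
  inferInstanceAs (CommGroup (X.gpSec (Scheme.Etale.mk u)))

variable {U V W : Scheme.{u}} {u : U ⟶ X.scheme} {v : V ⟶ X.scheme} {w : W ⟶ X.scheme}
  [Etale u] [Etale v] [Etale w]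

/-- Restriction of sections of `Mᵍᵖ` along a morphism of schemes étale over `X`. -/
def grs (a : U ⟶ V) (h : a ≫ v = u) : X.GSec v →* X.GSec u :=
  X.gpRes (etaleOver a h)

/-- The section of `Mᵍᵖ` given by a formal quotient of sections of `M`. -/
def tg : Algebra.GrothendieckGroup (X.Sec u) →* X.GSec u :=
  X.toGp (Scheme.Etale.mk u)

theorem grs_id (h : 𝟙 U ≫ u = u) (m : X.GSec u) : X.grs (𝟙 U) h m = m := by
  refine Eq.trans ?_ (X.gpRes_id m)
  exact congrArg (fun a => X.gpRes a m) (etaleHom_ext (etaleOver_left _ _))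

theorem grs_grs (a : U ⟶ V) (b : V ⟶ W) (c : U ⟶ W) (ha : a ≫ v = u) (hb : b ≫ w = v)
    (hc : c ≫ w = u) (e : c = a ≫ b) (m : X.GSec w) :
    X.grs a ha (X.grs b hb m) = X.grs c hc m := by
  refine (X.gpRes_comp _ _ m).symm.trans ?_
  refine congrArg (fun a => X.gpRes a m) (etaleHom_ext ?_)
  subst e
  refine Eq.trans ?_ (etaleOver_left _ hc).symm
  refine (etale_comp_left _ _).trans ?_
  exact congrArg₂ (· ≫ ·) (etaleOver_left _ ha) (etaleOver_left _ hb)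

theorem grs_tg (a : U ⟶ V) (ha : a ≫ v = u) (x : Algebra.GrothendieckGroup (X.Sec v)) :
    X.grs a ha (X.tg x) = X.tg (gpMap (X.rs a ha) x) :=
  X.gpRes_toGp _ _

theorem GSec_ext {s t : X.GSec v} (h : ∀ x : V, ∃ (U : Scheme.{u}) (u : U ⟶ X.scheme) (_ : Etale u)
    (a : U ⟶ V) (ha : a ≫ v = u) (y : U), a y = x ∧ X.grs a ha s = X.grs a ha t) : s = t := by
  refine X.gpSec_ext (V := Scheme.Etale.mk v) (s := s) (t := t) fun x => ?_
  obtain ⟨U, u, _, a, ha, y, hy, e⟩ := h x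
  exact ⟨_, etaleOver a ha, y, (congrArg (fun k : U ⟶ V => k y) (etaleOver_left a ha)).trans hy, e⟩

theorem exists_tg (s : X.GSec v) (x : V) : ∃ (U : Scheme.{u}) (u : U ⟶ X.scheme) (_ : Etale u)
    (a : U ⟶ V) (ha : a ≫ v = u) (y : U) (z : Algebra.GrothendieckGroup (X.Sec u)), a y = x ∧
      X.grs a ha s = X.tg z := by
  obtain ⟨W, a, y, z, hy, e⟩ := X.exists_toGp (V := Scheme.Etale.mk v) s x
  refine ⟨W.left, W.hom, inferInstance, a.left, etaleHom_w a, y, z, hy, Eq.trans ?_ e⟩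
  exact congrArg (fun k => X.gpRes k s) (eq_etaleOver a).symm

theorem tg_eq {z z' : Algebra.GrothendieckGroup (X.Sec v)} (h : X.tg z = X.tg z') (x : V) :
    ∃ (U : Scheme.{u}) (u : U ⟶ X.scheme) (_ : Etale u) (a : U ⟶ V) (ha : a ≫ v = u) (y : U),
      a y = x ∧ gpMap (X.rs a ha) z = gpMap (X.rs a ha) z' := by
  obtain ⟨W, a, y, hy, e⟩ := X.toGp_eq (V := Scheme.Etale.mk v) h x
  refine ⟨W.left, W.hom, inferInstance, a.left, etaleHom_w a, y, hy, ?_⟩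
  have h : X.res a = X.rs (u := W.hom) (v := v) a.left (etaleHom_w a) :=
    congrArg X.res (eq_etaleOver a)
  exact h ▸ e

variable {X}

theorem grs_gpPullback (F : X ⟶ Y) (s : Y.GSec (𝟙 Y.scheme)) {V : Scheme.{u}} {v : V ⟶ Y.scheme}
    [Etale v] (g : U ⟶ V) (h : g ≫ v = u ≫ F.f) (z : Algebra.GrothendieckGroup (Y.Sec v))
    (hz : Y.grs v (Category.comp_id v) s = Y.tg z) :
    X.grs u (Category.comp_id u) (gpPullback F s) = X.tg (gpMap (F.pl g h) z) :=
  gpPullback_spec F s (U := Scheme.Etale.mk u) (V := Scheme.Etale.mk v) g h z hz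

end GSec

/-! ### Global sections and strict étale localization -/

section Global

variable {X Y Z T : LogScheme.{u}}

/-- The monoid of global sections of `M`. -/
abbrev GlobalSec (X : LogScheme.{u}) : Type u := X.Sec (𝟙 X.scheme)

/-- The group of global sections of `Mᵍᵖ`. -/
abbrev GlobalGp (X : LogScheme.{u}) : Type u := X.GSec (𝟙 X.scheme)

/-- The pullback of global sections of `M`. -/
def gsec (F : X ⟶ Y) : Y.GlobalSec →* X.GlobalSec :=
  F.pl (u := 𝟙 X.scheme) (v := 𝟙 Y.scheme) F.f ((Category.comp_id _).trans (Category.id_comp _).symm)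

/-- The pullback of global sections of `Mᵍᵖ`. -/
def ggp (F : X ⟶ Y) (s : Y.GlobalGp) : X.GlobalGp := gpPullback F s

/-- The map from global sections of `M` to those of `Mᵍᵖ`. -/
def qt (X : LogScheme.{u}) : X.GlobalSec →* X.GlobalGp :=
  X.tg.comp Algebra.GrothendieckGroup.of

theorem gsec_comp (F : X ⟶ Y) (G : Y ⟶ Z) (m : Z.GlobalSec) :
    gsec (F ≫ G) m = gsec F (gsec G m) :=
  comp_pl F G _ _ _ _ _ _ rfl m

theorem gsec_id (m : X.GlobalSec) : gsec (𝟙 X) m = m := X.rs_id _ m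

theorem ggp_comp (F : X ⟶ Y) (G : Y ⟶ Z) (s : Z.GlobalGp) : ggp (F ≫ G) s = ggp F (ggp G s) :=
  ConcreteCategory.congr_hom (Glog.{u}.map_comp G.op F.op) s

theorem ggp_qt (F : X ⟶ Y) (m : Y.GlobalSec) : ggp F (qt Y m) = qt X (gsec F m) := by
  have h := grs_gpPullback F (qt Y m) (u := 𝟙 X.scheme) (v := 𝟙 Y.scheme) F.f
    ((Category.comp_id _).trans (Category.id_comp _).symm) (Algebra.GrothendieckGroup.of m)
    (Y.grs_id _ _)
  rw [gpMap_of] at h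
  exact (X.grs_id _ _).symm.trans h

theorem ex_gsec (F : X ⟶ Y) (m : Y.GlobalSec) : X.ex (gsec F m) = F.f.appTop (Y.ex m) :=
  F.ex_pl _ _ m

/-- A property of morphisms to `T` holds strict étale locally if every point of `T` is in the image
of a strict étale morphism which has it. -/
def EtLocally (T : LogScheme.{u}) (P : ∀ ⦃U : LogScheme.{u}⦄, (U ⟶ T) → Prop) : Prop :=
  ∀ t : T.scheme, ∃ (U : LogScheme.{u}) (a : U ⟶ T) (y : U.scheme), IsStrictEtale a ∧ a.f y = t ∧ P a

theorem EtLocally.bind {P Q : ∀ ⦃U : LogScheme.{u}⦄, (U ⟶ T) → Prop} (hP : EtLocally T P)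
    (h : ∀ (U : LogScheme.{u}) (a : U ⟶ T), IsStrictEtale a → P a →
      EtLocally U fun _ b => Q (b ≫ a)) : EtLocally T Q := by
  intro t
  obtain ⟨U, a, y, ha, rfl, hy⟩ := hP t
  obtain ⟨V, b, z, hb, rfl, hz⟩ := h U a ha hy y
  exact ⟨V, b ≫ a, z, hb.comp ha, rfl, hz⟩

theorem EtLocally.mono {P Q : ∀ ⦃U : LogScheme.{u}⦄, (U ⟶ T) → Prop} (hP : EtLocally T P)
    (h : ∀ (U : LogScheme.{u}) (a : U ⟶ T), IsStrictEtale a → P a → Q a) : EtLocally T Q := by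
  intro t
  obtain ⟨U, a, y, ha, rfl, hy⟩ := hP t
  exact ⟨U, a, y, ha, rfl, h U a ha hy⟩

theorem EtLocally.of_self {P : ∀ ⦃U : LogScheme.{u}⦄, (U ⟶ T) → Prop} (h : P (𝟙 T)) :
    EtLocally T P := fun t => ⟨T, 𝟙 T, t, isStrictEtale_id T, rfl, h⟩

theorem etLocally_of_cover {P : ∀ ⦃U : LogScheme.{u}⦄, (U ⟶ T) → Prop}
    (h : ∀ t : T.scheme, ∃ (U : Scheme.{u}) (u : U ⟶ T.scheme) (_ : Etale u) (y : U), u y = t ∧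
      P (T.inducedMap u)) : EtLocally T P := by
  intro t
  obtain ⟨U, u, _, y, hy, hP⟩ := h t
  exact ⟨_, T.inducedMap u, y, isStrictEtale_inducedMap T u, hy, hP⟩

theorem gsec_eq_of_etLocally {m n : T.GlobalSec} (h : EtLocally T fun _ a => gsec a m = gsec a n) :
    m = n := by
  refine Sec_ext fun t => ?_
  obtain ⟨U, a, y, ha, hy, e⟩ := h t
  have := ha.etale
  refine ⟨U.scheme, a.f, this, a.f, Category.comp_id _, y, hy, ?_⟩
  apply (ha.bijective (𝟙 _) a.f rfl).1
  exact (a.pl_rs _ _ _ _ _ _ (Category.id_comp _).symm m).trans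
    (e.trans (a.pl_rs _ _ _ _ _ _ (Category.id_comp _).symm n).symm)

theorem gpMap_injective {M N : Type u} [CommMonoid M] [CommMonoid N] (f : M →* N)
    (hf : Function.Bijective f) : Function.Injective (gpMap f) := by
  let e := MulEquiv.ofBijective f hf
  intro x y h
  have key : ∀ z, gpMap e.symm.toMonoidHom (gpMap f z) = z := by
    intro z
    rw [← gpMap_comp]
    refine Eq.trans ?_ (gpMap_id z)
    exact congrArg (fun k => gpMap k z) (MonoidHom.ext fun m => e.symm_apply_apply m)
  rw [← key x, h, key y]

/-- The sheaf `Mᵍᵖ` of the source of a strict étale morphism is the restriction of that of the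
target. -/
theorem IsStrictEtale.tg_eq {a : X ⟶ T} (ha : IsStrictEtale a) {U V : Scheme.{u}}
    {u : U ⟶ X.scheme} {v : V ⟶ T.scheme} [Etale u] [Etale v] {u' : U ⟶ T.scheme} [Etale u']
    (hu : u ≫ a.f = u') (g : U ⟶ V) (h : g ≫ v = u ≫ a.f) (h' : g ≫ v = u')
    {x y : Algebra.GrothendieckGroup (T.Sec v)}
    (e : X.tg (gpMap (a.pl g h) x) = X.tg (gpMap (a.pl g h) y)) :
    T.tg (gpMap (T.rs g h') x) = T.tg (gpMap (T.rs g h') y) := by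
  have := ha.etale
  subst hu
  refine T.GSec_ext fun t => ?_
  obtain ⟨W, w, _, b, rfl, z, hz, e'⟩ := X.tg_eq e t
  refine ⟨W, (b ≫ u) ≫ a.f, inferInstance, b, (Category.assoc _ _ _).symm, z, hz, ?_⟩
  rw [grs_tg, grs_tg]
  refine congrArg _ ?_
  have hb : 𝟙 W ≫ (b ≫ u) ≫ a.f = (b ≫ u) ≫ a.f := Category.id_comp _
  apply gpMap_injective _ (ha.bijective (b ≫ u) ((b ≫ u) ≫ a.f) hb)
  rw [← gpMap_comp, ← gpMap_comp] at e' ⊢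
  rw [← gpMap_comp, ← gpMap_comp] at ⊢
  have hf : ((a.pl (𝟙 W) hb).comp (T.rs b (Category.assoc _ _ _).symm)).comp (T.rs g h') =
      (X.rs b rfl).comp (a.pl g h) := by
    refine MonoidHom.ext fun m => ?_
    have h₁ : (b ≫ g) ≫ v = (b ≫ u) ≫ a.f := by rw [Category.assoc, h, Category.assoc]
    refine Eq.trans ?_ (a.rs_pl b rfl g h (b ≫ g) h₁ rfl m).symm
    refine Eq.trans ?_ (a.pl_rs (𝟙 W) hb (b ≫ g) h₁ (b ≫ g) h₁ (Category.id_comp _).symm m)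
    exact congrArg _ (T.rs_rs _ _ _ _ _ _ rfl m)
  rw [hf]
  exact e'

theorem ggp_eq_of_etLocally {α β : T.GlobalGp} (h : EtLocally T fun _ a => ggp a α = ggp a β) :
    α = β := by
  refine T.GSec_ext fun t => ?_
  obtain ⟨U, a, y, ha, hy, e⟩ := h t
  have := ha.etale
  obtain ⟨V, v, _, b, hb, z, x, hz, ex⟩ := T.exists_tg α t
  obtain rfl : b = v := (Category.comp_id _).symm.trans hb
  obtain ⟨V', v', _, c, rfl, z', x', hz', ex'⟩ := T.exists_tg (T.grs b hb β) z
  obtain ⟨r, hr, -⟩ := Scheme.Pullback.exists_preimage_pullback (f := c ≫ b) (g := a.f) z' y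
    (by simp [hz', hz, hy])
  let R := pullback (c ≫ b) a.f
  let p : R ⟶ V' := pullback.fst (c ≫ b) a.f
  let q : R ⟶ U.scheme := pullback.snd (c ≫ b) a.f
  have hpq : p ≫ c ≫ b = q ≫ a.f := pullback.condition
  rw [T.grs_grs c b (c ≫ b) rfl hb (Category.comp_id _) rfl] at ex'
  have ex₁ : T.grs (c ≫ b) (Category.comp_id _) α = T.tg (gpMap (T.rs c rfl) x) := by
    rw [← grs_tg, ← ex, T.grs_grs c b (c ≫ b) rfl hb (Category.comp_id _) rfl]
  refine ⟨R, q ≫ a.f, inferInstance, p ≫ c ≫ b, (Category.comp_id _).trans hpq, r,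
    by simp [hr, hz, hz', p], ?_⟩
  have e₁ := grs_gpPullback a α (u := q) p hpq _ ex₁
  have e₂ := grs_gpPullback a β (u := q) p hpq _ ex'
  have e₃ := ha.tg_eq rfl p hpq hpq (e₁.symm.trans ((congrArg _ e).trans e₂))
  rw [← T.grs_tg p hpq, ← T.grs_tg p hpq, ← ex₁, ← ex', T.grs_grs p (c ≫ b) (p ≫ c ≫ b) hpq _
    ((Category.comp_id _).trans hpq) rfl, T.grs_grs p (c ≫ b) (p ≫ c ≫ b) hpq _
    ((Category.comp_id _).trans hpq) rfl] at e₃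
  exact e₃

theorem grs_eq_of_ggp_eq_qt {a : X ⟶ T} (ha : IsStrictEtale a) [Etale a.f] {α : T.GlobalGp}
    {n : T.Sec a.f} (h : ggp a α = qt X (a.pl (u := 𝟙 X.scheme) (𝟙 _) rfl n)) :
    T.grs a.f (Category.comp_id _) α = T.tg (Algebra.GrothendieckGroup.of n) := by
  refine T.GSec_ext fun t => ?_
  obtain ⟨V, v, _, b, rfl, z, x, hz, ex⟩ := T.exists_tg (T.grs a.f (Category.comp_id _) α) t
  refine ⟨V, b ≫ a.f, inferInstance, b, rfl, z, hz, ?_⟩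
  have : Etale b := etale_of_comp (g := a.f) inferInstance (h := b ≫ a.f) inferInstance rfl
  rw [T.grs_grs b a.f (b ≫ a.f) rfl _ (Category.comp_id _) rfl] at ex
  have e₁ := grs_gpPullback a α (u := b) (𝟙 V) (Category.id_comp _) _ ex
  have e₂ : X.grs b (Category.comp_id _) (qt X (a.pl (u := 𝟙 X.scheme) (𝟙 _) rfl n)) =
      X.tg (gpMap (a.pl (u := b) (v := b ≫ a.f) (𝟙 V) (Category.id_comp _))
        (gpMap (T.rs b rfl) (Algebra.GrothendieckGroup.of n))) := by
    refine (X.grs_tg b _ _).trans (congrArg _ ?_)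
    rw [gpMap_of, gpMap_of, gpMap_of]
    refine congrArg _ ?_
    rw [a.rs_pl (v := a.f) b _ (𝟙 _) _ b rfl (Category.comp_id _).symm,
      a.pl_rs _ _ b rfl b rfl (Category.id_comp _).symm]
  have e₃ := ha.tg_eq (u' := b ≫ a.f) rfl (𝟙 V) (Category.id_comp _) (Category.id_comp _)
    (e₁.symm.trans ((congrArg _ h).trans e₂))
  rw [← grs_tg, ← grs_tg, grs_id, grs_id, ← grs_tg, ← ex] at e₃
  rw [← e₃, T.grs_grs b a.f (b ≫ a.f) rfl _ (Category.comp_id _) rfl]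

theorem exists_eq_of_div {M : Type u} [CommMonoid M] (x : Algebra.GrothendieckGroup M) :
    ∃ b c : M, x = (Algebra.GrothendieckGroup.of b)⁻¹ * Algebra.GrothendieckGroup.of c := by
  induction x using Localization.induction_on with
  | H y =>
    refine ⟨y.2.1, y.1, ?_⟩
    rw [eq_inv_mul_iff_mul_eq]
    have := (Localization.monoidOf (⊤ : Submonoid M)).mk'_spec y.1 y.2
    rw [mul_comm] at this
    refine Eq.trans ?_ this
    rw [Localization.mk_eq_monoidOf_mk']
    rfl

/-- Étale locally, a section of `Mᵍᵖ` is a quotient of sections of `M`. -/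
theorem etLocally_exists_div (α : T.GlobalGp) : EtLocally T fun U a =>
    ∃ β γ : U.GlobalSec, ggp a α = (qt U β)⁻¹ * qt U γ := by
  refine etLocally_of_cover fun t => ?_
  obtain ⟨V, v, _, b, hb, z, x, hz, ex⟩ := T.exists_tg α t
  obtain rfl : b = v := (Category.comp_id _).symm.trans hb
  obtain ⟨β, γ, rfl⟩ := exists_eq_of_div x
  refine ⟨V, b, inferInstance, z, hz, ?_⟩
  have hb' : 𝟙 V ≫ b = 𝟙 V ≫ (T.inducedMap b).f := rfl
  refine ⟨(T.inducedMap b).pl (u := 𝟙 V) (𝟙 V) hb' β, (T.inducedMap b).pl (u := 𝟙 V) (𝟙 V) hb' γ, ?_⟩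
  have h := grs_gpPullback (T.inducedMap b) α (u := 𝟙 V) (𝟙 V) hb' _ ex
  refine ((grs_id _ _ _).symm.trans h).trans ?_
  rw [map_mul, map_inv, map_mul, map_inv, gpMap_of, gpMap_of]
  rfl

theorem gpof_eq {M : Type u} [CommMonoid M] {x y : M}
    (h : Algebra.GrothendieckGroup.of x = Algebra.GrothendieckGroup.of y) :
    ∃ c : M, c * x = c * y := by
  obtain ⟨c, hc⟩ := (Localization.monoidOf (⊤ : Submonoid M)).eq_iff_exists.1 h
  exact ⟨c.1, hc⟩

theorem gsec_mul_eq (a : X ⟶ T) [Etale a.f] {m n : T.GlobalSec} {c : T.Sec a.f}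
    (hc : c * T.rs a.f (Category.comp_id _) m = c * T.rs a.f (Category.comp_id _) n) :
    ∃ c : X.GlobalSec, c * gsec a m = c * gsec a n := by
  have key : ∀ m : T.GlobalSec, a.pl (u := 𝟙 X.scheme) (𝟙 _) rfl
      (T.rs a.f (Category.comp_id _) m) = gsec a m := fun m =>
    a.pl_rs (u := 𝟙 X.scheme) (𝟙 _) rfl a.f _ _ _ (Category.id_comp _).symm m
  exact ⟨a.pl (u := 𝟙 X.scheme) (𝟙 _) rfl c, by rw [← key, ← key, ← map_mul, hc, map_mul]⟩

theorem etLocally_of_qt_eq {m n : T.GlobalSec} (h : qt T m = qt T n) : EtLocally T fun U a =>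
    ∃ c : U.GlobalSec, c * gsec a m = c * gsec a n := by
  have h' : T.tg (Algebra.GrothendieckGroup.of m) = T.tg (Algebra.GrothendieckGroup.of n) := h
  refine etLocally_of_cover fun t => ?_
  obtain ⟨V, v, _, b, hb, z, hz, e⟩ := T.tg_eq h' t
  obtain rfl : b = v := (Category.comp_id _).symm.trans hb
  rw [gpMap_of, gpMap_of] at e
  obtain ⟨c, hc⟩ := gpof_eq e
  exact ⟨V, b, inferInstance, z, hz, @gsec_mul_eq _ _ (T.inducedMap b) ‹_› m n c hc⟩

end Global

end

end LogScheme

end LogGeometry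

namespace LogGeometry

namespace LogScheme

noncomputable section

/-! ### Charts -/

section Charts

variable {X Y Z T : LogScheme.{u}} {P : Type u} [CommMonoid P]

/-- Sections of `M` over the source of a strict étale morphism. -/
def IsStrictEtale.secEquiv {a : X ⟶ T} (ha : IsStrictEtale a) [Etale a.f] :
    T.Sec a.f ≃* X.GlobalSec :=
  MulEquiv.ofBijective (a.pl (u := 𝟙 X.scheme) (𝟙 _) rfl) (ha.bijective (𝟙 _) a.f rfl)

theorem IsStrictEtale.gsec_secEquiv {a : X ⟶ T} (ha : IsStrictEtale a) [Etale a.f] {b : Y ⟶ X}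
    {c : Y ⟶ T} (hc : IsStrictEtale c) [Etale c.f] (e : b ≫ a = c) (e' : b.f ≫ a.f = c.f)
    (m : T.Sec a.f) : gsec b (ha.secEquiv m) = hc.secEquiv (T.rs b.f e' m) := by
  subst e
  have h : b.f ≫ a.f = 𝟙 _ ≫ (b ≫ a).f := (Category.id_comp _).symm
  refine (comp_pl b a (u := 𝟙 _) (v := 𝟙 _) b.f ((Category.comp_id _).trans
    (Category.id_comp _).symm) (𝟙 _) rfl b.f h (Category.comp_id _).symm m).symm.trans ?_
  exact ((b ≫ a).pl_rs (𝟙 _) rfl b.f e' b.f h (Category.id_comp _).symm m).symm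

theorem IsStrictEtale.secEquiv_rs {a : X ⟶ T} (ha : IsStrictEtale a) [Etale a.f]
    (m : T.GlobalSec) : ha.secEquiv (T.rs a.f (Category.comp_id _) m) = gsec a m :=
  a.pl_rs (u := 𝟙 X.scheme) (𝟙 _) rfl a.f _ _ _ (Category.id_comp _).symm m

/-- The notion of a chart, in terms of sections over étale schemes. -/
def ChartAt (X : LogScheme.{u}) {U : Scheme.{u}} (u : U ⟶ X.scheme) [Etale u] (θ : P →* X.Sec u) :
    Prop :=
  (∀ {V : Scheme.{u}} (v : V ⟶ X.scheme) [Etale v] (a : V ⟶ U) (ha : a ≫ u = v) (m : X.Sec v)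
    (x : V), ∃ (W : Scheme.{u}) (w : W ⟶ X.scheme) (_ : Etale w) (b : W ⟶ V) (hb : b ≫ v = w)
      (y : W) (p : P) (e : X.Sec w), b y = x ∧ IsUnit e ∧
        X.rs b hb m = e * X.rs (b ≫ a) (by rw [Category.assoc, ha, hb]) (θ p)) ∧
  (∀ {V : Scheme.{u}} (v : V ⟶ X.scheme) [Etale v] (a : V ⟶ U) (ha : a ≫ u = v) (p p' : P)
    (e : X.Sec v) (x : V), IsUnit e → X.rs a ha (θ p) = e * X.rs a ha (θ p') →
    ∃ (W : Scheme.{u}) (w : W ⟶ X.scheme) (_ : Etale w) (b : W ⟶ V) (hb : b ≫ v = w)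
      (y : W) (n n' : P), b y = x ∧
        IsUnit (X.rs (b ≫ a) (by rw [Category.assoc, ha, hb] : (b ≫ a) ≫ u = w) (θ n)) ∧
        IsUnit (X.rs (b ≫ a) (by rw [Category.assoc, ha, hb] : (b ≫ a) ≫ u = w) (θ n')) ∧
        p * n = p' * n' ∧
        X.rs (b ≫ a) (by rw [Category.assoc, ha, hb] : (b ≫ a) ≫ u = w) (θ n') =
          X.rs b hb e * X.rs (b ≫ a) (by rw [Category.assoc, ha, hb]) (θ n))

theorem rs_eq_res {U V : X.scheme.Etale} (a : U ⟶ V) (m : X.sec V) :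
    X.res a m = X.rs (u := U.hom) (v := V.hom) a.left (etaleHom_w a) m :=
  congrArg (fun k => X.res k m) (eq_etaleOver a)

theorem res_eq_of_left {U V : X.scheme.Etale} {a b : U ⟶ V} (h : a.left = b.left) (m : X.sec V) :
    X.res a m = X.res b m :=
  congrArg (fun k => X.res k m) (etaleHom_ext h)

/-- `ChartAt` is the notion of a chart of the definition, with étale schemes over `X` unbundled. -/
theorem chartAt_iff {U : Scheme.{u}} (u : U ⟶ X.scheme) [Etale u] (θ : P →* X.Sec u) :
    IsChart X (Scheme.Etale.mk u) θ ↔ X.ChartAt u θ := by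
  constructor
  · rintro ⟨h₁, h₂⟩
    refine ⟨fun {V} v _ a ha m x => ?_, fun {V} v _ a ha p p' e x he h => ?_⟩
    · obtain ⟨W, b, w, p, e, hw, h⟩ := h₁ (Scheme.Etale.mk v) (etaleOver a ha) m x
      refine ⟨W.left, W.hom, inferInstance, b.left, etaleHom_w b, w, p, e.1, hw, e.isUnit, ?_⟩
      refine (rs_eq_res b m).symm.trans (h.trans (congrArg _ ?_))
      refine res_eq_of_left ?_ _
      refine Eq.trans ?_ (etaleOver_left (u := W.hom) (v := u) (b.left ≫ a) _).symm
      exact (etale_comp_left _ _).trans (congrArg (b.left ≫ ·) (etaleOver_left a ha))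
    · obtain ⟨W, b, w, n, n', hw, hn, hn', hp, h⟩ :=
        h₂ (Scheme.Etale.mk v) (etaleOver a ha) p p' he.unit x h
      have key : ∀ (m : X.Sec u) (i), X.res (b ≫ etaleOver a ha) m =
          X.rs (u := W.hom) (v := u) (b.left ≫ a) i m := by
        intro m i
        refine res_eq_of_left ?_ _
        refine Eq.trans ?_ (etaleOver_left (u := W.hom) (v := u) (b.left ≫ a) i).symm
        exact (etale_comp_left _ _).trans (congrArg (b.left ≫ ·) (etaleOver_left a ha))
      have hi : (b.left ≫ a) ≫ u = W.hom := by
        refine (Category.assoc _ _ _).trans ((congrArg (b.left ≫ ·) ha).trans ?_)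
        exact etaleHom_w b
      refine ⟨W.left, W.hom, inferInstance, b.left, etaleHom_w b, w, n, n', hw, ?_, ?_, hp, ?_⟩
      · exact (key (θ n) hi) ▸ hn
      · exact (key (θ n') hi) ▸ hn'
      · refine (key (θ n') hi).symm.trans (h.trans ?_)
        exact congrArg₂ (· * ·) (rs_eq_res b e) (key (θ n) hi)
  · rintro ⟨h₁, h₂⟩
    refine ⟨fun V a m x => ?_, fun V a p p' e x h => ?_⟩
    · obtain ⟨W, w, _, b, hb, y, p, e, hy, he, h⟩ :=
        h₁ (V.hom : V.left ⟶ X.scheme) a.left (etaleHom_w a) m x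
      refine ⟨Scheme.Etale.mk w, etaleOver (v := V.hom) b hb, y, p, he.unit, ?_, ?_⟩
      · exact (congrArg (fun k : W ⟶ V.left => k y) (etaleOver_left (v := V.hom) b hb)).trans hy
      · refine Eq.trans h (congrArg (e * ·) ?_)
        refine res_eq_of_left ?_ _
        refine (etaleOver_left (u := w) (v := u) (b ≫ a.left) _).trans ?_
        exact ((etale_comp_left _ _).trans (congrArg (· ≫ a.left)
          (etaleOver_left (v := V.hom) b hb))).symm
    · obtain ⟨W, w, _, b, hb, y, n, n', hy, hn, hn', hp, h⟩ :=
        h₂ (V.hom : V.left ⟶ X.scheme) a.left (etaleHom_w a) p p' e.1 x e.isUnit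
          ((rs_eq_res a _).symm.trans (h.trans (congrArg (e.1 * ·) (rs_eq_res a _))))
      have key : ∀ (m : X.Sec u) (i), X.res (etaleOver (v := V.hom) b hb ≫ a) m =
          X.rs (u := w) (v := u) (b ≫ a.left) i m := by
        intro m i
        refine res_eq_of_left ?_ _
        refine Eq.trans ?_ (etaleOver_left (u := w) (v := u) (b ≫ a.left) _).symm
        exact ((etale_comp_left _ _).trans (congrArg (· ≫ a.left)
          (etaleOver_left (v := V.hom) b hb)))
      have hi : (b ≫ a.left) ≫ u = w := by
        refine Eq.trans ?_ hb
        exact (Category.assoc _ _ _).trans (congrArg (b ≫ ·) (etaleHom_w a))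
      refine ⟨Scheme.Etale.mk w, etaleOver (v := V.hom) b hb, y, n, n', ?_, ?_, ?_, hp, ?_⟩
      · exact (congrArg (fun k : W ⟶ V.left => k y) (etaleOver_left (v := V.hom) b hb)).trans hy
      · exact (key (θ n) hi).symm ▸ hn
      · exact (key (θ n') hi).symm ▸ hn'
      · exact (key (θ n') hi).trans (h.trans (congrArg (_ * ·) (key (θ n) hi).symm))

/-- A homomorphism `θ : P → Γ(X, M)` is a global chart if the same conditions as for a chart hold
strict étale locally. -/
def Chart (X : LogScheme.{u}) (θ : P →* X.GlobalSec) : Prop :=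
  (∀ {U : LogScheme.{u}} (a : U ⟶ X), IsStrictEtale a → ∀ m : U.GlobalSec, EtLocally U fun V b =>
    ∃ (p : P) (e : V.GlobalSec), IsUnit e ∧ gsec b m = e * gsec (b ≫ a) (θ p)) ∧
  (∀ {U : LogScheme.{u}} (a : U ⟶ X), IsStrictEtale a → ∀ (p p' : P) (e : U.GlobalSec), IsUnit e →
    gsec a (θ p) = e * gsec a (θ p') → EtLocally U fun _ b =>
    ∃ n n' : P, IsUnit (gsec (b ≫ a) (θ n)) ∧ IsUnit (gsec (b ≫ a) (θ n')) ∧ p * n = p' * n' ∧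
      gsec (b ≫ a) (θ n') = gsec b e * gsec (b ≫ a) (θ n))

theorem Chart.comp {θ : P →* X.GlobalSec} (h : X.Chart θ) {a : Y ⟶ X} (ha : IsStrictEtale a) :
    Y.Chart ((gsec a).comp θ) := by
  constructor
  · intro U b hb m
    refine (h.1 (b ≫ a) (hb.comp ha) m).mono fun V c _ ⟨p, e, he, h⟩ => ⟨p, e, he, ?_⟩
    rw [h, MonoidHom.comp_apply, ← gsec_comp, Category.assoc]
  · intro U b hb p p' e he h'
    rw [MonoidHom.comp_apply, MonoidHom.comp_apply, ← gsec_comp, ← gsec_comp] at h'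
    refine (h.2 (b ≫ a) (hb.comp ha) p p' e he h').mono fun V c _ ⟨n, n', hn⟩ => ⟨n, n', ?_⟩
    simp only [MonoidHom.comp_apply, ← gsec_comp, Category.assoc]
    exact hn

theorem Chart.exists_eq {θ : P →* X.GlobalSec} (h : X.Chart θ) (m : X.GlobalSec) :
    EtLocally X fun V b => ∃ (p : P) (e : V.GlobalSec), IsUnit e ∧
      gsec b m = e * gsec b (θ p) := by
  refine (h.1 (𝟙 X) (isStrictEtale_id X) m).mono fun V b _ ⟨p, e, he, h⟩ => ⟨p, e, he, ?_⟩
  rwa [Category.comp_id] at h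

theorem Chart.of_eq {θ : P →* X.GlobalSec} (h : X.Chart θ) {p p' : P} {e : X.GlobalSec}
    (he : IsUnit e) (h' : θ p = e * θ p') : EtLocally X fun _ b => ∃ n n' : P,
      IsUnit (gsec b (θ n)) ∧ IsUnit (gsec b (θ n')) ∧ p * n = p' * n' ∧
      gsec b (θ n') = gsec b e * gsec b (θ n) := by
  refine (h.2 (𝟙 X) (isStrictEtale_id X) p p' e he (by rw [gsec_id, gsec_id, h'])).mono
    fun V b _ ⟨n, n', h⟩ => ⟨n, n', ?_⟩
  rwa [Category.comp_id] at h

/-- A chart over the source of a strict étale morphism is a global chart of that source. -/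
theorem chartAt_iff_chart {s : X ⟶ T} (hs : IsStrictEtale s) [Etale s.f] (θ : P →* T.Sec s.f) :
    T.ChartAt s.f θ ↔ X.Chart (hs.secEquiv.toMonoidHom.comp θ) := by
  constructor
  · rintro ⟨h₁, h₂⟩
    constructor
    · intro U a ha m t
      have := ha.etale
      have hg := ha.comp hs
      have i : Etale (a ≫ s).f := hg.etale
      obtain ⟨m, rfl⟩ := hg.secEquiv.surjective m
      obtain ⟨W, w, _, b, rfl, y, p, e, hy, he, h⟩ := h₁ (a ≫ s).f a.f rfl m t
      have hb : Etale b := etale_of_comp i (h := b ≫ (a ≫ s).f) inferInstance rfl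
      have hi := isStrictEtale_inducedMap U b
      have hc := hi.comp hg
      have i' : Etale (U.inducedMap b ≫ a ≫ s).f := hc.etale
      refine ⟨_, U.inducedMap b, y, hi, hy, p, hc.secEquiv e, he.map _, ?_⟩
      rw [hg.gsec_secEquiv hc rfl rfl]
      refine (congrArg hc.secEquiv h).trans ((map_mul hc.secEquiv _ _).trans ?_)
      refine congrArg _ ?_
      exact (hs.gsec_secEquiv (b := U.inducedMap b ≫ a) (c := U.inducedMap b ≫ a ≫ s) hc
        (Category.assoc _ _ _) (Category.assoc _ _ _) (θ p)).symm
    · intro U a ha p p' e he h t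
      have := ha.etale
      have hg := ha.comp hs
      have i : Etale (a ≫ s).f := hg.etale
      obtain ⟨e, rfl⟩ := hg.secEquiv.surjective e
      have he' : IsUnit e := by
        have := he.map hg.secEquiv.symm
        rwa [MulEquiv.symm_apply_apply] at this
      have h' : T.rs (u := (a ≫ s).f) a.f rfl (θ p) = e * T.rs (u := (a ≫ s).f) a.f rfl (θ p') := by
        apply hg.secEquiv.injective
        rw [map_mul]
        exact (hs.gsec_secEquiv hg rfl rfl _).symm.trans (h.trans
          (congrArg _ (hs.gsec_secEquiv hg rfl rfl _)))
      obtain ⟨W, w, _, b, rfl, y, n, n', hy, hn, hn', hp, h⟩ :=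
        h₂ (a ≫ s).f a.f rfl p p' e t he' h'
      have hb : Etale b := etale_of_comp i (h := b ≫ (a ≫ s).f) inferInstance rfl
      have hi := isStrictEtale_inducedMap U b
      have hc := hi.comp hg
      have i' : Etale (U.inducedMap b ≫ a ≫ s).f := hc.etale
      have key : ∀ n, gsec (U.inducedMap b ≫ a) (hs.secEquiv (θ n)) = hc.secEquiv _ := fun n =>
        hs.gsec_secEquiv (b := U.inducedMap b ≫ a) (c := U.inducedMap b ≫ a ≫ s) hc
          (Category.assoc _ _ _) (Category.assoc _ _ _) (θ n)
      refine ⟨_, U.inducedMap b, y, hi, hy, n, n', ?_, ?_, hp, ?_⟩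
      · exact (key n).symm ▸ hn.map hc.secEquiv
      · exact (key n').symm ▸ hn'.map hc.secEquiv
      · rw [hg.gsec_secEquiv hc rfl rfl]
        refine (key n').trans ((congrArg hc.secEquiv h).trans ((map_mul hc.secEquiv _ _).trans ?_))
        exact congrArg _ (key n).symm
  · rintro ⟨h₁, h₂⟩
    refine ⟨fun {V} v _ a ha m x => ?_, fun {V} v _ a ha p p' e x he h => ?_⟩
    · subst ha
      have ia : Etale a := etale_of_comp (g := s.f) inferInstance (h := a ≫ s.f) inferInstance rfl
      have hi := isStrictEtale_inducedMap X a
      have hg := hi.comp hs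
      have i : Etale (X.inducedMap a ≫ s).f := hg.etale
      obtain ⟨W, b, y, hb, hy, p, e, he, h⟩ := h₁ _ hi (hg.secEquiv m) x
      have ib := hb.etale
      have hc := hb.comp hg
      have ic : Etale (b ≫ X.inducedMap a ≫ s).f := hc.etale
      obtain ⟨e, rfl⟩ := hc.secEquiv.surjective e
      have he' : IsUnit e := by
        have := he.map hc.secEquiv.symm
        rwa [MulEquiv.symm_apply_apply] at this
      refine ⟨W.scheme, (b ≫ X.inducedMap a ≫ s).f, ic, b.f, rfl, y, p, e, hy, he', ?_⟩
      apply hc.secEquiv.injective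
      rw [map_mul]
      refine (hg.gsec_secEquiv hc rfl rfl m).symm.trans (h.trans (congrArg _ ?_))
      exact hs.gsec_secEquiv (b := b ≫ X.inducedMap a) (c := b ≫ X.inducedMap a ≫ s) hc
        (Category.assoc _ _ _) (Category.assoc _ _ _) (θ p)
    · subst ha
      have ia : Etale a := etale_of_comp (g := s.f) inferInstance (h := a ≫ s.f) inferInstance rfl
      have hi := isStrictEtale_inducedMap X a
      have hg := hi.comp hs
      have i : Etale (X.inducedMap a ≫ s).f := hg.etale
      have h' : gsec (X.inducedMap a) (hs.secEquiv (θ p)) = hg.secEquiv e *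
          gsec (X.inducedMap a) (hs.secEquiv (θ p')) := by
        refine (hs.gsec_secEquiv hg rfl rfl _).trans ((congrArg hg.secEquiv h).trans
          ((map_mul hg.secEquiv _ _).trans ?_))
        exact congrArg _ (hs.gsec_secEquiv hg rfl rfl _).symm
      obtain ⟨W, b, y, hb, hy, n, n', hn, hn', hp, h⟩ := h₂ _ hi p p' (hg.secEquiv e) (he.map _) h' x
      have ib := hb.etale
      have hc := hb.comp hg
      have ic : Etale (b ≫ X.inducedMap a ≫ s).f := hc.etale
      have key : ∀ n, gsec (b ≫ X.inducedMap a) (hs.secEquiv (θ n)) = hc.secEquiv _ := fun n =>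
        hs.gsec_secEquiv (b := b ≫ X.inducedMap a) (c := b ≫ X.inducedMap a ≫ s) hc
          (Category.assoc _ _ _) (Category.assoc _ _ _) (θ n)
      have hu : ∀ {m}, IsUnit (hc.secEquiv m) → IsUnit m := fun {m} hm => by
        have := hm.map hc.secEquiv.symm
        rwa [MulEquiv.symm_apply_apply] at this
      refine ⟨W.scheme, (b ≫ X.inducedMap a ≫ s).f, ic, b.f, rfl, y, n, n', hy, ?_, ?_, hp, ?_⟩
      · exact hu ((key n) ▸ hn)
      · exact hu ((key n') ▸ hn')
      · apply hc.secEquiv.injective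
        rw [map_mul]
        refine (key n').symm.trans (h.trans ?_)
        exact congrArg₂ (· * ·) (hg.gsec_secEquiv hc rfl rfl e) (key n)

theorem isFs_iff : IsFs X ↔ EtLocally X fun U _ => ∃ (P : Type u) (_ : CommMonoid P)
    (θ : P →* U.GlobalSec), Monoid.FG P ∧ IsCancelMul P ∧ IsSaturatedMonoid P ∧ U.Chart θ := by
  constructor
  · intro h x
    obtain ⟨U, y, P, _, θ, hy, h₁, h₂, h₃, h₄⟩ := h x
    have hi := isStrictEtale_inducedMap X (U.hom : U.left ⟶ X.scheme)
    have i : Etale (X.inducedMap (U.hom : U.left ⟶ X.scheme)).f := hi.etale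
    refine ⟨_, X.inducedMap (U.hom : U.left ⟶ X.scheme), y, hi, hy, P, inferInstance, _, h₁, h₂, h₃,
      (chartAt_iff_chart hi θ).1 ((chartAt_iff (U.hom : U.left ⟶ X.scheme) θ).1 h₄)⟩
  · intro h x
    obtain ⟨U, a, y, ha, hy, P, _, θ, h₁, h₂, h₃, h₄⟩ := h x
    have i := ha.etale
    refine ⟨Scheme.Etale.mk a.f, y, P, inferInstance, ha.secEquiv.symm.toMonoidHom.comp θ, hy, h₁, h₂,
      h₃, (chartAt_iff a.f _).2 ((chartAt_iff_chart ha _).2 ?_)⟩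
    convert h₄
    ext p
    exact ha.secEquiv.apply_symm_apply _

/-- Properties which hold étale locally on the target of a morphism hold étale locally on the
source, after composition with the morphism. -/
theorem EtLocally.pull {Q : ∀ ⦃U : LogScheme.{u}⦄, (U ⟶ T) → Prop} (h : EtLocally T Q)
    (s : X ⟶ T) : EtLocally X fun V b => ∃ (U : LogScheme.{u}) (a : U ⟶ T) (d : V ⟶ U),
      IsStrictEtale a ∧ d ≫ a = b ≫ s ∧ Q a := by
  intro x
  obtain ⟨U, a, y, ha, hy, hQa⟩ := h (s.f x)
  have := ha.etale
  obtain ⟨z, hz, -⟩ := Scheme.Pullback.exists_preimage_pullback x y hy.symm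
  let c : pullback s.f a.f ⟶ X.scheme := pullback.fst s.f a.f
  obtain ⟨d, hd, hd'⟩ := (ha.existsUnique_lift (X.inducedMap c ≫ s) (pullback.snd s.f a.f)
    pullback.condition.symm).exists
  exact ⟨_, X.inducedMap c, z, isStrictEtale_inducedMap X c, hz, U, a, d, ha, hd, hQa⟩

theorem IsStrictEtale.isFs {s : X ⟶ T} (hs : IsStrictEtale s) (hT : IsFs T) : IsFs X := by
  intro x
  revert x
  change IsFs X
  rw [isFs_iff] at hT ⊢
  refine (hT.pull s).mono ?_
  rintro V b hb ⟨U, a, d, ha, e, P, _, θ, h₁, h₂, h₃, h₄⟩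
  have hd : IsStrictEtale d := ha.of_comp (hb.comp hs) e
  exact ⟨P, inferInstance, (gsec d).comp θ, h₁, h₂, h₃, h₄.comp hd⟩

theorem isFs_of_etLocally (h : EtLocally X fun U _ => IsFs U) : IsFs X := by
  rw [isFs_iff]
  refine h.bind fun U a _ hU => ?_
  exact isFs_iff.1 hU

end Charts

/-! ### Integral and saturated logarithmic structures -/

section Fs

variable {X Y Z T : LogScheme.{u}}

theorem isUnit_iff_ex {U : Scheme.{u}} {u : U ⟶ T.scheme} [Etale u] {m : T.Sec u} :
    IsUnit m ↔ IsUnit (T.ex m) := by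
  refine ⟨fun h => h.map _, fun h => ?_⟩
  obtain ⟨g, hg⟩ := h.exists_right_inv
  have hg' : IsUnit g := IsUnit.of_mul_eq_one_right _ hg
  obtain ⟨n, hn, -⟩ := T.existsUnique_ex (u := u) hg'
  refine IsUnit.of_mul_eq_one n ?_
  refine (T.existsUnique_ex (u := u) isUnit_one).unique ?_ (map_one _)
  rw [map_mul, hn, hg]

theorem exists_chart_eq (hT : IsFs T) (m₁ m₂ m₃ : T.GlobalSec) : EtLocally T fun V b =>
    ∃ (P : Type u) (_ : CommMonoid P) (θ : P →* V.GlobalSec) (p₁ p₂ p₃ : P)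
      (e₁ e₂ e₃ : V.GlobalSecˣ), IsCancelMul P ∧ IsSaturatedMonoid P ∧ V.Chart θ ∧
      gsec b m₁ = e₁ * θ p₁ ∧ gsec b m₂ = e₂ * θ p₂ ∧ gsec b m₃ = e₃ * θ p₃ := by
  refine (isFs_iff.1 hT).bind ?_
  rintro U a - ⟨P, _, θ, -, hc, hs, hθ⟩
  refine (hθ.exists_eq (gsec a m₁)).bind ?_
  rintro U₁ a₁ h₁ ⟨p₁, e₁, he₁, hm₁⟩
  refine ((hθ.comp h₁).exists_eq (gsec a₁ (gsec a m₂))).bind ?_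
  rintro U₂ a₂ h₂ ⟨p₂, e₂, he₂, hm₂⟩
  refine (((hθ.comp h₁).comp h₂).exists_eq (gsec a₂ (gsec a₁ (gsec a m₃)))).mono ?_
  rintro U₃ a₃ h₃ ⟨p₃, e₃, he₃, hm₃⟩
  have f₁ : IsUnit (gsec a₃ (gsec a₂ e₁)) := (he₁.map _).map _
  have f₂ : IsUnit (gsec a₃ e₂) := he₂.map _
  refine ⟨P, inferInstance, _, p₁, p₂, p₃, f₁.unit, f₂.unit, he₃.unit, hc, hs,
    ((hθ.comp h₁).comp h₂).comp h₃, ?_, ?_, ?_⟩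
  · simp only [gsec_comp, hm₁, map_mul]
    rfl
  · simp only [gsec_comp, hm₂, map_mul]
    rfl
  · simp only [gsec_comp, hm₃]
    rfl

/-- The sheaf `M` of an fs logarithmic scheme is cancellative, as can be checked on charts. -/
theorem eq_of_mul_eq (hT : IsFs T) {c m n : T.GlobalSec} (h : c * m = c * n) : m = n := by
  apply gsec_eq_of_etLocally
  refine (exists_chart_eq hT c m n).bind ?_
  rintro V b - ⟨P, _, θ, p₁, p₂, p₃, e₁, e₂, e₃, hc, -, hθ, h₁, h₂, h₃⟩
  have h' := congrArg (gsec b) h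
  rw [map_mul, map_mul, h₁, h₂, h₃] at h'
  have h'' : θ (p₁ * p₂) = ((e₂⁻¹ * e₃ : V.GlobalSecˣ) : V.GlobalSec) * θ (p₁ * p₃) := by
    rw [map_mul, map_mul, Units.val_mul, mul_assoc, Units.eq_inv_mul_iff_mul_eq]
    apply (Units.isUnit e₁).mul_left_cancel
    calc _ = _ := ?_
      _ = _ := h'
      _ = _ := ?_
    · ac_rfl
    · ac_rfl
  refine (hθ.of_eq (Units.isUnit _) h'').mono ?_
  rintro W d - ⟨n₁, n₂, hn₁, hn₂, hp, hn⟩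
  rw [mul_assoc, mul_assoc] at hp
  have hp' := congrArg (fun p => gsec d (θ p)) (mul_left_cancel hp)
  simp only [map_mul] at hp'
  have e := congrArg (gsec d) (Units.mul_inv e₂)
  rw [map_mul, map_one] at e
  rw [gsec_comp, gsec_comp, h₂, h₃, map_mul, map_mul]
  apply hn₁.mul_right_cancel
  rw [mul_assoc, hp', hn, Units.val_mul, map_mul]
  calc _ = (gsec d e₂ * gsec d (↑e₂⁻¹ : V.GlobalSec)) * (gsec d e₃ * gsec d (θ p₃) * gsec d (θ n₁)) := by
        ac_rfl
    _ = _ := by rw [e, one_mul]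

theorem Sec_eq_of_mul_eq (hT : IsFs T) {U : Scheme.{u}} {u : U ⟶ T.scheme} [Etale u] {c m n : T.Sec u}
    (h : c * m = c * n) : m = n := by
  have hi := isStrictEtale_inducedMap T u
  have i : Etale (T.inducedMap u).f := hi.etale
  have h' := congrArg hi.secEquiv h
  apply hi.secEquiv.injective
  refine eq_of_mul_eq (c := hi.secEquiv c) (hi.isFs hT) ?_
  exact (map_mul hi.secEquiv c m).symm.trans (h'.trans (map_mul hi.secEquiv c n))

theorem ggp_mul (F : X ⟶ Y) (s t : Y.GlobalGp) : ggp F (s * t) = ggp F s * ggp F t := by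
  refine X.GSec_ext fun x => ?_
  obtain ⟨V, v, _, b, hb, y, z, hy, ez⟩ := Y.exists_tg s (F.f x)
  obtain rfl : b = v := (Category.comp_id _).symm.trans hb
  obtain ⟨V', v', _, c, rfl, y', w, hy', ew⟩ := Y.exists_tg (Y.grs b hb t) y
  rw [Y.grs_grs c b (c ≫ b) rfl hb (Category.comp_id _) rfl] at ew
  have ez' : Y.grs (c ≫ b) (Category.comp_id _) s = Y.tg (gpMap (Y.rs c rfl) z) := by
    rw [← grs_tg, ← ez, Y.grs_grs c b (c ≫ b) rfl hb (Category.comp_id _) rfl]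
  obtain ⟨r, hr, -⟩ := Scheme.Pullback.exists_preimage_pullback (f := F.f) (g := c ≫ b) x y'
    (by simp [hy', hy])
  refine ⟨_, pullback.fst F.f (c ≫ b), inferInstance, pullback.fst F.f (c ≫ b), Category.comp_id _,
    r, hr, ?_⟩
  have h : pullback.snd F.f (c ≫ b) ≫ c ≫ b = pullback.fst F.f (c ≫ b) ≫ F.f :=
    pullback.condition.symm
  rw [map_mul]
  refine (grs_gpPullback F (s * t) _ h _ ((map_mul _ s t).trans ((congrArg₂ (· * ·) ez' ew).trans
    (map_mul _ _ _).symm))).trans ?_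
  rw [map_mul, map_mul]
  exact congrArg₂ (· * ·) (grs_gpPullback F s _ h _ ez').symm (grs_gpPullback F t _ h _ ew).symm

/-- The pullback of global sections of `Mᵍᵖ` as a homomorphism. -/
def ggpHom (F : X ⟶ Y) : Y.GlobalGp →* X.GlobalGp := MonoidHom.mk' (ggp F) (ggp_mul F)

theorem ggp_inv (F : X ⟶ Y) (s : Y.GlobalGp) : ggp F s⁻¹ = (ggp F s)⁻¹ := map_inv (ggpHom F) s

theorem ggp_pow (F : X ⟶ Y) (s : Y.GlobalGp) (n : ℕ) : ggp F (s ^ n) = ggp F s ^ n :=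
  map_pow (ggpHom F) s n

/-- The logarithmic structure of an fs logarithmic scheme is integral. -/
theorem qt_injective (hT : IsFs T) : Function.Injective (qt T) := by
  intro m n h
  apply gsec_eq_of_etLocally
  refine (etLocally_of_qt_eq h).mono ?_
  rintro U a ha ⟨c, hc⟩
  exact eq_of_mul_eq (ha.isFs hT) hc

/-- Sections of `M` can be recognized among those of `Mᵍᵖ` étale locally. -/
theorem mem_range_qt_of_etLocally (hT : IsFs T) {α : T.GlobalGp}
    (h : EtLocally T fun U a => ggp a α ∈ Set.range (qt U)) : α ∈ Set.range (qt T) := by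
  have huniq : ∀ {U : Scheme.{u}} (u : U ⟶ T.scheme) [Etale u] (m n : T.Sec u),
      T.tg (Algebra.GrothendieckGroup.of m) = T.tg (Algebra.GrothendieckGroup.of n) → m = n := by
    intro U u _ m n e
    refine Sec_ext fun x => ?_
    obtain ⟨W, w, _, b, hb, y, hy, e⟩ := T.tg_eq e x
    rw [gpMap_of, gpMap_of] at e
    obtain ⟨c, hc⟩ := gpof_eq e
    exact ⟨W, w, inferInstance, b, hb, y, hy, Sec_eq_of_mul_eq hT hc⟩
  obtain ⟨m, hm⟩ := Sec_glue (X := T) (v := 𝟙 T.scheme)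
    (fun {U} u _ a ha n => T.grs a ha α = T.tg (Algebra.GrothendieckGroup.of n))
    (by
      rintro U U' u _ a ha u' _ b hb a' ha' rfl n hn
      rw [← T.grs_grs b a _ hb ha ha' rfl, hn, grs_tg, gpMap_of])
    (by
      rintro U u _ a ha m n hm hn
      exact huniq u m n (hm.symm.trans hn))
    (by
      intro t
      obtain ⟨U, a, y, ha, hy, n, hn⟩ := h t
      have := ha.etale
      obtain ⟨n, rfl⟩ := ha.secEquiv.surjective n
      exact ⟨U.scheme, a.f, this, a.f, Category.comp_id _, y, n, hy, grs_eq_of_ggp_eq_qt ha hn.symm⟩)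
  refine ⟨m, ggp_eq_of_etLocally (h.mono ?_)⟩
  rintro U a ha ⟨n, hn⟩
  have := ha.etale
  obtain ⟨n, rfl⟩ := ha.secEquiv.surjective n
  have e := hm a.f a.f (Category.comp_id _) n (grs_eq_of_ggp_eq_qt ha hn.symm)
  rw [ggp_qt, ← hn, ← e, ha.secEquiv_rs]

/-- The logarithmic structure of an fs logarithmic scheme is saturated, as can be checked on
charts. -/
theorem mem_range_qt_of_pow (hT : IsFs T) {α : T.GlobalGp} {n : ℕ} (hn : 0 < n)
    (h : α ^ n ∈ Set.range (qt T)) : α ∈ Set.range (qt T) := by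
  obtain ⟨m, hm⟩ := h
  apply mem_range_qt_of_etLocally hT
  refine (etLocally_exists_div α).bind ?_
  rintro U a ha ⟨β, γ, hα⟩
  have hU := ha.isFs hT
  have h₁ : γ ^ n = β ^ n * gsec a m := by
    apply qt_injective hU
    rw [map_pow, map_mul, map_pow, ← ggp_qt, hm, ggp_pow, hα, mul_pow, inv_pow, mul_inv_cancel_left]
  refine (exists_chart_eq hU β γ (gsec a m)).bind ?_
  rintro V b hb ⟨P, _, θ, p₁, p₂, p₃, e₁, e₂, e₃, hc, hs, hθ, h₂, h₃, h₄⟩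
  have h' := congrArg (gsec b) h₁
  rw [map_mul, map_pow, map_pow, h₂, h₃, h₄] at h'
  -- In the chart, `γ = e₂ p₂` and `β = e₁ p₁`, and `p₂ ^ n` is `p₁ ^ n p₃` up to a unit.
  have h'' : θ (p₂ ^ n) = (((e₂ ^ n)⁻¹ * e₁ ^ n * e₃ : V.GlobalSecˣ) : V.GlobalSec) *
      θ (p₁ ^ n * p₃) := by
    rw [Units.val_mul, Units.val_mul, mul_assoc, mul_assoc, Units.eq_inv_mul_iff_mul_eq]
    simp only [map_mul, map_pow, Units.val_pow_eq_pow_val]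
    rw [← mul_pow, h', mul_pow]
    ac_rfl
  refine (hθ.of_eq (Units.isUnit _) h'').mono ?_
  rintro W d - ⟨n₁, n₂, hn₁, hn₂, hp, -⟩
  -- The chart monoid is saturated, so `p₁` divides `p₂ n₁`, where `n₁` is invertible on `W`.
  obtain ⟨k, hk⟩ := hs (p₂ * n₁) p₁ (p₃ * n₂ * n₁ ^ (n - 1)) n hn (by
    rw [mul_pow, ← mul_pow_sub_one hn.ne' n₁, ← mul_assoc, hp]
    ac_rfl)
  have hk' := congrArg (fun p => gsec d (θ p)) hk
  simp only [map_mul] at hk'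
  obtain ⟨w, hw⟩ := hn₁.exists_right_inv
  have i₁ := congrArg (gsec d) (Units.mul_inv e₁)
  rw [map_mul, map_one] at i₁
  refine ⟨gsec d (↑e₁⁻¹ : V.GlobalSec) * gsec d e₂ * gsec d (θ k) * w, ?_⟩
  rw [ggp_comp, ggp_comp, hα, ggp_mul, ggp_mul, ggp_inv, ggp_inv, ggp_qt, ggp_qt, ggp_qt, ggp_qt,
    eq_inv_mul_iff_mul_eq, ← map_mul, h₂, h₃]
  congr 1
  rw [map_mul, map_mul]
  apply hn₁.mul_right_cancel
  rw [mul_assoc (gsec d ↑e₂) (gsec d (θ p₂)), hk']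
  calc _ = (gsec d e₁ * gsec d (↑e₁⁻¹ : V.GlobalSec)) * (gsec d (θ n₁) * w) *
        (gsec d e₂ * (gsec d (θ p₁) * gsec d (θ k))) := by ac_rfl
    _ = _ := by rw [i₁, hw, one_mul, one_mul]

end Fs

end

end LogScheme

end LogGeometry

namespace LogGeometry

noncomputable section

/-! ### Sheafification of commutative monoids -/

/-- The congruence on a monoid whose quotient is the largest commutative quotient. -/
def commCon (M : Type u) [Monoid M] : Con M := conGen fun x y => ∃ a b, x = a * b ∧ y = b * a

instance (M : Type u) [Monoid M] : CommMonoid (commCon M).Quotient where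
  mul_comm := by
    intro x y
    induction x, y using Con.induction_on₂ with
    | H x y => exact (commCon M).eq.2 (ConGen.Rel.of _ _ ⟨x, y, rfl, rfl⟩)

/-- Homomorphisms from the largest commutative quotient. -/
def commConEquiv (M : Type u) [Monoid M] (N : Type u) [CommMonoid N] :
    ((commCon M).Quotient →* N) ≃ (M →* N) where
  toFun f := f.comp (commCon M).mk'
  invFun f := (commCon M).lift f (Con.conGen_le.2 (by
    rintro _ _ ⟨a, b, rfl, rfl⟩
    change f _ = f _
    rw [map_mul, map_mul, mul_comm]))
  left_inv f := by
    ext x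
    rfl
  right_inv f := by
    ext x
    rfl

instance : (forget₂ CommMonCat.{u} MonCat.{u}).IsRightAdjoint :=
  Adjunction.isRightAdjoint (Adjunction.adjunctionOfEquivLeft
    (F_obj := fun M => CommMonCat.of (commCon M).Quotient) (G := forget₂ CommMonCat.{u} MonCat.{u})
    (fun M N => 
      { toFun := fun f => MonCat.ofHom (commConEquiv M N f.hom)
        invFun := fun f => CommMonCat.ofHom ((commConEquiv M N).symm f.hom)
        left_inv := fun f => by
          exact congrArg CommMonCat.ofHom ((commConEquiv M N).left_inv f.hom)
        right_inv := fun f => by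
          ext x
          rfl })
    (fun M N N' g f => rfl))

instance : Reflective (forget₂ CommMonCat.{u} MonCat.{u}) where
  L := (forget₂ CommMonCat.{u} MonCat.{u}).leftAdjoint
  adj := Adjunction.ofIsRightAdjoint _

instance : HasColimits CommMonCat.{u} := hasColimits_of_reflective (forget₂ CommMonCat.{u} MonCat.{u})


/-! ### The logarithmic structure associated to a monoid of functions -/

section ChartMonoid

variable {Q A B : Type u} [CommMonoid Q] [CommRing A] [CommRing B]

/-- Two expressions `e · q`, with `e` a unit of `A` and `q ∈ Q`, are identified if they agree in the
amalgamated sum of `Q` and the units of `A` over the elements of `Q` that become invertible. -/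
def chartCon (φ : Q →* A) : Con (Q × Aˣ) where
  r x y := ∃ n n' : Q, IsUnit (φ n) ∧ IsUnit (φ n') ∧ x.1 * n = y.1 * n' ∧
    (x.2 : A) * φ n' = y.2 * φ n
  iseqv :=
    { refl := fun x => ⟨1, 1, by simp, by simp, rfl, rfl⟩
      symm := by
        rintro x y ⟨n, n', h, h', e, e'⟩
        exact ⟨n', n, h', h, e.symm, e'.symm⟩
      trans := by
        rintro x y z ⟨n, n', h, h', e, e'⟩ ⟨m, m', k, k', f, f'⟩
        refine ⟨n * m, n' * m', by simp [h, k], by simp [h', k'], ?_, ?_⟩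
        · rw [← mul_assoc, e, mul_right_comm, f]
          ac_rfl
        · rw [map_mul, map_mul, ← mul_assoc, e', mul_right_comm, f']
          ac_rfl }
  mul' := by
    rintro x y z w ⟨n, n', h, h', e, e'⟩ ⟨m, m', k, k', f, f'⟩
    refine ⟨n * m, n' * m', by simp [h, k], by simp [h', k'], ?_, ?_⟩
    · calc x.1 * z.1 * (n * m) = (x.1 * n) * (z.1 * m) := by ac_rfl
        _ = y.1 * w.1 * (n' * m') := by rw [e, f]; ac_rfl
    · simp only [Prod.snd_mul, Units.val_mul, map_mul]
      calc (x.2 : A) * z.2 * (φ n' * φ m') = (x.2 * φ n') * (z.2 * φ m') := by ring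
        _ = y.2 * w.2 * (φ n * φ m) := by rw [e', f']; ring

/-- The amalgamated sum of `Q` and the units of `A` over the elements of `Q` that become
invertible. -/
abbrev ChartMonoid (φ : Q →* A) : Type u := (chartCon φ).Quotient

/-- The map from the amalgamated sum to `A`. -/
def chartExp (φ : Q →* A) : ChartMonoid φ →* A :=
  (chartCon φ).lift ((Units.coeHom A).comp (MonoidHom.snd Q Aˣ) * φ.comp (MonoidHom.fst Q Aˣ)) (by
    rintro x y ⟨n, n', h, h', e, e'⟩
    change (x.2 : A) * φ x.1 = y.2 * φ y.1
    apply h.mul_right_cancel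
    have := congrArg φ e
    rw [map_mul, map_mul] at this
    calc (x.2 : A) * φ x.1 * φ n = (x.2 * φ n') * φ y.1 := by rw [mul_assoc, this]; ring
      _ = _ := by rw [e']; ring)

/-- Functoriality of the amalgamated sum. -/
def chartMap (φ : Q →* A) (ψ : Q →* B) (f : A →+* B) (h : ∀ q, f (φ q) = ψ q) :
    ChartMonoid φ →* ChartMonoid ψ :=
  (chartCon φ).lift ((chartCon ψ).mk'.comp
    (MonoidHom.prodMap (MonoidHom.id Q) (Units.map (f : A →* B)))) (by
    rintro x y ⟨n, n', i, i', e, e'⟩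
    refine (chartCon ψ).eq.2 ⟨n, n', ?_, ?_, e, ?_⟩
    · rw [← h]
      exact i.map f
    · rw [← h]
      exact i'.map f
    · change f x.2 * ψ n' = f y.2 * ψ n
      rw [← h, ← h, ← map_mul, e', map_mul])

/-- The element `e · q`. -/
def chartMk (φ : Q →* A) (q : Q) (e : Aˣ) : ChartMonoid φ := (chartCon φ).mk' (q, e)

theorem chartMap_mk (φ : Q →* A) (ψ : Q →* B) (f : A →+* B) (h : ∀ q, f (φ q) = ψ q) (q : Q)
    (e : Aˣ) : chartMap φ ψ f h (chartMk φ q e) = chartMk ψ q (Units.map (f : A →* B) e) := rfl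

theorem chartExp_mk (φ : Q →* A) (q : Q) (e : Aˣ) : chartExp φ (chartMk φ q e) = e * φ q := rfl

theorem exists_chartMk (φ : Q →* A) (x : ChartMonoid φ) : ∃ q e, x = chartMk φ q e := by
  induction x using Con.induction_on with
  | H x => exact ⟨x.1, x.2, rfl⟩

theorem chartMk_eq (φ : Q →* A) {q q' : Q} {e e' : Aˣ} : chartMk φ q e = chartMk φ q' e' ↔
    ∃ n n' : Q, IsUnit (φ n) ∧ IsUnit (φ n') ∧ q * n = q' * n' ∧ (e : A) * φ n' = e' * φ n :=
  (chartCon φ).eq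

end ChartMonoid

namespace LogScheme

section OfChart

variable (S : Scheme.{u}) {Q : Type u} [CommMonoid Q] (φ : Q →* Γ(S, ⊤))

/-- The restriction of a monoid of functions to an étale `S`-scheme. -/
def chartFun (U : S.Etale) : Q →* Γ(U.left, ⊤) :=
  (Scheme.Hom.appTop (U.hom : U.left ⟶ S)).hom.toMonoidHom.comp φ

theorem appTop_chartFun {U V : S.Etale} (a : U ⟶ V) (q : Q) :
    a.left.appTop (chartFun S φ V q) = chartFun S φ U q :=
  (appTop_comp_apply a.left V.hom (φ q)).symm.trans
    (congrArg (fun k : U.left ⟶ S => k.appTop (φ q)) (etaleHom_w a))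

/-- The presheaf whose sheafification is the logarithmic structure associated to a monoid of
functions. -/
def chartPresheaf : S.Etaleᵒᵖ ⥤ CommMonCat.{u} where
  obj U := CommMonCat.of (ChartMonoid (chartFun S φ U.unop))
  map {U V} a := CommMonCat.ofHom (chartMap _ _ a.unop.left.appTop.hom (appTop_chartFun S φ a.unop))
  map_id U := by
    refine CommMonCat.hom_ext (MonoidHom.ext fun x => ?_)
    obtain ⟨q, e, rfl⟩ := exists_chartMk _ x
    exact congrArg (chartMk (chartFun S φ U.unop) q) (Units.ext
      (appTop_id_apply (e : Γ(U.unop.left, ⊤))))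
  map_comp {U V W} a b := by
    refine CommMonCat.hom_ext (MonoidHom.ext fun x => ?_)
    obtain ⟨q, e, rfl⟩ := exists_chartMk _ x
    exact congrArg (chartMk (chartFun S φ W.unop) q) (Units.ext
      (appTop_comp_apply b.unop.left a.unop.left (e : Γ(U.unop.left, ⊤))))

/-- The map to the structure sheaf. -/
def chartPresheafExp : chartPresheaf S φ ⟶ multStructure S where
  app U := CommMonCat.ofHom (chartExp (chartFun S φ U.unop))
  naturality {U V} a := by
    refine CommMonCat.hom_ext (MonoidHom.ext fun x => ?_)
    obtain ⟨q, e, rfl⟩ := exists_chartMk _ x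
    refine Eq.trans ?_ (map_mul a.unop.left.appTop.hom (e : Γ(U.unop.left, ⊤))
      (chartFun S φ U.unop q)).symm
    exact congrArg (a.unop.left.appTop.hom (e : Γ(U.unop.left, ⊤)) * ·)
      (appTop_chartFun S φ a.unop q).symm

theorem isSheaf_multStructure : Presheaf.IsSheaf S.smallEtaleTopology (multStructure S) := by
  intro E U R hR x hx
  have hS := isSheaf_structurePresheaf S R hR
  have hx' : ∀ e : E, Presieve.FamilyOfElements.Compatible
      (P := structurePresheaf S ⋙ forget CommRingCat) (fun V a ha => (x a ha).hom e) :=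
    fun e V₁ V₂ W a₁ a₂ f₁ f₂ h₁ h₂ h => ConcreteCategory.congr_hom (hx a₁ a₂ h₁ h₂ h) e
  choose t ht huniq using fun e => hS _ (hx' e)
  have ht' : ∀ (e : E) (V : S.Etale) (a : V ⟶ U) (ha : R a),
      a.left.appTop (show Γ(U.left, ⊤) from t e) = (x a ha).hom e := fun e V a ha => ht e a ha
  let f : E →* Γ(U.left, ⊤) :=
    { toFun := fun e => t e
      map_one' := (huniq 1 (1 : Γ(U.left, ⊤)) fun V a ha =>
        (map_one a.left.appTop.hom).trans (map_one (x a ha).hom).symm).symm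
      map_mul' := fun e e' => (huniq (e * e')
        ((show Γ(U.left, ⊤) from t e) * (show Γ(U.left, ⊤) from t e')) fun V a ha =>
        (map_mul a.left.appTop.hom _ _).trans ((congrArg₂ (· * ·) (ht' e V a ha)
          (ht' e' V a ha)).trans (map_mul (x a ha).hom _ _).symm)).symm }
  refine ⟨CommMonCat.ofHom f, fun V a ha => ?_, fun g hg => ?_⟩
  · exact CommMonCat.hom_ext (MonoidHom.ext fun e => ht' e V a ha)
  · refine CommMonCat.hom_ext (MonoidHom.ext fun e => ?_)
    exact huniq e (g.hom e) fun V a ha => ConcreteCategory.congr_hom (hg a ha) e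

/-- The map to the structure sheaf of the logarithmic structure associated to a monoid of
functions. -/
def chartSheafExp : sheafify S.smallEtaleTopology (chartPresheaf S φ) ⟶ multStructure S :=
  sheafifyLift S.smallEtaleTopology (chartPresheafExp S φ) (isSheaf_multStructure S)

theorem chartSheafExp_toSheafify (U : S.Etale) (x : ChartMonoid (chartFun S φ U)) :
    ((chartSheafExp S φ).app (op U)).hom
      (((toSheafify S.smallEtaleTopology (chartPresheaf S φ)).app (op U)).hom x) =
    chartExp (chartFun S φ U) x :=
  ConcreteCategory.congr_hom (NatTrans.congr_app
    (toSheafify_sheafifyLift S.smallEtaleTopology (chartPresheafExp S φ) (isSheaf_multStructure S))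
    (op U)) x

theorem isSheaf_chart : Presieve.IsSheaf S.smallEtaleTopology
    (sheafify S.smallEtaleTopology (chartPresheaf S φ) ⋙ forget CommMonCat) := by
  rw [← isSheaf_iff_isSheaf_of_type]
  exact ((sheafCompose S.smallEtaleTopology (forget CommMonCat.{u})).obj
    ((presheafToSheaf S.smallEtaleTopology CommMonCat.{u}).obj (chartPresheaf S φ))).property

/-- The sections of the associated logarithmic structure given by expressions `e · q`. -/
def toChartSheaf (U : S.Etale) : ChartMonoid (chartFun S φ U) →*
    (sheafify S.smallEtaleTopology (chartPresheaf S φ)).obj (op U) :=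
  ((toSheafify S.smallEtaleTopology (chartPresheaf S φ)).app (op U)).hom

theorem exists_toChartSheaf {U : S.Etale}
    (m : (sheafify S.smallEtaleTopology (chartPresheaf S φ)).obj (op U)) (x : U.left) :
    ∃ (V : S.Etale) (a : V ⟶ U) (y : V.left) (z : ChartMonoid (chartFun S φ V)), a.left y = x ∧
      ((sheafify S.smallEtaleTopology (chartPresheaf S φ)).map a.op).hom m = toChartSheaf S φ V z := by
  have : Presheaf.IsLocallySurjective S.smallEtaleTopology
    (toSheafify S.smallEtaleTopology (chartPresheaf S φ)) := inferInstance
  have h := Presheaf.imageSieve_mem S.smallEtaleTopology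
    (toSheafify S.smallEtaleTopology (chartPresheaf S φ)) (U := op U) m
  obtain ⟨W, a, y, ⟨x, hx⟩, hy⟩ := (mem_smallEtale_iff _).1 h x
  exact ⟨W, a, y, x, hy, hx.symm⟩

theorem toChartSheaf_eq {U : S.Etale} {z z' : ChartMonoid (chartFun S φ U)}
    (h : toChartSheaf S φ U z = toChartSheaf S φ U z') (x : U.left) :
    ∃ (V : S.Etale) (a : V ⟶ U) (y : V.left), a.left y = x ∧
      chartMap _ _ a.left.appTop.hom (appTop_chartFun S φ a) z =
      chartMap _ _ a.left.appTop.hom (appTop_chartFun S φ a) z' := by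
  have : Presheaf.IsLocallyInjective S.smallEtaleTopology
    (toSheafify S.smallEtaleTopology (chartPresheaf S φ)) := inferInstance
  have h := Presheaf.equalizerSieve_mem S.smallEtaleTopology
    (toSheafify S.smallEtaleTopology (chartPresheaf S φ)) (X := op U) z z' h
  obtain ⟨W, a, w, hx, hy⟩ := (mem_smallEtale_iff _).1 h x
  exact ⟨W, a, w, hy, hx⟩

theorem map_toChartSheaf {U V : S.Etale} (a : V ⟶ U) (z : ChartMonoid (chartFun S φ U)) :
    ((sheafify S.smallEtaleTopology (chartPresheaf S φ)).map a.op).hom (toChartSheaf S φ U z) =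
      toChartSheaf S φ V (chartMap _ _ a.left.appTop.hom (appTop_chartFun S φ a) z) :=
  (ConcreteCategory.congr_hom
    ((toSheafify S.smallEtaleTopology (chartPresheaf S φ)).naturality a.op) z).symm

/-- The logarithmic scheme with the logarithmic structure associated to a monoid of functions. -/
abbrev ofChart : LogScheme.{u} where
  scheme := S
  M := sheafify S.smallEtaleTopology (chartPresheaf S φ)
  isSheaf := isSheaf_chart S φ
  exp := chartSheafExp S φ
  existsUnique_unit U f hf := by
    refine ⟨toChartSheaf S φ U (chartMk _ 1 hf.unit), ?_, ?_⟩
    · refine (chartSheafExp_toSheafify S φ U _).trans ?_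
      rw [chartExp_mk, map_one, mul_one]
      rfl
    · intro m hm
      refine sheaf_ext (isSheaf_chart S φ) fun x => ?_
      obtain ⟨V, a, y, z, hy, e⟩ := exists_toChartSheaf S φ m x
      refine ⟨V, a, y, hy, ?_⟩
      refine e.trans (Eq.trans ?_ (map_toChartSheaf S φ a _).symm)
      refine congrArg _ ?_
      obtain ⟨q, ε, rfl⟩ := exists_chartMk _ z
      have h₁ : (ε : Γ(V.left, ⊤)) * chartFun S φ V q = a.left.appTop f := by
        rw [← chartExp_mk, ← chartSheafExp_toSheafify, ← hm]
        refine (congrArg _ e.symm).trans ?_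
        exact ConcreteCategory.congr_hom ((chartSheafExp S φ).naturality a.op) m
      have h₂ : IsUnit (chartFun S φ V q) :=
        isUnit_of_mul_isUnit_right (h₁.symm ▸ hf.map a.left.appTop.hom)
      rw [chartMap_mk, chartMk_eq]
      refine ⟨1, q, by simp, h₂, by rw [mul_one, one_mul], ?_⟩
      rw [map_one, mul_one]
      exact h₁

variable {S}
variable {U V W : Scheme.{u}} {u : U ⟶ S} {v : V ⟶ S} [Etale u] [Etale v]

/-- The section `e · q` of the associated logarithmic structure. -/
def chartSec (v : V ⟶ S) [Etale v] (q : Q) (e : Γ(V, ⊤)ˣ) : (ofChart S φ).Sec v :=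
  toChartSheaf S φ (Scheme.Etale.mk v) (chartMk _ q e)

theorem ex_chartSec (q : Q) (e : Γ(V, ⊤)ˣ) :
    (ofChart S φ).ex (chartSec φ v q e) = e * v.appTop (φ q) :=
  chartSheafExp_toSheafify S φ (Scheme.Etale.mk v) _

theorem chartSec_mul (q q' : Q) (e e' : Γ(V, ⊤)ˣ) :
    chartSec φ v q e * chartSec φ v q' e' = chartSec φ v (q * q') (e * e') :=
  (map_mul (toChartSheaf S φ (Scheme.Etale.mk v)) (chartMk _ q e) (chartMk _ q' e')).symm

theorem rs_chartSec (a : U ⟶ V) (h : a ≫ v = u) (q : Q) (e : Γ(V, ⊤)ˣ) :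
    (ofChart S φ).rs a h (chartSec φ v q e) =
      chartSec φ u q (Units.map (a.appTop.hom : Γ(V, ⊤) →* Γ(U, ⊤)) e) := by
  refine (map_toChartSheaf S φ (etaleOver a h) _).trans ?_
  refine congrArg (fun e : Γ(U, ⊤)ˣ => chartSec φ u q e) (Units.ext ?_)
  exact congrArg (fun k : U ⟶ V => k.appTop (e : Γ(V, ⊤))) (etaleOver_left a h)

theorem exists_chartSec (m : (ofChart S φ).Sec v) (x : V) : ∃ (W : Scheme.{u}) (w : W ⟶ S)
    (_ : Etale w) (b : W ⟶ V) (hb : b ≫ v = w) (y : W) (q : Q) (e : Γ(W, ⊤)ˣ), b y = x ∧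
      (ofChart S φ).rs b hb m = chartSec φ w q e := by
  obtain ⟨W, b, y, z, hy, h⟩ := exists_toChartSheaf S φ (U := Scheme.Etale.mk v) m x
  obtain ⟨q, e, rfl⟩ := exists_chartMk _ z
  exact ⟨W.left, W.hom, inferInstance, b.left, etaleHom_w b, y, q, e, hy,
    ((ofChart S φ).rs_eq_res b m).symm.trans h⟩

theorem chartSec_eq {q q' : Q} {e e' : Γ(V, ⊤)ˣ} (h : chartSec φ v q e = chartSec φ v q' e') (x : V) :
    ∃ (W : Scheme.{u}) (w : W ⟶ S) (_ : Etale w) (b : W ⟶ V) (_ : b ≫ v = w) (y : W) (n n' : Q),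
      b y = x ∧ IsUnit (w.appTop (φ n)) ∧ IsUnit (w.appTop (φ n')) ∧ q * n = q' * n' ∧
      b.appTop e * w.appTop (φ n') = b.appTop e' * w.appTop (φ n) := by
  obtain ⟨W, b, y, hy, h'⟩ := toChartSheaf_eq S φ (U := Scheme.Etale.mk v) h x
  obtain ⟨n, n', hn, hn', hp, hnn⟩ := (chartMk_eq (chartFun S φ W)).1 h'
  exact ⟨W.left, W.hom, inferInstance, b.left, etaleHom_w b, y, n, n', hy, hn, hn', hp, hnn⟩

variable (S)

/-- The chart of the associated logarithmic structure. -/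
def ofChartSec : Q →* (ofChart S φ).GlobalSec where
  toFun q := chartSec φ (𝟙 S) q 1
  map_one' := map_one (toChartSheaf S φ (Scheme.Etale.mk (𝟙 S)))
  map_mul' q q' := by
    rw [chartSec_mul, one_mul]

theorem rs_ofChartSec (a : U ⟶ S) (h : a ≫ 𝟙 S = u) (q : Q) :
    (ofChart S φ).rs (v := 𝟙 S) a h (ofChartSec S φ q) = chartSec φ u q 1 :=
  (rs_chartSec φ a h q 1).trans (congrArg _ (map_one _))

theorem ex_ofChartSec (q : Q) : (ofChart S φ).ex (ofChartSec S φ q) = φ q := by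
  refine (ex_chartSec φ q 1).trans ?_
  rw [Units.val_one, one_mul, appTop_id_apply]

theorem eq_of_ex_eq (X : LogScheme.{u}) {U : Scheme.{u}} {u : U ⟶ X.scheme} [Etale u]
    {m n : X.Sec u} (hm : IsUnit m) (h : X.ex m = X.ex n) : m = n :=
  (X.existsUnique_ex (u := u) (hm.map X.ex)).unique rfl h.symm

theorem chartAt_ofChartSec : (ofChart S φ).ChartAt (𝟙 S) (ofChartSec S φ) := by
  have hrs' : ∀ {V : Scheme.{u}} (v : V ⟶ S) [Etale v] (a : V ⟶ S) (ha : a ≫ 𝟙 S = v) (n : Q),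
      (ofChart S φ).ex ((ofChart S φ).rs (v := 𝟙 S) a ha (ofChartSec S φ n)) = v.appTop (φ n) := by
    intro V v _ a ha n
    rw [rs_ofChartSec, ex_chartSec, Units.val_one, one_mul]
  constructor
  · intro V v _ a ha m x
    obtain ⟨W, w, _, b, hb, y, q, e, hy, h⟩ := exists_chartSec φ m x
    refine ⟨W, w, inferInstance, b, hb, y, q, chartSec φ w 1 e, hy, ?_, ?_⟩
    · rw [isUnit_iff_ex, ex_chartSec, map_one, map_one, mul_one]
      exact e.isUnit
    · rw [h, rs_ofChartSec, chartSec_mul, one_mul, mul_one]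
  · intro V v _ a ha p p' e x he h
    have he' := he.map (ofChart S φ).ex
    have e₁ : e = chartSec φ v 1 he'.unit := by
      refine (ofChart S φ).eq_of_ex_eq he ?_
      rw [ex_chartSec, map_one, map_one, mul_one]
      rfl
    have h' := h
    rw [rs_ofChartSec, rs_ofChartSec, e₁, chartSec_mul, one_mul, mul_one] at h'
    obtain ⟨W, w, _, b, hb, y, n, n', hy, hn, hn', hp, hnn⟩ := chartSec_eq φ h' x
    rw [Units.val_one, map_one, one_mul] at hnn
    refine ⟨W, w, inferInstance, b, hb, y, n, n', hy, ?_, ?_, hp, ?_⟩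
    · rwa [isUnit_iff_ex, hrs' w]
    · rwa [isUnit_iff_ex, hrs' w]
    · refine (ofChart S φ).eq_of_ex_eq ?_ ?_
      · rwa [isUnit_iff_ex, hrs' w]
      · rw [map_mul, hrs' w, hrs' w, hnn, ex_rs]
        rfl

end OfChart

end LogScheme

end

end LogGeometry

namespace LogGeometry

namespace LogScheme

noncomputable section

/-! ### Morphisms to a logarithmic scheme with a global chart -/

section ChartHom

variable {X Y Z T : LogScheme.{u}} {P : Type u} [CommMonoid P]

theorem chartAt_id_iff {θ : P →* X.GlobalSec} : X.ChartAt (𝟙 X.scheme) θ ↔ X.Chart θ := by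
  have i : Etale (Hom.f (𝟙 X)) := inferInstanceAs (Etale (𝟙 X.scheme))
  refine (chartAt_iff_chart (isStrictEtale_id X) θ).trans ?_
  have : (isStrictEtale_id X).secEquiv.toMonoidHom.comp θ = θ := by
    ext p
    exact X.rs_id _ (θ p)
  rw [this]

theorem pl_rs_gsec (F : T ⟶ X) {U V : Scheme.{u}} {u : U ⟶ T.scheme} {v : V ⟶ X.scheme} [Etale u]
    [Etale v] (g : U ⟶ V) (h : g ≫ v = u ≫ F.f) (m : X.GlobalSec) :
    F.pl g h (X.rs v (Category.comp_id v) m) = T.rs u (Category.comp_id u) (gsec F m) := by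
  have h' : (u ≫ F.f) ≫ 𝟙 X.scheme = u ≫ F.f := Category.comp_id _
  rw [F.pl_rs g h v _ (u ≫ F.f) h' h.symm]
  exact (F.rs_pl _ _ _ _ _ _ rfl m).symm

theorem hom_ext_of_chart {θ : P →* X.GlobalSec} (hθ : X.Chart θ) {F G : T ⟶ X} (h : F.f = G.f)
    (h' : ∀ p, gsec F (θ p) = gsec G (θ p)) : F = G := by
  have hθ' := chartAt_id_iff.2 hθ
  refine Hom_ext h fun {U V} u v _ _ g w w' m => Sec_ext fun x => ?_
  obtain ⟨W, w₀, _, b, rfl, y, p, e, hy, he, hm⟩ := hθ'.1 v v (Category.comp_id v) m (g x)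
  obtain ⟨z, hz, -⟩ := Scheme.Pullback.exists_preimage_pullback x y hy.symm
  have : Etale b := etale_of_comp (g := v) inferInstance (h := b ≫ v) inferInstance rfl
  let a : pullback g b ⟶ U := pullback.fst g b
  let c : pullback g b ⟶ W := pullback.snd g b
  have hac : a ≫ g = c ≫ b := pullback.condition
  have wF : c ≫ b ≫ v = (a ≫ u) ≫ F.f := by
    rw [← Category.assoc, ← hac, Category.assoc, w, Category.assoc]
  have wG : c ≫ b ≫ v = (a ≫ u) ≫ G.f := by rw [wF, h]
  have key : ∀ (H : T ⟶ X) (w : g ≫ v = u ≫ H.f) (wH : c ≫ b ≫ v = (a ≫ u) ≫ H.f),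
      T.rs a rfl (H.pl g w m) = H.pl c wH e * T.rs (a ≫ u) (Category.comp_id _) (gsec H (θ p)) := by
    intro H w wH
    have w' : (a ≫ g) ≫ v = (a ≫ u) ≫ H.f := by rw [Category.assoc, w, Category.assoc]
    rw [H.rs_pl a rfl g w (a ≫ g) w' rfl, ← H.pl_rs c wH b rfl (a ≫ g) w' hac, hm, map_mul]
    refine congrArg (_ * ·) ?_
    exact pl_rs_gsec H c wH (θ p)
  refine ⟨_, a ≫ u, inferInstance, a, rfl, z, hz, ?_⟩
  rw [key F w wF, key G w' wG, h' p]
  refine congrArg (· * _) (T.eq_of_ex_eq (he.map _) ?_)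
  rw [F.ex_pl, G.ex_pl]

/-- A morphism to a logarithmic scheme with a global chart by `P` is given by a morphism of schemes
and a homomorphism from `P` to the sections of the logarithmic structure. -/
theorem exists_hom_of_chart {θ : P →* X.GlobalSec} (hθ : X.Chart θ) (f : T.scheme ⟶ X.scheme)
    (ψ : P →* T.GlobalSec) (h : ∀ p, T.ex (ψ p) = f.appTop (X.ex (θ p))) :
    ∃ F : T ⟶ X, F.f = f ∧ ∀ p, gsec F (θ p) = ψ p := by
  obtain ⟨hθ₁, hθ₂⟩ := chartAt_id_iff.2 hθ
  have hψ : ∀ {U V : Scheme.{u}} (u : U ⟶ T.scheme) (v : V ⟶ X.scheme) [Etale u] [Etale v]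
      (g : U ⟶ V) (_ : g ≫ v = u ≫ f) (p : P), T.ex (T.rs u (Category.comp_id u) (ψ p)) =
        g.appTop (X.ex (X.rs v (Category.comp_id v) (θ p))) := by
    intro U V u v _ _ g hg p
    rw [ex_rs, ex_rs, h, ← appTop_comp_apply, ← appTop_comp_apply, hg]
  -- A section `m` which is `e · θ p` for a unit `e` has to be sent to `ε · ψ p`, where the unit `ε` is
  -- determined by its image `f^* e` in the structure sheaf. The étale `V'` is where `m` has this form.
  obtain ⟨F, rfl, hF⟩ := exists_hom_of_rel (T := T) (X := X) f
    (fun {U V} u v _ _ g hg m t => ∃ (V' : Scheme.{u}) (c : V' ⟶ V) (_ : Etale c) (g' : U ⟶ V')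
      (_ : g' ≫ c = g) (p : P) (e : X.Sec (c ≫ v)) (ε : T.Sec u), IsUnit e ∧ IsUnit ε ∧
      X.rs c rfl m = e * X.rs (c ≫ v) (Category.comp_id _) (θ p) ∧
      T.ex ε = g'.appTop (X.ex e) ∧ t = ε * T.rs u (Category.comp_id u) (ψ p))
    (by
      rintro U U' V u v _ _ g hg u' _ a ha h' m _ ⟨V', c, _, g', hg', p, e, ε, he, hε, hm, hε', rfl⟩
      refine ⟨V', c, inferInstance, a ≫ g', by rw [Category.assoc, hg'], p, e, T.rs a ha ε, he,
        hε.map _, hm, ?_, ?_⟩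
      · rw [ex_rs, hε', appTop_comp_apply]
      · rw [map_mul, T.rs_rs a u u' ha _ (Category.comp_id _) ha.symm])
    (by
      rintro U V V' u v _ _ g hg v' _ b hb h' m t ⟨V'', c, _, g', hg', p, e, ε, he, hε, hm, hε', rfl⟩
      subst hb
      have : Etale b := etale_of_comp (g := v') inferInstance (h := b ≫ v') inferInstance rfl
      have hi : 𝟙 V'' ≫ c ≫ b ≫ v' = (c ≫ b) ≫ v' := by simp
      refine ⟨V'', c ≫ b, inferInstance, g', by rw [← Category.assoc, hg'], p, X.rs (𝟙 _) hi e, ε,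
        he.map _, hε, ?_, ?_, rfl⟩
      · rw [X.rs_rs c b (c ≫ b) rfl rfl (Category.assoc _ _ _) rfl] at hm
        have := congrArg (X.rs (𝟙 _) hi) hm
        rw [map_mul, X.rs_rs (𝟙 _) (c ≫ b) (c ≫ b) hi _ rfl (Category.id_comp _).symm,
          X.rs_rs (𝟙 _) (c ≫ b ≫ v') ((c ≫ b) ≫ v') hi _ (Category.comp_id _) (by simp)] at this
        exact this
      · rw [ex_rs, appTop_id_apply, hε'])
    (by
      rintro U V u v _ _ g hg m _ _ ⟨V₁, c₁, _, g₁, hg₁, p, e, ε, he, hε, hm, hε', rfl⟩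
        ⟨V₂, c₂, _, g₂, hg₂, p', e', δ, he', hδ, hm', hδ', rfl⟩
      -- Two expressions `e · θ p` and `e' · θ p'` of `m` are compared on `V₃` by means of the second
      -- condition in the definition of a chart.
      let V₃ := pullback c₁ c₂
      let q₁ : V₃ ⟶ V₁ := pullback.fst c₁ c₂
      let q₂ : V₃ ⟶ V₂ := pullback.snd c₁ c₂
      have hq : q₁ ≫ c₁ = q₂ ≫ c₂ := pullback.condition
      let g₃ : U ⟶ V₃ := pullback.lift g₁ g₂ (hg₁.trans hg₂.symm)
      have hg₃ : g₃ ≫ q₁ = g₁ := pullback.lift_fst _ _ _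
      have hg₃' : g₃ ≫ q₂ = g₂ := pullback.lift_snd _ _ _
      let v₃ := q₁ ≫ c₁ ≫ v
      have hv₃ : q₂ ≫ c₂ ≫ v = v₃ := by
        change _ = q₁ ≫ c₁ ≫ v
        rw [← Category.assoc, ← hq, Category.assoc]
      have f₁ := congrArg (X.rs q₁ (rfl : q₁ ≫ c₁ ≫ v = v₃)) hm
      have f₂ := congrArg (X.rs q₂ hv₃) hm'
      rw [map_mul, X.rs_rs q₁ c₁ (q₁ ≫ c₁) rfl rfl (Category.assoc _ _ _) rfl,
        X.rs_rs q₁ (c₁ ≫ v) v₃ rfl _ (Category.comp_id _) rfl] at f₁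
      rw [map_mul, X.rs_rs q₂ c₂ (q₁ ≫ c₁) hv₃ rfl (Category.assoc _ _ _) hq,
        X.rs_rs q₂ (c₂ ≫ v) v₃ hv₃ _ (Category.comp_id _) hv₃.symm] at f₂
      have hu : IsUnit (X.rs q₁ (rfl : q₁ ≫ c₁ ≫ v = v₃) e) := he.map _
      have f₃ : X.rs v₃ (Category.comp_id _) (θ p) =
          ((hu.unit⁻¹ : (X.Sec v₃)ˣ) * X.rs q₂ hv₃ e') * X.rs v₃ (Category.comp_id _) (θ p') := by
        rw [mul_assoc, Units.eq_inv_mul_iff_mul_eq, ← f₂, f₁]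
        rfl
      refine Sec_ext fun x => ?_
      obtain ⟨W, w, _, b, rfl, y, n, n', hy, hn, hn', hp, hnn⟩ := hθ₂ v₃ v₃ (Category.comp_id _) p p' _
        (g₃ x) ((Units.isUnit _).mul (he'.map _)) f₃
      have : Etale b := etale_of_comp (g := v₃) inferInstance (h := b ≫ v₃) inferInstance rfl
      obtain ⟨z, hz, -⟩ := Scheme.Pullback.exists_preimage_pullback x y hy.symm
      let a : pullback g₃ b ⟶ U := pullback.fst g₃ b
      let d : pullback g₃ b ⟶ W := pullback.snd g₃ b
      have had : a ≫ g₃ = d ≫ b := pullback.condition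
      refine ⟨_, a ≫ u, inferInstance, a, rfl, z, hz, ?_⟩
      have hd : d ≫ b ≫ v₃ = (a ≫ u) ≫ f := by
        rw [← Category.assoc, ← had, Category.assoc, Category.assoc, ← hg, ← hg₁, ← hg₃]
        simp only [Category.assoc]
        rfl
      have k : ∀ p, T.ex (T.rs (a ≫ u) (Category.comp_id _) (ψ p)) =
        d.appTop (X.ex (X.rs (b ≫ v₃) (Category.comp_id _) (θ p))) := hψ _ _ d hd
      have kn : IsUnit (T.rs (a ≫ u) (Category.comp_id _) (ψ n)) := by
        rw [isUnit_iff_ex, k]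
        exact (hn.map _).map d.appTop.hom
      have kn' : IsUnit (T.rs (a ≫ u) (Category.comp_id _) (ψ n')) := by
        rw [isUnit_iff_ex, k]
        exact (hn'.map _).map d.appTop.hom
      rw [map_mul, map_mul, T.rs_rs a u (a ≫ u) rfl _ (Category.comp_id _) rfl,
        T.rs_rs a u (a ≫ u) rfl _ (Category.comp_id _) rfl]
      have hεδ : T.rs a rfl ε * T.rs (a ≫ u) (Category.comp_id _) (ψ n') =
          T.rs a rfl δ * T.rs (a ≫ u) (Category.comp_id _) (ψ n) := by
        refine T.eq_of_ex_eq ((hε.map _).mul kn') ?_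
        have e₁ : a.appTop (g₁.appTop (X.ex e)) = d.appTop (X.ex (X.rs b rfl
            (X.rs q₁ (rfl : q₁ ≫ c₁ ≫ v = v₃) e))) := by
          rw [ex_rs, ex_rs, ← appTop_comp_apply, ← appTop_comp_apply, ← appTop_comp_apply,
            ← hg₃, ← Category.assoc, had, Category.assoc]
        have e₂ : a.appTop (g₂.appTop (X.ex e')) = d.appTop (X.ex (X.rs b rfl
            (X.rs q₂ hv₃ e'))) := by
          rw [ex_rs, ex_rs, ← appTop_comp_apply, ← appTop_comp_apply, ← appTop_comp_apply,
            ← hg₃', ← Category.assoc, had, Category.assoc]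
        rw [map_mul, map_mul, T.ex_rs a rfl ε, T.ex_rs a rfl δ, hε', hδ', k, k, e₁, e₂, ← map_mul, ← map_mul, ← map_mul,
          ← map_mul, hnn]
        refine congrArg (fun m => d.appTop (X.ex m)) ?_
        rw [← mul_assoc, ← map_mul, ← mul_assoc]
        refine congrArg (fun m => X.rs b rfl m * _) ?_
        rw [IsUnit.mul_val_inv, one_mul]
      apply kn.mul_right_cancel
      have hp' := congrArg (fun p => T.rs (a ≫ u) (Category.comp_id _) (ψ p)) hp
      simp only [map_mul] at hp'
      rw [mul_assoc, hp', mul_left_comm, hεδ]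
      ac_rfl)
    (by
      rintro U V u v _ _ g hg m _ ⟨V', c, _, g', hg', p, e, ε, he, hε, hm, hε', rfl⟩
      exact ⟨V', c, inferInstance, g', hg', 1, 1, 1, isUnit_one, isUnit_one, by simp, by simp,
        by simp⟩)
    (by
      rintro U V u v _ _ g hg m m' _ _ ⟨V₁, c₁, _, g₁, hg₁, p, e, ε, he, hε, hm, hε', rfl⟩
        ⟨V₂, c₂, _, g₂, hg₂, p', e', δ, he', hδ, hm', hδ', rfl⟩
      let V₃ := pullback c₁ c₂
      let q₁ : V₃ ⟶ V₁ := pullback.fst c₁ c₂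
      let q₂ : V₃ ⟶ V₂ := pullback.snd c₁ c₂
      have hq : q₁ ≫ c₁ = q₂ ≫ c₂ := pullback.condition
      let g₃ : U ⟶ V₃ := pullback.lift g₁ g₂ (hg₁.trans hg₂.symm)
      have hg₃ : g₃ ≫ q₁ = g₁ := pullback.lift_fst _ _ _
      have hg₃' : g₃ ≫ q₂ = g₂ := pullback.lift_snd _ _ _
      let v₃ := (q₁ ≫ c₁) ≫ v
      have hv₁ : q₁ ≫ c₁ ≫ v = v₃ := (Category.assoc _ _ _).symm
      have hv₃ : q₂ ≫ c₂ ≫ v = v₃ := by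
        rw [← Category.assoc, ← hq]
      have f₁ := congrArg (X.rs q₁ hv₁) hm
      have f₂ := congrArg (X.rs q₂ hv₃) hm'
      rw [map_mul, X.rs_rs q₁ c₁ (q₁ ≫ c₁) hv₁ rfl rfl rfl,
        X.rs_rs q₁ (c₁ ≫ v) v₃ hv₁ _ (Category.comp_id _) hv₁.symm] at f₁
      rw [map_mul, X.rs_rs q₂ c₂ (q₁ ≫ c₁) hv₃ rfl rfl hq,
        X.rs_rs q₂ (c₂ ≫ v) v₃ hv₃ _ (Category.comp_id _) hv₃.symm] at f₂
      refine ⟨V₃, q₁ ≫ c₁, inferInstance, g₃, by rw [← Category.assoc, hg₃, hg₁], p * p',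
        X.rs q₁ hv₁ e * X.rs q₂ hv₃ e', ε * δ, (he.map _).mul (he'.map _), hε.mul hδ, ?_, ?_, ?_⟩
      · rw [map_mul, f₁, f₂, map_mul, map_mul]
        ac_rfl
      · rw [map_mul, hε', hδ', map_mul, ex_rs, ex_rs, map_mul, ← appTop_comp_apply,
          ← appTop_comp_apply, hg₃, hg₃']
      · rw [map_mul, map_mul]
        ac_rfl)
    (by
      intro U V u v _ _ g hg m x
      obtain ⟨W, w, _, b, rfl, y, p, e, hy, he, hm⟩ := hθ₁ v v (Category.comp_id v) m (g x)
      have : Etale b := etale_of_comp (g := v) inferInstance (h := b ≫ v) inferInstance rfl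
      obtain ⟨z, hz, -⟩ := Scheme.Pullback.exists_preimage_pullback x y hy.symm
      let a : pullback g b ⟶ U := pullback.fst g b
      let c : pullback g b ⟶ W := pullback.snd g b
      have hac : a ≫ g = c ≫ b := pullback.condition
      have hu : IsUnit (c.appTop (X.ex e)) := (he.map _).map c.appTop.hom
      obtain ⟨ε, hε, -⟩ := T.existsUnique_ex (u := a ≫ u) hu
      refine ⟨_, a ≫ u, inferInstance, a, rfl, z, by rw [Category.assoc, hg, Category.assoc], _, hz,
        W, b, inferInstance, c, hac.symm, p, e, ε, he, ?_, hm, hε, rfl⟩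
      rwa [isUnit_iff_ex, hε])
    (by
      rintro U V u v _ _ g hg m _ ⟨V', c, _, g', hg', p, e, ε, he, hε, hm, hε', rfl⟩
      have hgc : g' ≫ c ≫ v = u ≫ f := by rw [← Category.assoc, hg', hg]
      rw [map_mul, hε', hψ u (c ≫ v) g' hgc, ← map_mul, ← map_mul, ← hm, ex_rs, ← appTop_comp_apply,
        hg'])
  refine ⟨F, rfl, fun p => ?_⟩
  have := hF (𝟙 T.scheme) (𝟙 X.scheme) F.f ((Category.comp_id _).trans (Category.id_comp _).symm)
    (θ p) (ψ p) ⟨_, 𝟙 _, inferInstance, F.f, Category.comp_id _, p, 1, 1, isUnit_one, isUnit_one, by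
      rw [one_mul]
      rfl, by simp, by
      rw [one_mul]
      exact (T.rs_id _ _).symm⟩
  exact this

end ChartHom

end

end LogScheme

end LogGeometry

namespace LogGeometry
noncomputable section

/-! ### Charts given by a regular pair of functions -/

/-- Both `f₀, f₁` and `f₁, f₀` are regular sequences, except that `(f₀, f₁)` may be the unit
ideal. -/
structure RegPair {R : Type u} [CommRing R] (f₀ f₁ : R) : Prop where
  left : ∀ x, f₀ * x = 0 → x = 0
  right : ∀ x, f₁ * x = 0 → x = 0
  dvd : ∀ a b, f₀ * a = f₁ * b → f₀ ∣ b

namespace RegPair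

variable {R : Type u} [CommRing R] {f₀ f₁ : R}

theorem symm (h : RegPair f₀ f₁) : RegPair f₁ f₀ where
  left := h.right
  right := h.left
  dvd a b e := by
    obtain ⟨c, rfl⟩ := h.dvd b a e.symm
    refine ⟨c, sub_eq_zero.1 (h.left _ ?_)⟩
    rw [mul_sub, ← e]
    ring

theorem _root_.LogGeometry.eq_zero_of_flat {A : Type u} [CommRing A] [Algebra R A]
    [Module.Flat R A] {f : R} (hf : ∀ x, f * x = 0 → x = 0) (x : A)
    (hx : algebraMap R A f * x = 0) : x = 0 := by
  have h' : f ∈ nonZeroDivisors R :=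
    mem_nonZeroDivisors_iff.2 ⟨hf, fun x hx => hf x ((mul_comm _ _).trans hx)⟩
  refine Module.Flat.isSMulRegular_of_nonZeroDivisors (M := A) h' ?_
  exact ((Algebra.smul_def f x).trans hx).trans (smul_zero f).symm

theorem _root_.LogGeometry.dvd_of_flat {A : Type u} [CommRing A] [Algebra R A]
    [Module.Flat R A] (h : ∀ a b, f₀ * a = f₁ * b → f₀ ∣ b) (a b : A)
    (e : algebraMap R A f₀ * a = algebraMap R A f₁ * b) : algebraMap R A f₀ ∣ b := by
  have e' : ∑ i, (![f₀, -f₁] : Fin 2 → R) i • (![a, b] : Fin 2 → A) i = 0 := by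
    simp only [Fin.sum_univ_two, Matrix.cons_val_zero, Matrix.cons_val_one, neg_smul]
    rw [← sub_eq_add_neg, sub_eq_zero, Algebra.smul_def, Algebra.smul_def]
    exact e
  obtain ⟨k, c, y, h₁, h₂⟩ :=
    Module.Flat.isTrivialRelation_of_sum_smul_eq_zero (R := R) (M := A) (f := ![f₀, -f₁])
      (x := ![a, b]) e'
  have h₃ : ∀ j, ∃ d, c 1 j = f₀ * d := fun j => h (c 0 j) (c 1 j) (by
    have := h₂ j
    simp only [Fin.sum_univ_two, Matrix.cons_val_zero, Matrix.cons_val_one] at this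
    linear_combination this)
  choose d hd using h₃
  refine ⟨∑ j, d j • y j, ?_⟩
  have h₄ : b = ∑ j, c 1 j • y j := h₁ 1
  rw [h₄, Finset.mul_sum]
  refine Finset.sum_congr rfl fun j _ => ?_
  rw [hd, mul_smul, Algebra.smul_def f₀]

theorem map {A : Type u} [CommRing A] (h : RegPair f₀ f₁) (φ : R →+* A) (hφ : φ.Flat) :
    RegPair (φ f₀) (φ f₁) :=
  let _ := φ.toAlgebra
  have _ : Module.Flat R A := hφ
  { left := eq_zero_of_flat h.left
    right := eq_zero_of_flat h.right
    dvd := dvd_of_flat h.dvd }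

theorem pow_dvd (h : RegPair f₀ f₁) {n : ℕ} (hd : f₀ ∣ f₁ ^ n) : IsUnit f₀ := by
  induction n with
  | zero => exact isUnit_of_dvd_one (by simpa using hd)
  | succ n ih =>
    obtain ⟨a, ha⟩ := hd
    exact ih (h.dvd a _ (by rw [← ha, pow_succ']))

theorem pow_left (h : RegPair f₀ f₁) (n : ℕ) (x : R) (hx : f₀ ^ n * x = 0) : x = 0 := by
  induction n with
  | zero => simpa using hx
  | succ n ih => exact ih (h.left _ (by rw [← hx]; ring))

theorem exp_le (h : RegPair f₀ f₁) {i j i' j' : ℕ} {e : R}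
    (hm : f₀ ^ i * f₁ ^ j = e * (f₀ ^ i' * f₁ ^ j')) (hu : ¬ IsUnit f₀) : i' ≤ i := by
  by_contra! hlt
  obtain ⟨k, rfl⟩ := Nat.exists_eq_add_of_lt hlt
  refine hu (h.pow_dvd (n := j) ⟨e * f₀ ^ k * f₁ ^ j', sub_eq_zero.1 (h.pow_left i _ ?_)⟩)
  rw [mul_sub, hm]
  ring

theorem exp_eq (h : RegPair f₀ f₁) {i j i' j' : ℕ} {e : R} (he : IsUnit e)
    (hm : f₀ ^ i * f₁ ^ j = e * (f₀ ^ i' * f₁ ^ j')) (hu : ¬ IsUnit f₀) : i = i' := by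
  obtain ⟨e, rfl⟩ := he
  refine le_antisymm (h.exp_le (j := j') (j' := j) (e := (e⁻¹ : Rˣ)) ?_ hu) (h.exp_le hm hu)
  rw [hm, Units.inv_mul_cancel_left]

end RegPair

/-- The free commutative monoid on two generators, written multiplicatively. -/
abbrev N2 : Type u := Multiplicative (ULift.{u} (ℕ × ℕ))

/-- The homomorphism `(i, j) ↦ aⁱ bʲ`. -/
def pairHom {M : Type u} [CommMonoid M] (a b : M) : N2.{u} →* M where
  toFun p := a ^ p.toAdd.down.1 * b ^ p.toAdd.down.2
  map_one' := by simp
  map_mul' p q := by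
    simp only [toAdd_mul, ULift.add_down, Prod.fst_add, Prod.snd_add, pow_add]
    exact mul_mul_mul_comm _ _ _ _

/-- The element `(i, j)` of the free commutative monoid on two generators. -/
def N2.mk (i j : ℕ) : N2.{u} := Multiplicative.ofAdd ⟨(i, j)⟩

theorem N2.exists_eq (p : N2.{u}) : ∃ i j, p = N2.mk i j := ⟨p.toAdd.down.1, p.toAdd.down.2, rfl⟩

theorem pairHom_mk {M : Type u} [CommMonoid M] (a b : M) (i j : ℕ) :
    pairHom a b (N2.mk i j) = a ^ i * b ^ j := rfl

theorem N2.mk_mul (i j i' j' : ℕ) : N2.mk.{u} i j * N2.mk i' j' = N2.mk (i + i') (j + j') := rfl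

theorem N2.mk_eq {i j i' j' : ℕ} (h : N2.mk.{u} i j = N2.mk i' j') : i = i' ∧ j = j' := by
  have h' := congrArg (fun p : N2.{u} => p.toAdd.down) h
  exact Prod.mk_inj.1 h'

theorem map_pairHom {M N : Type u} [CommMonoid M] [CommMonoid N] (f : M →* N) (a b : M) (p : N2.{u}) :
    f (pairHom a b p) = pairHom (f a) (f b) p := by
  obtain ⟨i, j, rfl⟩ := N2.exists_eq p
  rw [pairHom_mk, pairHom_mk, map_mul, map_pow, map_pow]

instance : IsCancelMul N2.{u} where
  mul_left_cancel p q r h := by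
    obtain ⟨i, j, rfl⟩ := N2.exists_eq p
    obtain ⟨i', j', rfl⟩ := N2.exists_eq q
    obtain ⟨i'', j'', rfl⟩ := N2.exists_eq r
    obtain ⟨h₁, h₂⟩ := N2.mk_eq h
    exact congrArg₂ N2.mk (Nat.add_left_cancel h₁) (Nat.add_left_cancel h₂)
  mul_right_cancel p q r h := by
    obtain ⟨i, j, rfl⟩ := N2.exists_eq p
    obtain ⟨i', j', rfl⟩ := N2.exists_eq q
    obtain ⟨i'', j'', rfl⟩ := N2.exists_eq r
    obtain ⟨h₁, h₂⟩ := N2.mk_eq h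
    exact congrArg₂ N2.mk (Nat.add_right_cancel h₁) (Nat.add_right_cancel h₂)

theorem N2.mk_pow (i j n : ℕ) : N2.mk.{u} i j ^ n = N2.mk (n * i) (n * j) := rfl

namespace LogScheme

theorem isSaturatedMonoid_N2 : IsSaturatedMonoid N2.{u} := by
  intro p q r n hn h
  obtain ⟨i, j, rfl⟩ := N2.exists_eq p
  obtain ⟨i', j', rfl⟩ := N2.exists_eq q
  obtain ⟨i'', j'', rfl⟩ := N2.exists_eq r
  rw [N2.mk_pow, N2.mk_pow, N2.mk_mul] at h
  obtain ⟨h₁, h₂⟩ := N2.mk_eq h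
  have h₃ : i' ≤ i := Nat.le_of_mul_le_mul_left (h₁ ▸ Nat.le_add_right _ _) hn
  have h₄ : j' ≤ j := Nat.le_of_mul_le_mul_left (h₂ ▸ Nat.le_add_right _ _) hn
  exact ⟨N2.mk (i - i') (j - j'), congrArg₂ N2.mk (Nat.add_sub_of_le h₃).symm
    (Nat.add_sub_of_le h₄).symm⟩

theorem fg_N2 : Monoid.FG N2.{u} := by
  refine (Monoid.fg_iff).2 ⟨{N2.mk 1 0, N2.mk 0 1}, Submonoid.ext fun p => ⟨fun _ => trivial, fun _ => ?_⟩,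
    (Set.finite_singleton _).insert _⟩
  obtain ⟨i, j, rfl⟩ := N2.exists_eq p
  have e : N2.mk.{u} i j = N2.mk 1 0 ^ i * N2.mk 0 1 ^ j := by
    rw [N2.mk_pow, N2.mk_pow, N2.mk_mul]
    exact congrArg₂ N2.mk (by omega) (by omega)
  rw [e]
  have h₁ : N2.mk.{u} 1 0 ∈ Submonoid.closure {N2.mk.{u} 1 0, N2.mk 0 1} :=
    Submonoid.subset_closure (Set.mem_insert _ _)
  have h₂ : N2.mk.{u} 0 1 ∈ Submonoid.closure {N2.mk.{u} 1 0, N2.mk 0 1} :=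
    Submonoid.subset_closure (Set.mem_insert_of_mem _ rfl)
  exact Submonoid.mul_mem _ (Submonoid.pow_mem _ h₁ _) (Submonoid.pow_mem _ h₂ _)

theorem isUnit_appTop_ι {V : Scheme.{u}} {W : V.Opens} {f : Γ(V, ⊤)} (h : W ≤ V.basicOpen f) :
    IsUnit (W.ι.appTop f) := by
  have h₁ : IsUnit (V.presheaf.map (homOfLE le_top : V.basicOpen f ⟶ ⊤).op f) :=
    V.toRingedSpace.isUnit_res_basicOpen f
  have h₂ : IsUnit ((V.basicOpen f).ι.appTop f) := by
    have h₃ := h₁.map (V.presheaf.map (homOfLE (V.basicOpen f).ι_image_top.le).op).hom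
    rw [Scheme.Opens.ι_appTop]
    refine (congrArg IsUnit ?_).mp h₃
    exact (ConcreteCategory.comp_apply _ _ _).symm.trans
      (ConcreteCategory.congr_hom (V.presheaf.map_comp _ _).symm f)
  have e : W.ι = V.homOfLE h ≫ (V.basicOpen f).ι := (V.homOfLE_ι h).symm
  rw [e, appTop_comp_apply]
  exact h₂.map (V.homOfLE h).appTop.hom

theorem mem_basicOpen_of_isUnit {V W : Scheme.{u}} (b : W ⟶ V) (f : Γ(V, ⊤)) (y : W)
    (h : IsUnit (b.appTop f)) : b y ∈ V.basicOpen f := by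
  have : y ∈ b ⁻¹ᵁ V.basicOpen f := by
    rw [Scheme.preimage_basicOpen_top, Scheme.basicOpen_of_isUnit _ h]
    trivial
  exact this

/-- Around each point there is an affine open on which each of the given functions is invertible or
vanishes at the point. -/
theorem exists_affine_shrink {V : Scheme.{u}} (f g : Γ(V, ⊤)) (x : V) :
    ∃ (W : Scheme.{u}) (b : W ⟶ V) (y : W), IsAffine W ∧ IsOpenImmersion b ∧ b y = x ∧
      (x ∈ V.basicOpen f → IsUnit (b.appTop f)) ∧ (x ∈ V.basicOpen g → IsUnit (b.appTop g)) := by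
  classical
  let O : Γ(V, ⊤) → V.Opens := fun f => if x ∈ V.basicOpen f then V.basicOpen f else ⊤
  have hO : ∀ f, x ∈ O f := fun f => by
    by_cases h : x ∈ V.basicOpen f
    · simp only [O, if_pos h]; exact h
    · simp only [O, if_neg h]; trivial
  obtain ⟨_, ⟨W, hW, rfl⟩, hx, hle⟩ := V.isBasis_affineOpens.exists_subset_of_mem_open
    (show x ∈ ((O f ⊓ O g : V.Opens) : Set V) from ⟨hO f, hO g⟩) (O f ⊓ O g).isOpen
  have key : ∀ (W : V.Opens) (f : Γ(V, ⊤)), W ≤ O f → x ∈ V.basicOpen f →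
      IsUnit (W.ι.appTop f) := fun W f h h' =>
    isUnit_appTop_ι (h.trans (by simp only [O, if_pos h']; exact le_rfl))
  refine ⟨W, Scheme.Opens.ι W, ⟨x, hx⟩, hW, inferInstance, rfl, key W f fun z hz => (hle hz).1,
    key W g fun z hz => (hle hz).2⟩

/-- A flat morphism from an affine scheme to `Spec R` preserves regular pairs. -/
theorem _root_.LogGeometry.RegPair.appTop {R : Type u} [CommRing R] {f₀ f₁ : R} (h : RegPair f₀ f₁) {W : Scheme.{u}}
    [IsAffine W] (c : W ⟶ Spec (.of R)) [Flat c] :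
    RegPair (c.appTop (specFun f₀)) (c.appTop (specFun f₁)) := by
  have h₁ : c.appTop.hom.Flat := HasRingHomProperty.appTop @Flat c inferInstance
  have h₂ : (Scheme.ΓSpecIso (.of R)).inv.hom.Flat :=
    RingHom.Flat.of_bijective (ConcreteCategory.bijective_of_isIso _)
  exact (h.map _ h₂).map _ h₁


variable {X : LogScheme.{u}}

/-- If `M` is a sheaf of functions and if, over a scheme étale over `X` and over `Spec R`, its
sections are locally monomials in a regular pair of functions, then these functions define a chart. -/
theorem chartAt_of_regPair {R : Type u} [CommRing R]
    {f₀ f₁ : R} (hf : RegPair f₀ f₁) (c : Spec (.of R) ⟶ X.scheme) [Etale c]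
    (hinj : ∀ {V : Scheme.{u}} (v : V ⟶ X.scheme) [Etale v], Function.Injective (X.ex (u := v)))
    (s₀ s₁ : X.Sec c) (h₀ : X.ex s₀ = specFun f₀) (h₁ : X.ex s₁ = specFun f₁)
    (hmon : ∀ {V : Scheme.{u}} (v : V ⟶ X.scheme) [Etale v] (a : V ⟶ Spec (.of R)), Etale a →
      a ≫ c = v → ∀ (m : X.Sec v) (x : V), ∃ (W : Scheme.{u}) (w : W ⟶ X.scheme) (_ : Etale w)
        (b : W ⟶ V) (_ : b ≫ v = w) (y : W) (i j : ℕ) (e : Γ(W, ⊤)), b y = x ∧ IsUnit e ∧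
        b.appTop (X.ex m) =
          e * ((b ≫ a).appTop (specFun f₀) ^ i * (b ≫ a).appTop (specFun f₁) ^ j)) :
    X.ChartAt c (pairHom s₀ s₁) := by
  have hex : ∀ {V : Scheme.{u}} (v : V ⟶ X.scheme) [Etale v] (a : V ⟶ Spec (.of R))
      (ha : a ≫ c = v) (i j : ℕ), X.ex (X.rs a ha (pairHom s₀ s₁ (N2.mk i j))) =
      a.appTop (specFun f₀) ^ i * a.appTop (specFun f₁) ^ j := by
    intro V v _ a ha i j
    rw [X.ex_rs a ha, pairHom_mk, map_mul, map_pow, map_pow, map_mul, map_pow, map_pow, h₀, h₁]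
  constructor
  · intro V v _ a ha m x
    have hae : Etale a := etale_of_comp (g := c) inferInstance (h := v) inferInstance ha
    obtain ⟨W, w, hw, b, hb, y, i, j, e, hy, he, hme⟩ := hmon v a hae ha m x
    obtain ⟨e', he', -⟩ := X.existsUnique_ex (u := w) he
    refine ⟨W, w, hw, b, hb, y, N2.mk i j, e', hy, isUnit_iff_ex.2 (he' ▸ he), hinj w ?_⟩
    rw [map_mul, he', hex, X.ex_rs b hb m]
    exact hme
  · intro V v _ a ha p p' e x he h
    obtain ⟨i, j, rfl⟩ := N2.exists_eq p
    obtain ⟨i', j', rfl⟩ := N2.exists_eq p'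
    have hae : Etale a := etale_of_comp (g := c) inferInstance (h := v) inferInstance ha
    have h' := congrArg X.ex h
    rw [map_mul, hex, hex] at h'
    obtain ⟨W, b, y, hW, hb, hy, hb₀, hb₁⟩ := exists_affine_shrink (a.appTop (specFun f₀))
      (a.appTop (specFun f₁)) x
    have hfl : Flat (b ≫ a) := inferInstance
    have hr := hf.appTop (b ≫ a)
    have heu : IsUnit (b.appTop (X.ex e)) := (isUnit_iff_ex.1 he).map b.appTop.hom
    have h₂ := congrArg b.appTop h'
    rw [map_mul, map_mul, map_mul, map_pow, map_pow, map_pow, map_pow, ← appTop_comp_apply,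
      ← appTop_comp_apply] at h₂
    have hwe : Etale (b ≫ v) := inferInstance
    have hba : (b ≫ a) ≫ c = b ≫ v := by rw [Category.assoc, ha]
    have hex' := fun i j => hex (b ≫ v) (b ≫ a) hba i j
    have hexe := X.ex_rs (u := b ≫ v) b rfl e
    -- Where `f₀` is not invertible its exponent is determined by the section, and similarly for `f₁`.
    have hn₀ : ¬ IsUnit ((b ≫ a).appTop (specFun f₀)) → i = i' := hr.exp_eq heu h₂
    have hn₁ : ¬ IsUnit ((b ≫ a).appTop (specFun f₁)) → j = j' := hr.symm.exp_eq heu (by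
      rw [mul_comm, h₂, mul_comm (_ ^ i')])
    have hr₀ := hr.pow_left
    have hr₁ := hr.symm.pow_left
    generalize (b ≫ a).appTop (specFun f₀) = F₀ at *
    generalize (b ≫ a).appTop (specFun f₁) = F₁ at *
    -- The witnesses are monomials in those of the two functions which are invertible near `x`.
    have key : ∀ n n' m m' : ℕ, (IsUnit F₀ ∨ (n = 0 ∧ n' = 0)) → (IsUnit F₁ ∨ (m = 0 ∧ m' = 0)) →
        i + n = i' + n' → j + m = j' + m' →
        F₀ ^ n' * F₁ ^ m' = b.appTop (X.ex e) * (F₀ ^ n * F₁ ^ m) →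
        ∃ (W : Scheme.{u}) (w : W ⟶ X.scheme) (_ : Etale w) (b : W ⟶ V) (hb : b ≫ v = w)
          (y : W) (n n' : N2.{u}), b y = x ∧
        IsUnit (X.rs (b ≫ a) (by rw [Category.assoc, ha, hb] : (b ≫ a) ≫ c = w)
          (pairHom s₀ s₁ n)) ∧
        IsUnit (X.rs (b ≫ a) (by rw [Category.assoc, ha, hb] : (b ≫ a) ≫ c = w)
          (pairHom s₀ s₁ n')) ∧
        N2.mk i j * n = N2.mk i' j' * n' ∧
        X.rs (b ≫ a) (by rw [Category.assoc, ha, hb] : (b ≫ a) ≫ c = w) (pairHom s₀ s₁ n') =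
          X.rs b hb e * X.rs (b ≫ a) (by rw [Category.assoc, ha, hb]) (pairHom s₀ s₁ n) := by
      intro n n' m m' hn hm e₁ e₂ e₃
      have hu : ∀ {F : Γ(W, ⊤)} {n n' : ℕ}, (IsUnit F ∨ (n = 0 ∧ n' = 0)) →
          IsUnit (F ^ n) ∧ IsUnit (F ^ n') := by
        rintro F n n' (h | ⟨rfl, rfl⟩)
        · exact ⟨h.pow _, h.pow _⟩
        · simp
      refine ⟨W, b ≫ v, hwe, b, rfl, y, N2.mk n m, N2.mk n' m', hy,
        isUnit_iff_ex.2 ?_, isUnit_iff_ex.2 ?_,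
        (by rw [N2.mk_mul, N2.mk_mul, e₁, e₂]), hinj _ ?_⟩
      · rw [hex']
        exact (hu hn).1.mul (hu hm).1
      · rw [hex']
        exact (hu hn).2.mul (hu hm).2
      · rw [map_mul, hex', hex', hexe]
        exact e₃
    by_cases hu₀ : IsUnit F₀ <;> by_cases hu₁ : IsUnit F₁
    · exact key i' i j' j (Or.inl hu₀) (Or.inl hu₁) (add_comm _ _) (add_comm _ _) h₂
    · obtain rfl := hn₁ hu₁
      refine key i' i 0 0 (Or.inl hu₀) (Or.inr ⟨rfl, rfl⟩) (add_comm _ _) rfl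
        (sub_eq_zero.1 (hr₁ j _ ?_))
      linear_combination h₂
    · obtain rfl := hn₀ hu₀
      refine key 0 0 j' j (Or.inr ⟨rfl, rfl⟩) (Or.inl hu₁) rfl (add_comm _ _)
        (sub_eq_zero.1 (hr₀ i _ ?_))
      linear_combination h₂
    · obtain rfl := hn₀ hu₀
      obtain rfl := hn₁ hu₁
      refine key 0 0 0 0 (Or.inr ⟨rfl, rfl⟩) (Or.inr ⟨rfl, rfl⟩) rfl rfl
        (sub_eq_zero.1 (hr₁ j _ (hr₀ i _ ?_)))
      linear_combination h₂

theorem genEx_injective {S : Scheme.{u}} (G : Generators S) {U : Scheme.{u}}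
    {u : U ⟶ (ofGenerators G).scheme} [Etale u] :
    Function.Injective ((ofGenerators G).ex (u := u)) := Subtype.val_injective

/-- A function in the logarithmic structure generated by `G`, as a section. -/
def genSec {S : Scheme.{u}} (G : Generators S) {U : Scheme.{u}} (u : U ⟶ (ofGenerators G).scheme)
    [i : Etale u] (f : Γ(U, ⊤)) (h : f ∈ genSections G (@Scheme.Etale.mk S U u i)) :
    (ofGenerators G).Sec u :=
  (⟨f, h⟩ : genSections G (@Scheme.Etale.mk S U u i))

/-- If the generators are monomials in a regular pair of functions, over a scheme étale over `S` and
over `Spec R`, then these two functions define a chart. -/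
theorem chartAt_ofGenerators {S : Scheme.{u}} (G : Generators S) {R : Type u} [CommRing R]
    {f₀ f₁ : R} (hf : RegPair f₀ f₁) (c : Spec (.of R) ⟶ (ofGenerators G).scheme) [Etale c]
    (s₀ s₁ : (ofGenerators G).Sec c) (h₀ : (ofGenerators G).ex s₀ = specFun f₀)
    (h₁ : (ofGenerators G).ex s₁ = specFun f₁)
    (hG : ∀ γ ∈ G, ∀ {V : Scheme.{u}} (a : V ⟶ Spec (.of R)) (b : V ⟶ γ.1.left),
      b ≫ (γ.1.hom : γ.1.left ⟶ S) = a ≫ c → ∃ (i j : ℕ) (e : Γ(V, ⊤)), IsUnit e ∧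
        b.appTop γ.2 = e * (a.appTop (specFun f₀) ^ i * a.appTop (specFun f₁) ^ j)) :
    (ofGenerators G).ChartAt c (pairHom s₀ s₁) := by
  refine chartAt_of_regPair hf c (fun v _ => genEx_injective G) s₀ s₁ h₀ h₁ ?_
  intro V v i a _ ha m x
  obtain ⟨W, b, y, hy, h⟩ := (show genSections G (@Scheme.Etale.mk S V v i) from m).2 x
  have hW : Etale (W.hom : W.left ⟶ S) := W.prop
  refine ⟨W.left, W.hom, hW, b.left, etaleHom_w b, y, ?_⟩
  suffices hmon : ∀ f : Γ(W.left, ⊤), f ∈ monomials G W → ∃ (i j : ℕ) (e : Γ(W.left, ⊤)), IsUnit e ∧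
      f = e * ((b.left ≫ a).appTop (specFun f₀) ^ i * (b.left ≫ a).appTop (specFun f₁) ^ j) by
    obtain ⟨i, j, e, he, h'⟩ := hmon _ h
    exact ⟨i, j, e, hy, he, h'⟩
  have hwa : W.hom = (b.left ≫ a) ≫ c :=
    (etaleHom_w b).symm.trans ((congrArg (b.left ≫ ·) ha.symm).trans (Category.assoc _ _ _).symm)
  intro f hf
  induction hf using Submonoid.closure_induction with
  | mem f hf =>
    rcases hf with hf | ⟨γ, hγ, d, rfl⟩
    · exact ⟨0, 0, f, hf, by rw [pow_zero, pow_zero, mul_one, mul_one]⟩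
    · exact hG γ hγ (b.left ≫ a) d.left ((etaleHom_w d).trans hwa)
  | one => exact ⟨0, 0, 1, isUnit_one, by rw [pow_zero, pow_zero, mul_one, mul_one]⟩
  | mul f g _ _ hf hg =>
    obtain ⟨i, j, e, he, rfl⟩ := hf
    obtain ⟨i', j', e', he', rfl⟩ := hg
    refine ⟨i + i', j + j', e * e', he.mul he', ?_⟩
    rw [pow_add, pow_add, mul_mul_mul_comm e, mul_mul_mul_comm (_ ^ i)]

end LogScheme
end
end LogGeometry

namespace LogGeometry
noncomputable section

/-! ### Morphisms to affine schemes and to charts of `Proj` -/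

namespace LogScheme

theorem spec_hom_ext {R : Type u} [CommRing R] {T : Scheme.{u}} {f g : T ⟶ Spec (.of R)}
    (h : ∀ r : R, f.appTop (specFun r) = g.appTop (specFun r)) : f = g := by
  apply ext_of_isAffine
  ext x
  obtain ⟨r, rfl⟩ := (ConcreteCategory.bijective_of_isIso (Scheme.ΓSpecIso (.of R)).inv).2 x
  exact h r

/-- The morphism to `Spec R` given by a ring homomorphism from `R` to the global functions. -/
def specHom {R : Type u} [CommRing R] {T : Scheme.{u}} (φ : R →+* Γ(T, ⊤)) : T ⟶ Spec (.of R) :=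
  T.toSpecΓ ≫ Spec.map (CommRingCat.ofHom φ)

theorem specHom_appTop {R : Type u} [CommRing R] {T : Scheme.{u}} (φ : R →+* Γ(T, ⊤)) (r : R) :
    (specHom φ).appTop (specFun r) = φ r := by
  refine (appTop_comp_apply _ _ _).trans ?_
  refine (congrArg T.toSpecΓ.appTop (specFun_map φ r)).trans ?_
  rw [Scheme.toSpecΓ_appTop]
  exact ConcreteCategory.congr_hom (Scheme.ΓSpecIso Γ(T, ⊤)).inv_hom_id (φ r)

/-- The ring homomorphism `R → Γ(T, 𝒪)` given by a morphism `T → Spec R`. -/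
def funHom {R : Type u} [CommRing R] {T : Scheme.{u}} (f : T ⟶ Spec (.of R)) : R →+* Γ(T, ⊤) :=
  f.appTop.hom.comp (Scheme.ΓSpecIso (.of R)).inv.hom

theorem uliftInt_hom_ext {A : Type*} [Ring A] (f g : ULift.{u} ℤ →+* A) : f = g := by
  have h : f.comp (ULift.ringEquiv.symm : ℤ ≃+* ULift.{u} ℤ).toRingHom =
      g.comp (ULift.ringEquiv.symm : ℤ ≃+* ULift.{u} ℤ).toRingHom := RingHom.ext_int _ _
  exact RingHom.ext fun x => DFunLike.congr_fun h x.down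

/-- The ring homomorphism from the integers. -/
def uliftIntHom (A : Type*) [CommRing A] : ULift.{u} ℤ →+* A :=
  (Int.castRingHom A).comp (ULift.ringEquiv : ULift.{u} ℤ ≃+* ℤ).toRingHom

/-- The ring homomorphism `ℤ[x₀, x₁] → A` with `xᵢ ↦ v i`. -/
def planeEval {A : Type*} [CommRing A] (v : Fin 2 → A) : PlaneRing.{u} →+* A :=
  MvPolynomial.eval₂Hom (uliftIntHom A) v

theorem planeEval_X {A : Type*} [CommRing A] (v : Fin 2 → A) (i : Fin 2) :
    planeEval v (MvPolynomial.X i : PlaneRing.{u}) = v i :=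
  MvPolynomial.eval₂Hom_X' _ _ _

theorem plane_hom_ext {A : Type*} [CommRing A] {f g : PlaneRing.{u} →+* A} {i j : Fin 2}
    (hij : i ≠ j) (hi : f (MvPolynomial.X i) = g (MvPolynomial.X i))
    (hj : f (MvPolynomial.X j) = g (MvPolynomial.X j)) : f = g := by
  refine MvPolynomial.ringHom_ext (fun r => ?_) fun k => ?_
  · exact DFunLike.congr_fun (uliftInt_hom_ext (f.comp MvPolynomial.C) (g.comp MvPolynomial.C)) r
  · obtain rfl | rfl : k = i ∨ k = j := by omega
    · exact hi
    · exact hj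

theorem plane_spec_hom_ext {T : Scheme.{u}} {f g : T ⟶ Spec (.of PlaneRing.{u})} {i j : Fin 2}
    (hij : i ≠ j)
    (hi : f.appTop (specFun (MvPolynomial.X i)) = g.appTop (specFun (MvPolynomial.X i)))
    (hj : f.appTop (specFun (MvPolynomial.X j)) = g.appTop (specFun (MvPolynomial.X j))) : f = g :=
  spec_hom_ext fun r => DFunLike.congr_fun
    (plane_hom_ext (f := funHom f) (g := funHom g) hij hi hj) r

instance : IsDomain (ULift.{u} ℤ) := (ULift.ringEquiv : ULift.{u} ℤ ≃+* ℤ).toMulEquiv.isDomain ℤ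

theorem regPair_X {i j : Fin 2} (hij : i ≠ j) :
    RegPair (MvPolynomial.X i : PlaneRing.{u}) (MvPolynomial.X j) where
  left _ hx := (mul_eq_zero.1 hx).resolve_left (MvPolynomial.X_ne_zero i)
  right _ hx := (mul_eq_zero.1 hx).resolve_left (MvPolynomial.X_ne_zero j)
  dvd a _ e := ((MvPolynomial.X_prime (i := i)).dvd_mul.1 ⟨a, e.symm⟩).resolve_left
    fun h => hij (MvPolynomial.X_dvd_X.1 h)

theorem regPair_one {R : Type u} [CommRing R] {t : R} (h : ∀ x, t * x = 0 → x = 0) :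
    RegPair t 1 where
  left := h
  right x hx := by simpa using hx
  dvd a b e := ⟨a, by rw [e, one_mul]⟩

section Proj

variable {A σ : Type u} [CommRing A] [SetLike σ A] [AddSubgroupClass σ A] (𝒜 : ℕ → σ) [GradedRing 𝒜]
variable {a b : A} (ha : a ∈ 𝒜 1) (hb : b ∈ 𝒜 1)

/-- The element `b / a` of the homogeneous localization. -/
def awayRatio : HomogeneousLocalization.Away 𝒜 a :=
  HomogeneousLocalization.Away.mk 𝒜 ha 1 b (by rwa [one_smul])

theorem val_awayRatio : (awayRatio 𝒜 ha hb).val = Localization.mk b (⟨a ^ 1, ⟨1, rfl⟩⟩ : Submonoid.powers a) :=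
  HomogeneousLocalization.Away.val_mk 𝒜 1 ha b _

theorem algebraMap_mul_awayRatio : algebraMap A (Localization.Away a) a * (awayRatio 𝒜 ha hb).val =
    algebraMap A _ b := by
  rw [val_awayRatio, ← Localization.mk_one_eq_algebraMap, ← Localization.mk_one_eq_algebraMap,
    Localization.mk_mul, Localization.mk_eq_mk_iff, Localization.r_iff_exists]
  exact ⟨1, by simp⟩

theorem awayRatio_self : awayRatio 𝒜 ha ha = 1 := by
  apply HomogeneousLocalization.val_injective
  rw [val_awayRatio, HomogeneousLocalization.val_one]
  exact (Localization.mk_eq_mk_iff.2 (Localization.r_iff_exists.2 ⟨1, by simp⟩)).trans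
    Localization.mk_one

/-- A morphism to `D₊(a)` under which `b / a` becomes invertible lands in `D₊(b)`. -/
theorem exists_factor_away {T : Scheme.{u}}
    (f : T ⟶ Spec (.of (HomogeneousLocalization.Away 𝒜 a)))
    (h : IsUnit (f.appTop (specFun (awayRatio 𝒜 ha hb)))) :
    ∃ g : T ⟶ Spec (.of (HomogeneousLocalization.Away 𝒜 b)),
      g ≫ Proj.awayι 𝒜 b hb one_pos = f ≫ Proj.awayι 𝒜 a ha one_pos := by
  refine ⟨IsOpenImmersion.lift (Proj.awayι 𝒜 b hb one_pos) (f ≫ Proj.awayι 𝒜 a ha one_pos) ?_,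
    IsOpenImmersion.lift_fac _ _ _⟩
  rintro _ ⟨t, rfl⟩
  change _ ∈ (Proj.awayι 𝒜 b hb one_pos).opensRange
  rw [Proj.opensRange_awayι, Scheme.Hom.comp_apply]
  change f t ∈ Proj.awayι 𝒜 a ha one_pos ⁻¹ᵁ Proj.basicOpen 𝒜 b
  rw [Proj.awayι_preimage_basicOpen 𝒜 ha one_pos hb one_pos]
  have e : HomogeneousLocalization.Away.isLocalizationElem ha hb = awayRatio 𝒜 ha hb :=
    HomogeneousLocalization.val_injective _ (by
      simp only [HomogeneousLocalization.Away.val_mk, awayRatio, pow_one])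
  rw [e]
  have h₁ := mem_basicOpen_of_isUnit f _ t h
  have h₂ := basicOpen_eq_of_affine (R := .of (HomogeneousLocalization.Away 𝒜 a))
    (awayRatio 𝒜 ha hb)
  exact h₂.le h₁

theorem away_ratio_mul' {U : Scheme.{u}} (p : U ⟶ Spec (.of (HomogeneousLocalization.Away 𝒜 a)))
    (q : U ⟶ Spec (.of (HomogeneousLocalization.Away 𝒜 b)))
    (h : p ≫ Proj.awayι 𝒜 a ha one_pos = q ≫ Proj.awayι 𝒜 b hb one_pos) :
    p.appTop (specFun (awayRatio 𝒜 ha hb)) * q.appTop (specFun (awayRatio 𝒜 hb ha)) = 1 :=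
  away_ratio_mul 𝒜 ha hb p q h

end Proj

/-! ### The charts of the projective line -/

attribute [local instance] MvPolynomial.gradedAlgebra

theorem planeEval_smul {A : Type*} [CommRing A] {n : ℕ} {p : PlaneRing.{u}}
    (hp : p ∈ planeGrading n) (s : A) (r : Fin 2 → A) :
    planeEval (fun k => s * r k) p = s ^ n * planeEval r p := by
  have hp' : p.IsHomogeneous n := hp
  change MvPolynomial.eval₂ _ _ p = _ * MvPolynomial.eval₂ _ _ p
  rw [MvPolynomial.eval₂_eq', MvPolynomial.eval₂_eq', Finset.mul_sum]
  refine Finset.sum_congr rfl fun d hd => ?_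
  have hd' : d 0 + d 1 = n := by
    have := hp' (MvPolynomial.mem_support_iff.1 hd)
    rwa [Finsupp.weight_apply, Finsupp.sum_fintype _ _ (by simp), Fin.sum_univ_two, Pi.one_apply,
      Pi.one_apply, smul_eq_mul, smul_eq_mul, mul_one, mul_one] at this
  rw [Fin.prod_univ_two, Fin.prod_univ_two, ← hd', pow_add, mul_pow, mul_pow]
  ring

/-- The coordinate ring of the chart `D₊(xᵢ)` of the projective line. -/
abbrev LineRing (i : Fin 2) : Type u :=
  HomogeneousLocalization.Away planeGrading.{u} (MvPolynomial.X i)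

/-- The coordinate `xⱼ / xᵢ`. -/
abbrev lineElt (i j : Fin 2) : LineRing.{u} i :=
  awayRatio planeGrading.{u} (X_mem_planeGrading i) (X_mem_planeGrading j)

theorem exists_lineRing_hom {A : Type u} [CommRing A] {i j : Fin 2} (hij : i ≠ j) (r : A) :
    ∃ φ : LineRing.{u} i →+* A, φ (lineElt i j) = r := by
  let v : Fin 2 → A := Function.update (fun _ => r) i 1
  have hi : planeEval v (MvPolynomial.X i : PlaneRing.{u}) = 1 := by
    rw [planeEval_X]; simp [v]
  have hj : planeEval v (MvPolynomial.X j : PlaneRing.{u}) = r := by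
    rw [planeEval_X]; simp [v, hij.symm]
  let ψ : Localization.Away (MvPolynomial.X i : PlaneRing.{u}) →+* A :=
    IsLocalization.Away.lift (g := planeEval v) (MvPolynomial.X i) (by rw [hi]; exact isUnit_one)
  refine ⟨ψ.comp (algebraMap (LineRing.{u} i) _), ?_⟩
  rw [RingHom.comp_apply, HomogeneousLocalization.algebraMap_apply, val_awayRatio]
  have e := congrArg ψ (algebraMap_mul_awayRatio planeGrading.{u} (X_mem_planeGrading i)
    (X_mem_planeGrading j))
  rw [map_mul, val_awayRatio] at e
  rw [IsLocalization.Away.lift_eq, IsLocalization.Away.lift_eq, hi, hj, one_mul] at e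
  exact e

theorem lineRing_hom_ext {A : Type*} [CommRing A] {i j : Fin 2} (hij : i ≠ j)
    {φ ψ : LineRing.{u} i →+* A} (h : φ (lineElt i j) = ψ (lineElt i j)) : φ = ψ := by
  -- every element of the homogeneous localization is a polynomial in `xⱼ / xᵢ`
  suffices H : ∀ z : LineRing.{u} i, ∃ q : PlaneRing.{u},
      planeEval (Function.update (fun _ => lineElt i j) i 1) q = z by
    refine RingHom.ext fun z => ?_
    obtain ⟨q, rfl⟩ := H z
    refine DFunLike.congr_fun (plane_hom_ext (f := φ.comp (planeEval _))
      (g := ψ.comp (planeEval _)) hij ?_ ?_) q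
    · simp only [RingHom.comp_apply, planeEval_X, Function.update_self, map_one]
    · simp only [RingHom.comp_apply, planeEval_X, Function.update_of_ne hij.symm, h]
  intro z
  obtain ⟨n, p, hp, rfl⟩ := HomogeneousLocalization.Away.mk_surjective planeGrading.{u}
    (X_mem_planeGrading i) z
  refine ⟨p, HomogeneousLocalization.val_injective _ ?_⟩
  let L := Localization.Away (MvPolynomial.X i : PlaneRing.{u})
  have h₁ : (planeEval (Function.update (fun _ => lineElt i j) i 1) p).val =
      planeEval (fun k => (lineElt i k).val) p := by
    refine DFunLike.congr_fun (plane_hom_ext (f := (algebraMap (LineRing.{u} i) L).comp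
      (planeEval _)) (g := planeEval _) hij ?_ ?_) p
    · rw [RingHom.comp_apply, planeEval_X, planeEval_X, Function.update_self]
      exact congrArg HomogeneousLocalization.val
        (awayRatio_self planeGrading.{u} (X_mem_planeGrading i)).symm
    · rw [RingHom.comp_apply, planeEval_X, planeEval_X, Function.update_of_ne hij.symm]
      rfl
  have h₂ := planeEval_smul (A := L) (n := n) (by simpa using hp)
    (algebraMap PlaneRing.{u} L (MvPolynomial.X i)) fun k => (lineElt i k).val
  have h₃ : planeEval (A := L) (fun k => algebraMap PlaneRing.{u} L (MvPolynomial.X i) * (lineElt i k).val) =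
      algebraMap PlaneRing.{u} L := by
    refine plane_hom_ext hij ?_ ?_ <;>
    · rw [planeEval_X]
      exact algebraMap_mul_awayRatio _ _ _
  rw [h₃] at h₂
  rw [h₁, HomogeneousLocalization.Away.val_mk, Localization.mk_eq_mk', IsLocalization.eq_mk'_iff_mul_eq,
    h₂, mul_comm, map_pow]

theorem lineElt_regular {i j : Fin 2} (x : LineRing.{u} i) (hx : lineElt i j * x = 0) : x = 0 := by
  apply HomogeneousLocalization.val_injective
  have h := congrArg HomogeneousLocalization.val hx
  rw [HomogeneousLocalization.val_mul, HomogeneousLocalization.val_zero] at h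
  rw [HomogeneousLocalization.val_zero]
  have : IsDomain (Localization.Away (MvPolynomial.X i : PlaneRing.{u})) :=
    IsLocalization.isDomain_localization
      (powers_le_nonZeroDivisors_of_noZeroDivisors (MvPolynomial.X_ne_zero i))
  refine (mul_eq_zero.1 h).resolve_left fun h' => ?_
  rw [val_awayRatio, Localization.mk_eq_mk', IsLocalization.mk'_eq_zero_iff] at h'
  obtain ⟨⟨_, k, rfl⟩, h'⟩ := h'
  exact (mul_ne_zero (pow_ne_zero k (MvPolynomial.X_ne_zero i)) (MvPolynomial.X_ne_zero j)) h'

end LogScheme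
end
end LogGeometry

namespace LogGeometry
noncomputable section
namespace LogScheme

/-! ### The charts of the blowup of the plane -/

/-- The grading of the Rees algebra of the ideal of the origin. -/
abbrev blGrading := reesGrading originIdeal.{u}

/-- The element `xᵢ T` of the Rees algebra. -/
abbrev blT (i : Fin 2) : reesAlgebra originIdeal.{u} := reesT _ (X_mem_originIdeal i)

theorem blT_mem (i : Fin 2) : blT.{u} i ∈ blGrading 1 := reesT_mem _ (X_mem_originIdeal i)

/-- The coordinate ring of the chart `D₊(xᵢ T)` of the blowup. -/
abbrev BlRing (i : Fin 2) : Type u := HomogeneousLocalization.Away blGrading.{u} (blT i)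

/-- The coordinate `xⱼ T / xᵢ T`. -/
abbrev blElt (i j : Fin 2) : BlRing.{u} i := awayRatio blGrading.{u} (blT_mem i) (blT_mem j)

/-- The functions on a chart of the blowup given by functions on the plane. -/
def blBase (i : Fin 2) : PlaneRing.{u} →+* BlRing.{u} i :=
  (HomogeneousLocalization.fromZeroRingHom blGrading.{u} (Submonoid.powers (blT i))).comp
    (algebraMap PlaneRing.{u} (blGrading.{u} 0))

/-- The inclusion of `ℤ[x₀, x₁]` in the Rees algebra, as the component of degree zero. -/
abbrev blConst : PlaneRing.{u} →+* reesAlgebra originIdeal.{u} := algebraMap _ _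

/-- The localization of the Rees algebra at `xᵢ T`. -/
abbrev BlLoc (i : Fin 2) : Type u := Localization.Away (blT.{u} i)

theorem val_blBase (i : Fin 2) (r : PlaneRing.{u}) :
    (blBase i r).val = algebraMap _ (BlLoc.{u} i) (blConst r) :=
  Localization.mk_one_eq_algebraMap _

theorem blConst_mul_blT (i j : Fin 2) : blConst.{u} (MvPolynomial.X i) * blT j =
    blConst (MvPolynomial.X j) * blT i := by
  apply Subtype.ext
  change Polynomial.C _ * Polynomial.monomial 1 _ = Polynomial.C _ * Polynomial.monomial 1 _
  rw [Polynomial.C_mul_monomial, Polynomial.C_mul_monomial, mul_comm]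

theorem blBase_eq (i j : Fin 2) : blBase.{u} i (MvPolynomial.X j) =
    blBase i (MvPolynomial.X i) * blElt i j := by
  apply HomogeneousLocalization.val_injective
  rw [HomogeneousLocalization.val_mul, val_blBase, val_blBase]
  have hu : IsUnit (algebraMap _ (BlLoc.{u} i) (blT i)) :=
    IsLocalization.Away.algebraMap_isUnit (blT i)
  refine hu.mul_left_cancel ?_
  rw [mul_left_comm, algebraMap_mul_awayRatio, ← map_mul, ← map_mul, blConst_mul_blT, mul_comm]

/-- The homomorphism `ℤ[x₀, x₁] → Γ(D₊(xᵢ T))` with `xᵢ ↦ xᵢ` and `xⱼ ↦ xⱼ / xᵢ`. -/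
def blMap (i j : Fin 2) : PlaneRing.{u} →+* BlRing.{u} i :=
  planeEval fun k => if k = i then blBase i (MvPolynomial.X i) else blElt i j

theorem blMap_self (i j : Fin 2) : blMap.{u} i j (MvPolynomial.X i) = blBase i (MvPolynomial.X i) := by
  rw [blMap, planeEval_X, if_pos rfl]

theorem blMap_other {i j : Fin 2} (hij : i ≠ j) : blMap.{u} i j (MvPolynomial.X j) = blElt i j := by
  rw [blMap, planeEval_X, if_neg hij.symm]

/-- The substitution `xᵢ ↦ xᵢ`, `xⱼ ↦ xᵢ xⱼ`. -/
def blSubst (i j : Fin 2) : PlaneRing.{u} →+* PlaneRing.{u} :=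
  planeEval fun k => if k = i then MvPolynomial.X i else MvPolynomial.X i * MvPolynomial.X j

theorem blSubst_self (i j : Fin 2) : blSubst.{u} i j (MvPolynomial.X i) = MvPolynomial.X i := by
  rw [blSubst, planeEval_X, if_pos rfl]

theorem blSubst_other {i j : Fin 2} (hij : i ≠ j) :
    blSubst.{u} i j (MvPolynomial.X j) = MvPolynomial.X i * MvPolynomial.X j := by
  rw [blSubst, planeEval_X, if_neg hij.symm]

theorem blMap_comp_blSubst {i j : Fin 2} (hij : i ≠ j) :
    (blMap.{u} i j).comp (blSubst i j) = blBase i := by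
  refine plane_hom_ext hij ?_ ?_
  · rw [RingHom.comp_apply, blSubst_self, blMap_self]
  · rw [RingHom.comp_apply, blSubst_other hij, map_mul, blMap_self, blMap_other hij, ← blBase_eq]

theorem blMap_injective {i j : Fin 2} (hij : i ≠ j) : Function.Injective (blMap.{u} i j) := by
  -- invert `xᵢ` and send `T` to `1 / xᵢ`
  let L := Localization.Away (MvPolynomial.X i : PlaneRing.{u})
  let ι : PlaneRing.{u} →+* L := algebraMap _ _
  have hL : IsUnit (ι (MvPolynomial.X i)) := IsLocalization.Away.algebraMap_isUnit _
  obtain ⟨t, ht⟩ := hL.exists_right_inv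
  let φ : reesAlgebra originIdeal.{u} →+* L :=
    (Polynomial.eval₂RingHom (ι.comp (blSubst i j)) t).comp (reesAlgebra originIdeal.{u}).val.toRingHom
  have hφT : ∀ k, φ (blT k) = ι (blSubst i j (MvPolynomial.X k)) * t := fun k => by
    change Polynomial.eval₂ _ _ (Polynomial.monomial 1 _) = _
    rw [Polynomial.eval₂_monomial, pow_one]
    rfl
  have hφC : ∀ r, φ (blConst r) = ι (blSubst i j r) := fun r => Polynomial.eval₂_C _ _
  have hφi : φ (blT i) = 1 := by rw [hφT, blSubst_self, ht]
  let ψ : BlLoc.{u} i →+* L := IsLocalization.Away.lift (g := φ) (blT i) (hφi ▸ isUnit_one)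
  have hψ : ∀ x, ψ (algebraMap _ _ x) = φ x := fun x => IsLocalization.Away.lift_eq _ _ _
  let χ : BlRing.{u} i →+* L := ψ.comp (algebraMap (BlRing.{u} i) (BlLoc.{u} i))
  have hχ : χ.comp (blMap.{u} i j) = ι := by
    refine plane_hom_ext hij ?_ ?_
    · rw [RingHom.comp_apply, blMap_self]
      refine (congrArg ψ (val_blBase i _)).trans ?_
      rw [hψ, hφC, blSubst_self]
    · rw [RingHom.comp_apply, blMap_other hij]
      have e := congrArg ψ (algebraMap_mul_awayRatio blGrading.{u} (blT_mem i) (blT_mem j))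
      rw [map_mul, hψ, hψ, hφi, hφT, one_mul, blSubst_other hij, map_mul, mul_right_comm, ht,
        one_mul] at e
      exact e
  have hι : Function.Injective ι := IsLocalization.injective _
    (powers_le_nonZeroDivisors_of_noZeroDivisors (MvPolynomial.X_ne_zero i))
  refine Function.Injective.of_comp (f := χ) ?_
  rw [← RingHom.coe_comp, hχ]
  exact hι

theorem blConst_coeff {z : reesAlgebra originIdeal.{u}} (hz : z ∈ blGrading 0) :
    z = blConst ((z : Polynomial PlaneRing.{u}).coeff 0) := by
  refine Subtype.ext (Polynomial.ext fun k => ?_)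
  change _ = (Polynomial.C _).coeff k
  rw [Polynomial.coeff_C]
  split_ifs with h
  · rw [h]
  · exact hz k h

theorem blConst_mem (r : PlaneRing.{u}) : blConst r ∈ blGrading.{u} 0 :=
  (algebraMap PlaneRing.{u} (blGrading.{u} 0) r).2

/-- The Rees algebra is generated in degree one by `x₀ T` and `x₁ T`. -/
theorem adjoin_blT : Algebra.adjoin (blGrading.{u} 0) (Set.range blT.{u}) = ⊤ := by
  let D := Algebra.adjoin (blGrading.{u} 0) (Set.range blT.{u})
  have hC : ∀ r, blConst r ∈ D := fun r => D.algebraMap_mem (⟨_, blConst_mem r⟩ : blGrading.{u} 0)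
  have hI : ∀ w ∈ originIdeal.{u}, ∃ s ∈ D, (s : Polynomial PlaneRing.{u}) =
      Polynomial.monomial 1 w := by
    intro w hw
    induction hw using Submodule.span_induction with
    | mem x hx =>
      obtain ⟨k, rfl⟩ := hx
      exact ⟨blT k, Algebra.subset_adjoin ⟨k, rfl⟩, rfl⟩
    | zero => exact ⟨0, zero_mem _, (map_zero _).symm⟩
    | add x y _ _ hx hy =>
      obtain ⟨s, hs, hx⟩ := hx
      obtain ⟨t, ht, hy⟩ := hy
      exact ⟨s + t, add_mem hs ht, by rw [map_add, ← hx, ← hy]; rfl⟩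
    | smul a x _ hx =>
      obtain ⟨s, hs, hx⟩ := hx
      refine ⟨blConst a * s, mul_mem (hC a) hs, ?_⟩
      rw [smul_eq_mul, ← Polynomial.C_mul_monomial, ← hx]
      rfl
  have key : ∀ g ∈ Algebra.adjoin PlaneRing.{u}
      (Submodule.map (Polynomial.monomial 1 : PlaneRing.{u} →ₗ[PlaneRing.{u}] _)
        originIdeal.{u} : Set (Polynomial PlaneRing.{u})),
      ∃ s ∈ D, (s : Polynomial PlaneRing.{u}) = g := by
    intro g hg
    induction hg using Algebra.adjoin_induction with
    | mem x hx =>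
      obtain ⟨w, hw, rfl⟩ := hx
      exact hI w hw
    | algebraMap r => exact ⟨blConst r, hC r, rfl⟩
    | add x y _ _ hx hy =>
      obtain ⟨s, hs, rfl⟩ := hx
      obtain ⟨t, ht, rfl⟩ := hy
      exact ⟨s + t, add_mem hs ht, rfl⟩
    | mul x y _ _ hx hy =>
      obtain ⟨s, hs, rfl⟩ := hx
      obtain ⟨t, ht, rfl⟩ := hy
      exact ⟨s * t, mul_mem hs ht, rfl⟩
  refine top_le_iff.1 fun f _ => ?_
  obtain ⟨s, hs, e⟩ := key f (by rw [adjoin_monomial_eq_reesAlgebra]; exact f.2)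
  exact (Subtype.ext e : s = f) ▸ hs

theorem blMap_surjective {i j : Fin 2} (hij : i ≠ j) : Function.Surjective (blMap.{u} i j) := by
  let B : Subalgebra (blGrading.{u} 0) (BlRing.{u} i) :=
    { (blMap.{u} i j).range with
      algebraMap_mem' := by
        rintro ⟨z, hz⟩
        refine ⟨blSubst i j ((z : Polynomial PlaneRing.{u}).coeff 0), ?_⟩
        refine (DFunLike.congr_fun (blMap_comp_blSubst hij) _).trans ?_
        refine congrArg (HomogeneousLocalization.fromZeroRingHom blGrading.{u}
          (Submonoid.powers (blT i))) (Subtype.ext ?_)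
        exact (blConst_coeff hz).symm }
  have hr : ∀ k, blElt i k ∈ B := by
    intro k
    obtain rfl | rfl : k = i ∨ k = j := by omega
    · exact ⟨1, (map_one _).trans (awayRatio_self _ _).symm⟩
    · exact ⟨MvPolynomial.X k, blMap_other hij⟩
  suffices h : B = ⊤ from fun z => (h.ge (show z ∈ ⊤ from trivial) : z ∈ B)
  rw [eq_top_iff, ← HomogeneousLocalization.Away.adjoin_mk_prod_pow_eq_top (blT_mem i) (Fin 2)
    blT.{u} adjoin_blT (fun _ => 1) blT_mem]
  refine Algebra.adjoin_le ?_
  rintro _ ⟨n, d, hd, -, rfl⟩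
  have e : HomogeneousLocalization.Away.mk blGrading.{u} (blT_mem i) n (∏ k, blT k ^ d k)
      (hd ▸ SetLike.prod_pow_mem_graded _ _ _ _ fun k _ => blT_mem k) =
      blElt i 0 ^ d 0 * blElt i 1 ^ d 1 := by
    apply HomogeneousLocalization.val_injective
    have hn : n = d 0 + d 1 := by simpa [Fin.sum_univ_two] using hd.symm
    rw [HomogeneousLocalization.Away.val_mk, Localization.mk_eq_mk', eq_comm,
      IsLocalization.eq_mk'_iff_mul_eq, HomogeneousLocalization.val_mul,
      HomogeneousLocalization.val_pow, HomogeneousLocalization.val_pow, Fin.prod_univ_two, map_mul,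
      map_pow (algebraMap (reesAlgebra originIdeal.{u}) (Localization (Submonoid.powers (blT.{u} i)))) (blT 0), map_pow (algebraMap (reesAlgebra originIdeal.{u}) (Localization (Submonoid.powers (blT.{u} i)))) (blT 1), ← algebraMap_mul_awayRatio blGrading.{u} (blT_mem i) (blT_mem 0),
      ← algebraMap_mul_awayRatio blGrading.{u} (blT_mem i) (blT_mem 1)]
    change _ * algebraMap _ _ (blT i ^ n) = _
    rw [hn, map_pow, pow_add, mul_pow, mul_pow]
    ring
  exact (congrArg (· ∈ B) e).mpr (mul_mem (pow_mem (hr 0) _) (pow_mem (hr 1) _))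

/-- The coordinates `xᵢ` and `xⱼ / xᵢ` identify the chart `D₊(xᵢ T)` with the plane. -/
def blEquiv {i j : Fin 2} (hij : i ≠ j) : PlaneRing.{u} ≃+* BlRing.{u} i :=
  RingEquiv.ofBijective (blMap i j) ⟨blMap_injective hij, blMap_surjective hij⟩

theorem blEquiv_symm_blBase {i j : Fin 2} (hij : i ≠ j) (r : PlaneRing.{u}) :
    (blEquiv hij).symm (blBase i r) = blSubst i j r := by
  rw [RingEquiv.symm_apply_eq]
  exact (DFunLike.congr_fun (blMap_comp_blSubst hij) r).symm

theorem blEquiv_symm_blElt {i j : Fin 2} (hij : i ≠ j) :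
    (blEquiv.{u} hij).symm (blElt i j) = MvPolynomial.X j := by
  rw [RingEquiv.symm_apply_eq]
  exact (blMap_other hij).symm

/-- The homomorphism of coordinate rings inverse to `xᵢ ↦ xᵢ`, `xⱼ ↦ xⱼ / xᵢ`. -/
def blInv {i j : Fin 2} (hij : i ≠ j) : BlRing.{u} i →+* PlaneRing.{u} := (blEquiv hij).symm

/-- The isomorphism of the plane with the chart `D₊(xᵢ T)` of the blowup. -/
def blSpec {i j : Fin 2} (hij : i ≠ j) : Spec (.of PlaneRing.{u}) ⟶ Spec (.of (BlRing.{u} i)) :=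
  Spec.map (CommRingCat.ofHom (blInv hij))

instance {i j : Fin 2} (hij : i ≠ j) : IsIso (blSpec.{u} hij) := by
  have : IsIso (CommRingCat.ofHom (blInv.{u} hij)) := by
    rw [ConcreteCategory.isIso_iff_bijective]
    exact (blEquiv.{u} hij).symm.bijective
  exact inferInstanceAs (IsIso (Spec.map _))

/-- The chart `D₊(xᵢ T)` of the blowup, parametrized by the plane. -/
def blChart {i j : Fin 2} (hij : i ≠ j) : Spec (.of PlaneRing.{u}) ⟶ Proj blGrading.{u} :=
  blSpec hij ≫ Proj.awayι blGrading.{u} (blT i) (blT_mem i) one_pos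

instance {i j : Fin 2} (hij : i ≠ j) : IsOpenImmersion (blChart.{u} hij) :=
  inferInstanceAs (IsOpenImmersion (_ ≫ _))

theorem blSpec_blElt {i j : Fin 2} (hij : i ≠ j) :
    (blSpec hij).appTop (specFun (blElt.{u} i j)) = specFun (MvPolynomial.X j) :=
  (specFun_map _ _).trans (congrArg specFun (blEquiv_symm_blElt hij))

theorem blChart_toSpec {i j : Fin 2} (hij : i ≠ j) : blChart.{u} hij ≫ blowupToSpec originIdeal =
    Spec.map (CommRingCat.ofHom (blSubst i j)) := by
  have e : Proj.awayι blGrading.{u} (blT i) (blT_mem i) one_pos ≫ blowupToSpec originIdeal.{u} =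
      Spec.map (CommRingCat.ofHom (blBase i)) := by
    refine (Category.assoc _ _ _).symm.trans ?_
    rw [Proj.awayι_toSpecZero, ← Spec.map_comp]
    rfl
  refine (Category.assoc _ _ _).trans ((congrArg (blSpec hij ≫ ·) e).trans ?_)
  refine (Spec.map_comp _ _).symm.trans (congrArg Spec.map ?_)
  exact congrArg CommRingCat.ofHom (RingHom.ext fun r => blEquiv_symm_blBase hij r)

theorem blCharts_cover (x : Proj blGrading.{u}) : ∃ (i j : Fin 2) (hij : i ≠ j)
    (y : Spec (.of PlaneRing.{u})), blChart hij y = x := by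
  have h := Proj.iSup_basicOpen_eq_top' blGrading.{u} (fun i : Fin 2 => blT.{u} i)
    (fun i => ⟨1, blT_mem i⟩) adjoin_blT
  obtain ⟨i, hi⟩ := TopologicalSpace.Opens.mem_iSup.1 (h.ge (show x ∈ ⊤ from trivial))
  rw [← Proj.opensRange_awayι blGrading.{u} _ (blT_mem i) one_pos] at hi
  obtain ⟨y, hy⟩ := hi
  obtain ⟨j, hij⟩ : ∃ j : Fin 2, i ≠ j := ⟨1 - i, by omega⟩
  refine ⟨i, j, hij, inv (blSpec hij) y, ?_⟩
  refine Eq.trans ?_ hy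
  refine (Scheme.Hom.comp_apply _ _ _).trans (congrArg _ ?_)
  exact (Scheme.Hom.comp_apply _ _ _).symm.trans
    (congrArg (fun k : Spec (.of (BlRing.{u} i)) ⟶ Spec (.of (BlRing.{u} i)) => k y)
      (IsIso.inv_hom_id (blSpec hij)))

end LogScheme
end
end LogGeometry

namespace LogGeometry
noncomputable section
namespace LogScheme

/-! ### Strict étale morphisms between logarithmic schemes with charts -/

variable {X Y T : LogScheme.{u}} {P : Type u} [CommMonoid P]

theorem isStrictEtale_of_inverse {F : X ⟶ Y} {G : Y ⟶ X} (h : F ≫ G = 𝟙 X) (h' : G ≫ F = 𝟙 Y) :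
    IsStrictEtale F := by
  have hf : F.f ≫ G.f = 𝟙 _ := congrArg Hom.f h
  have hf' : G.f ≫ F.f = 𝟙 _ := congrArg Hom.f h'
  have : IsIso F.f := ⟨G.f, hf, hf'⟩
  refine isStrictEtale_iff.2 ⟨inferInstance, fun {U} u _ v _ e => ?_⟩
  have ev : 𝟙 U ≫ u = v ≫ G.f := by
    rw [Category.id_comp] at e ⊢
    rw [e, Category.assoc, hf, Category.comp_id]
  refine Function.bijective_iff_has_inverse.2 ⟨G.pl (𝟙 U) ev, fun m => ?_, fun m => ?_⟩
  · have e₁ : 𝟙 U ≫ v = v ≫ G.f ≫ F.f := by rw [hf', Category.id_comp, Category.comp_id]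
    refine (comp_pl (u := v) (v := u) (w := v) G F (𝟙 U) ev (𝟙 U) e (𝟙 U) e₁
      (Category.id_comp _).symm m).symm.trans ?_
    have key : ∀ (H : Y ⟶ Y) (_ : H = 𝟙 Y) (e₁ : 𝟙 U ≫ v = v ≫ H.f), Hom.pl H (𝟙 U) e₁ m = m := by
      rintro _ rfl e₁
      exact (id_pl (𝟙 U) e₁ (Category.id_comp _) m).trans (Y.rs_id _ m)
    exact key _ h' e₁
  · have e₁ : 𝟙 U ≫ u = u ≫ F.f ≫ G.f := by rw [hf, Category.id_comp, Category.comp_id]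
    refine (comp_pl (u := u) (v := v) (w := u) F G (𝟙 U) e (𝟙 U) ev (𝟙 U) e₁
      (Category.id_comp _).symm m).symm.trans ?_
    have key : ∀ (H : X ⟶ X) (_ : H = 𝟙 X) (e₁ : 𝟙 U ≫ u = u ≫ H.f), Hom.pl H (𝟙 U) e₁ m = m := by
      rintro _ rfl e₁
      exact (id_pl (𝟙 U) e₁ (Category.id_comp _) m).trans (X.rs_id _ m)
    exact key _ h e₁

/-- Two logarithmic schemes with the same underlying scheme and with charts giving the same functions
are isomorphic. -/
theorem exists_strict_of_chart {s : Y ⟶ T} (hs : IsStrictEtale s) {θ : P →* X.GlobalSec}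
    (hθ : X.Chart θ) {θ' : P →* Y.GlobalSec} (hθ' : Y.Chart θ') (f : X.scheme ⟶ Y.scheme) [IsIso f]
    (h : ∀ p, X.ex (θ p) = f.appTop (Y.ex (θ' p))) :
    ∃ F : X ⟶ Y, F.f = f ∧ IsStrictEtale (F ≫ s) ∧ ∀ p, gsec F (θ' p) = θ p := by
  obtain ⟨F, hF, hF'⟩ := exists_hom_of_chart (T := X) hθ' f θ h
  obtain ⟨G, hG, hG'⟩ := exists_hom_of_chart (T := Y) hθ (inv f) θ' fun p => by
    rw [h, ← appTop_comp_apply, IsIso.inv_hom_id, appTop_id_apply]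
  refine ⟨F, hF, IsStrictEtale.comp (isStrictEtale_of_inverse (G := G) ?_ ?_) hs, hF'⟩
  · refine hom_ext_of_chart hθ (by rw [comp_f, hF, hG, IsIso.hom_inv_id]; rfl) fun p => ?_
    rw [gsec_comp, gsec_id, hG', hF']
  · refine hom_ext_of_chart hθ' (by rw [comp_f, hF, hG, IsIso.inv_hom_id]; rfl) fun p => ?_
    rw [gsec_comp, gsec_id, hF', hG']

/-! ### The affine plane -/

/-- The coordinates of the plane as global sections. -/
def planeSec (i : Fin 2) : A2.{u}.GlobalSec := A2.coord i

theorem ex_planeSec (i : Fin 2) : A2.{u}.ex (planeSec i) = specFun (MvPolynomial.X i : PlaneRing.{u}) :=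
  rfl

theorem planeGenerators_eq {γ : Σ U : (Spec (.of PlaneRing.{u})).Etale, Γ(U.left, ⊤)}
    (hγ : γ ∈ globalGenerators (Set.range fun i : Fin 2 =>
      specFun (MvPolynomial.X i : PlaneRing.{u}))) {V : Scheme.{u}} (a : V ⟶ Spec (.of PlaneRing.{u}))
    (b : V ⟶ γ.1.left) (h : b ≫ (γ.1.hom : γ.1.left ⟶ _) = a ≫ 𝟙 _) :
    ∃ i, b.appTop γ.2 = a.appTop (specFun (MvPolynomial.X i : PlaneRing.{u})) := by
  obtain ⟨_, ⟨i, rfl⟩, rfl⟩ := hγ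
  have e : b = a := (Category.comp_id b).symm.trans (h.trans (Category.comp_id a))
  exact ⟨i, e ▸ rfl⟩

/-- The coordinates in either order form a chart of the plane. -/
theorem chart_A2 {i j : Fin 2} (hij : i ≠ j) :
    A2.{u}.Chart (pairHom (planeSec.{u} i) (planeSec j)) := by
  refine chartAt_id_iff.1 ?_
  have hid : Etale (𝟙 A2.{u}.scheme) := inferInstance
  refine @chartAt_ofGenerators _ _ PlaneRing.{u} _ _ _ (regPair_X hij) (𝟙 A2.{u}.scheme) hid _ _ (ex_planeSec i) (ex_planeSec j) ?_
  intro γ hγ V a b h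
  obtain ⟨k, hk⟩ := planeGenerators_eq hγ a b h
  obtain rfl | rfl : k = i ∨ k = j := by omega
  · exact ⟨1, 0, 1, isUnit_one, by rw [pow_one, pow_zero, mul_one, one_mul]; exact hk⟩
  · exact ⟨0, 1, 1, isUnit_one, by rw [pow_one, pow_zero, one_mul, one_mul]; exact hk⟩

theorem isFs_A2 : IsFs A2.{u} :=
  isFs_iff.2 (EtLocally.of_self ⟨N2, inferInstance, _, fg_N2, inferInstance, isSaturatedMonoid_N2,
    chart_A2 zero_ne_one⟩)

theorem A2_hom_ext {F G : T ⟶ A2.{u}} {i j : Fin 2} (hij : i ≠ j)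
    (hi : gsec F (planeSec i) = gsec G (planeSec i))
    (hj : gsec F (planeSec j) = gsec G (planeSec j)) : F = G := by
  refine hom_ext_of_chart (chart_A2 hij) ?_ fun p => ?_
  · refine plane_spec_hom_ext hij ?_ ?_
    · exact (ex_gsec F (planeSec i)).symm.trans ((congrArg T.ex hi).trans (ex_gsec G (planeSec i)))
    · exact (ex_gsec F (planeSec j)).symm.trans ((congrArg T.ex hj).trans (ex_gsec G (planeSec j)))
  · rw [map_pairHom, map_pairHom, hi, hj]

theorem exists_A2_hom {i j : Fin 2} (hij : i ≠ j) (β γ : T.GlobalSec) :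
    ∃ F : T ⟶ A2.{u}, gsec F (planeSec i) = β ∧ gsec F (planeSec j) = γ := by
  let v : Fin 2 → Γ(T.scheme, ⊤) := fun k => if k = i then T.ex β else T.ex γ
  have hi : (specHom (planeEval v)).appTop (specFun (MvPolynomial.X i : PlaneRing.{u})) = T.ex β := by
    rw [specHom_appTop, planeEval_X]; exact if_pos rfl
  have hj : (specHom (planeEval v)).appTop (specFun (MvPolynomial.X j : PlaneRing.{u})) = T.ex γ := by
    rw [specHom_appTop, planeEval_X]; exact if_neg hij.symm
  obtain ⟨F, -, hF⟩ := exists_hom_of_chart (T := T) (chart_A2.{u} hij) (specHom (planeEval v))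
    (pairHom β γ) fun p => by
      obtain ⟨a, b, rfl⟩ := N2.exists_eq p
      rw [pairHom_mk, pairHom_mk, map_mul, map_mul, map_pow, map_pow, map_pow, map_pow, ex_planeSec,
        ex_planeSec]
      refine (congrArg₂ (· * ·) (congrArg (· ^ a) hi.symm) (congrArg (· ^ b) hj.symm)).trans ?_
      exact ((map_mul (specHom (planeEval v)).appTop.hom _ _).trans
        (congrArg₂ (· * ·) (map_pow _ _ _) (map_pow _ _ _))).symm
  have h₁ := hF (N2.mk 1 0)
  have h₂ := hF (N2.mk 0 1)
  rw [pairHom_mk, pairHom_mk, pow_one, pow_zero, mul_one, pow_one, pow_zero, mul_one] at h₁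
  rw [pairHom_mk, pairHom_mk, pow_one, pow_zero, one_mul, pow_one, pow_zero, one_mul] at h₂
  exact ⟨F, h₁, h₂⟩

/-! ### The charts of the projective line and of the blowup -/

/-- Two strict étale charts of `X`, with a section `ρ i` of the logarithmic structure of each, such that
the locus in either chart where the section is invertible lies in the overlap. -/
structure TwoCharts (X : LogScheme.{u}) where
  L : Fin 2 → LogScheme.{u}
  s : ∀ i, L i ⟶ X
  strict : ∀ i, IsStrictEtale (s i)
  cover : ∀ x : X.scheme, ∃ (i : Fin 2) (y : (L i).scheme), (s i).f y = x
  ρ : ∀ i, (L i).GlobalSec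
  factor : ∀ {T : LogScheme.{u}} {i j : Fin 2} (_ : i ≠ j) (q : T ⟶ L i), IsUnit (gsec q (ρ i)) →
    ∃ q' : T ⟶ L j, q' ≫ s j = q ≫ s i

/-- The charts of a logarithmic scheme on `Proj` given by two elements `a 0`, `a 1` of degree one. -/
def twoChartsOfProj {A σ : Type u} [CommRing A] [SetLike σ A] [AddSubgroupClass σ A] (𝒜 : ℕ → σ)
    [GradedRing 𝒜] (a : Fin 2 → A) (ha : ∀ i, a i ∈ 𝒜 1) (X : LogScheme.{u})
    (e : X.scheme ⟶ Proj 𝒜) [IsIso e] (L : Fin 2 → LogScheme.{u}) (s : ∀ i, L i ⟶ X)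
    (strict : ∀ i, IsStrictEtale (s i))
    (c : ∀ i, (L i).scheme ⟶ Spec (.of (HomogeneousLocalization.Away 𝒜 (a i)))) [∀ i, IsIso (c i)]
    (hc : ∀ i, (s i).f ≫ e = c i ≫ Proj.awayι 𝒜 (a i) (ha i) one_pos)
    (cover : ∀ x : X.scheme, ∃ (i : Fin 2) (y : (L i).scheme), (s i).f y = x)
    (ρ : ∀ i, (L i).GlobalSec)
    (hρ : ∀ i j, i ≠ j → (L i).ex (ρ i) = (c i).appTop (specFun (awayRatio 𝒜 (ha i) (ha j)))) :
    TwoCharts X where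
  L := L
  s := s
  strict := strict
  cover := cover
  ρ := ρ
  factor {T i j} hij q hq := by
    have hq' := isUnit_iff_ex.1 hq
    rw [ex_gsec, hρ i j hij, ← appTop_comp_apply] at hq'
    obtain ⟨g, hg⟩ := exists_factor_away 𝒜 (ha i) (ha j) (q.f ≫ c i) hq'
    have e₁ : (g ≫ inv (c j)) ≫ (s j).f = (q ≫ s i).f := by
      rw [← cancel_mono e, Category.assoc, Category.assoc, hc, IsIso.inv_hom_id_assoc, hg, comp_f,
        Category.assoc, Category.assoc, hc]
    obtain ⟨q', ⟨h, -⟩, -⟩ := (strict j).existsUnique_lift (q ≫ s i) _ e₁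
    exact ⟨q', h⟩

namespace TwoCharts

variable (C : TwoCharts X)

theorem etLocally (p : T ⟶ X) : EtLocally T fun U b => ∃ i, ∃ q : U ⟶ C.L i, q ≫ C.s i = b ≫ p := by
  have h : EtLocally X fun U a => ∃ i, ∃ q : U ⟶ C.L i, q ≫ C.s i = a := fun x => by
    obtain ⟨i, y, hy⟩ := C.cover x
    exact ⟨C.L i, C.s i, y, C.strict i, hy, i, 𝟙 _, Category.id_comp _⟩
  refine (h.pull p).mono ?_
  rintro V b - ⟨U, a, d, -, hd, i, q, hq⟩
  exact ⟨i, d ≫ q, by rw [Category.assoc, hq, hd]⟩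

/-- Two morphisms to `X` agree if they agree wherever both land in the same chart, and if they land in
both charts wherever they land in different ones. -/
theorem hom_ext {p p' : T ⟶ X}
    (hs : ∀ (U : LogScheme.{u}) (b : U ⟶ T), IsStrictEtale b → ∀ i (q q' : U ⟶ C.L i),
      q ≫ C.s i = b ≫ p → q' ≫ C.s i = b ≫ p' → q = q')
    (hd : ∀ (U : LogScheme.{u}) (b : U ⟶ T), IsStrictEtale b → ∀ i j (_ : i ≠ j) (q : U ⟶ C.L i)
      (q' : U ⟶ C.L j), q ≫ C.s i = b ≫ p → q' ≫ C.s j = b ≫ p' → IsUnit (gsec q (C.ρ i))) :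
    p = p' := by
  have h : EtLocally T fun U b => b ≫ p = b ≫ p' := by
    refine (C.etLocally p).bind fun U b hb => ?_
    rintro ⟨i, q, hq⟩
    refine (C.etLocally (b ≫ p')).mono fun V d hd' => ?_
    rintro ⟨j, q', hq'⟩
    rw [← Category.assoc] at hq'
    have hq₁ : (d ≫ q) ≫ C.s i = (d ≫ b) ≫ p := by rw [Category.assoc, hq, Category.assoc]
    by_cases hij : i = j
    · subst hij
      have e := hs V (d ≫ b) (hd'.comp hb) i _ _ hq₁ hq'
      rw [← hq₁, ← hq', e]
    · obtain ⟨q'', hq''⟩ := C.factor hij _ (hd V (d ≫ b) (hd'.comp hb) i j hij _ _ hq₁ hq')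
      have e := hs V (d ≫ b) (hd'.comp hb) j _ _ (hq''.trans hq₁) hq'
      rw [← hq₁, ← hq', ← e, hq'']
  choose U a y ha hy h using h
  exact hom_ext_of_cover ha (fun t => ⟨t, y t, hy t⟩) h

end TwoCharts

/-- Morphisms which exist étale locally and are unique glue. -/
theorem exists_hom_of_local (Good : ∀ ⦃U : LogScheme.{u}⦄, (U ⟶ T) → (U ⟶ X) → Prop)
    (hres : ∀ (U V : LogScheme.{u}) (a : U ⟶ T) (b : V ⟶ U) (p : U ⟶ X), IsStrictEtale a →
      IsStrictEtale b → Good a p → Good (b ≫ a) (b ≫ p))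
    (huniq : ∀ (U : LogScheme.{u}) (a : U ⟶ T) (p p' : U ⟶ X), IsStrictEtale a → Good a p →
      Good a p' → p = p')
    (hex : EtLocally T fun _ a => ∃ p, Good a p) :
    ∃ p : T ⟶ X, EtLocally T fun _ a => Good a (a ≫ p) := by
  choose U a y ha hy p hp using hex
  obtain ⟨G, hG⟩ := exists_hom_of_cover ha (fun t => ⟨t, y t, hy t⟩) p
    fun k l Z b d hb hd e => huniq Z (b ≫ a k) _ _ (hb.comp (ha k)) (hres _ _ _ _ _ (ha k) hb (hp k))
      (e ▸ hres _ _ _ _ _ (ha l) hd (hp l))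
  refine ⟨G, fun t => ⟨U t, a t, y t, ha t, hy t, ?_⟩⟩
  change Good _ _
  rw [hG]
  exact hp t

end LogScheme
end
end LogGeometry

namespace LogGeometry
noncomputable section
namespace LogScheme

attribute [local instance] MvPolynomial.gradedAlgebra

variable {X T : LogScheme.{u}}

theorem exists_monomial_left {A : Type u} [CommMonoid A] {z x : A} (y : A) (h : z = x) :
    ∃ (i j : ℕ) (e : A), IsUnit e ∧ z = e * (x ^ i * y ^ j) :=
  ⟨1, 0, 1, isUnit_one, by simp [h]⟩

theorem exists_monomial_right {A : Type u} [CommMonoid A] {z y : A} (x : A) (h : z = y) :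
    ∃ (i j : ℕ) (e : A), IsUnit e ∧ z = e * (x ^ i * y ^ j) :=
  ⟨0, 1, 1, isUnit_one, by simp [h]⟩

theorem exists_monomial_unit {A : Type u} [CommMonoid A] {z : A} (x y : A) (h : IsUnit z) :
    ∃ (i j : ℕ) (e : A), IsUnit e ∧ z = e * (x ^ i * y ^ j) :=
  ⟨0, 0, z, h, by simp⟩

/-! ### Sections over an étale scheme as global sections -/

section Induced

variable {U : Scheme.{u}} (u : U ⟶ X.scheme) [Etale u]

/-- The sections of `M` over an étale `U → X` are the global sections of the logarithmic structure
induced on `U`. -/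
def indSec : X.Sec u ≃* (X.induced u).GlobalSec :=
  haveI : Etale (X.inducedMap u).f := ‹Etale u›
  (isStrictEtale_inducedMap X u).secEquiv

theorem ex_indSec (m : X.Sec u) : (X.induced u).ex (indSec u m) = X.ex m := by
  refine ((X.inducedMap u).ex_pl (u := 𝟙 _) (v := u) (𝟙 _) rfl m).trans ?_
  exact appTop_id_apply _

theorem chart_indSec {σ₀ σ₁ : X.Sec u} (h : X.ChartAt u (pairHom σ₀ σ₁)) :
    (X.induced u).Chart (pairHom (indSec u σ₀) (indSec u σ₁)) := by
  have : Etale (X.inducedMap u).f := ‹Etale u›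
  have h' := (@chartAt_iff_chart _ _ _ _ _ (isStrictEtale_inducedMap X u) this
    (pairHom σ₀ σ₁)).1 h
  have e : (indSec u).toMonoidHom.comp (pairHom σ₀ σ₁) = pairHom (indSec u σ₀) (indSec u σ₁) :=
    MonoidHom.ext fun p => map_pairHom (indSec u).toMonoidHom _ _ p
  exact e ▸ h'

theorem ggp_inducedMap {α : X.GlobalGp} {σ : X.Sec u}
    (h : X.grs u (Category.comp_id u) α = X.tg (Algebra.GrothendieckGroup.of σ)) :
    ggp (X.inducedMap u) α = qt _ (indSec u σ) := by
  have := grs_gpPullback (X.inducedMap u) α (u := 𝟙 _) (v := u) (𝟙 _) rfl _ h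
  refine ((grs_id (X.induced u) _ _).symm.trans this).trans ?_
  exact congrArg _ (gpMap_of _ _)

theorem ggp_inducedMap_inv {α : X.GlobalGp} {σ : X.Sec u}
    (h : X.grs u (Category.comp_id u) α = (X.tg (Algebra.GrothendieckGroup.of σ))⁻¹) :
    ggp (X.inducedMap u) α = (qt _ (indSec u σ))⁻¹ := by
  have h' : X.grs u (Category.comp_id u) α⁻¹ = X.tg (Algebra.GrothendieckGroup.of σ) := by
    rw [map_inv, h, inv_inv]
  rw [← ggp_inducedMap u h', ggp_inv, inv_inv]

end Induced

/-! ### Morphisms to the projective line -/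

theorem exists_lineGenerator {γ : Σ U : (Proj planeGrading.{u}).Etale, Γ(U.left, ⊤)}
    (hγ : γ ∈ lineGenerators.{u}) : ∃ k l, k ≠ l ∧ γ = ⟨lineChart k, lineRatio k l⟩ := by
  rcases hγ with rfl | rfl
  · exact ⟨0, 1, zero_ne_one, rfl⟩
  · exact ⟨1, 0, one_ne_zero, rfl⟩

/-- The chart `D₊(xᵢ)` of the projective line. -/
def lineι (i : Fin 2) : Spec (.of (LineRing.{u} i)) ⟶ P1.{u}.scheme :=
  Proj.awayι planeGrading.{u} (MvPolynomial.X i) (X_mem_planeGrading i) one_pos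

instance isOpenImmersion_lineι (i : Fin 2) : IsOpenImmersion (lineι.{u} i) :=
  inferInstanceAs (IsOpenImmersion (Proj.awayι planeGrading.{u} _ (X_mem_planeGrading i) one_pos))

instance etale_lineι (i : Fin 2) : Etale (lineι.{u} i) :=
  inferInstanceAs (Etale (Proj.awayι planeGrading.{u} _ (X_mem_planeGrading i) one_pos))

/-- The section `xⱼ / xᵢ` of the logarithmic structure over `D₊(xᵢ)`. -/
def lineSec : ∀ i : Fin 2, P1.{u}.Sec (lineι i)
  | 0 => P1.ratio
  | 1 => P1.ratio'

theorem ne_one_sub (i : Fin 2) : i ≠ 1 - i := by omega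

theorem ex_lineSec : ∀ i : Fin 2, P1.{u}.ex (lineSec i) = specFun (lineElt i (1 - i))
  | 0 => rfl
  | 1 => rfl

theorem chartAt_line (i : Fin 2) :
    P1.{u}.ChartAt (lineι i) (pairHom (lineSec i) (1 : P1.{u}.Sec (lineι i))) := by
  refine @chartAt_ofGenerators _ lineGenerators.{u} _ _ (lineElt i (1 - i)) 1
    (regPair_one fun x => lineElt_regular x) (lineι i) (etale_lineι i) (lineSec i)
    (1 : P1.{u}.Sec (lineι i)) (ex_lineSec i)
    ((map_one (P1.{u}.ex (u := lineι i))).trans specFun_one.symm) ?_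
  intro γ hγ V a b h
  obtain ⟨k, l, hkl, rfl⟩ := exists_lineGenerator hγ
  have h' : (show V ⟶ Spec (.of (LineRing.{u} k)) from b) ≫ lineι k = a ≫ lineι i := h
  by_cases hk : k = i
  · subst hk
    obtain rfl : l = 1 - k := by omega
    have e : (show V ⟶ Spec (.of (LineRing.{u} k)) from b) = a := (cancel_mono (lineι k)).1 h'
    exact exists_monomial_left _ (congrArg (fun g : V ⟶ Spec (.of (LineRing.{u} k)) =>
      g.appTop (specFun (lineElt k (1 - k)))) e)
  · obtain rfl : l = i := by omega
    have e := away_ratio_mul' planeGrading.{u} (X_mem_planeGrading k) (X_mem_planeGrading l) _ _ h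
    exact exists_monomial_unit _ _ (IsUnit.of_mul_eq_one _ e)

/-- The chart `D₊(xᵢ)` of the projective line with the induced logarithmic structure. -/
def lineLog (i : Fin 2) : LogScheme.{u} := P1.{u}.induced (lineι i)

/-- The inclusion of the chart `D₊(xᵢ)`. -/
def lineIncl (i : Fin 2) : lineLog.{u} i ⟶ P1.{u} := P1.{u}.inducedMap (lineι i)

theorem isStrictEtale_lineIncl (i : Fin 2) : IsStrictEtale (lineIncl.{u} i) :=
  isStrictEtale_inducedMap P1.{u} (lineι i)

/-- The section `xⱼ / xᵢ` of the chart `D₊(xᵢ)`. -/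
def lineRho (i : Fin 2) : (lineLog.{u} i).GlobalSec := indSec (lineι i) (lineSec i)

theorem chart_lineLog (i : Fin 2) : (lineLog.{u} i).Chart (pairHom (lineRho i) 1) := by
  have h := chart_indSec (lineι.{u} i) (chartAt_line i)
  have e : indSec (lineι.{u} i) (1 : P1.{u}.Sec (lineι i)) = 1 := map_one _
  rwa [e] at h

theorem ex_lineRho (i : Fin 2) : (lineLog.{u} i).ex (lineRho i) = specFun (lineElt i (1 - i)) :=
  (ex_indSec (lineι i) (lineSec i)).trans (ex_lineSec i)

theorem line_hom_ext {i : Fin 2} {F G : T ⟶ lineLog.{u} i}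
    (h : gsec F (lineRho i) = gsec G (lineRho i)) : F = G := by
  refine hom_ext_of_chart (chart_lineLog i) ?_ fun p => ?_
  · refine spec_hom_ext (R := LineRing.{u} i) fun r => DFunLike.congr_fun
      (lineRing_hom_ext (φ := funHom (R := LineRing.{u} i) F.f)
        (ψ := funHom (R := LineRing.{u} i) G.f) (ne_one_sub i) ?_) r
    have h' := congrArg T.ex h
    rw [ex_gsec, ex_gsec, ex_lineRho] at h'
    exact h'
  · rw [map_pairHom, map_pairHom, h, map_one, map_one]

theorem exists_line_hom (i : Fin 2) (r : T.GlobalSec) :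
    ∃ F : T ⟶ lineLog.{u} i, gsec F (lineRho i) = r := by
  obtain ⟨φ, hφ⟩ := exists_lineRing_hom (ne_one_sub i) (T.ex r)
  have h : (specHom φ).appTop (specFun (lineElt i (1 - i))) = T.ex r := (specHom_appTop _ _).trans hφ
  obtain ⟨F, -, hF⟩ := exists_hom_of_chart (T := T) (chart_lineLog.{u} i) (specHom φ)
    (pairHom r 1) fun p => by
      obtain ⟨a, b, rfl⟩ := N2.exists_eq p
      rw [pairHom_mk, pairHom_mk, one_pow, one_pow, mul_one, mul_one, map_pow, map_pow, ex_lineRho]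
      refine (congrArg (· ^ a) h.symm).trans ?_
      exact (map_pow (specHom φ).appTop.hom _ _).symm
  have h₁ := hF (N2.mk 1 0)
  rw [pairHom_mk, pairHom_mk, one_pow, mul_one, pow_one, one_pow, mul_one, pow_one] at h₁
  exact ⟨F, h₁⟩

/-- The coordinate of the projective line as a global section. -/
def lineCoord : P1.{u}.GlobalGp := P1.coord

theorem ggp_lineIncl_zero : ggp (lineIncl.{u} 0) lineCoord = qt _ (lineRho 0) :=
  ggp_inducedMap (lineι.{u} 0) (α := lineCoord) (σ := lineSec 0) P1.coord_spec.1

theorem ggp_lineIncl_one : ggp (lineIncl.{u} 1) lineCoord = (qt _ (lineRho 1))⁻¹ :=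
  ggp_inducedMap_inv (lineι.{u} 1) (α := lineCoord) (σ := lineSec 1) P1.coord_spec.2

theorem lineCover (x : P1.{u}.scheme) : ∃ (i : Fin 2) (y : (lineLog.{u} i).scheme),
    (lineIncl i).f y = x := by
  obtain ⟨i, y, hy⟩ := P1.charts_cover x
  refine ⟨i, y, Eq.trans ?_ hy⟩
  exact congrArg (fun k : (P1.chart.{u} i).left ⟶ P1.{u}.scheme => k y)
    (etaleHomMk_left (V := P1.{u}.top) (P1.chart i).hom (Category.comp_id _)).symm

/-- The standard charts of the projective line. -/
def lineCharts : TwoCharts P1.{u} :=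
  haveI : IsIso (show P1.{u}.scheme ⟶ Proj planeGrading.{u} from 𝟙 (Proj planeGrading.{u})) :=
    inferInstanceAs (IsIso (𝟙 (Proj planeGrading.{u})))
  let c : ∀ i : Fin 2, (lineLog.{u} i).scheme ⟶ Spec (.of (LineRing.{u} i)) :=
    fun i => 𝟙 (Spec (.of (LineRing.{u} i)))
  haveI : ∀ i, IsIso (c i) := fun i => inferInstanceAs (IsIso (𝟙 (Spec (.of (LineRing.{u} i)))))
  twoChartsOfProj planeGrading.{u} (fun i => MvPolynomial.X i) X_mem_planeGrading P1.{u}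
    (show P1.{u}.scheme ⟶ Proj planeGrading.{u} from 𝟙 (Proj planeGrading.{u})) lineLog lineIncl
    isStrictEtale_lineIncl c
    (fun i => (Category.comp_id _).trans (Category.id_comp _).symm) lineCover lineRho
    (fun i j hij => by
      obtain rfl : j = 1 - i := by omega
      exact (ex_lineRho i).trans (appTop_id_apply (A := Spec (.of (LineRing.{u} i))) _).symm)

end LogScheme
end
end LogGeometry

namespace LogGeometry
noncomputable section
namespace LogScheme

variable {X T : LogScheme.{u}}

/-! ### The charts of the blowup -/

theorem appTop_mem_genSections {S : Scheme.{u}} {G : Generators S}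
    {γ : Σ U : S.Etale, Γ(U.left, ⊤)} (hγ : γ ∈ G) {U : S.Etale} (b : U.left ⟶ γ.1.left)
    (hb : b ≫ γ.1.hom = U.hom) {f : Γ(U.left, ⊤)} (hf : b.appTop γ.2 = f) :
    f ∈ genSections G U := by
  have h := generator_mem_genSections G hγ (etaleHomMk b hb)
  rw [etaleHomMk_left, hf] at h
  exact h

theorem exists_blowupGenerator {γ : Σ U : (blowup originIdeal.{u}).Etale, Γ(U.left, ⊤)}
    (hγ : γ ∈ blowupGenerators.{u}) :
    (∃ k : Fin 2, γ = ⟨Scheme.Etale.mk (𝟙 (blowup originIdeal.{u})),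
      (blowupToSpec originIdeal.{u}).appTop (specFun (MvPolynomial.X k : PlaneRing.{u}))⟩) ∨
    ∃ k l, k ≠ l ∧ γ = ⟨blowupChart k, blowupRatio k l⟩ := by
  rcases hγ with ⟨_, ⟨k, rfl⟩, rfl⟩ | rfl | rfl
  · exact Or.inl ⟨k, rfl⟩
  · exact Or.inr ⟨0, 1, zero_ne_one, rfl⟩
  · exact Or.inr ⟨1, 0, one_ne_zero, rfl⟩

/-- The chart `D₊(xᵢ T)` of the blowup, a copy of the plane. -/
def blι (i : Fin 2) : Spec (.of PlaneRing.{u}) ⟶ Bl.{u}.scheme := blChart (ne_one_sub i)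

instance etale_blι (i : Fin 2) : Etale (blι.{u} i) :=
  have : Etale (blChart.{u} (ne_one_sub i)) := inferInstance
  this

theorem blι_toSpec (i j : Fin 2) : (blι.{u} i).appTop ((blowupToSpec originIdeal.{u}).appTop
    (specFun (MvPolynomial.X j : PlaneRing.{u}))) =
      specFun (blSubst i (1 - i) (MvPolynomial.X j)) := by
  refine (appTop_comp_apply _ _ _).symm.trans ?_
  refine (congrArg (fun k : Spec (.of PlaneRing.{u}) ⟶ Spec (.of PlaneRing.{u}) => k.appTop
    (specFun (MvPolynomial.X j : PlaneRing.{u}))) (blChart_toSpec (ne_one_sub i))).trans ?_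
  exact specFun_map _ _

/-- The coordinate `xᵢ` on `D₊(xᵢ T)`. -/
def blBaseSec (i : Fin 2) : Bl.{u}.Sec (blι i) :=
  @genSec _ blowupGenerators.{u} _ (blι i) (etale_blι i)
    (specFun (MvPolynomial.X i : PlaneRing.{u}))
    (appTop_mem_genSections (U := @Scheme.Etale.mk _ _ (blι i) (etale_blι i))
      (γ := ⟨Scheme.Etale.mk (𝟙 (blowup originIdeal.{u})),
        (blowupToSpec originIdeal.{u}).appTop (specFun (MvPolynomial.X i : PlaneRing.{u}))⟩)
      (Or.inl ⟨_, ⟨i, rfl⟩, rfl⟩) (blι i) (Category.comp_id _)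
      ((blι_toSpec i i).trans (congrArg specFun (blSubst_self _ _))))

theorem ratio_mem_blowupGenerators : ∀ i : Fin 2,
    (⟨blowupChart i, blowupRatio i (1 - i)⟩ : Σ U : (blowup originIdeal.{u}).Etale, Γ(U.left, ⊤)) ∈
      blowupGenerators.{u}
  | 0 => Or.inr (Or.inl rfl)
  | 1 => Or.inr (Or.inr rfl)

/-- The coordinate `xⱼ / xᵢ` on `D₊(xᵢ T)`. -/
def blRatioSec (i : Fin 2) : Bl.{u}.Sec (blι i) :=
  @genSec _ blowupGenerators.{u} _ (blι i) (etale_blι i)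
    (specFun (MvPolynomial.X (1 - i) : PlaneRing.{u}))
    (appTop_mem_genSections (U := @Scheme.Etale.mk _ _ (blι i) (etale_blι i))
      (ratio_mem_blowupGenerators i) (blSpec (ne_one_sub i)) rfl (blSpec_blElt (ne_one_sub i)))

theorem chartAt_bl (i : Fin 2) : Bl.{u}.ChartAt (blι i) (pairHom (blBaseSec i) (blRatioSec i)) := by
  refine @chartAt_ofGenerators _ blowupGenerators.{u} _ _ (MvPolynomial.X i)
    (MvPolynomial.X (1 - i)) (regPair_X (ne_one_sub i)) (blι i) (etale_blι i) (blBaseSec i)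
    (blRatioSec i) rfl rfl ?_
  intro γ hγ V a b h
  obtain ⟨k, rfl⟩ | ⟨k, l, hkl, rfl⟩ := exists_blowupGenerator hγ
  · have e : b.appTop ((blowupToSpec originIdeal.{u}).appTop
        (specFun (MvPolynomial.X k : PlaneRing.{u}))) =
          a.appTop (specFun (blSubst i (1 - i) (MvPolynomial.X k))) := by
      refine Eq.trans ?_ (congrArg a.appTop (blι_toSpec i k))
      refine Eq.trans ?_ (appTop_comp_apply _ _ _)
      exact congrArg (fun g : V ⟶ Bl.{u}.scheme => g.appTop ((blowupToSpec originIdeal.{u}).appTop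
        (specFun (MvPolynomial.X k : PlaneRing.{u})))) ((Category.comp_id b).symm.trans h)
    by_cases hk : k = i
    · subst hk
      exact exists_monomial_left _ (e.trans (congrArg (fun r => a.appTop (specFun r))
        (blSubst_self k _)))
    · obtain rfl : k = 1 - i := by omega
      refine ⟨1, 1, 1, isUnit_one, ?_⟩
      rw [pow_one, pow_one, one_mul]
      refine e.trans ((congrArg (fun r => a.appTop (specFun r)) (blSubst_other (ne_one_sub i))).trans ?_)
      exact (congrArg a.appTop (specFun_mul _ _)).trans (map_mul a.appTop.hom _ _)
  · have h' : (show V ⟶ Spec (.of (BlRing.{u} k)) from b) ≫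
        Proj.awayι blGrading.{u} (blT k) (blT_mem k) one_pos = (a ≫ blSpec (ne_one_sub i)) ≫
          Proj.awayι blGrading.{u} (blT i) (blT_mem i) one_pos :=
      h.trans (Category.assoc _ _ _).symm
    by_cases hk : k = i
    · subst hk
      obtain rfl : l = 1 - k := by omega
      have e := (cancel_mono _).1 h'
      refine exists_monomial_right _ ((congrArg (fun g : V ⟶ Spec (.of (BlRing.{u} k)) =>
        g.appTop (specFun (blElt k (1 - k)))) e).trans ?_)
      exact (appTop_comp_apply _ _ _).trans (congrArg a.appTop (blSpec_blElt (ne_one_sub k)))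
    · obtain rfl : l = i := by omega
      have e := away_ratio_mul' blGrading.{u} (blT_mem k) (blT_mem l) _ _ h'
      exact exists_monomial_unit _ _ (IsUnit.of_mul_eq_one _ e)

theorem exists_blHom (i : Fin 2) : ∃ F : A2.{u} ⟶ Bl.{u}, F.f = blι i ∧ IsStrictEtale F := by
  let f : A2.{u}.scheme ⟶ (Bl.{u}.induced (blι i)).scheme := 𝟙 (Spec (.of PlaneRing.{u}))
  have hf : IsIso f := inferInstanceAs (IsIso (𝟙 (Spec (.of PlaneRing.{u}))))
  obtain ⟨F, hF, hs, -⟩ := exists_strict_of_chart (isStrictEtale_inducedMap Bl.{u} (blι i))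
    (chart_A2 (ne_one_sub i)) (chart_indSec (blι.{u} i) (chartAt_bl i)) f fun p => by
      obtain ⟨a, b, rfl⟩ := N2.exists_eq p
      rw [pairHom_mk, pairHom_mk, map_mul, map_mul, map_pow, map_pow, map_pow, map_pow]
      refine Eq.trans ?_ (appTop_id_apply (A := Spec (.of PlaneRing.{u})) _).symm
      exact congrArg₂ (· * ·) (congrArg (· ^ a) (ex_indSec (blι i) (blBaseSec i)).symm)
        (congrArg (· ^ b) (ex_indSec (blι i) (blRatioSec i)).symm)
  exact ⟨_, (congrArg (fun g : Spec (.of PlaneRing.{u}) ⟶ Spec (.of PlaneRing.{u}) => g ≫ blι i)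
    hF).trans (Category.id_comp _), hs⟩

/-- The chart `D₊(xᵢ T)` of the blowup, as a morphism of logarithmic schemes. -/
def blIncl (i : Fin 2) : A2.{u} ⟶ Bl.{u} := (exists_blHom i).choose

theorem blIncl_f (i : Fin 2) : (blIncl.{u} i).f = blι i := (exists_blHom i).choose_spec.1

theorem isStrictEtale_blIncl (i : Fin 2) : IsStrictEtale (blIncl.{u} i) :=
  (exists_blHom i).choose_spec.2

theorem A2_ex_injective : Function.Injective (A2.{u}.ex (u := 𝟙 A2.{u}.scheme)) :=
  @genEx_injective _ _ _ (𝟙 A2.{u}.scheme) (inferInstanceAs (Etale (𝟙 A2.{u}.scheme)))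

theorem ex_gsec_blIncl_blowupMap (i j : Fin 2) :
    A2.{u}.ex (gsec (blIncl i ≫ blowupMap) (planeSec j)) =
      specFun (blSubst i (1 - i) (MvPolynomial.X j)) := by
  refine (ex_gsec _ _).trans ?_
  refine Eq.trans ?_ (blι_toSpec i j)
  refine (appTop_comp_apply (blIncl.{u} i).f blowupMap.{u}.f _).trans ?_
  exact congrArg (fun g : Spec (.of PlaneRing.{u}) ⟶ Bl.{u}.scheme => g.appTop
    ((blowupToSpec originIdeal.{u}).appTop (specFun (MvPolynomial.X j : PlaneRing.{u})))) (blIncl_f i)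

theorem gsec_blIncl_blowupMap_self (i : Fin 2) :
    gsec (blIncl.{u} i ≫ blowupMap) (planeSec i) = planeSec i := by
  refine A2_ex_injective ((ex_gsec_blIncl_blowupMap i i).trans ?_)
  rw [blSubst_self]
  rfl

theorem gsec_blIncl_blowupMap_other (i : Fin 2) :
    gsec (blIncl.{u} i ≫ blowupMap) (planeSec (1 - i)) = planeSec i * planeSec (1 - i) := by
  refine A2_ex_injective ((ex_gsec_blIncl_blowupMap i (1 - i)).trans ?_)
  rw [blSubst_other (ne_one_sub i), specFun_mul, map_mul]
  rfl

theorem blCover (x : Bl.{u}.scheme) : ∃ (i : Fin 2) (y : A2.{u}.scheme), (blIncl i).f y = x := by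
  obtain ⟨i, j, hij, y, hy⟩ := blCharts_cover x
  obtain rfl : j = 1 - i := by omega
  exact ⟨i, y, (congrArg (fun g : Spec (.of PlaneRing.{u}) ⟶ Bl.{u}.scheme => g y)
    (blIncl_f i)).trans hy⟩

/-- The standard charts of the blowup. -/
def blCharts : TwoCharts Bl.{u} :=
  haveI : IsIso (show Bl.{u}.scheme ⟶ Proj blGrading.{u} from 𝟙 (Proj blGrading.{u})) :=
    inferInstanceAs (IsIso (𝟙 (Proj blGrading.{u})))
  let c : ∀ i : Fin 2, A2.{u}.scheme ⟶ Spec (.of (BlRing.{u} i)) := fun i => blSpec (ne_one_sub i)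
  haveI : ∀ i, IsIso (c i) := fun i => inferInstanceAs (IsIso (blSpec.{u} (ne_one_sub i)))
  twoChartsOfProj blGrading.{u} blT blT_mem Bl.{u}
    (show Bl.{u}.scheme ⟶ Proj blGrading.{u} from 𝟙 (Proj blGrading.{u})) (fun _ => A2) blIncl
    isStrictEtale_blIncl c
    (fun i => (Category.comp_id _).trans (blIncl_f i)) blCover (fun i => planeSec (1 - i))
    (fun i j hij => by
      obtain rfl : j = 1 - i := by omega
      exact (blSpec_blElt (ne_one_sub i)).symm)

theorem isFs_Bl : IsFs Bl.{u} :=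
  isFs_of_etLocally fun x => by
    obtain ⟨i, y, hy⟩ := blCover x
    exact ⟨A2, blIncl i, y, isStrictEtale_blIncl i, hy, isFs_A2⟩

end LogScheme
end
end LogGeometry

namespace LogGeometry
noncomputable section
namespace LogScheme

variable {X T : LogScheme.{u}}

/-! ### The functors of points of the projective line and of the blowup -/

/-- The exponents of `x₀⁻¹ x₁` in the coordinates `x₁ / x₀` and `x₀ / x₁` of the two charts. -/
def chartSign : Fin 2 → ℤ
  | 0 => 1
  | 1 => -1

theorem chartSign_injective {G : Type*} [CommGroup G] {i : Fin 2} {x y : G}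
    (h : x ^ chartSign i = y ^ chartSign i) : x = y := by
  match i with
  | 0 => simpa [chartSign] using h
  | 1 => simpa [chartSign] using h

theorem chartSign_mul_eq_one {G : Type*} [CommGroup G] {i j : Fin 2} (hij : i ≠ j) {x y : G}
    (h : x ^ chartSign i = y ^ chartSign j) : x * y = 1 := by
  match i, j with
  | 0, 0 | 1, 1 => exact absurd rfl hij
  | 0, 1 =>
    rw [chartSign, chartSign, zpow_one, zpow_neg_one] at h
    rw [h, inv_mul_cancel]
  | 1, 0 =>
    rw [chartSign, chartSign, zpow_one, zpow_neg_one] at h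
    rw [← h, mul_inv_cancel]

theorem ggp_zpow (F : X ⟶ T) (s : T.GlobalGp) (n : ℤ) : ggp F (s ^ n) = ggp F s ^ n :=
  map_zpow (ggpHom F) s n

/-- A section of `Mᵍᵖ` is locally comparable to `1` if, étale locally, it or its inverse is in `M`. -/
def LocComparable (T : LogScheme.{u}) (α : T.GlobalGp) : Prop :=
  EtLocally T fun U a => ∃ (i : Fin 2) (r : U.GlobalSec), ggp a α = qt U r ^ chartSign i

theorem LocComparable.pull {α : T.GlobalGp} (h : LocComparable T α) (F : X ⟶ T) :
    LocComparable X (ggp F α) := by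
  refine (EtLocally.pull h F).mono ?_
  rintro V b - ⟨U, a, d, -, e, i, r, hr⟩
  refine ⟨i, gsec d r, ?_⟩
  rw [← ggp_comp, ← e, ggp_comp, hr, ggp_zpow, ggp_qt]

namespace TwoCharts

variable (C : TwoCharts X) {τ : X.GlobalGp}

theorem ggp_comp_s (hτ : ∀ i, ggp (C.s i) τ = qt _ (C.ρ i) ^ chartSign i)
    {i : Fin 2} (q : T ⟶ C.L i) :
    ggp (q ≫ C.s i) τ = qt T (gsec q (C.ρ i)) ^ chartSign i := by
  rw [ggp_comp, hτ, ggp_zpow, ggp_qt]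

theorem locComparable (hτ : ∀ i, ggp (C.s i) τ = qt _ (C.ρ i) ^ chartSign i)
    (p : T ⟶ X) : LocComparable T (ggp p τ) := by
  refine (C.etLocally p).mono ?_
  rintro U a - ⟨i, q, hq⟩
  exact ⟨i, gsec q (C.ρ i), by rw [← ggp_comp, ← hq, C.ggp_comp_s hτ]⟩

/-- Morphisms to `X` with the same pullback of `τ` agree if this holds for morphisms to the charts
with the same pullback of the coordinate. -/
theorem hom_ext_of_ggp (hτ : ∀ i, ggp (C.s i) τ = qt _ (C.ρ i) ^ chartSign i)
    (hT : IsFs T) {p p' : T ⟶ X} (h : ggp p τ = ggp p' τ)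
    (hs : ∀ (U : LogScheme.{u}) (b : U ⟶ T), IsStrictEtale b → ∀ i (q q' : U ⟶ C.L i),
      q ≫ C.s i = b ≫ p → q' ≫ C.s i = b ≫ p' → gsec q (C.ρ i) = gsec q' (C.ρ i) → q = q') :
    p = p' := by
  have key : ∀ (U : LogScheme.{u}) (b : U ⟶ T) (i j) (q : U ⟶ C.L i) (q' : U ⟶ C.L j),
      q ≫ C.s i = b ≫ p → q' ≫ C.s j = b ≫ p' →
      qt U (gsec q (C.ρ i)) ^ chartSign i = qt U (gsec q' (C.ρ j)) ^ chartSign j := by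
    intro U b i j q q' hq hq'
    rw [← C.ggp_comp_s hτ, ← C.ggp_comp_s hτ, hq, hq', ggp_comp, ggp_comp, h]
  refine C.hom_ext (fun U b hb i q q' hq hq' => hs U b hb i q q' hq hq' ?_)
    fun U b hb i j hij q q' hq hq' => ?_
  · exact qt_injective (hb.isFs hT) (chartSign_injective (key U b i i q q' hq hq'))
  · refine IsUnit.of_mul_eq_one (gsec q' (C.ρ j)) (qt_injective (hb.isFs hT) ?_)
    rw [map_mul, map_one]
    exact chartSign_mul_eq_one hij (key U b i j q q' hq hq')

/-- A lifting problem to `X`, with prescribed pullback of `τ`, has a solution if it has one locally and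
solutions are unique. -/
theorem exists_hom_of_locComparable {α : T.GlobalGp}
    (Good : ∀ ⦃U : LogScheme.{u}⦄, (U ⟶ T) → (U ⟶ X) → Prop)
    (hres : ∀ (U V : LogScheme.{u}) (a : U ⟶ T) (b : V ⟶ U) (p : U ⟶ X), IsStrictEtale a →
      IsStrictEtale b → Good a p → Good (b ≫ a) (b ≫ p))
    (huniq : ∀ (U : LogScheme.{u}) (a : U ⟶ T) (p p' : U ⟶ X), IsStrictEtale a → Good a p →
      Good a p' → p = p')
    (hα : LocComparable T α)
    (hex : ∀ (U : LogScheme.{u}) (a : U ⟶ T), IsStrictEtale a → ∀ i (r : U.GlobalSec),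
      ggp a α = qt U r ^ chartSign i → ∃ q : U ⟶ C.L i, Good a (q ≫ C.s i)) :
    ∃ p : T ⟶ X, EtLocally T fun _ a => Good a (a ≫ p) :=
  exists_hom_of_local Good hres huniq (hα.mono fun U a ha ⟨i, r, h⟩ => by
    obtain ⟨q, hq⟩ := hex U a ha i r h
    exact ⟨_, hq⟩)

end TwoCharts

theorem ggp_lineIncl : ∀ i, ggp (lineCharts.{u}.s i) lineCoord =
    qt (lineCharts.{u}.L i) (lineCharts.{u}.ρ i) ^ chartSign i
  | 0 => ggp_lineIncl_zero.trans (zpow_one _).symm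
  | 1 => ggp_lineIncl_one.trans (zpow_neg_one _).symm

theorem locComparable_line (p : T ⟶ P1.{u}) : LocComparable T (ggp p lineCoord) :=
  lineCharts.locComparable ggp_lineIncl p

theorem P1_hom_ext (hT : IsFs T) {p p' : T ⟶ P1.{u}} (h : ggp p lineCoord = ggp p' lineCoord) :
    p = p' :=
  lineCharts.hom_ext_of_ggp ggp_lineIncl hT h fun _ _ _ _ _ _ _ _ h => line_hom_ext h

theorem exists_P1_hom (hT : IsFs T) {α : T.GlobalGp} (hα : LocComparable T α) :
    ∃ p : T ⟶ P1.{u}, ggp p lineCoord = α := by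
  obtain ⟨p, hp⟩ := lineCharts.exists_hom_of_locComparable (X := P1.{u}) (T := T)
    (fun U a p => ggp p lineCoord = ggp a α)
    (fun U V a b p _ _ h => by rw [ggp_comp, ggp_comp, h])
    (fun U a p p' ha h h' => P1_hom_ext (ha.isFs hT) (h.trans h'.symm)) hα
    fun U a ha i r h => by
      obtain ⟨q, hq⟩ := exists_line_hom i r
      refine ⟨q, ?_⟩
      have e : gsec q (lineCharts.{u}.ρ i) = r := hq
      exact (lineCharts.ggp_comp_s ggp_lineIncl _).trans ((congrArg (qt U · ^ chartSign i) e).trans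
        h.symm)
  exact ⟨p, ggp_eq_of_etLocally (hp.mono fun U a _ h => by rw [← ggp_comp, h])⟩

/-- The quotient `x₀⁻¹ x₁` of the coordinates of the plane. -/
def planeRatio : A2.{u}.GlobalGp := (qt _ (planeSec 0))⁻¹ * qt _ (planeSec 1)

theorem planeRatio_eq : ∀ i : Fin 2, planeRatio.{u} =
    ((qt _ (planeSec i))⁻¹ * qt _ (planeSec (1 - i))) ^ chartSign i
  | 0 => (zpow_one _).symm
  | 1 => (zpow_neg_one _ |>.trans (mul_inv_rev _ _) |>.trans (by rw [inv_inv]; rfl)).symm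

theorem ggp_planeRatio (H : T ⟶ A2.{u}) (i : Fin 2) : ggp H planeRatio =
    ((qt T (gsec H (planeSec i)))⁻¹ * qt T (gsec H (planeSec (1 - i)))) ^ chartSign i := by
  rw [planeRatio_eq i, ggp_zpow, ggp_mul, ggp_inv, ggp_qt, ggp_qt]

theorem ggp_blIncl (i : Fin 2) : ggp (blCharts.{u}.s i) (ggp blowupMap planeRatio) =
    qt (blCharts.{u}.L i) (blCharts.{u}.ρ i) ^ chartSign i := by
  refine (ggp_comp _ _ _).symm.trans ((ggp_planeRatio (blIncl i ≫ blowupMap) i).trans ?_)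
  rw [gsec_blIncl_blowupMap_self, gsec_blIncl_blowupMap_other, map_mul, inv_mul_cancel_left]
  rfl

theorem locComparable_blowup (p : T ⟶ Bl.{u}) : LocComparable T (ggp (p ≫ blowupMap) planeRatio) := by
  rw [ggp_comp]
  exact blCharts.locComparable ggp_blIncl p

theorem blowup_hom_ext (hT : IsFs T) {p p' : T ⟶ Bl.{u}} (h : p ≫ blowupMap = p' ≫ blowupMap) :
    p = p' := by
  refine blCharts.hom_ext_of_ggp ggp_blIncl hT (by rw [← ggp_comp, ← ggp_comp, h]) ?_
  intro U b hb i (q : U ⟶ A2.{u}) (q' : U ⟶ A2.{u}) (hq : q ≫ blIncl i = b ≫ p)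
    (hq' : q' ≫ blIncl i = b ≫ p') e
  refine A2_hom_ext (ne_one_sub i) ?_ e
  rw [← gsec_blIncl_blowupMap_self, ← gsec_comp, ← gsec_comp, ← Category.assoc, ← Category.assoc, hq,
    hq', Category.assoc, Category.assoc, h]

/-- A morphism to the plane lifts to the blowup if the quotient of the coordinates is locally
comparable to `1`. -/
theorem exists_blowup_lift (hT : IsFs T) (H : T ⟶ A2.{u})
    (hH : LocComparable T (ggp H planeRatio)) : ∃ p : T ⟶ Bl.{u}, p ≫ blowupMap = H := by
  obtain ⟨p, hp⟩ := blCharts.exists_hom_of_locComparable (X := Bl.{u}) (T := T)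
    (fun U a p => p ≫ blowupMap = a ≫ H)
    (fun U V a b p _ _ h => by rw [Category.assoc, Category.assoc, h])
    (fun U a p p' ha h h' => blowup_hom_ext (ha.isFs hT) (h.trans h'.symm)) hH
    fun U a ha i r h => by
      obtain ⟨q, hq, hq'⟩ := exists_A2_hom (ne_one_sub i) (gsec (a ≫ H) (planeSec i)) r
      refine ⟨q, ?_⟩
      change (q ≫ blIncl i) ≫ blowupMap = a ≫ H
      rw [Category.assoc]
      refine A2_hom_ext (ne_one_sub i) ?_ ?_
      · rw [gsec_comp, gsec_blIncl_blowupMap_self, hq]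
      · rw [gsec_comp, gsec_blIncl_blowupMap_other, map_mul, hq, hq']
        apply qt_injective (ha.isFs hT)
        rw [← ggp_comp, ggp_planeRatio _ i] at h
        rw [map_mul, ← chartSign_injective h, mul_inv_cancel_left]
  refine ⟨p, ?_⟩
  choose U a y ha hy h using hp
  refine hom_ext_of_cover ha (fun t => ⟨t, y t, hy t⟩) fun t => ?_
  rw [← Category.assoc]
  exact h t

end LogScheme
end
end LogGeometry

universe w
namespace LogGeometry
noncomputable section
namespace LogScheme

variable {X T : LogScheme.{u}}

/-! ### Representing the locus where a section is comparable to `1` -/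

/-- The functor of morphisms `a : T ⟶ S` for which `a^* α` is locally comparable to `1` is represented
by `F : X ⟶ S`. -/
structure IsComparableLocus {S X : LogScheme.{u}} (α : S.GlobalGp) (F : X ⟶ S) : Prop where
  comparable : LocComparable X (ggp F α)
  hom_ext : ∀ {T : LogScheme.{u}}, IsFs T → ∀ {p q : T ⟶ X}, p ≫ F = q ≫ F → p = q
  exists_hom : ∀ {T : LogScheme.{u}}, IsFs T → ∀ a : T ⟶ S, LocComparable T (ggp a α) →
    ∃ p : T ⟶ X, p ≫ F = a

theorem existsUnique_A2_hom (β γ : T.GlobalSec) :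
    ∃! h : T ⟶ A2.{u}, gsec h (planeSec 0) = β ∧ gsec h (planeSec 1) = γ := by
  obtain ⟨h, h₀, h₁⟩ := exists_A2_hom zero_ne_one β γ
  exact ⟨h, ⟨h₀, h₁⟩, fun h' ⟨h₀', h₁'⟩ =>
    A2_hom_ext zero_ne_one (h₀'.trans h₀.symm) (h₁'.trans h₁.symm)⟩

theorem exists_quotient (S : FsLogScheme.{u}) (α : S.obj.gpSec S.obj.top) (s : S.obj.scheme) :
    ∃ (U : FsLogScheme.{u}) (a : U ⟶ S) (y : U.obj.scheme) (β γ : U.obj.sec U.obj.top),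
      IsStrictEtale a.hom ∧ a.hom.f y = s ∧
      gpPullback a.hom α = (U.obj.secToGp _ β)⁻¹ * U.obj.secToGp _ γ := by
  obtain ⟨U, a, y, ha, hy, β, γ, h⟩ := etLocally_exists_div (T := S.obj) α s
  exact ⟨⟨U, ha.isFs S.property⟩, ⟨a⟩, y, β, γ, ha, hy, h⟩

/-! ### The fibre products over `G_log` and over the plane -/

section Presheaves

variable {C : Type*} [Category C]

theorem isPullback_of_exists_lift {P X Y Z : C} {fst : P ⟶ X} {snd : P ⟶ Y} {f : X ⟶ Z} {g : Y ⟶ Z}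
    (w : fst ≫ f = snd ≫ g)
    (h : ∀ (T : C) (x : T ⟶ X) (y : T ⟶ Y), x ≫ f = y ≫ g → ∃ l : T ⟶ P, l ≫ fst = x ∧ l ≫ snd = y)
    (hu : ∀ (T : C) (l l' : T ⟶ P), l ≫ fst = l' ≫ fst → l ≫ snd = l' ≫ snd → l = l') :
    IsPullback fst snd f g := by
  choose l hl hl' using h
  exact ⟨⟨w⟩, ⟨PullbackCone.IsLimit.mk w (fun s => l _ s.fst s.snd s.condition)
    (fun s => hl _ _ _ _) (fun s => hl' _ _ _ _)
    fun s m h₁ h₂ => hu _ _ _ (h₁.trans (hl _ _ _ _).symm) (h₂.trans (hl' _ _ _ _).symm)⟩⟩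

variable {A B Y P Q : Cᵒᵖ ⥤ Type w}

theorem exists_presheaf_hom (R : ∀ c, A.obj c → B.obj c → Prop)
    (hex : ∀ c x, ∃ y, R c x y) (hu : ∀ c x y y', R c x y → R c x y' → y = y')
    (hR : ∀ c d (a : c ⟶ d) x y, R c x y → R d (A.map a x) (B.map a y)) :
    ∃ f : A ⟶ B, ∀ c x, R c x (f.app c x) := by
  choose f hf using hex
  refine ⟨{ app := fun c => TypeCat.ofHom (f c), naturality := fun c d a => ?_ }, fun c x => hf c x⟩
  ext x
  exact hu d _ _ _ (hf d _) (hR c d a _ _ (hf c x))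

theorem nonempty_over_iso_of_range_eq {i : A ⟶ Y} {j : B ⟶ Y}
    (hi : ∀ c x x', i.app c x = i.app c x' → x = x') (hj : ∀ c x x', j.app c x = j.app c x' → x = x')
    (h : ∀ c y, (∃ x, i.app c x = y) ↔ ∃ x, j.app c x = y) : Nonempty (Over.mk i ≅ Over.mk j) := by
  have key : ∀ {A B : Cᵒᵖ ⥤ Type w} (i : A ⟶ Y) (j : B ⟶ Y)
      (_ : ∀ c x x', j.app c x = j.app c x' → x = x')
      (_ : ∀ c x, ∃ y, j.app c y = i.app c x), ∃ f : A ⟶ B, f ≫ j = i := by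
    intro A B i j hj h
    obtain ⟨f, hf⟩ := exists_presheaf_hom (A := A) (B := B) (fun c x y => j.app c y = i.app c x) h
      (fun c x y y' h h' => hj c _ _ (h.trans h'.symm)) fun c d a x y e => by
        rw [NatTrans.naturality_apply, e, NatTrans.naturality_apply]
    exact ⟨f, by ext c x; exact hf c x⟩
  obtain ⟨f, hf⟩ := key i j hj fun c x => (h c _).1 ⟨x, rfl⟩
  obtain ⟨g, hg⟩ := key j i hi fun c x => (h c _).2 ⟨x, rfl⟩
  have e₁ : f ≫ g = 𝟙 A := by
    ext c x
    apply hi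
    exact congrArg (fun k : A ⟶ Y => k.app c x)
      (show (f ≫ g) ≫ i = 𝟙 A ≫ i by rw [Category.assoc, hg, hf, Category.id_comp])
  have e₂ : g ≫ f = 𝟙 B := by
    ext c x
    apply hj
    exact congrArg (fun k : B ⟶ Y => k.app c x)
      (show (g ≫ f) ≫ j = 𝟙 B ≫ j by rw [Category.assoc, hf, hg, Category.id_comp])
  exact ⟨Over.isoMk ⟨f, g, e₁, e₂⟩ hf⟩

theorem presheaf_isPullback_ext {fst : P ⟶ A} {snd : P ⟶ B} {f : A ⟶ Y} {g : B ⟶ Y}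
    (h : IsPullback fst snd f g) (c : Cᵒᵖ) {x y : P.obj c} (h₁ : fst.app c x = fst.app c y)
    (h₂ : snd.app c x = snd.app c y) : x = y :=
  Types.ext_of_isPullback (h.map ((evaluation Cᵒᵖ (Type w)).obj c)) h₁ h₂

theorem presheaf_isPullback_exists {fst : P ⟶ A} {snd : P ⟶ B} {f : A ⟶ Y} {g : B ⟶ Y}
    (h : IsPullback fst snd f g) (c : Cᵒᵖ) {a : A.obj c} {b : B.obj c} (e : f.app c a = g.app c b) :
    ∃ x, fst.app c x = a ∧ snd.app c x = b :=
  Types.exists_of_isPullback (h.map ((evaluation Cᵒᵖ (Type w)).obj c)) a b e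

theorem presheaf_isPullback {fst : P ⟶ A} {snd : P ⟶ B} {f : A ⟶ Y} {g : B ⟶ Y}
    (w : fst ≫ f = snd ≫ g)
    (h : ∀ c (a : A.obj c) (b : B.obj c), f.app c a = g.app c b → ∃ x, fst.app c x = a ∧ snd.app c x = b)
    (hu : ∀ c (x x' : P.obj c), fst.app c x = fst.app c x' → snd.app c x = snd.app c x' → x = x') :
    IsPullback fst snd f g := by
  refine isPullback_of_exists_lift w ?_ ?_
  · intro Q x y e
    obtain ⟨l, hl⟩ := exists_presheaf_hom (A := Q) (B := P)
      (fun c t z => fst.app c z = x.app c t ∧ snd.app c z = y.app c t)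
      (fun c t => h c _ _ (congrArg (fun k : Q ⟶ Y => k.app c t) e))
      (fun c t z z' hz hz' => hu c _ _ (hz.1.trans hz'.1.symm) (hz.2.trans hz'.2.symm))
      fun c d a t z ⟨h₁, h₂⟩ => by
        simp only [NatTrans.naturality_apply, h₁, h₂, and_self]
    exact ⟨l, by ext c t; exact (hl c t).1, by ext c t; exact (hl c t).2⟩
  · intro Q l l' h₁ h₂
    ext c t
    exact hu c _ _ (congrArg (fun k : Q ⟶ A => k.app c t) h₁)
      (congrArg (fun k : Q ⟶ B => k.app c t) h₂)

end Presheaves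

theorem exists_pullback_p1ToGlog_iff (S : FsLogScheme.{u}) (α : S.obj.GlobalGp) (T : FsLogScheme.{u})
    (a : T ⟶ S) : (∃ x, (pullback.snd p1ToGlog (toGlog S α)).app (op T) x = a) ↔
      LocComparable T.obj (ggp a.hom α) := by
  constructor
  · rintro ⟨x, rfl⟩
    have h := congrArg (fun k : pullback p1ToGlog (toGlog S α) ⟶ GlogFs.{u} => k.app (op T) x)
      (pullback.condition (f := p1ToGlog) (g := toGlog S α))
    have h' : ggp (X := T.obj) ((pullback.fst p1ToGlog (toGlog S α)).app (op T) x) lineCoord =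
      ggp ((pullback.snd p1ToGlog (toGlog S α)).app (op T) x).hom α := congrArg ULift.down h
    have := locComparable_line (T := T.obj) ((pullback.fst p1ToGlog (toGlog S α)).app (op T) x)
    exact h' ▸ this
  · intro h
    obtain ⟨p, hp⟩ := exists_P1_hom T.property h
    obtain ⟨x, -, hx⟩ := presheaf_isPullback_exists
      (IsPullback.of_hasPullback p1ToGlog (toGlog S α)) (op T) (a := p) (b := a)
      (congrArg ULift.up hp)
    exact ⟨x, hx⟩

theorem pullback_p1ToGlog_ext (S : FsLogScheme.{u}) (α : S.obj.GlobalGp) (c : FsLogScheme.{u}ᵒᵖ)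
    (x x' : (pullback p1ToGlog (toGlog S α)).obj c)
    (h : (pullback.snd p1ToGlog (toGlog S α)).app c x =
      (pullback.snd p1ToGlog (toGlog S α)).app c x') : x = x' := by
  have hp := IsPullback.of_hasPullback p1ToGlog (toGlog S α)
  refine presheaf_isPullback_ext hp c ?_ h
  refine P1_hom_ext c.unop.property ?_
  have e : ∀ x, p1ToGlog.app c ((pullback.fst p1ToGlog (toGlog S α)).app c x) =
      (toGlog S α).app c ((pullback.snd p1ToGlog (toGlog S α)).app c x) := fun x =>
    congrArg (fun k : pullback p1ToGlog (toGlog S α) ⟶ GlogFs.{u} => k.app c x) hp.w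
  exact congrArg ULift.down ((e x).trans ((congrArg _ h).trans (e x').symm))

theorem nonempty_pullback_iso (S : FsLogScheme.{u}) (α : S.obj.GlobalGp) (h : S.obj ⟶ A2.{u})
    (hα : α = ggp h planeRatio) :
    Nonempty (Over.mk (pullback.snd p1ToGlog (toGlog S α)) ≅
      Over.mk (pullback.snd (pointsMap blowupMap) (toPoints S h))) := by
  have hp := IsPullback.of_hasPullback (pointsMap blowupMap.{u}) (toPoints S h)
  have e : ∀ c x, (pullback.fst (pointsMap blowupMap.{u}) (toPoints S h)).app c x ≫ blowupMap =
      ((pullback.snd (pointsMap blowupMap.{u}) (toPoints S h)).app c x).hom ≫ h := fun c x =>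
    congrArg (fun k : pullback (pointsMap blowupMap.{u}) (toPoints S h) ⟶ points A2 => k.app c x) hp.w
  refine nonempty_over_iso_of_range_eq (pullback_p1ToGlog_ext S α) (fun c x x' h' => ?_) fun c a => ?_
  · refine presheaf_isPullback_ext hp c (blowup_hom_ext c.unop.property ?_) h'
    exact (e c x).trans ((congrArg (fun k : c.unop ⟶ S => k.hom ≫ h) h').trans (e c x').symm)
  · refine (exists_pullback_p1ToGlog_iff S α c.unop a).trans ?_
    rw [hα, ← ggp_comp]
    constructor
    · intro hc
      obtain ⟨p, hp'⟩ := exists_blowup_lift c.unop.property _ hc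
      obtain ⟨x, -, hx⟩ := presheaf_isPullback_exists hp c (a := p) (b := a) hp'
      exact ⟨x, hx⟩
    · rintro ⟨x, rfl⟩
      have := locComparable_blowup ((pullback.fst (pointsMap blowupMap.{u}) (toPoints S h)).app c x)
      exact e c x ▸ this

end LogScheme
end
end LogGeometry

namespace LogGeometry
noncomputable section
namespace LogScheme

variable {X T : LogScheme.{u}}

/-! ### Logarithmic modifications from comparable loci -/

/-- Base change of morphisms of fs logarithmic schemes along strict étale morphisms. -/
theorem exists_isPullback_strictEtale {X S U : FsLogScheme.{u}} (p : X ⟶ S) (a : U ⟶ S)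
    (ha : IsStrictEtale a.hom) : ∃ (V : FsLogScheme.{u}) (b : V ⟶ X) (q : V ⟶ U),
      IsStrictEtale b.hom ∧ IsPullback b q p a := by
  have := ha.etale
  let v : pullback p.hom.f a.hom.f ⟶ X.obj.scheme := pullback.fst p.hom.f a.hom.f
  have hv : IsStrictEtale (X.obj.inducedMap v) := isStrictEtale_inducedMap X.obj v
  obtain ⟨q, ⟨hq, hq'⟩, -⟩ := ha.existsUnique_lift (X.obj.inducedMap v ≫ p.hom)
    (pullback.snd p.hom.f a.hom.f) pullback.condition.symm
  let V : FsLogScheme.{u} := ⟨X.obj.induced v, hv.isFs X.property⟩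
  refine ⟨V, ⟨X.obj.inducedMap v⟩, ⟨q⟩, hv, isPullback_of_exists_lift ?_ ?_ ?_⟩
  · exact ObjectProperty.hom_ext _ hq.symm
  · intro T x y e
    have e' : x.hom ≫ p.hom = y.hom ≫ a.hom := congrArg (fun k => k.hom) e
    obtain ⟨l, ⟨hl, hl'⟩, -⟩ := hv.existsUnique_lift x.hom
      (pullback.lift x.hom.f y.hom.f (congrArg Hom.f e')) (pullback.lift_fst _ _ _)
    refine ⟨⟨l⟩, ObjectProperty.hom_ext _ hl, ObjectProperty.hom_ext _ ?_⟩
    refine ha.hom_ext ?_ ?_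
    · change (l ≫ q) ≫ a.hom = y.hom ≫ a.hom
      rw [Category.assoc, hq, ← Category.assoc, hl, e']
    · change l.f ≫ q.f = y.hom.f
      rw [hq', hl']
      exact pullback.lift_snd _ _ _
  · intro T l l' h₁ h₂
    refine ObjectProperty.hom_ext _ (hv.hom_ext (congrArg (fun k => k.hom) h₁) ?_)
    refine pullback.hom_ext (congrArg (fun k => k.hom.f) h₁) ?_
    rw [← hq']
    exact congrArg (fun k => k.hom.f) h₂

/-- Étale locally `α` is `β⁻¹ γ`, and there the comparable locus is the base change of the blowup along
`(β, γ)`, since both represent the functor of morphisms along which `β` and `γ` are comparable. -/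
theorem isLogModification_of_isComparableLocus (hbl : IsToricModification blowupMap.{u})
    {S X : FsLogScheme.{u}} {α : S.obj.GlobalGp} {p : X ⟶ S} (hp : IsComparableLocus α p.hom) :
    IsLogModification p := by
  intro s
  obtain ⟨U, a, y, ha, hy, β, γ, h⟩ := etLocally_exists_div α s
  let U' : FsLogScheme.{u} := ⟨U, ha.isFs S.property⟩
  let a' : U' ⟶ S := ⟨a⟩
  obtain ⟨V, b, q, hb, hV⟩ := exists_isPullback_strictEtale p a' ha
  obtain ⟨H, hβ, hγ⟩ := exists_A2_hom zero_ne_one β γ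
  have hH : ggp H planeRatio = ggp a α := by
    rw [ggp_planeRatio H 0, h, hβ]
    exact (zpow_one _).trans (congrArg (fun r => (qt U β)⁻¹ * qt U r) hγ)
  have hw : b.hom ≫ p.hom = q.hom ≫ a := congrArg (fun k => k.hom) hV.w
  have hc : LocComparable V.obj (ggp (q.hom ≫ H) planeRatio) := by
    rw [ggp_comp, hH, ← ggp_comp, ← hw, ggp_comp]
    exact hp.comparable.pull _
  obtain ⟨r, hr⟩ := exists_blowup_lift V.property _ hc
  let W : FsLogScheme.{u} := ⟨Bl, isFs_Bl⟩
  let A : FsLogScheme.{u} := ⟨A2, isFs_A2⟩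
  refine ⟨U', a', y, W, A, ⟨blowupMap⟩, ⟨H⟩, V, b, q, ⟨r⟩, ha, hy, hbl, hV,
    isPullback_of_exists_lift (ObjectProperty.hom_ext _ hr) ?_ ?_⟩
  · intro T t w e
    have e' : t.hom ≫ blowupMap = w.hom ≫ H := congrArg (fun k => k.hom) e
    have hc' : LocComparable T.obj (ggp (w.hom ≫ a) α) := by
      rw [ggp_comp, ← hH, ← ggp_comp, ← e']
      exact locComparable_blowup t.hom
    obtain ⟨x, hx⟩ := hp.exists_hom T.property (w.hom ≫ a) hc'
    let x' : T ⟶ X := ⟨x⟩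
    have hx' : x' ≫ p = w ≫ a' := ObjectProperty.hom_ext _ hx
    refine ⟨hV.lift x' w hx', ?_, hV.lift_snd _ _ _⟩
    refine ObjectProperty.hom_ext _ (blowup_hom_ext T.property ?_)
    have e₂ : (hV.lift x' w hx').hom ≫ q.hom = w.hom :=
      congrArg (fun k => k.hom) (hV.lift_snd x' w hx')
    change ((hV.lift x' w hx').hom ≫ r) ≫ blowupMap = t.hom ≫ blowupMap
    rw [Category.assoc, hr, ← Category.assoc, e₂, e']
  · intro T l l' _ h₂
    refine hV.hom_ext (ObjectProperty.hom_ext _ (hp.hom_ext T.property ?_)) h₂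
    have e₂ : l.hom ≫ q.hom = l'.hom ≫ q.hom := congrArg (fun k => k.hom) h₂
    change (l.hom ≫ b.hom) ≫ p.hom = (l'.hom ≫ b.hom) ≫ p.hom
    rw [Category.assoc, Category.assoc, hw, ← Category.assoc, ← Category.assoc, e₂]

theorem isStrictEtale_of_iso {X Y : LogScheme.{u}} (e : X ≅ Y) : IsStrictEtale e.hom :=
  isStrictEtale_of_inverse e.hom_inv_id e.inv_hom_id

instance respectsIso_isLogModification : IsLogModification.{u}.RespectsIso := by
  refine MorphismProperty.RespectsIso.mk _ ?_ ?_
  · intro X Y Z e f hf s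
    obtain ⟨U, a, y, W, A, π, h, V, b, q, r, ha, hy, hπ, h₁, h₂⟩ := hf s
    refine ⟨U, a, y, W, A, π, h, V, b ≫ e.inv, q, r, ha, hy, hπ, ?_, h₂⟩
    exact h₁.of_iso (Iso.refl _) e.symm (Iso.refl _) (Iso.refl _) (by simp) (by simp) (by simp)
      (by simp)
  · intro X Y Z e f hf s
    let e' : Y.obj ≅ Z.obj := (ObjectProperty.ι _).mapIso e
    obtain ⟨U, a, y, W, A, π, h, V, b, q, r, ha, hy, hπ, h₁, h₂⟩ := hf (e'.inv.f s)
    refine ⟨U, a ≫ e.hom, y, W, A, π, h, V, b, q, r, ha.comp (isStrictEtale_of_iso e'), ?_, hπ, ?_, h₂⟩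
    · change e'.hom.f (a.hom.f y) = s
      rw [hy]
      exact congrArg (fun k : Z.obj ⟶ Z.obj => k.f s) e'.inv_hom_id
    · exact h₁.of_iso (Iso.refl _) (Iso.refl _) (Iso.refl _) e (by simp) (by simp) (by simp)
        (by simp)

theorem presheaf_isLogModification (hbl : IsToricModification blowupMap.{u})
    (hrep : ∀ (S : FsLogScheme.{u}) (α : S.obj.GlobalGp), ∃ (X : FsLogScheme.{u}) (p : X ⟶ S),
      IsComparableLocus α p.hom) : IsLogModification.{u}.presheaf p1ToGlog := by
  refine MorphismProperty.relative.of_exists fun S g => ?_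
  obtain ⟨α, rfl⟩ : ∃ α : S.obj.GlobalGp, g = toGlog S α :=
    ⟨(yonedaEquiv g).down, (yonedaEquiv.symm_apply_apply g).symm⟩
  obtain ⟨X, F, hF⟩ := hrep S α
  obtain ⟨p, hp⟩ := exists_P1_hom X.property hF.comparable
  refine ⟨X, toPoints X p, F, ?_, isLogModification_of_isComparableLocus hbl hF⟩
  refine presheaf_isPullback ?_ ?_ ?_
  · refine yonedaEquiv.injective ?_
    have e₁ : ggp (𝟙 X.obj ≫ p) lineCoord = ggp (𝟙 X.obj ≫ F.hom) α := by
      rw [Category.id_comp, Category.id_comp, hp]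
    exact congrArg ULift.up e₁
  · intro c (t : c.unop.obj ⟶ P1) (a : c.unop ⟶ S) e
    have e' : ggp t lineCoord = ggp a.hom α := congrArg ULift.down e
    obtain ⟨x, hx⟩ := hF.exists_hom c.unop.property a.hom (e' ▸ locComparable_line t)
    refine ⟨⟨x⟩, P1_hom_ext c.unop.property ?_, ObjectProperty.hom_ext _ hx⟩
    change ggp (x ≫ p) lineCoord = ggp t lineCoord
    rw [ggp_comp, hp, ← ggp_comp, hx, e']
  · intro c x x' _ h
    exact ObjectProperty.hom_ext _ (hF.hom_ext c.unop.property (congrArg (fun k => k.hom) h))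

end LogScheme
end
end LogGeometry

namespace LogGeometry
noncomputable section
namespace LogScheme

variable {X T T' : LogScheme.{u}}

/-! ### Gluing logarithmic structures along an étale cover -/

/-- Global sections which are given étale locally and are unique glue: they are the morphisms to a
chart of the projective line. -/
theorem exists_gsec_of_etLocally (P : ∀ ⦃U : LogScheme.{u}⦄, (U ⟶ T) → U.GlobalSec → Prop)
    (hres : ∀ (U V : LogScheme.{u}) (a : U ⟶ T) (b : V ⟶ U) (m : U.GlobalSec), IsStrictEtale a →
      IsStrictEtale b → P a m → P (b ≫ a) (gsec b m))
    (huniq : ∀ (U : LogScheme.{u}) (a : U ⟶ T) (m n : U.GlobalSec), IsStrictEtale a → P a m → P a n →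
      m = n)
    (hex : EtLocally T fun _ a => ∃ m, P a m) :
    ∃ m : T.GlobalSec, EtLocally T fun _ a => P a (gsec a m) := by
  obtain ⟨p, hp⟩ := exists_hom_of_local (X := lineLog.{u} 0) (T := T)
    (fun U a p => P a (gsec p (lineRho 0)))
    (fun U V a b p ha hb h => by rw [gsec_comp]; exact hres _ _ _ _ _ ha hb h)
    (fun U a p p' ha h h' => line_hom_ext (huniq _ _ _ _ ha h h'))
    (hex.mono fun U a _ ⟨m, hm⟩ => by
      obtain ⟨p, rfl⟩ := exists_line_hom 0 m
      exact ⟨p, hm⟩)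
  exact ⟨gsec p (lineRho 0), hp.mono fun U a _ h => by rwa [← gsec_comp]⟩

theorem Hom.pl_congr {Y : LogScheme.{u}} (F : X ⟶ Y) {U V : Scheme.{u}} {u : U ⟶ X.scheme}
    {v : V ⟶ Y.scheme} [Etale u] [Etale v] {g g' : U ⟶ V} (e : g = g') (h : g ≫ v = u ≫ F.f)
    (h' : g' ≫ v = u ≫ F.f) (m : Y.Sec v) : F.pl g h m = F.pl g' h' m := by
  subst e
  rfl

theorem bijective_pl_inducedMap {V : Scheme.{u}} (v : V ⟶ X.scheme) [Etale v]
    (g : (X.induced v).scheme ⟶ V) (hg : g = 𝟙 V) (h : g ≫ v = 𝟙 _ ≫ (X.inducedMap v).f) :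
    Function.Bijective ((X.inducedMap v).pl (u := 𝟙 (X.induced v).scheme) (v := v) g h) := by
  subst hg
  exact (isStrictEtale_inducedMap X v).bijective (𝟙 (X.induced v).scheme) v h

/-- Logarithmic schemes étale over a scheme `Y`, with an identification of their logarithmic structures
over common fs refinements: a relation `R` between morphisms to them, which are to become equal as
morphisms to the logarithmic scheme obtained by gluing. -/
structure EtaleGluing (Y : Scheme.{u}) where
  K : Type u
  X : K → LogScheme.{u}
  fs : ∀ k, IsFs (X k)
  c : ∀ k, (X k).scheme ⟶ Y
  etale : ∀ k, Etale (c k)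
  cover : ∀ y : Y, ∃ (k : K) (x : (X k).scheme), c k x = y
  R : ∀ {T : LogScheme.{u}} {k l : K}, (T ⟶ X k) → (T ⟶ X l) → Prop
  R_refl : ∀ {T : LogScheme.{u}} {k : K} (F : T ⟶ X k), R F F
  R_euclid : ∀ {T : LogScheme.{u}} {k l m : K} {F : T ⟶ X k} {F₁ : T ⟶ X l} {F₂ : T ⟶ X m},
    R F F₁ → R F F₂ → R F₁ F₂
  R_comp : ∀ {T T' : LogScheme.{u}} {k l : K} (a : T' ⟶ T) {F : T ⟶ X k} {F' : T ⟶ X l},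
    R F F' → R (a ≫ F) (a ≫ F')
  R_f : ∀ {T : LogScheme.{u}} {k l : K} {F : T ⟶ X k} {F' : T ⟶ X l}, IsFs T → R F F' →
    F.f ≫ c k = F'.f ≫ c l
  R_ext : ∀ {T : LogScheme.{u}} {k : K} {F F' : T ⟶ X k}, IsFs T → R F F' → F.f = F'.f → F = F'
  R_lift : ∀ {T : LogScheme.{u}} {k l : K} (F : T ⟶ X k) (f' : T.scheme ⟶ (X l).scheme), IsFs T →
    f' ≫ c l = F.f ≫ c k → ∃ F' : T ⟶ X l, F'.f = f' ∧ R F F'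

namespace EtaleGluing

variable {Y : Scheme.{u}} (D : EtaleGluing Y)

instance (k : D.K) : Etale (D.c k) := D.etale k

variable {U V : Scheme.{u}} (u : U ⟶ Y) [Etale u] {k l : D.K}

/-- The sections over `X k ×_Y U`. -/
abbrev LocSec (k : D.K) : Type u := (D.X k).Sec (pullback.fst (D.c k) u)

/-- The pullback of a section over `X k ×_Y U` to a logarithmic scheme mapping to it. -/
def ev (F : T ⟶ D.X k) (g : T.scheme ⟶ U) (h : g ≫ u = F.f ≫ D.c k) : D.LocSec u k →* T.GlobalSec :=
  F.pl (u := 𝟙 T.scheme) (v := pullback.fst (D.c k) u) (pullback.lift F.f g h.symm)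
    ((pullback.lift_fst _ _ _).trans (Category.id_comp _).symm)

/-- The logarithmic scheme `X k ×_Y U`. -/
def loc (k : D.K) : LogScheme.{u} := (D.X k).induced (pullback.fst (D.c k) u)

/-- The projection `X k ×_Y U ⟶ X k`. -/
def locFst (k : D.K) : D.loc u k ⟶ D.X k := (D.X k).inducedMap (pullback.fst (D.c k) u)

/-- The projection `X k ×_Y U ⟶ U`. -/
def locSnd (k : D.K) : (D.loc u k).scheme ⟶ U := pullback.snd (D.c k) u

theorem isStrictEtale_locFst (k : D.K) : IsStrictEtale (D.locFst u k) :=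
  isStrictEtale_inducedMap _ _

theorem isFs_loc (k : D.K) : IsFs (D.loc u k) := (D.isStrictEtale_locFst u k).isFs (D.fs k)

theorem locSnd_comp (k : D.K) : D.locSnd u k ≫ u = (D.locFst u k).f ≫ D.c k :=
  pullback.condition.symm

theorem bijective_ev (k : D.K) :
    Function.Bijective (D.ev u (D.locFst u k) (D.locSnd u k) (D.locSnd_comp u k)) := by
  exact bijective_pl_inducedMap (pullback.fst (D.c k) u) _ (pullback.hom_ext
    ((pullback.lift_fst _ _ _).trans (Category.id_comp _).symm)
    ((pullback.lift_snd _ _ _).trans (Category.id_comp _).symm)) _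

theorem gsec_ev (b : T' ⟶ T) (F : T ⟶ D.X k) (g : T.scheme ⟶ U) (h : g ≫ u = F.f ≫ D.c k)
    (F' : T' ⟶ D.X k) (hF : b ≫ F = F') (g' : T'.scheme ⟶ U) (hg : b.f ≫ g = g')
    (h' : g' ≫ u = F'.f ≫ D.c k) (m : D.LocSec u k) :
    gsec b (D.ev u F g h m) = D.ev u F' g' h' m := by
  subst hF hg
  refine (comp_pl b F (u := 𝟙 _) (v := 𝟙 _) b.f _ (pullback.lift F.f g h.symm) _
    (pullback.lift (b ≫ F).f (b.f ≫ g) h'.symm) _ ?_ m).symm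
  refine pullback.hom_ext ?_ ?_
  · exact (pullback.lift_fst _ _ _).trans ((congrArg (b.f ≫ ·) (pullback.lift_fst _ _ _)).symm.trans
      (Category.assoc _ _ _).symm)
  · exact (pullback.lift_snd _ _ _).trans ((congrArg (b.f ≫ ·) (pullback.lift_snd _ _ _)).symm.trans
      (Category.assoc _ _ _).symm)

theorem exists_hom_loc (F : T ⟶ D.X k) (g : T.scheme ⟶ U) (h : g ≫ u = F.f ≫ D.c k) :
    ∃ b : T ⟶ D.loc u k, b ≫ D.locFst u k = F ∧ b.f ≫ D.locSnd u k = g := by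
  obtain ⟨b, ⟨h₁, h₂⟩, -⟩ := (D.isStrictEtale_locFst u k).existsUnique_lift F
    (pullback.lift F.f g h.symm) (pullback.lift_fst _ _ _)
  exact ⟨b, h₁, by rw [h₂]; exact pullback.lift_snd _ _ _⟩

/-- The sections over `U` of the glued logarithmic structure: the compatible families of sections over
the `X k ×_Y U`. -/
def secs : Submonoid (∀ k, D.LocSec u k) where
  carrier := {m | ∀ {T : LogScheme.{u}}, IsFs T → ∀ {k l : D.K} (F : T ⟶ D.X k) (F' : T ⟶ D.X l),
    D.R F F' → ∀ (g : T.scheme ⟶ U) (h : g ≫ u = F.f ≫ D.c k) (h' : g ≫ u = F'.f ≫ D.c l),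
    D.ev u F g h (m k) = D.ev u F' g h' (m l)}
  one_mem' := by
    intro T hT k l F F' hR g h h'
    simp only [Pi.one_apply, map_one]
  mul_mem' hm hn := by
    intro T hT k l F F' hR g h h'
    simp only [Pi.mul_apply, map_mul, hm hT F F' hR g h h', hn hT F F' hR g h h']

/-- The pullback of a section over `U` to a logarithmic scheme mapping to `X k ×_Y U`. -/
def evs (F : T ⟶ D.X k) (g : T.scheme ⟶ U) (h : g ≫ u = F.f ≫ D.c k) : D.secs u →* T.GlobalSec :=
  (D.ev u F g h).comp ((Pi.evalMonoidHom _ k).comp (D.secs u).subtype)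

theorem gsec_evs (b : T' ⟶ T) (F : T ⟶ D.X k) (g : T.scheme ⟶ U) (h : g ≫ u = F.f ≫ D.c k)
    (F' : T' ⟶ D.X k) (hF : b ≫ F = F') (g' : T'.scheme ⟶ U) (hg : b.f ≫ g = g')
    (h' : g' ≫ u = F'.f ≫ D.c k) (m : D.secs u) :
    gsec b (D.evs u F g h m) = D.evs u F' g' h' m :=
  D.gsec_ev u b F g h F' hF g' hg h' (m.1 k)

variable {u} in
theorem secs_ext {m n : D.secs u} (h : ∀ (T : LogScheme.{u}), IsFs T → ∀ (k : D.K) (F : T ⟶ D.X k)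
    (g : T.scheme ⟶ U) (h : g ≫ u = F.f ≫ D.c k), EtLocally T fun _ a =>
      gsec a (D.evs u F g h m) = gsec a (D.evs u F g h n)) : m = n :=
  Subtype.ext (funext fun k => (D.bijective_ev u k).1 (gsec_eq_of_etLocally
    (h _ (D.isFs_loc u k) k (D.locFst u k) (D.locSnd u k) (D.locSnd_comp u k))))

/-- A section of the glued logarithmic structure is given by its pullbacks, which may be given étale
locally. -/
theorem exists_secs (Rel : ∀ {T : LogScheme.{u}} {k : D.K} (F : T ⟶ D.X k) (g : T.scheme ⟶ U),
      g ≫ u = F.f ≫ D.c k → T.GlobalSec → Prop)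
    (hnat : ∀ {T T' : LogScheme.{u}}, IsFs T → IsFs T' → ∀ (b : T' ⟶ T) {k : D.K} (F : T ⟶ D.X k)
      (g : T.scheme ⟶ U) (h) (t : T.GlobalSec) (F' : T' ⟶ D.X k) (_ : b ≫ F = F') (g') (_ : b.f ≫ g = g')
      (h'), Rel F g h t → Rel F' g' h' (gsec b t))
    (huniq : ∀ {T : LogScheme.{u}}, IsFs T → ∀ {k : D.K} (F : T ⟶ D.X k) (g : T.scheme ⟶ U) (h)
      (t t' : T.GlobalSec), Rel F g h t → Rel F g h t' → t = t')
    (hR : ∀ {T : LogScheme.{u}}, IsFs T → ∀ {k l : D.K} (F : T ⟶ D.X k) (F' : T ⟶ D.X l), D.R F F' →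
      ∀ (g : T.scheme ⟶ U) (h) (h') (t : T.GlobalSec), Rel F g h t → Rel F' g h' t)
    (hex : ∀ {T : LogScheme.{u}}, IsFs T → ∀ {k : D.K} (F : T ⟶ D.X k) (g : T.scheme ⟶ U)
      (_ : g ≫ u = F.f ≫ D.c k), EtLocally T fun _ a => ∃ (h' : (a.f ≫ g) ≫ u = (a ≫ F).f ≫ D.c k) (t : _),
        Rel (a ≫ F) (a.f ≫ g) h' t) :
    ∃ m : D.secs u, ∀ (T : LogScheme.{u}), IsFs T → ∀ (k : D.K) (F : T ⟶ D.X k) (g : T.scheme ⟶ U)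
      (h : g ≫ u = F.f ≫ D.c k) (t : T.GlobalSec), Rel F g h t → D.evs u F g h m = t := by
  have h₁ : ∀ k, ∃ m : D.LocSec u k, EtLocally (D.loc u k) fun _ a => ∃ h',
      Rel (a ≫ D.locFst u k) (a.f ≫ D.locSnd u k) h'
        (gsec a (D.ev u (D.locFst u k) (D.locSnd u k) (D.locSnd_comp u k) m)) := by
    intro k
    have hfs := D.isFs_loc u k
    obtain ⟨t, ht⟩ := exists_gsec_of_etLocally (T := D.loc u k)
      (fun V a t => ∃ h', Rel (a ≫ D.locFst u k) (a.f ≫ D.locSnd u k) h' t)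
      (fun V W a b m ha hb ⟨h', hm⟩ => ⟨by
        have := congrArg (b.f ≫ ·) h'
        simpa only [comp_f, Category.assoc] using this, hnat (ha.isFs hfs) (hb.isFs (ha.isFs hfs)) b _ _ h' _
          _ (Category.assoc _ _ _).symm _ (Category.assoc _ _ _).symm _ hm⟩)
      (fun V a m n ha ⟨h', hm⟩ ⟨_, hn⟩ => huniq (ha.isFs hfs) _ _ _ _ _ hm hn)
      ((hex hfs (D.locFst u k) (D.locSnd u k) (D.locSnd_comp u k)).mono
        fun V a _ ⟨h', t, ht⟩ => ⟨t, h', ht⟩)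
    obtain ⟨m, rfl⟩ := (D.bijective_ev u k).2 t
    exact ⟨m, ht⟩
  choose m hm using h₁
  have key : ∀ {T : LogScheme.{u}}, IsFs T → ∀ {k : D.K} (F : T ⟶ D.X k) (g : T.scheme ⟶ U) (h)
      (t : T.GlobalSec), Rel F g h t → D.ev u F g h (m k) = t := by
    intro T hT k F g h t ht
    obtain ⟨b, rfl, rfl⟩ := D.exists_hom_loc u F g h
    rw [← D.gsec_ev u b _ _ (D.locSnd_comp u k) _ rfl _ rfl h]
    refine gsec_eq_of_etLocally (((hm k).pull b).mono ?_)
    rintro V a ha ⟨W, c, d, hc, e, h', hW⟩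
    have hV := ha.isFs hT
    have e' : d.f ≫ c.f = a.f ≫ b.f := congrArg Hom.f e
    have h'' : (a.f ≫ b.f ≫ D.locSnd u k) ≫ u = (a ≫ b ≫ D.locFst u k).f ≫ D.c k := by
      have := congrArg (a.f ≫ ·) h
      simpa only [comp_f, Category.assoc] using this
    refine huniq hV (a ≫ b ≫ D.locFst u k) (a.f ≫ b.f ≫ D.locSnd u k) h'' _ _ ?_
      (hnat hT hV a _ _ h t _ rfl _ rfl h'' ht)
    rw [← gsec_comp, ← e, gsec_comp]
    refine hnat (hc.isFs (D.isFs_loc u k)) hV d _ _ h' _ _ ?_ _ ?_ h'' hW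
    · rw [← Category.assoc, e, Category.assoc]
    · rw [← Category.assoc, e', Category.assoc]
  refine ⟨⟨m, ?_⟩, fun T hT k F g h t ht => key hT F g h t ht⟩
  intro T hT k l F F' hFF g h h'
  refine gsec_eq_of_etLocally ((hex hT F g h).mono ?_)
  rintro V a ha ⟨h₂, t, ht⟩
  have hV := ha.isFs hT
  have h₃ : (a.f ≫ g) ≫ u = (a ≫ F').f ≫ D.c l := by
    have := congrArg (a.f ≫ ·) h'
    simpa only [comp_f, Category.assoc] using this
  rw [D.gsec_ev u a F g h _ rfl _ rfl h₂, D.gsec_ev u a F' g h' _ rfl _ rfl h₃, key hV _ _ _ _ ht,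
    key hV _ _ _ _ (hR hV _ _ (D.R_comp a hFF) _ h₂ h₃ t ht)]

end EtaleGluing

end LogScheme
end
end LogGeometry

namespace LogGeometry
noncomputable section
namespace LogScheme
namespace EtaleGluing

variable {X T T' : LogScheme.{u}} {Y : Scheme.{u}} (D : EtaleGluing Y)
variable {U V : Scheme.{u}} {u : U ⟶ Y} {v : V ⟶ Y} [Etale u] [Etale v] {k l : D.K}

/-! ### The glued logarithmic scheme -/

theorem comp_condition {W : Scheme.{u}} {u : W ⟶ Y} {F : T ⟶ D.X k} {g : T.scheme ⟶ W} (h : g ≫ u = F.f ≫ D.c k) (a : T' ⟶ T) :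
    (a.f ≫ g) ≫ u = (a ≫ F).f ≫ D.c k :=
  (Category.assoc _ _ _).trans ((congrArg (a.f ≫ ·) h).trans (Category.assoc _ _ _).symm)

/-- Restriction of sections over `X k ×_Y V`. -/
def locRs (k : D.K) (a : U ⟶ V) (ha : a ≫ v = u) : D.LocSec v k →* D.LocSec u k :=
  (D.X k).rs (pullback.lift (pullback.fst (D.c k) u) (pullback.snd (D.c k) u ≫ a)
    (by rw [Category.assoc, ha, pullback.condition])) (pullback.lift_fst _ _ _)

theorem ev_locRs (a : U ⟶ V) (ha : a ≫ v = u) (F : T ⟶ D.X k) (g : T.scheme ⟶ U)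
    (h : g ≫ u = F.f ≫ D.c k) (g' : T.scheme ⟶ V) (hg : g ≫ a = g') (h' : g' ≫ v = F.f ≫ D.c k)
    (m : D.LocSec v k) : D.ev u F g h (D.locRs k a ha m) = D.ev v F g' h' m := by
  subst hg
  refine Hom.pl_rs F _ _ _ _ _ _ (pullback.hom_ext ?_ ?_) m
  · rw [pullback.lift_fst, Category.assoc, pullback.lift_fst, pullback.lift_fst]
  · rw [pullback.lift_snd, Category.assoc, pullback.lift_snd, ← Category.assoc, pullback.lift_snd]

/-- Restriction of sections of the glued logarithmic structure. -/
def secsRs (a : U ⟶ V) (ha : a ≫ v = u) : D.secs v →* D.secs u where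
  toFun m := ⟨fun k => D.locRs k a ha (m.1 k), by
    intro T hT k l F F' hR g h h'
    have e : ∀ {k} {F : T ⟶ D.X k}, g ≫ u = F.f ≫ D.c k → (g ≫ a) ≫ v = F.f ≫ D.c k := fun h => by
      rw [Category.assoc, ha, h]
    rw [D.ev_locRs a ha F g h _ rfl (e h), D.ev_locRs a ha F' g h' _ rfl (e h')]
    exact m.2 hT F F' hR _ _ _⟩
  map_one' := Subtype.ext (funext fun k => map_one _)
  map_mul' m n := Subtype.ext (funext fun k => map_mul _ _ _)

theorem evs_secsRs (a : U ⟶ V) (ha : a ≫ v = u) (F : T ⟶ D.X k) (g : T.scheme ⟶ U)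
    (h : g ≫ u = F.f ≫ D.c k) (g' : T.scheme ⟶ V) (hg : g ≫ a = g') (h' : g' ≫ v = F.f ≫ D.c k)
    (m : D.secs v) : D.evs u F g h (D.secsRs a ha m) = D.evs v F g' h' m :=
  D.ev_locRs a ha F g h g' hg h' (m.1 k)

theorem evs_eq_of_R (hT : IsFs T) {F : T ⟶ D.X k} {F' : T ⟶ D.X l} (hR : D.R F F')
    (g : T.scheme ⟶ U) (h : g ≫ u = F.f ≫ D.c k) (h' : g ≫ u = F'.f ≫ D.c l) (m : D.secs u) :
    D.evs u F g h m = D.evs u F' g h' m := m.2 hT F F' hR g h h'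

theorem secs_ext' {m n : D.secs u} (h : ∀ (T : LogScheme.{u}), IsFs T → ∀ (k : D.K) (F : T ⟶ D.X k)
    (g : T.scheme ⟶ U) (h : g ≫ u = F.f ≫ D.c k), D.evs u F g h m = D.evs u F g h n) : m = n :=
  D.secs_ext fun T hT k F g h' => EtLocally.of_self (congrArg _ (h T hT k F g h'))

/-- The function on `X k ×_Y U` given by a section. -/
def exLoc (k : D.K) : D.LocSec u k →* Γ(pullback (D.c k) u, ⊤) := (D.X k).ex

theorem ex_ev (F : T ⟶ D.X k) (g : T.scheme ⟶ U) (h : g ≫ u = F.f ≫ D.c k) (m : D.LocSec u k) :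
    T.ex (D.ev u F g h m) = (pullback.lift F.f g h.symm).appTop (D.exLoc k m) :=
  F.ex_pl _ _ m

/-- The functions on the members of the cover given by a section glue to a function on `U`. -/
theorem exists_ex (m : D.secs u) : ∃ f : Γ(U, ⊤), ∀ (T : LogScheme.{u}), IsFs T → ∀ (k : D.K)
    (F : T ⟶ D.X k) (g : T.scheme ⟶ U) (h : g ≫ u = F.f ≫ D.c k),
    g.appTop f = T.ex (D.evs u F g h m) := by
  have cov : ∀ (x : U), ∃ (k : D.K) (y : (D.loc u k).scheme), D.locSnd u k y = x := fun x => by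
    obtain ⟨k, y, hy⟩ := D.cover (u x)
    obtain ⟨z, -, hz⟩ := Scheme.Pullback.exists_preimage_pullback (f := D.c k) (g := u) y x hy
    exact ⟨k, z, hz⟩
  have het : ∀ k, Etale (D.locSnd u k) := fun k => inferInstanceAs (Etale (pullback.snd (D.c k) u))
  -- The function on `X k ×_Y U` has the required property, since any `F : T ⟶ X l` over it can be
  -- replaced by a related morphism to `X k`.
  have hP : ∀ (k : D.K) {T : LogScheme.{u}}, IsFs T → ∀ {l : D.K} (F : T ⟶ D.X l)
      (g : T.scheme ⟶ (D.loc u k).scheme) (h : (g ≫ D.locSnd u k) ≫ u = F.f ≫ D.c l),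
      g.appTop (D.exLoc k (m.1 k)) = T.ex (D.evs u F (g ≫ D.locSnd u k) h m) := by
    intro k T hT l F g h
    have h₁ : (g ≫ (D.locFst u k).f) ≫ D.c k = F.f ≫ D.c l := by
      rw [← h, Category.assoc, Category.assoc, D.locSnd_comp]
    obtain ⟨F', hF', hR⟩ := D.R_lift F _ hT h₁
    have h₂ : (g ≫ D.locSnd u k) ≫ u = F'.f ≫ D.c k := by rw [hF', h₁, h]
    rw [D.evs_eq_of_R hT hR _ h h₂]
    refine Eq.trans ?_ (D.ex_ev F' _ h₂ (m.1 k)).symm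
    refine congrArg (fun g : T.scheme ⟶ pullback (D.c k) u => g.appTop (D.exLoc k (m.1 k))) ?_
    refine pullback.hom_ext ?_ ?_
    · exact hF'.symm.trans (pullback.lift_fst _ _ _).symm
    · exact (pullback.lift_snd _ _ _).symm
  have hiff : ∀ {W : Scheme.{u}} (a : W ⟶ U) (f : Γ(W, ⊤)) (f' : Γ(W, ⊤)), Etale a →
      (∀ (T : LogScheme.{u}), IsFs T → ∀ (k : D.K) (F : T ⟶ D.X k) (g : T.scheme ⟶ W)
        (_ : (g ≫ a) ≫ u = F.f ≫ D.c k), g.appTop f = g.appTop f') → f = f' := by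
    intro W a f f' _ h
    refine appTop_etale_ext fun x => ?_
    obtain ⟨k, y, hy⟩ := cov (a x)
    obtain ⟨z, -, hz⟩ := Scheme.Pullback.exists_preimage_pullback (f := D.locSnd u k) (g := a) y x hy
    have := het k
    have hs := isStrictEtale_inducedMap (D.loc u k) (pullback.fst (D.locSnd u k) a)
    refine ⟨_, pullback.snd (D.locSnd u k) a, inferInstance, z, hz,
      h ((D.loc u k).induced (pullback.fst (D.locSnd u k) a)) (hs.isFs (D.isFs_loc u k)) k
        ((D.loc u k).inducedMap _ ≫ D.locFst u k) (pullback.snd (D.locSnd u k) a) ?_⟩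
    rw [← pullback.condition]
    exact D.comp_condition (D.locSnd_comp u k) ((D.loc u k).inducedMap (pullback.fst (D.locSnd u k) a))
  obtain ⟨f, hf⟩ := appTop_etale_glue (T := U)
    (fun {W} a _ f => ∀ (T : LogScheme.{u}), IsFs T → ∀ (k : D.K) (F : T ⟶ D.X k)
      (g : T.scheme ⟶ W) (h : (g ≫ a) ≫ u = F.f ≫ D.c k), g.appTop f = T.ex (D.evs u F (g ≫ a) h m))
    (by
      rintro W W' a _ b _ a' _ rfl f hf T hT k F g h
      rw [← Category.assoc] at h
      rw [← appTop_comp_apply, hf T hT k F (g ≫ b) h]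
      simp only [Category.assoc])
    (fun {W} a ha f f' hf hf' => hiff a f f' ha fun T hT k F g h =>
      (hf T hT k F g h).trans (hf' T hT k F g h).symm)
    (fun x => by
      obtain ⟨k, y, hy⟩ := cov x
      exact ⟨_, D.locSnd u k, het k, y, D.exLoc k (m.1 k), hy, fun T hT l => hP k hT⟩)
  refine ⟨f, fun T hT k F g h => ?_⟩
  obtain ⟨b, rfl, rfl⟩ := D.exists_hom_loc u F g h
  rw [appTop_comp_apply, hf (D.locSnd u k) (het k) (D.exLoc k (m.1 k)) fun T hT l => hP k hT]
  exact hP k hT (b ≫ D.locFst u k) b.f h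

/-- The function given by a section of the glued logarithmic structure. -/
def secsEx : D.secs u →* Γ(U, ⊤) :=
  have huniq : ∀ (f f' : Γ(U, ⊤)), (∀ (T : LogScheme.{u}), IsFs T → ∀ (k : D.K) (F : T ⟶ D.X k)
      (g : T.scheme ⟶ U) (_ : g ≫ u = F.f ≫ D.c k), g.appTop f = g.appTop f') → f = f' :=
    fun f f' h => appTop_etale_ext fun x => by
      obtain ⟨k, y, hy⟩ := D.cover (u x)
      obtain ⟨z, -, hz⟩ := Scheme.Pullback.exists_preimage_pullback (f := D.c k) (g := u) y x hy
      exact ⟨_, D.locSnd u k, inferInstanceAs (Etale (pullback.snd (D.c k) u)), z, hz,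
        h _ (D.isFs_loc u k) k (D.locFst u k) _ (D.locSnd_comp u k)⟩
  { toFun := fun m => (D.exists_ex m).choose
    map_one' := huniq _ _ fun T hT k F g h => by
      rw [(D.exists_ex (1 : D.secs u)).choose_spec T hT k F g h, map_one, map_one]
      exact (map_one g.appTop.hom).symm
    map_mul' := fun m n => huniq _ _ fun T hT k F g h => by
      rw [(D.exists_ex (m * n)).choose_spec T hT k F g h, map_mul, map_mul,
        ← (D.exists_ex m).choose_spec T hT k F g h, ← (D.exists_ex n).choose_spec T hT k F g h]
      exact (map_mul g.appTop.hom _ _).symm }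

theorem appTop_secsEx (m : D.secs u) (hT : IsFs T) (F : T ⟶ D.X k) (g : T.scheme ⟶ U)
    (h : g ≫ u = F.f ≫ D.c k) : g.appTop (D.secsEx m) = T.ex (D.evs u F g h m) :=
  (D.exists_ex m).choose_spec T hT k F g h

theorem appTop_ext {f f' : Γ(U, ⊤)} (h : ∀ (T : LogScheme.{u}), IsFs T → ∀ (k : D.K) (F : T ⟶ D.X k)
    (g : T.scheme ⟶ U) (_ : g ≫ u = F.f ≫ D.c k), g.appTop f = g.appTop f') : f = f' :=
  appTop_etale_ext fun x => by
    obtain ⟨k, y, hy⟩ := D.cover (u x)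
    obtain ⟨z, -, hz⟩ := Scheme.Pullback.exists_preimage_pullback (f := D.c k) (g := u) y x hy
    exact ⟨_, D.locSnd u k, inferInstanceAs (Etale (pullback.snd (D.c k) u)), z, hz,
      h _ (D.isFs_loc u k) k (D.locFst u k) _ (D.locSnd_comp u k)⟩

/-- Base change of étale covers of `V` to a logarithmic scheme mapping to `V`. -/
theorem etLocally_lift {W : Scheme.{u}} (g : T.scheme ⟶ W)
    (P : ∀ {U : Scheme.{u}} (_ : U ⟶ W), Prop)
    (h : ∀ x : W, ∃ (U : Scheme.{u}) (a : U ⟶ W) (_ : Etale a) (y : U), a y = x ∧ P a) :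
    EtLocally T fun V b => ∃ (U : Scheme.{u}) (a : U ⟶ W) (c : V.scheme ⟶ U), P a ∧ c ≫ a = b.f ≫ g :=
  etLocally_of_cover fun t => by
    obtain ⟨U, a, _, y, hy, hP⟩ := h (g t)
    obtain ⟨z, hz, -⟩ := Scheme.Pullback.exists_preimage_pullback (f := g) (g := a) t y hy.symm
    exact ⟨_, pullback.fst g a, inferInstance, z, hz, U, a, pullback.snd g a, hP,
      pullback.condition.symm⟩

/-- The glued logarithmic structure. -/
def logData : LogData Y where
  Sec u _ := D.secs u
  mon u _ := inferInstance
  rs a ha := D.secsRs a ha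
  ex u _ := D.secsEx
  rs_id u _ h m := D.secs_ext' fun T hT k F g hg =>
    D.evs_secsRs _ _ F g hg g (Category.comp_id g) hg m
  rs_rs {U V W u v w} _ _ _ a b ha hb hc m := D.secs_ext' fun T hT k F g hg => by
    have h₁ : (g ≫ a) ≫ v = F.f ≫ D.c k := by rw [Category.assoc, ha, hg]
    have h₂ : (g ≫ a ≫ b) ≫ w = F.f ≫ D.c k := by rw [Category.assoc, hc, hg]
    rw [D.evs_secsRs a ha F g hg _ rfl h₁, D.evs_secsRs b hb F _ h₁ _ (Category.assoc _ _ _) h₂,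
      D.evs_secsRs (a ≫ b) hc F g hg _ rfl h₂]
  ex_rs {U V u v} _ _ a ha m := D.appTop_ext (u := u) fun T hT k F g hg => by
    have h₁ : (g ≫ a) ≫ v = F.f ≫ D.c k := by rw [Category.assoc, ha, hg]
    rw [D.appTop_secsEx _ hT F g hg, D.evs_secsRs a ha F g hg _ rfl h₁, ← appTop_comp_apply,
      D.appTop_secsEx _ hT F _ h₁]
  ext {V} v _ m n h := D.secs_ext fun T hT k F g hg => by
    refine (etLocally_lift g (fun {U} a => ∃ (u : U ⟶ Y) (_ : Etale u) (ha : a ≫ v = u),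
      D.secsRs a ha m = D.secsRs a ha n) fun x => ?_).mono ?_
    · obtain ⟨U, u, i, a, ha, y, hy, e⟩ := h x
      exact ⟨U, a, etale_of_comp inferInstance i ha, y, hy, u, i, ha, e⟩
    · rintro W b - ⟨U, a, c, ⟨u, i, rfl, e⟩, hc⟩
      have h₁ := D.comp_condition hg b
      have h₂ : c ≫ a ≫ v = (b ≫ F).f ≫ D.c k := by rw [← Category.assoc, hc, h₁]
      rw [D.gsec_evs v b F g hg _ rfl _ rfl h₁, D.gsec_evs v b F g hg _ rfl _ rfl h₁,
        ← D.evs_secsRs a rfl _ c h₂ _ hc h₁, ← D.evs_secsRs a rfl _ c h₂ _ hc h₁, e]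
  glue {V} v _ P hres huniq hex := by
    obtain ⟨m, hm⟩ := D.exists_secs v
      (fun {T k} F g h t => ∀ {U : Scheme.{u}} (u : U ⟶ Y) [Etale u] (a : U ⟶ V) (ha : a ≫ v = u)
        (n : D.secs u), P u a ha n → ∀ {T' : LogScheme.{u}} (b : T' ⟶ T) (c : T'.scheme ⟶ U),
        IsFs T' → c ≫ a = b.f ≫ g → ∀ h', gsec b t = D.evs u (b ≫ F) c h' n)
      (by
        rintro T T' hT hT' b k F g h t F' rfl g' rfl h' H U u _ a ha n hn T'' d c hT'' hc h''
        rw [← gsec_comp]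
        rw [← Category.assoc] at hc
        have h₃ : c ≫ u = ((d ≫ b) ≫ F).f ≫ D.c k := by rw [h'', Category.assoc]
        rw [H u a ha n hn (d ≫ b) c hT'' hc h₃]
        simp only [Category.assoc])
      (by
        intro T hT k F g h t t' H H'
        refine gsec_eq_of_etLocally ((etLocally_lift g (fun {U} a => ∃ (u : U ⟶ Y) (_ : Etale u)
          (ha : a ≫ v = u) (n : D.secs u), P u a ha n) fun x => ?_).mono ?_)
        · obtain ⟨U, u, i, a, ha, y, n, hy, hn⟩ := hex x
          exact ⟨U, a, etale_of_comp inferInstance i ha, y, hy, u, i, ha, n, hn⟩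
        · rintro W b hb ⟨U, a, c, ⟨u, i, ha, n, hn⟩, hc⟩
          have h₂ : c ≫ u = (b ≫ F).f ≫ D.c k := by
            rw [← D.comp_condition h b, ← hc, Category.assoc, ha]
          rw [H u a ha n hn b c (hb.isFs hT) hc h₂, H' u a ha n hn b c (hb.isFs hT) hc h₂])
      (by
        intro T hT k l F F' hR g h h' t H U u _ a ha n hn T' b c hT' hc h₁
        have h₂ : c ≫ u = (b ≫ F).f ≫ D.c k := by
          rw [← D.comp_condition h b, ← hc, Category.assoc, ha]
        rw [H u a ha n hn b c hT' hc h₂]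
        exact D.evs_eq_of_R hT' (D.R_comp b hR) _ _ _ _)
      (by
        intro T hT k F g h
        refine (etLocally_lift g (fun {U} a => ∃ (u : U ⟶ Y) (_ : Etale u)
          (ha : a ≫ v = u) (n : D.secs u), P u a ha n) fun x => ?_).mono ?_
        · obtain ⟨U, u, i, a, ha, y, n, hy, hn⟩ := hex x
          exact ⟨U, a, etale_of_comp inferInstance i ha, y, hy, u, i, ha, n, hn⟩
        · rintro W b hb ⟨U, a, c, ⟨u, i, ha, n, hn⟩, hc⟩
          have h₁ := D.comp_condition h b
          have h₂ : c ≫ u = (b ≫ F).f ≫ D.c k := by rw [← h₁, ← hc, Category.assoc, ha]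
          refine ⟨h₁, D.evs u (b ≫ F) c h₂ n, ?_⟩
          intro U' u' _ a' ha' n' hn' T' d c' hT' hc' h₃
          have h₄ : (d.f ≫ c) ≫ u = (d ≫ b ≫ F).f ≫ D.c k := D.comp_condition h₂ d
          rw [D.gsec_evs u d _ c h₂ _ rfl _ rfl h₄]
          -- compare the two sections on the fibre product of their domains
          have h₅ : (d.f ≫ c) ≫ a = c' ≫ a' := by rw [hc', Category.assoc, hc]
          have := etale_of_comp (f := a') inferInstance ‹Etale u'› ha'
          have hq : pullback.fst a a' ≫ u = pullback.snd a a' ≫ u' := by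
            rw [← ha, ← ha', ← Category.assoc, pullback.condition, Category.assoc]
          have hw₁ := hres u a ha (pullback.fst a a' ≫ u) (pullback.fst a a') rfl (pullback.fst a a' ≫ a)
            (by rw [Category.assoc, ha]) rfl n hn
          have hw₂ := hres u' a' ha' (pullback.fst a a' ≫ u) (pullback.snd a a') hq.symm
            (pullback.fst a a' ≫ a) (by rw [Category.assoc, ha]) pullback.condition n' hn'
          have e := huniq _ _ _ _ _ hw₁ hw₂
          have h₆ : pullback.lift (d.f ≫ c) c' h₅ ≫ pullback.fst a a' ≫ u =
              (d ≫ b ≫ F).f ≫ D.c k := by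
            rw [← Category.assoc, pullback.lift_fst, h₄]
          rw [← D.evs_secsRs (pullback.fst a a') rfl _ _ h₆ _ (pullback.lift_fst _ _ _) h₄,
            ← D.evs_secsRs (pullback.snd a a') hq.symm _ _ h₆ _ (pullback.lift_snd _ _ _) h₃]
          exact congrArg _ e)
    refine ⟨m, fun {U} u _ a ha n hn => D.secs_ext' fun T hT k F g hg => ?_⟩
    have h₁ : (g ≫ a) ≫ v = F.f ≫ D.c k := by rw [Category.assoc, ha, hg]
    rw [D.evs_secsRs a ha F g hg _ rfl h₁]
    refine hm T hT k F _ h₁ _ ?_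
    intro U' u' _ a' ha' n' hn' T' d c' hT' hc' h₃
    have h₄ : (d.f ≫ g) ≫ u = (d ≫ F).f ≫ D.c k := D.comp_condition hg d
    rw [D.gsec_evs u d _ g hg _ rfl _ rfl h₄]
    have h₅ : (d.f ≫ g) ≫ a = c' ≫ a' := by rw [hc', Category.assoc]
    have := etale_of_comp (f := a') inferInstance ‹Etale u'› ha'
    have hq : pullback.fst a a' ≫ u = pullback.snd a a' ≫ u' := by
      rw [← ha, ← ha', ← Category.assoc, pullback.condition, Category.assoc]
    have hw₁ := hres u a ha (pullback.fst a a' ≫ u) (pullback.fst a a') rfl (pullback.fst a a' ≫ a)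
      (by rw [Category.assoc, ha]) rfl n hn
    have hw₂ := hres u' a' ha' (pullback.fst a a' ≫ u) (pullback.snd a a') hq.symm
      (pullback.fst a a' ≫ a) (by rw [Category.assoc, ha]) pullback.condition n' hn'
    have e := huniq _ _ _ _ _ hw₁ hw₂
    have h₆ : pullback.lift (d.f ≫ g) c' h₅ ≫ pullback.fst a a' ≫ u = (d ≫ F).f ≫ D.c k := by
      rw [← Category.assoc, pullback.lift_fst, h₄]
    rw [← D.evs_secsRs (pullback.fst a a') rfl _ _ h₆ _ (pullback.lift_fst _ _ _) h₄,
      ← D.evs_secsRs (pullback.snd a a') hq.symm _ _ h₆ _ (pullback.lift_snd _ _ _) h₃]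
    exact congrArg _ e
  unit {U} u _ f hf := by
    obtain ⟨m, hm⟩ := D.exists_secs u (fun {T k} F g h t => T.ex t = g.appTop f)
      (by
        rintro T T' hT hT' b k F g h t F' rfl g' rfl h' e
        rw [ex_gsec, e, appTop_comp_apply])
      (fun {T} hT k F g h t t' e e' =>
        ((existsUnique_ex (X := T) (u := 𝟙 T.scheme) (hf.map g.appTop.hom)).unique e e'))
      (fun hT k l F F' _ g h h' t e => e)
      (fun {T} hT k F g h => by
        obtain ⟨t, ht, -⟩ := existsUnique_ex (X := T) (u := 𝟙 T.scheme) (hf.map g.appTop.hom)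
        refine EtLocally.of_self ⟨D.comp_condition h (𝟙 T), t, ?_⟩
        rw [appTop_comp_apply]
        exact ht.trans (appTop_id_apply _).symm)
    have hm' : ∀ (T : LogScheme.{u}), IsFs T → ∀ (k : D.K) (F : T ⟶ D.X k) (g : T.scheme ⟶ U)
        (h : g ≫ u = F.f ≫ D.c k), T.ex (D.evs u F g h m) = g.appTop f := by
      intro T hT k F g h
      obtain ⟨t, ht, -⟩ := existsUnique_ex (X := T) (u := 𝟙 T.scheme) (hf.map g.appTop.hom)
      exact (congrArg T.ex (hm T hT k F g h t ht)).trans ht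
    refine ⟨m, D.appTop_ext (u := u) fun T hT k F g h => ?_, fun n hn =>
      D.secs_ext' fun T hT k F g h => ?_⟩
    · rw [D.appTop_secsEx m hT F g h, hm' T hT k F g h]
    · refine (hm T hT k F g h _ ?_).symm
      rw [← D.appTop_secsEx n hT F g h]
      exact congrArg g.appTop hn

end EtaleGluing

end LogScheme
end
end LogGeometry

namespace LogGeometry
noncomputable section
namespace LogScheme

variable {X T T' : LogScheme.{u}}

/-- Two morphisms with the same underlying morphism of schemes agree if they have the same effect on
sections, tested on global sections of étale `T`-schemes. -/
theorem hom_ext_of_global {Y : LogScheme.{u}} {F G : T ⟶ Y} (hf : F.f = G.f)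
    (h : ∀ {U V : Scheme.{u}} (u : U ⟶ T.scheme) [Etale u] (v : V ⟶ Y.scheme) [Etale v] (g : U ⟶ V)
      (w : g ≫ v = 𝟙 U ≫ (T.inducedMap u ≫ F).f) (w' : g ≫ v = 𝟙 U ≫ (T.inducedMap u ≫ G).f)
      (m : Y.Sec v), Hom.pl (T.inducedMap u ≫ F) (u := 𝟙 (T.induced u).scheme) g w m =
        Hom.pl (T.inducedMap u ≫ G) (u := 𝟙 (T.induced u).scheme) g w' m) : F = G := by
  refine Hom_ext hf fun {U V} u v _ _ g w w' m => ?_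
  have e : 𝟙 U ≫ u = 𝟙 U ≫ (T.inducedMap u).f := rfl
  have key : ∀ (H : T ⟶ Y) (w : g ≫ v = u ≫ H.f) (w' : g ≫ v = 𝟙 U ≫ (T.inducedMap u ≫ H).f),
      Hom.pl (T.inducedMap u ≫ H) (u := 𝟙 (T.induced u).scheme) g w' m =
        (T.inducedMap u).pl (u := 𝟙 (T.induced u).scheme) (𝟙 U) e (H.pl g w m) := fun H w w' =>
    comp_pl (T.inducedMap u) H (u := 𝟙 (T.induced u).scheme) (𝟙 U) e g w g w'
      (Category.id_comp g).symm m
  have hw : ∀ {H : T ⟶ Y}, g ≫ v = u ≫ H.f → g ≫ v = 𝟙 U ≫ (T.inducedMap u ≫ H).f := fun w =>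
    w.trans (Category.id_comp _).symm
  refine ((isStrictEtale_inducedMap T u).bijective (𝟙 (T.induced u).scheme) u e).1 ?_
  exact (key F w (hw w)).symm.trans ((h u v g (hw w) (hw w') m).trans (key G w' (hw w')))

namespace EtaleGluing

variable {Y : Scheme.{u}} (D : EtaleGluing Y) {k l : D.K}

/-- The glued logarithmic scheme. -/
abbrev glued : LogScheme.{u} := D.logData.toLog

/-- The pullback of sections of the glued logarithmic structure to `X k`. -/
def gluedPl (k : D.K) {U V : Scheme.{u}} {u : U ⟶ (D.X k).scheme} {v : V ⟶ Y} [Etale u] [Etale v]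
    (g : U ⟶ V) (h : g ≫ v = u ≫ D.c k) : D.secs v →* (D.X k).Sec u :=
  ((D.X k).rs (v := pullback.fst (D.c k) v) (pullback.lift u g h.symm)
    (pullback.lift_fst _ _ _)).comp ((Pi.evalMonoidHom _ k).comp (D.secs v).subtype)

theorem ex_gluedPl (k : D.K) {U V : Scheme.{u}} {u : U ⟶ (D.X k).scheme} {v : V ⟶ Y} [Etale u]
    [Etale v] (g : U ⟶ V) (h : g ≫ v = u ≫ D.c k) (m : D.secs v) :
    (D.X k).ex (D.gluedPl k g h m) = g.appTop (D.secsEx m) := by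
  have h' : g ≫ v = ((D.X k).inducedMap u).f ≫ D.c k := h
  refine Eq.trans ?_ (D.appTop_secsEx m ((isStrictEtale_inducedMap (D.X k) u).isFs (D.fs k))
    ((D.X k).inducedMap u) g h').symm
  refine Eq.trans ?_ (D.ex_ev ((D.X k).inducedMap u) g h' (m.1 k)).symm
  exact (D.X k).ex_rs _ _ _

/-- The canonical morphism `X k ⟶ D.glued`. -/
def gluedι (k : D.K) : D.X k ⟶ D.glued :=
  mkHom (X := D.X k) (Y := D.glued) (D.c k) (fun {U V u v} _ _ g h => D.gluedPl k (v := v) g h)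
    (by
      intro U V U' V' u v _ _ u' v' _ _ a ha g h b hb g' h' e m
      refine (congrArg (fun n : D.secs v => (D.X k).rs a ha (D.gluedPl k g h n))
        (D.logData.toLog_rs b hb m)).trans ?_
      have e₁ : pullback.lift u g h.symm ≫ pullback.fst (D.c k) v = u := pullback.lift_fst _ _ _
      refine (congrArg ((D.X k).rs a ha) ((D.X k).rs_rs _ _ _ _ _ ?_ rfl _)).trans
        ((D.X k).rs_rs _ _ _ _ _ ?_ ?_ _)
      · rw [Category.assoc, pullback.lift_fst, pullback.lift_fst]
      · rw [pullback.lift_fst]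
      · refine pullback.hom_ext ?_ ?_
        · rw [Category.assoc, Category.assoc, pullback.lift_fst, pullback.lift_fst,
            pullback.lift_fst, ha]
        · rw [Category.assoc, Category.assoc, pullback.lift_snd, pullback.lift_snd,
            ← Category.assoc (pullback.lift u g _), pullback.lift_snd, e])
    (by
      intro U V u v _ _ g h m
      exact D.ex_gluedPl k g h m)

theorem gluedι_f (k : D.K) : (D.gluedι k).f = D.c k := rfl

theorem pl_gluedι (F : T ⟶ D.X k) (H : T ⟶ D.glued) (hH : F ≫ D.gluedι k = H) {V : Scheme.{u}}
    (v : V ⟶ D.glued.scheme) [Etale v] (g : T.scheme ⟶ V) (h : g ≫ v = F.f ≫ D.c k)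
    (h' : g ≫ v = 𝟙 T.scheme ≫ H.f) (m : D.glued.Sec v) :
    Hom.pl H (u := 𝟙 T.scheme) g h' m = D.evs (u := v) F g h m := by
  subst hH
  have e : pullback.lift F.f g h.symm ≫ pullback.fst (D.c k) v = 𝟙 T.scheme ≫ F.f := by
    rw [pullback.lift_fst, Category.id_comp]
  have e' : pullback.snd (D.c k) v ≫ v = pullback.fst (D.c k) v ≫ (D.gluedι k).f :=
    pullback.condition.symm
  refine (comp_pl F (D.gluedι k) (u := 𝟙 T.scheme) (v := pullback.fst (D.c k) v)
    (w := v) (pullback.lift F.f g h.symm) e (pullback.snd (D.c k) v) e' g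
    h' (pullback.lift_snd _ _ _).symm m).trans ?_
  obtain ⟨n, rfl⟩ : ∃ n : D.secs v, n = m := ⟨m, rfl⟩
  refine F.pl_rs (u := 𝟙 T.scheme) (v := pullback.fst (D.c k) v) (v' := pullback.fst (D.c k) v)
    (pullback.lift F.f g h.symm) e (pullback.lift (pullback.fst (D.c k) v)
      (pullback.snd (D.c k) v) e'.symm) (pullback.lift_fst _ _ _) (pullback.lift F.f g h.symm)
    e (pullback.hom_ext ?_ ?_) (n.1 k)
  · exact (pullback.lift_fst _ _ _).trans ((Category.assoc _ _ _).trans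
      ((congrArg (_ ≫ ·) (pullback.lift_fst _ _ _)).trans (pullback.lift_fst _ _ _))).symm
  · exact (pullback.lift_snd _ _ _).trans ((Category.assoc _ _ _).trans
      ((congrArg (_ ≫ ·) (pullback.lift_snd _ _ _)).trans (pullback.lift_snd _ _ _))).symm

theorem comp_gluedι_eq_of_R (hT : IsFs T) {F : T ⟶ D.X k} {F' : T ⟶ D.X l} (hR : D.R F F') :
    F ≫ D.gluedι k = F' ≫ D.gluedι l := by
  refine hom_ext_of_global (D.R_f hT hR) fun {U V} u _ v _ g w w' m => ?_
  have hU := (isStrictEtale_inducedMap T u).isFs hT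
  have h₁ : g ≫ v = (T.inducedMap u ≫ F).f ≫ D.c k :=
    w.trans ((Category.id_comp _).trans (Category.assoc _ _ _).symm)
  have h₂ : g ≫ v = (T.inducedMap u ≫ F').f ≫ D.c l :=
    w'.trans ((Category.id_comp _).trans (Category.assoc _ _ _).symm)
  refine (D.pl_gluedι (T := T.induced u) (T.inducedMap u ≫ F) _ (Category.assoc _ _ _) v g h₁ w m).trans
    (Eq.trans ?_ (D.pl_gluedι (T := T.induced u) (T.inducedMap u ≫ F') _ (Category.assoc _ _ _) v g h₂ w' m).symm)
  exact D.evs_eq_of_R hU (D.R_comp _ hR) g h₁ h₂ m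

theorem evs_eq_pl (F : T ⟶ D.X k) {U V : Scheme.{u}} {u : U ⟶ (D.X k).scheme} {v : V ⟶ Y} [Etale u]
    [Etale v] (b : U ⟶ V) (h : b ≫ v = u ≫ D.c k) (g : T.scheme ⟶ U) (hg : g ≫ u = 𝟙 T.scheme ≫ F.f)
    (h' : (g ≫ b) ≫ v = F.f ≫ D.c k) (m : D.secs v) :
    D.evs v F (g ≫ b) h' m = F.pl g hg (D.gluedPl k b h m) := by
  refine (F.pl_rs _ _ _ _ _ _ (pullback.hom_ext ?_ ?_) _).symm
  · rw [pullback.lift_fst, Category.assoc, pullback.lift_fst, hg, Category.id_comp]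
  · rw [pullback.lift_snd, Category.assoc, pullback.lift_snd]

/-- The glued logarithmic structure restricts to the given one on each member of the cover. -/
theorem bijective_gluedPl {U : Scheme.{u}} (u : U ⟶ (D.X k).scheme) (v : U ⟶ Y) [Etale u] [Etale v]
    (h : 𝟙 U ≫ v = u ≫ D.c k) : Function.Bijective (D.gluedPl k (u := u) (𝟙 U) h) := by
  have hv : v = u ≫ D.c k := by rw [← h, Category.id_comp]
  constructor
  · intro m n e
    refine D.secs_ext' fun T hT l F g hg => ?_
    have h₁ : (g ≫ u) ≫ D.c k = F.f ≫ D.c l := by rw [Category.assoc, ← hv, hg]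
    obtain ⟨F₁, hF₁, hR⟩ := D.R_lift F (g ≫ u) hT h₁
    have h₂ : (g ≫ 𝟙 U) ≫ v = F₁.f ≫ D.c k := by
      rw [hF₁, Category.comp_id, hv, Category.assoc]
    have h₃ : g ≫ v = F₁.f ≫ D.c k := by rw [← h₂, Category.comp_id]
    have h₄ : g ≫ u = 𝟙 T.scheme ≫ F₁.f := by rw [hF₁, Category.id_comp]
    have key : ∀ m : D.secs v, D.evs v F g hg m = F₁.pl g h₄ (D.gluedPl k (𝟙 U) h m) := fun m => by
      rw [D.evs_eq_of_R hT hR g hg h₃, ← D.evs_eq_pl F₁ (𝟙 U) h g h₄ h₂]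
      simp only [Category.comp_id]
    rw [key, key, e]
  · intro n
    -- The section of the glued structure with value `F₁^* n` along every `F` related to a morphism `F₁`
    -- to `X k` over `g`.
    obtain ⟨m, hm⟩ := D.exists_secs v (fun {T l} F g _ t => ∃ (F₁ : T ⟶ D.X k)
        (e : g ≫ u = 𝟙 T.scheme ≫ F₁.f), D.R F F₁ ∧ t = F₁.pl g e n)
      (by
        rintro T T' hT hT' b l F g hg t F' rfl g' rfl h' ⟨F₁, e, hR, rfl⟩
        have e' : (b.f ≫ g) ≫ u = 𝟙 T'.scheme ≫ (b ≫ F₁).f := by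
          rw [Category.assoc, e, Category.id_comp, Category.id_comp, comp_f]
        refine ⟨b ≫ F₁, e', D.R_comp b hR, ?_⟩
        exact (comp_pl b F₁ (u := 𝟙 _) (v := 𝟙 _) b.f _ g e (b.f ≫ g) e' rfl n).symm)
      (by
        rintro T hT l F g hg _ _ ⟨F₁, e₁, hR₁, rfl⟩ ⟨F₂, e₂, hR₂, rfl⟩
        have e : F₁.f = F₂.f := by rw [← Category.id_comp F₁.f, ← e₁, e₂, Category.id_comp]
        obtain rfl := D.R_ext hT (D.R_euclid hR₁ hR₂) e
        rfl)
      (by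
        rintro T hT l l' F F' hR g hg hg' t ⟨F₁, e, hR₁, rfl⟩
        exact ⟨F₁, e, D.R_euclid hR hR₁, rfl⟩)
      (by
        intro T hT l F g hg
        have h₁ : (g ≫ u) ≫ D.c k = F.f ≫ D.c l := by rw [Category.assoc, ← hv, hg]
        obtain ⟨F₁, hF₁, hR⟩ := D.R_lift F (g ≫ u) hT h₁
        refine EtLocally.of_self ⟨D.comp_condition hg (𝟙 T), _, 𝟙 T ≫ F₁, ?_,
          D.R_comp (𝟙 T) hR, rfl⟩
        rw [Category.assoc, ← hF₁, Category.id_comp, comp_f])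
    have hfs := (isStrictEtale_inducedMap (D.X k) u).isFs (D.fs k)
    have e : 𝟙 U ≫ u = 𝟙 U ≫ ((D.X k).inducedMap u).f := rfl
    have h₂ : (𝟙 U ≫ 𝟙 U) ≫ v = ((D.X k).inducedMap u).f ≫ D.c k := by
      rw [Category.assoc, h, Category.id_comp]
      rfl
    refine ⟨m, ((isStrictEtale_inducedMap (D.X k) u).bijective
      (𝟙 ((D.X k).induced u).scheme) u e).1 ?_⟩
    refine (D.evs_eq_pl ((D.X k).inducedMap u) (𝟙 U) h (𝟙 U) e h₂ m).symm.trans ?_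
    refine hm _ hfs k ((D.X k).inducedMap u) _ h₂ _ ⟨(D.X k).inducedMap u, ?_, D.R_refl _, ?_⟩
    · rw [Category.id_comp (𝟙 U)]
      exact e
    · exact Hom.pl_congr _ (Category.id_comp _).symm _ _ _

theorem isStrictEtale_gluedι (k : D.K) : IsStrictEtale (D.gluedι k) :=
  isStrictEtale_iff.2 ⟨D.etale k, fun {_} u _ v _ h => D.bijective_gluedPl u v h⟩

theorem gluedι_cover (y : D.glued.scheme) : ∃ (k : D.K) (x : (D.X k).scheme), (D.gluedι k).f x = y :=
  D.cover y

theorem isFs_glued : IsFs D.glued := isFs_of_etLocally fun y => by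
  obtain ⟨k, x, hx⟩ := D.cover y
  exact ⟨_, D.gluedι k, x, D.isStrictEtale_gluedι k, hx, D.fs k⟩

/-- Morphisms which become equal in the glued logarithmic scheme are related. -/
theorem R_of_comp_gluedι_eq (hT : IsFs T) {F : T ⟶ D.X k} {F' : T ⟶ D.X l}
    (h : F ≫ D.gluedι k = F' ≫ D.gluedι l) : D.R F F' := by
  obtain ⟨F₁, hF₁, hR⟩ := D.R_lift F F'.f hT (congrArg Hom.f h).symm
  obtain rfl : F₁ = F' := (D.isStrictEtale_gluedι l).hom_ext
    ((D.comp_gluedι_eq_of_R hT hR).symm.trans h) hF₁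
  exact hR

end EtaleGluing

end LogScheme
end
end LogGeometry

namespace LogGeometry
noncomputable section
namespace LogScheme

/-! ### Representability of sheaves is étale local on the base -/

/-- A sheaf on logarithmic schemes for strict étale covers, with a natural map `τ` to the functor of
points of a scheme `B`. -/
structure EtaleSheaf (B : Scheme.{u}) where
  obj : LogScheme.{u} → Type (u + 1)
  pull : ∀ {T T' : LogScheme.{u}}, (T' ⟶ T) → obj T → obj T'
  pull_comp : ∀ {T T' T'' : LogScheme.{u}} (a : T'' ⟶ T') (b : T' ⟶ T) (x : obj T),
    pull (a ≫ b) x = pull a (pull b x)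
  τ : ∀ {T : LogScheme.{u}}, obj T → (T.scheme ⟶ B)
  τ_pull : ∀ {T T' : LogScheme.{u}} (a : T' ⟶ T) (x : obj T), τ (pull a x) = a.f ≫ τ x
  ext_of_cover : ∀ {T : LogScheme.{u}} {K : Type u} {C : K → LogScheme.{u}} (s : ∀ k, C k ⟶ T),
    (∀ k, IsStrictEtale (s k)) → (∀ t : T.scheme, ∃ k y, (s k).f y = t) → ∀ (x y : obj T),
    (∀ k, pull (s k) x = pull (s k) y) → x = y
  exists_of_cover : ∀ {T : LogScheme.{u}} {K : Type u} {C : K → LogScheme.{u}} (s : ∀ k, C k ⟶ T),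
    (∀ k, IsStrictEtale (s k)) → (∀ t : T.scheme, ∃ k y, (s k).f y = t) → ∀ x : ∀ k, obj (C k),
    (∀ (k l : K) (Z : LogScheme.{u}) (a : Z ⟶ C k) (b : Z ⟶ C l), IsStrictEtale a → IsStrictEtale b →
      a ≫ s k = b ≫ s l → pull a (x k) = pull b (x l)) → ∃ y : obj T, ∀ k, pull (s k) y = x k

namespace EtaleSheaf

variable {B : Scheme.{u}} (G : EtaleSheaf B)

theorem ext_of_etLocally {T : LogScheme.{u}} {x y : G.obj T}
    (h : EtLocally T fun _ a => G.pull a x = G.pull a y) : x = y := by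
  choose U a z ha hz e using h
  exact G.ext_of_cover a ha (fun t => ⟨t, z t, hz t⟩) x y e

/-- The fs logarithmic scheme `X` represents the sheaf of pairs of a section `x` of `G` and a lift of
`τ x` along `b : V ⟶ B`; the universal pair is `(g, v)`. -/
structure Rep {V : Scheme.{u}} (b : V ⟶ B) (X : LogScheme.{u}) (g : G.obj X) (v : X.scheme ⟶ V) :
    Prop where
  fs : IsFs X
  w : v ≫ b = G.τ g
  hom_ext : ∀ {T : LogScheme.{u}}, IsFs T → ∀ p q : T ⟶ X, G.pull p g = G.pull q g →
    p.f ≫ v = q.f ≫ v → p = q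
  exists_hom : ∀ {T : LogScheme.{u}}, IsFs T → ∀ (x : G.obj T) (t : T.scheme ⟶ V), t ≫ b = G.τ x →
    ∃ p : T ⟶ X, G.pull p g = x ∧ p.f ≫ v = t

variable {G} {V V' : Scheme.{u}} {b : V ⟶ B} {X : LogScheme.{u}} {g : G.obj X} {v : X.scheme ⟶ V}

theorem Rep.pull_w (h : G.Rep b X g v) {T : LogScheme.{u}} (p : T ⟶ X) :
    p.f ≫ v ≫ b = G.τ (G.pull p g) := by rw [G.τ_pull, h.w]

theorem Rep.hom_ext_of_mono (h : G.Rep b X g v) [Mono b] {T : LogScheme.{u}} (hT : IsFs T) (p q : T ⟶ X)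
    (e : G.pull p g = G.pull q g) : p = q :=
  h.hom_ext hT p q e (by
    rw [← cancel_mono b, Category.assoc, Category.assoc, h.pull_w, h.pull_w, e])

/-- Representability is preserved by étale base change. -/
theorem Rep.baseChange (h : G.Rep b X g v) (a : V' ⟶ V) [Etale a] :
    G.Rep (a ≫ b) (X.induced (pullback.fst v a)) (G.pull (X.inducedMap (pullback.fst v a)) g)
      (pullback.snd v a) where
  fs := (isStrictEtale_inducedMap X _).isFs h.fs
  w := by
    rw [G.τ_pull, ← h.w, ← Category.assoc, ← pullback.condition, Category.assoc]
    rfl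
  hom_ext {T} hT p q e e' := by
    have hs := isStrictEtale_inducedMap X (pullback.fst v a)
    rw [← G.pull_comp, ← G.pull_comp] at e
    have hpq : p ≫ X.inducedMap (pullback.fst v a) = q ≫ X.inducedMap (pullback.fst v a) := by
      refine h.hom_ext hT _ _ e ?_
      have := congrArg (· ≫ a) e'
      simp only [Category.assoc, ← pullback.condition] at this
      exact ((Category.assoc _ _ _).trans this).trans (Category.assoc _ _ _).symm
    exact hs.hom_ext hpq (pullback.hom_ext (congrArg Hom.f hpq) e')
  exists_hom {T} hT x t ht := by
    have hs := isStrictEtale_inducedMap X (pullback.fst v a)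
    obtain ⟨p, rfl, hp⟩ := h.exists_hom hT x (t ≫ a) (by rw [Category.assoc, ht])
    obtain ⟨q, ⟨rfl, hq⟩, -⟩ := hs.existsUnique_lift p (pullback.lift p.f t hp) (pullback.lift_fst _ _ _)
    exact ⟨q, (G.pull_comp _ _ _).symm, by rw [hq]; exact pullback.lift_snd _ _ _⟩

theorem Rep.congr_base {b' : V ⟶ B} (h : G.Rep b X g v) (e : b = b') : G.Rep b' X g v := e ▸ h

/-- If the schemes underlying the representing objects over an étale cover `W k` of `V` are the base
changes of a scheme `Y` over `V`, compatibly with the comparison isomorphisms, then the logarithmic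
structures descend to `Y`. -/
theorem Rep.glue [Mono b] {K : Type u} {W : K → Scheme.{u}} (a : ∀ k, W k ⟶ V) [∀ k, Etale (a k)]
    (ha : ∀ x : V, ∃ k y, a k y = x) {X : K → LogScheme.{u}} {g : ∀ k, G.obj (X k)}
    {v : ∀ k, (X k).scheme ⟶ W k} (h : ∀ k, G.Rep (a k ≫ b) (X k) (g k) (v k)) {Y : Scheme.{u}}
    (y : Y ⟶ V) (c : ∀ k, (X k).scheme ⟶ Y) (hc : ∀ k, IsPullback (c k) (v k) y (a k))
    (hcomp : ∀ {T : LogScheme.{u}}, IsFs T → ∀ {k l} (F : T ⟶ X k) (F' : T ⟶ X l),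
      G.pull F (g k) = G.pull F' (g l) → F.f ≫ c k = F'.f ≫ c l) :
    ∃ (N : LogScheme.{u}) (n : G.obj N) (z : N.scheme ⟶ V), G.Rep b N n z := by
  -- Two morphisms to the members of the cover are related if they give the same object of `G`.
  let D : EtaleGluing Y :=
    { K := K
      X := X
      fs := fun k => (h k).fs
      c := c
      etale := fun k => MorphismProperty.of_isPullback (P := @Etale) (hc k).flip inferInstance
      cover := fun z => by
        obtain ⟨k, w, hw⟩ := ha (y z)
        obtain ⟨t, ht, -⟩ := Scheme.Pullback.exists_preimage_pullback (f := y) (g := a k) z w hw.symm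
        refine ⟨k, (hc k).isoPullback.inv t, ?_⟩
        rw [← Scheme.Hom.comp_apply, (hc k).isoPullback_inv_fst, ht]
      R := fun {T k l} F F' => G.pull F (g k) = G.pull F' (g l)
      R_refl := fun F => rfl
      R_euclid := fun h₁ h₂ => h₁.symm.trans h₂
      R_comp := fun {T T' k l} a {F F'} e => by rw [G.pull_comp, e, G.pull_comp]
      R_f := fun hT e => hcomp hT _ _ e
      R_ext := fun {T k F F'} hT e e' => (h k).hom_ext hT F F' e (by rw [e'])
      R_lift := fun {T k l} F f' hT e => by
        have e₁ : (f' ≫ v l) ≫ a l = F.f ≫ v k ≫ a k := by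
          rw [Category.assoc, ← (hc l).w, ← (hc k).w, ← Category.assoc, e, Category.assoc]
        obtain ⟨F', hF', hv⟩ := (h l).exists_hom hT (G.pull F (g k)) (f' ≫ v l) (by
          rw [← Category.assoc, e₁, ← (h k).pull_w]
          simp only [Category.assoc])
        refine ⟨F', (hc l).hom_ext ?_ hv, hF'.symm⟩
        rw [e, hcomp hT F F' hF'.symm] }
  have hs := D.isStrictEtale_gluedι
  -- The objects `g k` glue to the universal object `n` over the glued logarithmic scheme.
  obtain ⟨n, hn⟩ := G.exists_of_cover (T := D.glued) D.gluedι hs D.gluedι_cover g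
    (fun k l Z p q hp hq e => D.R_of_comp_gluedι_eq (hp.isFs (h k).fs) e)
  have w : y ≫ b = G.τ n := by
    refine etale_hom_ext fun z => ?_
    obtain ⟨k, x, hx⟩ := D.cover z
    refine ⟨_, D.c k, D.etale k, x, hx, ?_⟩
    have e₁ : D.c k ≫ y = v k ≫ a k := (hc k).w
    rw [← Category.assoc, e₁, Category.assoc, (h k).w, ← hn k, G.τ_pull, D.gluedι_f]
  have hcov : EtLocally D.glued fun U a => ∃ k, ∃ p : U ⟶ X k, p ≫ D.gluedι k = a := fun z => by
    obtain ⟨k, x, hx⟩ := D.cover z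
    exact ⟨_, D.gluedι k, x, hs k, hx, k, 𝟙 _, Category.id_comp _⟩
  have huniq : ∀ {T : LogScheme.{u}}, IsFs T → ∀ p q : T ⟶ D.glued, G.pull p n = G.pull q n →
      p = q := by
    intro T hT p q e
    have hloc : EtLocally T fun _ d => d ≫ p = d ≫ q := by
      refine (hcov.pull p).bind ?_
      rintro U d hd ⟨U₁, _, d₁, -, e₁, k, p', rfl⟩
      refine (hcov.pull (d ≫ q)).mono ?_
      rintro U' d' hd' ⟨U₂, _, d₂, -, e₂, l, q', rfl⟩
      have hU := hd'.isFs (hd.isFs hT)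
      have e₃ : (d' ≫ d) ≫ p = (d' ≫ d₁ ≫ p') ≫ D.gluedι k := by
        rw [Category.assoc, Category.assoc, Category.assoc, e₁]
      have e₄ : (d' ≫ d) ≫ q = (d₂ ≫ q') ≫ D.gluedι l := by
        rw [Category.assoc, Category.assoc, e₂]
      rw [e₃, e₄]
      refine D.comp_gluedι_eq_of_R hU ?_
      change G.pull _ (g k) = G.pull _ (g l)
      rw [← hn k, ← hn l, ← G.pull_comp, ← G.pull_comp, ← e₃, ← e₄, G.pull_comp _ p, e, G.pull_comp _ q]
    choose U d z hd hz e using hloc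
    exact hom_ext_of_cover hd (fun t => ⟨t, z t, hz t⟩) e
  refine ⟨D.glued, n, y, D.isFs_glued, w, fun hT p q e _ => huniq hT p q e, ?_⟩
  intro T hT x t ht
  obtain ⟨p, hp⟩ := exists_hom_of_local (X := D.glued) (T := T)
    (fun U d p => G.pull p n = G.pull d x)
    (fun U V d d' p _ _ e => by rw [G.pull_comp, e, G.pull_comp])
    (fun U d p p' hd e e' => huniq (hd.isFs hT) p p' (e.trans e'.symm))
    ((EtaleGluing.etLocally_lift t (fun {U} a' => ∃ k, ∃ j : U ⟶ W k, j ≫ a k = a') fun z => by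
        obtain ⟨k, w, hw⟩ := ha z
        exact ⟨_, a k, inferInstance, w, hw, k, 𝟙 _, Category.id_comp _⟩).mono (by
      rintro U d hd ⟨U', _, j', ⟨k, j, rfl⟩, hj⟩
      obtain ⟨p, hp, -⟩ := (h k).exists_hom (hd.isFs hT) (G.pull d x) (j' ≫ j) (by
        have := congrArg (· ≫ b) hj
        simp only [Category.assoc] at this
        rw [Category.assoc, this, ht, G.τ_pull])
      exact ⟨p ≫ D.gluedι k, by rw [G.pull_comp, hn, hp]⟩))
  have hpx : G.pull p n = x := G.ext_of_etLocally (hp.mono fun U d _ e => by rw [← G.pull_comp, e])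
  refine ⟨p, hpx, ?_⟩
  rw [← cancel_mono b, Category.assoc, w, ht, ← hpx, G.τ_pull]

end EtaleSheaf

end LogScheme
end
end LogGeometry

namespace LogGeometry
noncomputable section
namespace LogScheme
namespace EtaleSheaf

variable {B : Scheme.{u}} {G : EtaleSheaf B} {V V' : Scheme.{u}} {b : V ⟶ B} {X X' : LogScheme.{u}}
  {g : G.obj X} {g' : G.obj X'} {v : X.scheme ⟶ V} {v' : X'.scheme ⟶ V'}

/-- The scheme underlying the representing object is compatible with étale base change. -/
theorem Rep.isPullback (h : G.Rep b X g v) (a : V' ⟶ V) [Etale a] (h' : G.Rep (a ≫ b) X' g' v')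
    (p : X' ⟶ X) (hp : G.pull p g = g') (hv : p.f ≫ v = v' ≫ a) : IsPullback p.f v' v a := by
  have h₁ := h.baseChange a
  obtain ⟨i, hi, hi'⟩ := h₁.exists_hom h'.fs g' v' h'.w
  obtain ⟨j, hj, hj'⟩ := h'.exists_hom h₁.fs _ _ h₁.w
  have hij : i ≫ j = 𝟙 _ := h'.hom_ext h'.fs _ _
    (by rw [G.pull_comp, hj, hi]; subst hp; rw [← G.pull_comp, Category.id_comp])
    (by rw [comp_f, Category.assoc, hj', hi', id_f, Category.id_comp])
  have hji : j ≫ i = 𝟙 _ := h₁.hom_ext h₁.fs _ _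
    (by rw [G.pull_comp, hi, hj, ← G.pull_comp, Category.id_comp])
    (by rw [comp_f, Category.assoc, hi', hj', id_f, Category.id_comp])
  have hpi : i ≫ X.inducedMap (pullback.fst v a) = p := h.hom_ext h'.fs _ _
    (by rw [G.pull_comp, hi, hp]) (by
      rw [hv, ← hi', Category.assoc, ← pullback.condition]
      rfl)
  exact IsPullback.of_iso_pullback ⟨hv⟩ ⟨i.f, j.f, congrArg Hom.f hij, congrArg Hom.f hji⟩
    (congrArg Hom.f hpi) hi'

/-- The opens of the base over which `G` is representable. -/
def IsRep (G : EtaleSheaf B) (U : B.Opens) : Prop :=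
  ∃ (X : LogScheme.{u}) (g : G.obj X) (v : X.scheme ⟶ U), G.Rep U.ι X g v

theorem IsRep.mono {U U' : B.Opens} (h : G.IsRep U) (hU : U' ≤ U) : G.IsRep U' := by
  obtain ⟨X, g, v, h⟩ := h
  exact ⟨_, _, _, (h.baseChange (B.homOfLE hU)).congr_base (B.homOfLE_ι hU)⟩

/-- The open cover by the opens over which `G` is representable. -/
def repCover (H : ∀ x : B, ∃ U : B.Opens, x ∈ U ∧ G.IsRep U) : B.OpenCover where
  I₀ := {U : B.Opens // G.IsRep U}
  X U := U.1
  f U := U.1.ι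
  mem₀ := by
    rw [Scheme.presieve₀_mem_precoverage_iff]
    refine ⟨fun x => ?_, inferInstance⟩
    obtain ⟨U, hx, hU⟩ := H x
    exact ⟨⟨U, hU⟩, ⟨x, hx⟩, rfl⟩

variable {H : ∀ x : B, ∃ U : B.Opens, x ∈ U ∧ G.IsRep U}

instance : PartialOrder (repCover H).I₀ :=
  inferInstanceAs (PartialOrder {U : B.Opens // G.IsRep U})

instance : Small.{u} (repCover H).I₀ := inferInstanceAs (Small.{u} {U : B.Opens // G.IsRep U})

instance : (repCover H).LocallyDirected :=
  Scheme.Cover.LocallyDirected.ofIsBasisOpensRange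
    (fun {i j} => by
      change i.1 ≤ j.1 ↔ i.1.ι.opensRange ≤ j.1.ι.opensRange
      rw [Scheme.Opens.opensRange_ι, Scheme.Opens.opensRange_ι]) (by
    refine TopologicalSpace.Opens.isBasis_iff_nbhd.2 fun {U x} hx => ?_
    obtain ⟨W, hxW, hW⟩ := H x
    have e : (W ⊓ U).ι.opensRange = W ⊓ U := Scheme.Opens.opensRange_ι _
    exact ⟨_, ⟨⟨W ⊓ U, hW.mono inf_le_left⟩, rfl⟩, e.ge ⟨hxW, hx⟩, e.le.trans inf_le_right⟩)

theorem exists_glued {S : Scheme.{u}} {𝒰 : S.OpenCover} [Category 𝒰.I₀] [𝒰.LocallyDirected]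
    [Small.{u} 𝒰.I₀] [Quiver.IsThin 𝒰.I₀] (d : 𝒰.RelativeGluingData) :
    ∃ (Y : Scheme.{u}) (y : Y ⟶ S) (c : ∀ i, d.functor.obj i ⟶ Y),
      (∀ i, IsPullback (c i) (d.natTrans.app i) y (𝒰.f i)) ∧
        ∀ (i j : 𝒰.I₀) (e : i ⟶ j), d.functor.map e ≫ c j = c i :=
  ⟨d.glued, d.toBase, fun i => colimit.ι d.functor i,
    fun i => (d.isPullback_natTrans_ι_toBase i).flip, fun _ _ e => colimit.w d.functor e⟩

/-- A sheaf which is representable locally on the base is representable. -/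
theorem exists_rep_of_opens (H : ∀ x : B, ∃ U : B.Opens, x ∈ U ∧ G.IsRep U) :
    ∃ (N : LogScheme.{u}) (n : G.obj N) (z : N.scheme ⟶ B), G.Rep (𝟙 B) N n z := by
  have hrep : ∀ U : (repCover H).I₀, ∃ (X : LogScheme.{u}) (g : G.obj X)
      (v : X.scheme ⟶ (repCover H).X U), G.Rep ((repCover H).f U) X g v := fun U => U.2
  choose X g v h using hrep
  have hmono : ∀ U, Mono ((repCover H).f U) := fun U => inferInstance
  have hw : ∀ {U U' : (repCover H).I₀} (e : U ⟶ U'),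
      (repCover H).trans e ≫ (repCover H).f U' = (repCover H).f U := fun e =>
    (repCover H).trans_map e
  have hp : ∀ (U U' : (repCover H).I₀) (e : U ⟶ U'), ∃ p : X U ⟶ X U', G.pull p (g U') = g U ∧
      p.f ≫ v U' = v U ≫ (repCover H).trans e := fun U U' e =>
    (h U').exists_hom (h U).fs _ _ (by rw [Category.assoc, hw e]; exact (h U).w)
  choose p hp hpv using hp
  have hid : ∀ U, G.pull (𝟙 _) (g U) = g U := fun U => by
    have := G.pull_comp (𝟙 _) (p U U (𝟙 U)) (g U)
    rw [Category.id_comp, hp] at this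
    exact this.symm
  let F : (repCover H).I₀ ⥤ Scheme.{u} :=
    { obj := fun U => (X U).scheme
      map := fun {U U'} e => (p U U' e).f
      map_id := fun U => congrArg Hom.f ((h U).hom_ext_of_mono (h U).fs (p U U (𝟙 U)) (𝟙 _)
        ((hp U U (𝟙 U)).trans (hid U).symm))
      map_comp := fun {U U' U''} e e' => congrArg Hom.f ((h U'').hom_ext_of_mono (h U).fs
        (p U U'' (e ≫ e')) (p U U' e ≫ p U' U'' e') (by rw [G.pull_comp, hp, hp, hp])) }
  let d : (repCover H).RelativeGluingData :=
    { functor := F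
      natTrans := { app := v, naturality := fun U U' e => hpv U U' e }
      equifibered := fun {U U'} e => by
        have : Etale ((repCover H).trans e) := inferInstance
        exact (h U').isPullback ((repCover H).trans e) ((h U).congr_base (hw e).symm) (p U U' e)
          (hp U U' e) (hpv U U' e) }
  obtain ⟨Y, y, c, hc, hcw⟩ := exists_glued d
  refine Rep.glue (G := G) (b := 𝟙 B) (K := (repCover H).I₀) (repCover H).f
    (fun x => ?_) (X := X) (g := g) (v := v) (fun U => (h U).congr_base (Category.comp_id _).symm)
    y c hc ?_
  · obtain ⟨U, hx, hU⟩ := H x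
    exact ⟨⟨U, hU⟩, ⟨x, hx⟩, rfl⟩
  · intro T hT U U' K K' e
    -- both morphisms factor through the object representing `G` over the intersection
    let U'' : (repCover H).I₀ := ⟨U.1 ⊓ U'.1, U.2.mono inf_le_left⟩
    have hr : Set.range (G.τ (G.pull K (g U))) ⊆ Set.range ((repCover H).f U'') := by
      rintro _ ⟨t, rfl⟩
      refine (Scheme.Opens.range_ι (U.1 ⊓ U'.1)).ge ?_
      constructor
      · rw [← (h U).pull_w]
        exact (v U (K.f t)).2
      · rw [e, ← (h U').pull_w]
        exact (v U' (K'.f t)).2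
    obtain ⟨q, hq, -⟩ := (h U'').exists_hom hT (G.pull K (g U)) (IsOpenImmersion.lift ((repCover H).f U'') _ hr)
      (IsOpenImmersion.lift_fac _ _ _)
    have key : ∀ {W : (repCover H).I₀} (i : U'' ⟶ W) (L : T ⟶ X W),
        G.pull L (g W) = G.pull K (g U) → L.f ≫ c W = q.f ≫ c U'' := by
      intro W i L hL
      have : L = q ≫ p U'' W i := (h W).hom_ext_of_mono hT _ _ (by rw [G.pull_comp, hp, hq, hL])
      rw [this, comp_f, Category.assoc]
      exact congrArg (q.f ≫ ·) (hcw _ _ i)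
    exact (key (homOfLE (inf_le_left : U.1 ⊓ U'.1 ≤ U.1)) K rfl).trans
      (key (homOfLE (inf_le_right : U.1 ⊓ U'.1 ≤ U'.1)) K' e.symm).symm

end EtaleSheaf
end LogScheme
end
end LogGeometry

namespace LogGeometry
noncomputable section
open scoped TensorProduct

/-! ### Descent of algebras along flat ring extensions -/

section Algebra

open Algebra.TensorProduct

variable {R R' C : Type u} [CommRing R] [CommRing R'] [CommRing C] [Algebra R R'] [Algebra R' C]
  [Algebra R C] [IsScalarTower R R' C]

variable (R R' C) in
/-- The multiplication `R' ⊗ C → C`. -/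
def mulLeft : R' ⊗[R] C →ₐ[R] C :=
  lift (IsScalarTower.toAlgHom R R' C) (AlgHom.id R C) fun _ _ => mul_comm _ _

theorem mulLeft_tmul (r : R') (c : C) : mulLeft R R' C (r ⊗ₜ c) = algebraMap R' C r * c := by
  exact lift_tmul ..

/-- The canonical map from the base change of the ring of invariants of a descent datum. -/
def invariantsMap (e : C →ₐ[R] R' ⊗[R] C) : R' ⊗[R] (AlgHom.equalizer includeRight e) →ₐ[R] C :=
  (mulLeft R R' C).comp (Algebra.TensorProduct.map (AlgHom.id R R')
    (AlgHom.equalizer includeRight e).val)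

/-- A descent datum for an algebra along a flat ring extension is effective. -/
theorem bijective_invariantsMap [Module.Flat R R'] (e : C →ₐ[R] R' ⊗[R] C)
    (h₁ : ∀ r : R', e (algebraMap R' C r) = r ⊗ₜ 1) (h₂ : ∀ c, mulLeft R R' C (e c) = c)
    (h₃ : ∀ c, Algebra.TensorProduct.map (AlgHom.id R R') (includeRight : C →ₐ[R] R' ⊗[R] C) (e c) =
      Algebra.TensorProduct.map (AlgHom.id R R') e (e c)) :
    Function.Bijective (invariantsMap e) := by
  let s : R' ⊗[R] (R' ⊗[R] C) →ₐ[R] R' ⊗[R] C :=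
    lift includeLeft (AlgHom.id R _) fun _ _ => mul_comm _ _
  -- an element of the equalizer is the image of its product under `e`
  have hs₁ : ∀ y, s (Algebra.TensorProduct.map (AlgHom.id R R')
      (includeRight : C →ₐ[R] R' ⊗[R] C) y) = y := fun y => by
    induction y using TensorProduct.induction_on with
    | zero => simp
    | add x y hx hy => rw [map_add, map_add, hx, hy]
    | tmul r c =>
      refine (lift_tmul ..).trans ?_
      simp
  have hs₂ : ∀ y, s (Algebra.TensorProduct.map (AlgHom.id R R') e y) = e (mulLeft R R' C y) := fun y => by
    induction y using TensorProduct.induction_on with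
    | zero => simp
    | add x y hx hy => simp only [map_add, hx, hy]
    | tmul r c =>
      refine (lift_tmul ..).trans ?_
      rw [mulLeft_tmul, map_mul, h₁]
      simp
  let φ := AlgHom.tensorEqualizerEquiv R R' (includeRight : C →ₐ[R] R' ⊗[R] C) e
  have hφ : ∀ x, ((φ x : _) : R' ⊗[R] C) = Algebra.TensorProduct.map (AlgHom.id R R')
      (AlgHom.equalizer includeRight e).val x := fun x => AlgHom.coe_tensorEqualizer R R' _ _ x
  have key : ∀ x, ((φ x : _) : R' ⊗[R] C) = e (invariantsMap e x) := fun x => by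
    have := (φ x).2
    rw [AlgHom.mem_equalizer] at this
    rw [← hs₁ (φ x : R' ⊗[R] C), this, hs₂, hφ]
    rfl
  constructor
  · intro x x' hx
    exact φ.injective (Subtype.ext (by rw [key, key, hx]))
  · intro c
    obtain ⟨x, hx⟩ := φ.surjective ⟨e c, (AlgHom.mem_equalizer _ _ _).2 (h₃ c)⟩
    refine ⟨x, ?_⟩
    rw [← h₂ c, ← h₂ (invariantsMap e x), ← key, hx]

theorem isPushout_invariants (e : C →ₐ[R] R' ⊗[R] C) (h : Function.Bijective (invariantsMap e)) :
    IsPushout (CommRingCat.ofHom (algebraMap R R'))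
      (CommRingCat.ofHom (algebraMap R (AlgHom.equalizer includeRight e)))
      (CommRingCat.ofHom (algebraMap R' C))
      (CommRingCat.ofHom (AlgHom.equalizer includeRight e).val.toRingHom) := by
  refine (CommRingCat.isPushout_tensorProduct R R' (AlgHom.equalizer includeRight e)).of_iso
    (Iso.refl _) (Iso.refl _) (Iso.refl _)
    (RingEquiv.ofBijective (invariantsMap e).toRingHom h).toCommRingCatIso ?_ ?_ ?_ ?_
  · simp
  · simp
  · ext r
    simp [invariantsMap, mulLeft_tmul]
  · ext r
    simp [invariantsMap, mulLeft_tmul]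

end Algebra

/-- The morphism of spectra given by a ring homomorphism. -/
abbrev specMap {A A' : Type u} [CommRing A] [CommRing A'] (f : A →+* A') :
    Spec (.of A') ⟶ Spec (.of A) :=
  Spec.map (CommRingCat.ofHom f)

theorem specMap_comp {A A' A'' : Type u} [CommRing A] [CommRing A'] [CommRing A''] (f : A →+* A')
    (f' : A' →+* A'') : specMap f' ≫ specMap f = specMap (f'.comp f) :=
  (Spec.map_comp _ _).symm

theorem specMap_injective {A A' : Type u} [CommRing A] [CommRing A'] {f f' : A →+* A'}
    (h : specMap f = specMap f') : f = f' := by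
  have := Spec.map_injective h
  exact congrArg CommRingCat.Hom.hom this

namespace LogScheme
namespace EtaleSheaf

/-! ### Effectivity of étale descent for affine representing objects -/

variable {B : Scheme.{u}} {G : EtaleSheaf B} {X : LogScheme.{u}} {g : G.obj X}

open Algebra.TensorProduct in
/-- Effectivity of descent along an étale surjection `Spec R' ⟶ Spec R`. The universal property provides
a descent datum on the coordinate ring `C` of the representing object, and the scheme over which the
logarithmic structures are glued is the spectrum of its ring of invariants. -/
theorem Rep.descend_spec {R R' C : Type u} [CommRing R] [CommRing R'] [CommRing C] [Algebra R R']
    [Algebra R' C] [Algebra R C] [IsScalarTower R R' C] {b : Spec (.of R) ⟶ B} [Mono b]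
    [Etale (specMap (algebraMap R R'))] [Surjective (specMap (algebraMap R R'))]
    (φ : X.scheme ≅ Spec (.of C))
    (h : G.Rep (specMap (algebraMap R R') ≫ b) X g (φ.hom ≫ specMap (algebraMap R' C))) :
    ∃ (N : LogScheme.{u}) (n : G.obj N) (z : N.scheme ⟶ Spec (.of R)), G.Rep b N n z := by
  have hflat : Module.Flat R R' := by
    have : Flat (specMap (algebraMap R R')) := inferInstance
    exact RingHom.flat_algebraMap_iff.1 ((HasRingHomProperty.Spec_iff (P := @Flat)).1 this)
  let D := R' ⊗[R] C
  let e₀ : C →+* D := (includeRight : C →ₐ[R] R' ⊗[R] C).toRingHom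
  let r : R' →+* D := includeLeftRingHom
  have sq : IsPullback (specMap r) (specMap e₀) (specMap (algebraMap R R'))
      (specMap (algebraMap R C)) :=
    isPullback_SpecMap_of_isPushout _ _ _ _ (CommRingCat.isPushout_tensorProduct R R' C)
  have hva : (φ.hom ≫ specMap (algebraMap R' C)) ≫ specMap (algebraMap R R') =
      φ.hom ≫ specMap (algebraMap R C) := by
    rw [Category.assoc, specMap_comp, ← IsScalarTower.algebraMap_eq]
  have i₀ : Etale (specMap e₀) := MorphismProperty.of_isPullback (P := @Etale) sq inferInstance
  -- `Z` is the product of `Spec R'` with `X` over `Spec R`, with its two morphisms `π`, `σ` to `X`: the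
  -- projection, and the comparison with the other base change given by the universal property.
  let Z := X.induced (specMap e₀ ≫ φ.inv)
  let π : Z ⟶ X := X.inducedMap (specMap e₀ ≫ φ.inv)
  have hπ : IsStrictEtale π := isStrictEtale_inducedMap _ _
  have hπf : π.f ≫ φ.hom = specMap e₀ := by
    change (specMap e₀ ≫ φ.inv) ≫ φ.hom = _
    rw [Category.assoc, Iso.inv_hom_id, Category.comp_id]
  have hZ : IsFs Z := hπ.isFs h.fs
  obtain ⟨σ, hσ, hσv⟩ := h.exists_hom hZ (G.pull π g) (specMap r) (by
    rw [← h.pull_w, ← Category.assoc, sq.w, ← Category.assoc _ _ b, hva, ← hπf]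
    simp only [Category.assoc])
  obtain ⟨e₁, he₁⟩ : ∃ e₁ : C →+* D, σ.f ≫ φ.hom = specMap e₁ :=
    ⟨(Spec.preimage (σ.f ≫ φ.hom)).hom, (Spec.map_preimage _).symm⟩
  have h₁ : e₁.comp (algebraMap R' C) = r := specMap_injective (by
    rw [← specMap_comp, ← he₁, ← hσv, Category.assoc])
  have h₁' : ∀ x : R', e₁ (algebraMap R' C x) = x ⊗ₜ 1 := fun x => RingHom.congr_fun h₁ x
  let e : C →ₐ[R] R' ⊗[R] C :=
    { e₁ with
      commutes' := fun x => by
        change e₁ _ = _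
        rw [IsScalarTower.algebraMap_apply R R' C, h₁']
        rfl }
  have lift : ∀ {T : LogScheme.{u}} (F : T ⟶ X) (t : T.scheme ⟶ Spec (.of D)),
      t ≫ specMap e₀ = F.f ≫ φ.hom → ∃ d : T ⟶ Z, d ≫ π = F ∧ d.f = t := fun {T} F t ht => by
    obtain ⟨d, hd, -⟩ := hπ.existsUnique_lift F t (by
      rw [← cancel_mono φ.hom, Category.assoc, hπf, ht])
    exact ⟨d, hd⟩
  -- Morphisms to `X` giving the same object of `G` are the compositions of a morphism to `Z` with `π`, `σ`.
  have hcomp : ∀ {T : LogScheme.{u}}, IsFs T → ∀ F F' : T ⟶ X, G.pull F g = G.pull F' g →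
      ∃ d : T ⟶ Z, d ≫ π = F ∧ d ≫ σ = F' := by
    intro T hT F F' hF
    have hw : (F'.f ≫ φ.hom ≫ specMap (algebraMap R' C)) ≫ specMap (algebraMap R R') =
        (F.f ≫ φ.hom) ≫ specMap (algebraMap R C) := by
      rw [← cancel_mono b, Category.assoc F.f, ← hva]
      have h₁ := h.pull_w F
      have h₂ := h.pull_w F'
      simp only [Category.assoc] at h₁ h₂ ⊢
      rw [h₁, h₂, hF]
    obtain ⟨d, hd, hd'⟩ := lift F (sq.lift _ _ hw) (sq.lift_snd _ _ hw)
    refine ⟨d, hd, h.hom_ext hT _ _ ?_ ?_⟩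
    · rw [G.pull_comp, hσ, ← G.pull_comp, hd, hF]
    · rw [comp_f, Category.assoc, hσv, hd', sq.lift_fst]
  -- The descent datum restricts to the identity on the diagonal.
  have h₂ : ∀ c, mulLeft R R' C (e c) = c := by
    obtain ⟨d, hd, hd'⟩ := hcomp h.fs (𝟙 X) (𝟙 X) rfl
    obtain ⟨m, hm⟩ : ∃ m : D →+* C, φ.inv ≫ d.f = specMap m :=
      ⟨(Spec.preimage (φ.inv ≫ d.f)).hom, (Spec.map_preimage _).symm⟩
    have hid : ∀ {ρ : Z ⟶ X} {f : C →+* D}, d ≫ ρ = 𝟙 X → ρ.f ≫ φ.hom = specMap f →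
        m.comp f = RingHom.id C := fun {ρ f} e e' => specMap_injective (by
      have e'' : d.f ≫ ρ.f = 𝟙 X.scheme := congrArg Hom.f e
      rw [← specMap_comp, ← hm, ← e', Category.assoc, ← Category.assoc d.f, e'', Category.id_comp,
        Iso.inv_hom_id]
      exact (Spec.map_id _).symm)
    have m₀ := hid hd hπf
    have m₁ := hid hd' he₁
    have mr : m.comp r = algebraMap R' C := by rw [← h₁, ← RingHom.comp_assoc, m₁, RingHom.id_comp]
    have hm' : ∀ y : D, mulLeft R R' C y = m y := fun y => by
      induction y using TensorProduct.induction_on with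
      | zero => simp
      | add x y hx hy => rw [map_add, map_add, hx, hy]
      | tmul x c =>
        have e : (x ⊗ₜ c : R' ⊗[R] C) = r x * e₀ c := by
          change _ = (x ⊗ₜ 1) * (1 ⊗ₜ c)
          simp
        rw [mulLeft_tmul, e, map_mul, ← mr]
        congr 1
        exact (RingHom.congr_fun m₀ c).symm
    exact fun c => (hm' _).trans (RingHom.congr_fun m₁ c)
  -- The cocycle condition, from the uniqueness of morphisms to `X` over the double base change of `Z`.
  have h₃ : ∀ c, Algebra.TensorProduct.map (AlgHom.id R R') (includeRight : C →ₐ[R] R' ⊗[R] C) (e c) =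
      Algebra.TensorProduct.map (AlgHom.id R R') e (e c) := by
    let D₂ := R' ⊗[R] D
    let i : D →+* D₂ := (includeRight : D →ₐ[R] R' ⊗[R] D).toRingHom
    have sq₂ : IsPullback (specMap (includeLeftRingHom : R' →+* D₂)) (specMap i)
        (specMap (algebraMap R R')) (specMap (algebraMap R D)) :=
      isPullback_SpecMap_of_isPushout _ _ _ _ (CommRingCat.isPushout_tensorProduct R R' D)
    have i₁ : Etale (specMap i) := MorphismProperty.of_isPullback (P := @Etale) sq₂ inferInstance
    let Z₂ := Z.induced (specMap i)
    let π₂ : Z₂ ⟶ Z := Z.inducedMap (specMap i)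
    have hπ₂ : IsStrictEtale π₂ := isStrictEtale_inducedMap _ _
    have hZ₂ : IsFs Z₂ := hπ₂.isFs hZ
    let E₀ : D →+* D₂ := (Algebra.TensorProduct.map (AlgHom.id R R')
      (includeRight : C →ₐ[R] R' ⊗[R] C)).toRingHom
    let E₁ : D →+* D₂ := (Algebra.TensorProduct.map (AlgHom.id R R') e).toRingHom
    have c₀ : E₀.comp e₀ = i.comp e₀ := RingHom.ext fun c =>
      map_tmul (AlgHom.id R R') (includeRight : C →ₐ[R] R' ⊗[R] C) 1 c
    have c₁ : E₁.comp e₀ = i.comp e₁ := RingHom.ext fun c => map_tmul (AlgHom.id R R') e 1 c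
    have cr : E₀.comp r = E₁.comp r := RingHom.ext fun x =>
      (map_tmul (AlgHom.id R R') (includeRight : C →ₐ[R] R' ⊗[R] C) x 1).trans
        ((congrArg (x ⊗ₜ[R] ·) ((map_one (includeRight : C →ₐ[R] R' ⊗[R] C)).trans
          (map_one e).symm)).trans (map_tmul (AlgHom.id R R') e x 1).symm)
    obtain ⟨d₁, hd₁, hd₁'⟩ := lift (π₂ ≫ π) (specMap E₀) (by
      rw [comp_f, Category.assoc, hπf, specMap_comp, c₀, ← specMap_comp]
      rfl)
    obtain ⟨d₂, hd₂, hd₂'⟩ := lift (π₂ ≫ σ) (specMap E₁) (by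
      rw [comp_f, Category.assoc, he₁, specMap_comp, c₁, ← specMap_comp]
      rfl)
    have hd : d₁ ≫ σ = d₂ ≫ σ := by
      refine h.hom_ext hZ₂ _ _ ?_ ?_
      · rw [G.pull_comp, hσ, ← G.pull_comp, hd₁, G.pull_comp, G.pull_comp d₂, hσ, ← G.pull_comp d₂,
          hd₂, G.pull_comp, hσ]
      · rw [comp_f, comp_f, Category.assoc, Category.assoc, hσv, hd₁', hd₂', specMap_comp,
          specMap_comp, cr]
    have he : E₀.comp e₁ = E₁.comp e₁ := specMap_injective (by
      have := congrArg (fun F : Z₂ ⟶ X => F.f ≫ φ.hom) hd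
      simp only [comp_f, Category.assoc, he₁, hd₁', hd₂', specMap_comp] at this
      exact this)
    exact fun c => RingHom.congr_fun he c
  have hpush := isPushout_invariants e (bijective_invariantsMap e h₁' h₂ h₃)
  have hpull := (isPullback_SpecMap_of_isPushout _ _ _ _ hpush).flip
  refine Rep.glue (K := PUnit.{u + 1}) (b := b) (fun _ => specMap (algebraMap R R'))
    (fun x => ⟨⟨⟩, (specMap (algebraMap R R')).surjective x⟩) (fun _ => h)
    (specMap (algebraMap R (AlgHom.equalizer includeRight e)))
    (fun _ => φ.hom ≫ specMap (AlgHom.equalizer includeRight e).val.toRingHom)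
    (fun _ => hpull.of_iso φ.symm (Iso.refl _) (Iso.refl _) (Iso.refl _) (by simp) (by simp) (by simp)
      (by simp)) ?_
  intro T hT _ _ F F' hF
  obtain ⟨d, rfl, rfl⟩ := hcomp hT F F' hF
  have he : e₀.comp (AlgHom.equalizer includeRight e).val.toRingHom =
      e₁.comp (AlgHom.equalizer includeRight e).val.toRingHom := RingHom.ext fun x =>
    (AlgHom.mem_equalizer _ _ _).1 x.2
  rw [comp_f, comp_f, Category.assoc, Category.assoc, ← Category.assoc π.f, ← Category.assoc σ.f, hπf,
    he₁, specMap_comp, specMap_comp, he]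

/-- Descent along a surjective étale morphism of affine schemes, if the representing object is
affine. -/
theorem Rep.descend {V W : Scheme.{u}} [IsAffine V] [IsAffine W] {b : V ⟶ B} [Mono b] {a : W ⟶ V}
    [Etale a] [Surjective a] [IsAffine X.scheme] {v : X.scheme ⟶ W} (h : G.Rep (a ≫ b) X g v) :
    ∃ (N : LogScheme.{u}) (n : G.obj N) (z : N.scheme ⟶ V), G.Rep b N n z := by
  let R := Γ(V, ⊤)
  let R' := Γ(W, ⊤)
  let C := Γ(X.scheme, ⊤)
  let _ : Algebra R R' := a.appTop.hom.toAlgebra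
  let _ : Algebra R' C := v.appTop.hom.toAlgebra
  let _ : Algebra R C := (v.appTop.hom.comp a.appTop.hom).toAlgebra
  have : IsScalarTower R R' C := IsScalarTower.of_algebraMap_eq fun _ => rfl
  have e₁ : specMap (algebraMap R R') = W.isoSpec.inv ≫ a ≫ V.isoSpec.hom := by
    rw [Iso.eq_inv_comp]
    exact Scheme.isoSpec_hom_naturality a
  have e₂ : X.scheme.isoSpec.hom ≫ specMap (algebraMap R' C) = v ≫ W.isoSpec.hom :=
    Scheme.isoSpec_hom_naturality v
  have : Etale (specMap (algebraMap R R')) := by rw [e₁]; infer_instance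
  have : Surjective (specMap (algebraMap R R')) := by rw [e₁]; infer_instance
  obtain ⟨N, n, z, hz⟩ := Rep.descend_spec (R := R) (R' := R') (C := C) (b := V.isoSpec.inv ≫ b)
    (g := g) X.scheme.isoSpec (by
      rw [e₂, e₁]
      exact
        { fs := h.fs
          w := by simpa using h.w
          hom_ext := fun hT p q e e' => h.hom_ext hT p q e (by
            simpa [← Category.assoc] using e')
          exists_hom := fun hT x t ht => by
            obtain ⟨p, hp, hp'⟩ := h.exists_hom hT x (t ≫ W.isoSpec.inv) (by simpa using ht)
            exact ⟨p, hp, by rw [← Category.assoc, hp', Category.assoc, Iso.inv_hom_id,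
              Category.comp_id]⟩ })
  exact ⟨N, n, z ≫ V.isoSpec.inv,
    { fs := hz.fs
      w := by rw [Category.assoc, hz.w]
      hom_ext := fun hT p q e _ => hz.hom_ext_of_mono hT p q e
      exists_hom := fun hT x t ht => by
        obtain ⟨p, hp, hp'⟩ := hz.exists_hom hT x (t ≫ V.isoSpec.hom) (by simpa using ht)
        exact ⟨p, hp, by rw [← Category.assoc, hp', Category.assoc, Iso.hom_inv_id,
          Category.comp_id]⟩ }⟩

end EtaleSheaf
end LogScheme
end
end LogGeometry

namespace LogGeometry
noncomputable section
namespace LogScheme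
attribute [local instance] MvPolynomial.gradedAlgebra
namespace EtaleSheaf

variable {B : Scheme.{u}} {G : EtaleSheaf B}

/-- A sheaf is representable if it is representable by affine objects over an étale cover of the base
by affine schemes. -/
theorem exists_rep (H : ∀ x : B, ∃ (W : Scheme.{u}) (b : W ⟶ B) (w : W) (X : LogScheme.{u}) (g : G.obj X)
    (v : X.scheme ⟶ W), IsAffine W ∧ Etale b ∧ b w = x ∧ IsAffine X.scheme ∧ G.Rep b X g v) :
    ∃ (N : LogScheme.{u}) (n : G.obj N) (z : N.scheme ⟶ B), G.Rep (𝟙 B) N n z := by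
  refine exists_rep_of_opens fun x => ?_
  obtain ⟨W, b, w, X, g, v, _, _, rfl, _, h⟩ := H x
  obtain ⟨A : B.Opens, hA, hwA, -⟩ := TopologicalSpace.Opens.isBasis_iff_nbhd.1 B.isBasis_affineOpens
    (show b w ∈ (⊤ : B.Opens) from trivial)
  obtain ⟨W₁ : W.Opens, hW₁, hwW, hWA⟩ := TopologicalSpace.Opens.isBasis_iff_nbhd.1 W.isBasis_affineOpens
    (show w ∈ b ⁻¹ᵁ A from hwA)
  let O : B.Opens := ⟨Set.range (W₁.ι ≫ b), (W₁.ι ≫ b).isOpenMap.isOpen_range⟩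
  have hOA : O ≤ A := by
    rintro _ ⟨y, rfl⟩
    exact hWA y.2
  obtain ⟨V : B.Opens, hV, hxV, hVO⟩ := TopologicalSpace.Opens.isBasis_iff_nbhd.1 B.isBasis_affineOpens
    (show b w ∈ O from ⟨⟨w, hwW⟩, rfl⟩)
  have hVA := hVO.trans hOA
  have : IsAffine (A : Scheme.{u}) := hA
  have : IsAffine (W₁ : Scheme.{u}) := hW₁
  have : IsAffine (V : Scheme.{u}) := hV
  have hr : Set.range (W₁.ι ≫ b) ⊆ Set.range A.ι := by
    rw [Scheme.Opens.range_ι]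
    exact hOA
  let c : (W₁ : Scheme.{u}) ⟶ A := IsOpenImmersion.lift A.ι (W₁.ι ≫ b) hr
  have hc : c ≫ A.ι = W₁.ι ≫ b := IsOpenImmersion.lift_fac _ _ _
  have : Etale c := etale_of_comp inferInstance (inferInstance : Etale (W₁.ι ≫ b)) hc
  let a : pullback c (B.homOfLE hVA) ⟶ V := pullback.snd _ _
  let j : pullback c (B.homOfLE hVA) ⟶ W := pullback.fst _ _ ≫ W₁.ι
  have hj : j ≫ b = a ≫ V.ι := by
    rw [Category.assoc, ← hc, ← Category.assoc, pullback.condition, Category.assoc, B.homOfLE_ι]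
  have : Surjective a := ⟨fun y => by
    obtain ⟨z, hz⟩ := hVO y.2
    obtain ⟨t, -, ht⟩ := Scheme.Pullback.exists_preimage_pullback (f := c) (g := B.homOfLE hVA) z y (by
      refine A.ι.injective ?_
      rw [← Scheme.Hom.comp_apply, ← Scheme.Hom.comp_apply, hc, B.homOfLE_ι]
      exact hz)
    exact ⟨t, ht⟩⟩
  have h₁ := (h.baseChange j).congr_base hj
  have : IsAffine (X.induced (pullback.fst v j)).scheme :=
    inferInstanceAs (IsAffine (pullback v j))
  exact ⟨V, hxV, h₁.descend⟩

end EtaleSheaf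

/-! ### The locus where a section of the logarithmic multiplicative group is comparable -/

variable {S T U X : LogScheme.{u}}

/-- The product of the schemes underlying `S` and the projective line. -/
abbrev lineOver (S : LogScheme.{u}) : Scheme.{u} :=
  pullback (specULiftZIsTerminal.from S.scheme) (specULiftZIsTerminal.from P1.{u}.scheme)

/-- The fibre product of `S` and the projective line over the logarithmic multiplicative group, as a
sheaf over the product of the underlying schemes. -/
def lineSheaf (S : LogScheme.{u}) (α : S.GlobalGp) : EtaleSheaf (lineOver S) where
  obj T := {p : (T ⟶ S) × (T ⟶ P1.{u}) // ggp p.2 lineCoord = ggp p.1 α}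
  pull a p := ⟨(a ≫ p.1.1, a ≫ p.1.2), by rw [ggp_comp, ggp_comp, p.2]⟩
  pull_comp a b p := Subtype.ext (Prod.ext (Category.assoc _ _ _) (Category.assoc _ _ _))
  τ p := pullback.lift p.1.1.f p.1.2.f (specULiftZIsTerminal.hom_ext _ _)
  τ_pull a p := pullback.hom_ext
    ((pullback.lift_fst _ _ _).trans (by rw [Category.assoc, pullback.lift_fst]; rfl))
    ((pullback.lift_snd _ _ _).trans (by rw [Category.assoc, pullback.lift_snd]; rfl))
  ext_of_cover s hs hcov p q h := Subtype.ext (Prod.ext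
    (hom_ext_of_cover hs hcov fun k => congrArg (fun x => x.1.1) (h k))
    (hom_ext_of_cover hs hcov fun k => congrArg (fun x => x.1.2) (h k)))
  exists_of_cover s hs hcov p h := by
    obtain ⟨F, hF⟩ := exists_hom_of_cover hs hcov (fun k => (p k).1.1)
      fun k l Z a b ha hb e => congrArg (fun x => x.1.1) (h k l Z a b ha hb e)
    obtain ⟨q, hq⟩ := exists_hom_of_cover hs hcov (fun k => (p k).1.2)
      fun k l Z a b ha hb e => congrArg (fun x => x.1.2) (h k l Z a b ha hb e)
    refine ⟨⟨(F, q), ggp_eq_of_etLocally fun t => ?_⟩, fun k => Subtype.ext (Prod.ext (hF k) (hq k))⟩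
    obtain ⟨k, y, hy⟩ := hcov t
    refine ⟨_, s k, y, hs k, hy, ?_⟩
    change ggp (s k) (ggp q lineCoord) = ggp (s k) (ggp F α)
    rw [← ggp_comp, ← ggp_comp, hF, hq]
    exact (p k).2

theorem chartSign_zpow {A : Type*} [Group A] (x : A) (i : Fin 2) :
    (x ^ chartSign i) ^ chartSign i = x := by
  match i with
  | 0 => simp [chartSign]
  | 1 => simp [chartSign]

/-- The locus where a section of the logarithmic multiplicative group is a section of the logarithmic
structure is representable by `X`. -/
structure IsEffectiveLocus (β : U.GlobalGp) (F : X ⟶ U) (m : X.GlobalSec) : Prop where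
  fs : IsFs X
  qt_eq : qt X m = ggp F β
  hom_ext : ∀ {T : LogScheme.{u}}, IsFs T → ∀ p q : T ⟶ X, p ≫ F = q ≫ F → p = q
  exists_hom : ∀ {T : LogScheme.{u}}, IsFs T → ∀ (a : T ⟶ U) (n : T.GlobalSec), qt T n = ggp a β →
    ∃ p : T ⟶ X, p ≫ F = a

theorem ggp_lineCoord (i : Fin 2) (r : T ⟶ lineLog.{u} i) :
    ggp (r ≫ lineIncl i) lineCoord = qt T (gsec r (lineRho i)) ^ chartSign i := by
  refine (ggp_comp _ _ _).trans ((congrArg (ggp r) (ggp_lineIncl i)).trans ?_)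
  exact (ggp_zpow r _ _).trans (congrArg (· ^ chartSign i) (ggp_qt r (lineRho i)))

/-- Over the product of `U` with the `i`-th chart of `P¹`, a morphism to `P¹` with coordinate `α` is the
same as a section of the logarithmic structure whose class is `α` or its inverse. -/
theorem rep_of_isEffectiveLocus {α : S.GlobalGp} {a : U ⟶ S} (ha : IsStrictEtale a) (i : Fin 2)
    {F : X ⟶ U} {m : X.GlobalSec} (h : IsEffectiveLocus (ggp a α ^ chartSign i) F m)
    (r : X ⟶ lineLog.{u} i) (hr : gsec r (lineRho i) = m) :
    ∃ hg, (lineSheaf S α).Rep (pullback.map (specULiftZIsTerminal.from U.scheme)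
      (specULiftZIsTerminal.from (lineLog.{u} i).scheme) _ _ a.f (lineIncl i).f (𝟙 _)
      (specULiftZIsTerminal.hom_ext _ _) (specULiftZIsTerminal.hom_ext _ _)) X
      ⟨(F ≫ a, r ≫ lineIncl i), hg⟩
      (pullback.lift F.f r.f (specULiftZIsTerminal.hom_ext _ _)) := by
  have key : ∀ {T : LogScheme.{u}} (A : T ⟶ U) (n : T.GlobalSec),
      qt T n ^ chartSign i = ggp (A ≫ a) α ↔ qt T n = ggp A (ggp a α ^ chartSign i) := by
    intro T A n
    rw [ggp_zpow, ← ggp_comp]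
    constructor
    · intro e
      rw [← e, chartSign_zpow]
    · intro e
      rw [e, chartSign_zpow]
  have hg : ggp (r ≫ lineIncl i) lineCoord = ggp (F ≫ a) α := by
    rw [ggp_lineCoord, hr, (key F m).2 h.qt_eq]
  refine ⟨hg, h.fs, ?_, ?_, ?_⟩
  · refine pullback.hom_ext ?_ ?_
    · exact (Category.assoc _ _ _).trans ((congrArg (_ ≫ ·) (pullback.lift_fst _ _ _)).trans
        ((pullback.lift_fst_assoc _ _ _ _).trans (pullback.lift_fst _ _ _).symm))
    · exact (Category.assoc _ _ _).trans ((congrArg (_ ≫ ·) (pullback.lift_snd _ _ _)).trans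
        ((pullback.lift_snd_assoc _ _ _ _).trans (pullback.lift_snd _ _ _).symm))
  · intro T hT p q e e'
    refine h.hom_ext hT p q (ha.hom_ext ?_ ?_)
    · exact (Category.assoc _ _ _).trans ((congrArg (fun x => x.1.1) e).trans
        (Category.assoc _ _ _).symm)
    · have := congrArg (· ≫ pullback.fst _ _) e'
      simpa only [Category.assoc, pullback.lift_fst, comp_f] using this
  · rintro T hT ⟨⟨A, ρ⟩, e⟩ t ht
    have h₁ : (t ≫ pullback.fst _ _) ≫ a.f = A.f := by
      refine Eq.trans ?_ ((congrArg (· ≫ pullback.fst _ _) ht).trans (pullback.lift_fst _ _ _))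
      exact (Category.assoc _ _ _).trans ((congrArg (t ≫ ·) (pullback.lift_fst _ _ _).symm).trans
        (Category.assoc _ _ _).symm)
    have h₂ : (t ≫ pullback.snd _ _) ≫ (lineIncl i).f = ρ.f := by
      refine Eq.trans ?_ ((congrArg (· ≫ pullback.snd _ _) ht).trans (pullback.lift_snd _ _ _))
      exact (Category.assoc _ _ _).trans ((congrArg (t ≫ ·) (pullback.lift_snd _ _ _).symm).trans
        (Category.assoc _ _ _).symm)
    obtain ⟨A', ⟨rfl, hA⟩, -⟩ := ha.existsUnique_lift A _ h₁
    obtain ⟨ρ', ⟨rfl, hρ⟩, -⟩ := (isStrictEtale_lineIncl i).existsUnique_lift ρ _ h₂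
    have e' : qt T (gsec ρ' (lineRho i)) = ggp A' (ggp a α ^ chartSign i) :=
      (key A' _).1 ((ggp_lineCoord i ρ').symm.trans e)
    obtain ⟨p, hp⟩ := h.exists_hom hT A' _ e'
    have hpr : p ≫ r = ρ' := line_hom_ext (qt_injective hT (by
      rw [gsec_comp, hr, e', ← ggp_qt, h.qt_eq, ← ggp_comp, hp]))
    refine ⟨p, Subtype.ext (Prod.ext ?_ ?_), pullback.hom_ext ?_ ?_⟩
    · exact (Category.assoc _ _ _).symm.trans (congrArg (· ≫ a) hp)
    · exact (Category.assoc _ _ _).symm.trans (congrArg (· ≫ lineIncl i) hpr)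
    · rw [Category.assoc, pullback.lift_fst, ← hA, ← hp]
      rfl
    · rw [Category.assoc, pullback.lift_snd, ← hρ, ← hpr]
      rfl

instance isAffine_lineLog (i : Fin 2) : IsAffine (lineLog.{u} i).scheme :=
  inferInstanceAs (IsAffine (Spec (.of (LineRing.{u} i))))

/-- The locus where `α` is comparable is representable if the loci where `α` and its inverse are
sections of the logarithmic structure are étale locally representable by affine logarithmic schemes. -/
theorem exists_isComparableLocus (α : S.GlobalGp)
    (H : EtLocally S fun U a => IsAffine U.scheme ∧ ∀ i, ∃ (X : LogScheme.{u}) (F : X ⟶ U)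
      (m : X.GlobalSec), IsAffine X.scheme ∧ IsEffectiveLocus (ggp a α ^ chartSign i) F m) :
    ∃ (X : LogScheme.{u}) (F : X ⟶ S), IsFs X ∧ IsComparableLocus α F := by
  obtain ⟨N, n, z, h⟩ := (EtaleSheaf.exists_rep (G := lineSheaf S α) fun x => by
    obtain ⟨U, a, y, ha, hy, hU, hX⟩ := H (pullback.fst (specULiftZIsTerminal.from S.scheme)
      (specULiftZIsTerminal.from P1.{u}.scheme) x)
    obtain ⟨i, w, hw⟩ := lineCharts.{u}.cover (pullback.snd (specULiftZIsTerminal.from S.scheme)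
      (specULiftZIsTerminal.from P1.{u}.scheme) x)
    obtain ⟨X, F, m, hXa, hF⟩ := hX i
    obtain ⟨r, hr⟩ := exists_line_hom i m
    obtain ⟨hg, hrep⟩ := rep_of_isEffectiveLocus ha i hF r hr
    have := ha.etale
    have := (isStrictEtale_lineIncl.{u} i).etale
    have hcomp : MorphismProperty.IsStableUnderComposition (@Etale : MorphismProperty Scheme.{u}) :=
      ⟨fun f g (_ : Etale f) (_ : Etale g) => (inferInstance : Etale (f ≫ g))⟩
    have hsq : Etale (pullback.map (specULiftZIsTerminal.from U.scheme)
        (specULiftZIsTerminal.from (lineLog.{u} i).scheme) (specULiftZIsTerminal.from S.scheme)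
        (specULiftZIsTerminal.from P1.{u}.scheme) a.f (lineIncl i).f (𝟙 _)
        (specULiftZIsTerminal.hom_ext _ _) (specULiftZIsTerminal.hom_ext _ _)) :=
      MorphismProperty.pullbackMap (P := @Etale) ‹_› ‹_› (specULiftZIsTerminal.hom_ext _ _)
        (specULiftZIsTerminal.hom_ext _ _)
    have hx : x ∈ Set.range (pullback.map (specULiftZIsTerminal.from U.scheme)
        (specULiftZIsTerminal.from (lineLog.{u} i).scheme) (specULiftZIsTerminal.from S.scheme)
        (specULiftZIsTerminal.from P1.{u}.scheme) a.f (lineIncl i).f (𝟙 _)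
        (specULiftZIsTerminal.hom_ext _ _) (specULiftZIsTerminal.hom_ext _ _)) := by
      rw [Scheme.Pullback.range_map]
      exact ⟨⟨y, hy⟩, ⟨w, hw⟩⟩
    obtain ⟨x', hx'⟩ := hx
    exact ⟨_, _, x', X, _, _, inferInstance, hsq, hx', hXa, hrep⟩)
  have hL : LocComparable N (ggp n.1.1 α) := by
    rw [← n.2]
    exact locComparable_line _
  refine ⟨N, n.1.1, h.fs, hL, ?_, ?_⟩
  · intro T hT p q e
    refine h.hom_ext_of_mono hT p q (Subtype.ext (Prod.ext e (P1_hom_ext hT ?_)))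
    change ggp (p ≫ n.1.2) lineCoord = ggp (q ≫ n.1.2) lineCoord
    rw [ggp_comp, ggp_comp, n.2, ← ggp_comp, ← ggp_comp, e]
  · intro T hT a ha
    obtain ⟨p, hp⟩ := exists_P1_hom hT ha
    obtain ⟨q, hq, -⟩ := h.exists_hom hT ⟨(a, p), hp⟩ _ (Category.comp_id _)
    exact ⟨q, congrArg (fun x => x.1.1) hq⟩

end LogScheme
end
end LogGeometry

namespace LogGeometry
noncomputable section

/-! ### Saturations of finitely generated monoids -/

section Saturation

/-- The saturation of a submonoid of an abelian group. -/
def addSaturation {L : Type*} [AddCommGroup L] (M : AddSubmonoid L) : AddSubmonoid L where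
  carrier := {x | ∃ n : ℕ, 0 < n ∧ n • x ∈ M}
  zero_mem' := ⟨1, one_pos, by simp⟩
  add_mem' := by
    rintro x y ⟨m, hm, hx⟩ ⟨n, hn, hy⟩
    refine ⟨m * n, Nat.mul_pos hm hn, ?_⟩
    rw [smul_add]
    refine M.add_mem ?_ ?_
    · rw [mul_comm, mul_smul]
      exact M.nsmul_mem hx n
    · rw [mul_smul]
      exact M.nsmul_mem hy m

/-- Gordan's lemma for lattices: an element of the saturation is the sum of an element of the monoid
and of an element of the saturation in a bounded region. -/
theorem fg_addSaturation_pi {k : ℕ} (M : AddSubmonoid (Fin k → ℤ)) (hM : M.FG) :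
    (addSaturation M).FG := by
  obtain ⟨s, rfl⟩ := hM
  let c : Fin k → ℤ := fun j => ∑ g ∈ s, |g j|
  have hfin : {x : Fin k → ℤ | x ∈ addSaturation (AddSubmonoid.closure (s : Set (Fin k → ℤ))) ∧
      x ∈ Set.Icc (-c) c}.Finite := (Set.finite_Icc (-c) c).subset fun x hx => hx.2
  refine (AddSubmonoid.fg_iff _).2 ⟨_, le_antisymm ?_ ?_, s.finite_toSet.union hfin⟩
  · refine AddSubmonoid.closure_le.2 (Set.union_subset ?_ fun x hx => hx.1)
    intro g hg
    exact ⟨1, one_pos, by simpa using AddSubmonoid.subset_closure hg⟩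
  · rintro x ⟨n, hn, hx⟩
    obtain ⟨a, -, ha⟩ := AddSubmonoid.mem_closure_finset.1 hx
    have hsum : ∀ b : (Fin k → ℤ) → ℕ, ∑ g ∈ s, b g • g ∈
        AddSubmonoid.closure (s : Set (Fin k → ℤ)) := fun b =>
      AddSubmonoid.sum_mem _ fun g hg => AddSubmonoid.nsmul_mem _ (AddSubmonoid.subset_closure hg) _
    have e : ∑ g ∈ s, a g • g = n • (∑ g ∈ s, (a g / n) • g) + ∑ g ∈ s, (a g % n) • g := by
      rw [Finset.smul_sum, ← Finset.sum_add_distrib]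
      refine Finset.sum_congr rfl fun g _ => ?_
      rw [← mul_smul, ← add_smul, Nat.div_add_mod]
    have hr : n • (x - ∑ g ∈ s, (a g / n) • g) = ∑ g ∈ s, (a g % n) • g := by
      rw [smul_sub, ← ha, e, add_sub_cancel_left]
    rw [← add_sub_cancel (∑ g ∈ s, (a g / n) • g) x]
    refine AddSubmonoid.add_mem _ ?_ (AddSubmonoid.subset_closure (Or.inr ⟨⟨n, hn, ?_⟩, ?_⟩))
    · exact AddSubmonoid.closure_mono Set.subset_union_left (hsum _)
    · rw [hr]
      exact hsum _
    · have hn' : (0 : ℤ) < n := by exact_mod_cast hn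
      have hb : ∀ j, |(x - ∑ g ∈ s, (a g / n) • g) j| ≤ c j := fun j => by
        have hj := congrFun hr j
        rw [Finset.sum_apply] at hj
        refine le_of_mul_le_mul_left ?_ hn'
        have h₁ : (n : ℤ) * |(x - ∑ g ∈ s, (a g / n) • g) j| = |∑ g ∈ s, ((a g % n) • g) j| := by
          rw [← hj, Pi.smul_apply, nsmul_eq_mul, abs_mul, Nat.abs_cast]
        rw [h₁, Finset.mul_sum]
        refine (Finset.abs_sum_le_sum_abs _ _).trans (Finset.sum_le_sum fun g _ => ?_)
        rw [Pi.smul_apply, nsmul_eq_mul, abs_mul, Nat.abs_cast]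
        refine mul_le_mul_of_nonneg_right ?_ (abs_nonneg _)
        exact_mod_cast (Nat.mod_lt _ hn).le
      exact ⟨fun j => (abs_le.1 (hb j)).1, fun j => (abs_le.1 (hb j)).2⟩

/-- The saturation of a finitely generated submonoid of a finitely generated abelian group is finitely
generated, by lifting to a free abelian group. -/
theorem fg_addSaturation {L : Type*} [AddCommGroup L] [Module.Finite ℤ L] (M : AddSubmonoid L)
    (hM : M.FG) : (addSaturation M).FG := by
  obtain ⟨k, π, hπ⟩ := Module.Finite.exists_fin' ℤ L
  obtain ⟨s, hs, hfin⟩ := (AddSubmonoid.fg_iff M).1 hM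
  obtain ⟨t, ht⟩ : (LinearMap.ker π).FG := IsNoetherian.noetherian _
  -- the preimage of `M` is generated by lifts of generators of `M` and the kernel
  have hcomap : (M.comap π.toAddMonoidHom).FG := by
    refine (AddSubmonoid.fg_iff _).2 ⟨Function.surjInv hπ '' s ∪ ((t : Set _) ∪ -(t : Set _)),
      le_antisymm ?_ ?_, (hfin.image _).union (t.finite_toSet.union (Set.Finite.neg t.finite_toSet))⟩
    · refine AddSubmonoid.closure_le.2 ?_
      have htk : ∀ y ∈ t, π y = 0 := fun y hy => by
        have : y ∈ LinearMap.ker π := ht ▸ Submodule.subset_span hy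
        exact this
      rintro x (⟨y, hy, rfl⟩ | hx | hx)
      · change π _ ∈ M
        rw [Function.surjInv_eq hπ, ← hs]
        exact AddSubmonoid.subset_closure hy
      · change π _ ∈ M
        rw [htk x hx]
        exact M.zero_mem
      · change π _ ∈ M
        rw [← neg_neg x, map_neg, htk _ hx, neg_zero]
        exact M.zero_mem
    · have hker : ∀ y, π y = 0 → y ∈ AddSubmonoid.closure (Function.surjInv hπ '' s ∪
          ((t : Set _) ∪ -(t : Set _))) := fun y hy => by
        have h₁ : y ∈ Submodule.span ℤ (t : Set (Fin k → ℤ)) := ht ▸ hy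
        rw [← Submodule.mem_toAddSubgroup, Submodule.span_int_eq_addSubgroupClosure,
          ← AddSubgroup.mem_toAddSubmonoid, AddSubgroup.closure_toAddSubmonoid] at h₁
        exact AddSubmonoid.closure_mono Set.subset_union_right h₁
      have hlift : ∀ m ∈ AddSubmonoid.closure s, ∃ y ∈ AddSubmonoid.closure
          (Function.surjInv hπ '' s ∪ ((t : Set _) ∪ -(t : Set _))), π y = m := fun m hm => by
        induction hm using AddSubmonoid.closure_induction with
        | mem m hm => exact ⟨_, AddSubmonoid.subset_closure (Or.inl ⟨m, hm, rfl⟩),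
            Function.surjInv_eq hπ m⟩
        | zero => exact ⟨0, AddSubmonoid.zero_mem _, map_zero _⟩
        | add m n _ _ hm hn =>
          obtain ⟨y, hy, rfl⟩ := hm
          obtain ⟨z, hz, rfl⟩ := hn
          exact ⟨y + z, AddSubmonoid.add_mem _ hy hz, map_add _ _ _⟩
      intro x hx
      obtain ⟨y, hy, e⟩ := hlift (π x) (hs.symm ▸ hx)
      rw [← add_sub_cancel y x]
      exact AddSubmonoid.add_mem _ hy (hker _ (by rw [map_sub, e, sub_self]))
  have h := (fg_addSaturation_pi _ hcomap).map π.toAddMonoidHom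
  have e : (addSaturation (M.comap π.toAddMonoidHom)).map π.toAddMonoidHom = addSaturation M := by
    ext x
    constructor
    · rintro ⟨y, ⟨n, hn, hy⟩, rfl⟩
      exact ⟨n, hn, (map_nsmul π n y).symm ▸ hy⟩
    · rintro ⟨n, hn, hx⟩
      obtain ⟨y, rfl⟩ := hπ x
      exact ⟨y, ⟨n, hn, show π (n • y) ∈ M from (map_nsmul π n y).symm ▸ hx⟩, rfl⟩
  rwa [e] at h

/-- The saturation of a submonoid of an abelian group, in multiplicative notation. -/
def saturation {L : Type*} [CommGroup L] (M : Submonoid L) : Submonoid L where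
  carrier := {x | ∃ n : ℕ, 0 < n ∧ x ^ n ∈ M}
  one_mem' := ⟨1, one_pos, by simp⟩
  mul_mem' := (addSaturation (Submonoid.toAddSubmonoid M)).add_mem'

theorem le_saturation {L : Type*} [CommGroup L] (M : Submonoid L) : M ≤ saturation M :=
  fun x hx => ⟨1, one_pos, by rwa [pow_one]⟩

theorem fg_saturation {L : Type*} [CommGroup L] [Group.FG L] (M : Submonoid L) (hM : M.FG) :
    (saturation M).FG := by
  have : Module.Finite ℤ (Additive L) := Module.Finite.iff_addGroup_fg.2 inferInstance
  exact (Submonoid.fg_iff_add_fg _).2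
    (fg_addSaturation (Submonoid.toAddSubmonoid M) ((Submonoid.fg_iff_add_fg _).1 hM))

theorem isSaturatedMonoid_saturation {L : Type u} [CommGroup L] (M : Submonoid L) :
    LogScheme.IsSaturatedMonoid (saturation M) := by
  rintro ⟨a, ha⟩ ⟨b, hb⟩ ⟨c, m, hm, hc⟩ n hn h
  have h' : a ^ n = b ^ n * c := congrArg Subtype.val h
  refine ⟨⟨b⁻¹ * a, n * m, Nat.mul_pos hn hm, ?_⟩, Subtype.ext (by simp)⟩
  rw [pow_mul, mul_pow, h', inv_pow, inv_mul_cancel_left]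
  exact hc

open Algebra in
theorem groupFG_grothendieckGroup (P : Type u) [CommMonoid P] [Monoid.FG P] :
    Group.FG (GrothendieckGroup P) := by
  obtain ⟨s, hs⟩ := Monoid.FG.fg_top (M := P)
  refine Group.fg_iff.2 ⟨GrothendieckGroup.of '' (s : Set P), ?_, s.finite_toSet.image _⟩
  have h : ∀ p : P, GrothendieckGroup.of p ∈ Subgroup.closure (GrothendieckGroup.of '' (s : Set P)) :=
    fun p => by
      have hp : p ∈ Submonoid.closure (s : Set P) := hs ▸ Submonoid.mem_top p
      have : GrothendieckGroup.of p ∈ (Submonoid.closure (s : Set P)).map GrothendieckGroup.of :=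
        ⟨p, hp, rfl⟩
      rw [MonoidHom.map_mclosure] at this
      rw [← Subgroup.mem_toSubmonoid, Subgroup.closure_toSubmonoid]
      exact Submonoid.closure_mono Set.subset_union_left this
  refine top_le_iff.1 fun x _ => ?_
  obtain ⟨b, c, rfl⟩ := LogScheme.exists_eq_of_div x
  exact mul_mem (inv_mem (h b)) (h c)

open Algebra in
/-- The saturation of the monoid generated by `P` and an element of its group completion. -/
def adjoinSat (P : Type u) [CommMonoid P] (x : GrothendieckGroup P) :
    Submonoid (GrothendieckGroup P) :=
  saturation (MonoidHom.mrange (GrothendieckGroup.of : P →* GrothendieckGroup P) ⊔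
    Submonoid.powers x)

open Algebra in
theorem fg_adjoinSat (P : Type u) [CommMonoid P] [Monoid.FG P] (x : GrothendieckGroup P) :
    Monoid.FG (adjoinSat P x) := by
  have := groupFG_grothendieckGroup P
  refine (Monoid.fg_iff_submonoid_fg _).2 (fg_saturation _ (Submonoid.FG.sup ?_ ?_))
  · rw [MonoidHom.mrange_eq_map]
    exact Monoid.FG.fg_top.map _
  · exact Submonoid.powers_fg x

end Saturation
end
end LogGeometry

namespace LogGeometry
noncomputable section
namespace LogScheme
open Algebra

/-! ### Local models of the effective loci -/

variable {S T U : LogScheme.{u}}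

theorem groupLift_of {P G : Type*} [CommMonoid P] [CommGroup G] (f : P →* G) (p : P) :
    GrothendieckGroup.lift f (GrothendieckGroup.of p) = f p :=
  DFunLike.congr_fun (GrothendieckGroup.lift.symm_apply_apply f) p

theorem liftNCRingHom_algebraMap {A M B : Type*} [CommRing A] [CommMonoid M] [CommRing B]
    (ρ : A →+* B) (ψ : M →* B) (a : A) :
    MonoidAlgebra.liftNCRingHom ρ ψ (fun _ _ => mul_comm _ _) (algebraMap A _ a) = ρ a := by
  refine (MonoidAlgebra.liftNC_single _ _ _ _).trans ?_
  exact (congrArg (_ * ·) (map_one ψ)).trans (mul_one _)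

theorem liftNCRingHom_of {A M B : Type*} [CommRing A] [CommMonoid M] [CommRing B]
    (ρ : A →+* B) (ψ : M →* B) (m : M) :
    MonoidAlgebra.liftNCRingHom ρ ψ (fun _ _ => mul_comm _ _) (MonoidAlgebra.of A M m) = ψ m := by
  refine (MonoidAlgebra.liftNC_single _ _ _ _).trans ?_
  exact (congrArg (· * _) (map_one ρ)).trans (one_mul _)

theorem exists_hom_of_isAffine {X Y : Scheme.{u}} [IsAffine Y] (φ : Γ(Y, ⊤) →+* Γ(X, ⊤)) :
    ∃ f : X ⟶ Y, ∀ a, f.appTop a = φ a := by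
  refine ⟨specHom φ ≫ Y.isoSpec.inv, fun a => ?_⟩
  have e : Y.isoSpec.inv.appTop a = specFun a := by
    have h : Y.isoSpec.hom.appTop (specFun a) = a := by
      rw [Scheme.isoSpec_hom, Scheme.toSpecΓ_appTop]
      exact ConcreteCategory.congr_hom (Scheme.ΓSpecIso Γ(Y, ⊤)).inv_hom_id a
    conv_lhs => rw [← h]
    exact (appTop_comp_apply Y.isoSpec.inv Y.isoSpec.hom _).trans
      ((congrArg (fun g : Spec Γ(Y, ⊤) ⟶ Spec Γ(Y, ⊤) => g.appTop (specFun a))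
        Y.isoSpec.inv_hom_id).trans (appTop_id_apply _))
  exact (appTop_comp_apply _ _ _).trans
    ((congrArg (specHom φ).appTop e).trans (specHom_appTop _ _))

section Model

section Ring

variable {A P : Type u} [CommRing A] [CommMonoid P] (ε : P →* A) (x : GrothendieckGroup P)

/-- An element of `P` as an element of the saturation of `P[x]`. -/
def toAdjoinSat : P →* adjoinSat P x :=
  GrothendieckGroup.of.codRestrict _ fun p => le_saturation _ (Submonoid.mem_sup_left ⟨p, rfl⟩)

/-- The element `x` of the saturation of `P[x]`. -/
def adjoinSatGen : adjoinSat P x :=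
  ⟨x, le_saturation _ (Submonoid.mem_sup_right (Submonoid.mem_powers x))⟩

/-- The ideal of the relations `[p] = ε p`. -/
def modelIdeal : Ideal (MonoidAlgebra A (adjoinSat P x)) :=
  Ideal.span (Set.range fun p => MonoidAlgebra.of A (adjoinSat P x) (toAdjoinSat x p) -
    algebraMap A (MonoidAlgebra A (adjoinSat P x)) (ε p))

/-- The base change of `ℤ[P] → ℤ[Q]` along `ε : ℤ[P] → A`, where `Q` is the saturation of `P[x]`. -/
def ModelRing : Type u := MonoidAlgebra A (adjoinSat P x) ⧸ modelIdeal ε x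

instance : CommRing (ModelRing ε x) :=
  inferInstanceAs (CommRing (MonoidAlgebra A (adjoinSat P x) ⧸ modelIdeal ε x))

/-- The quotient map to the coordinate ring of the local model. -/
def modelMk : MonoidAlgebra A (adjoinSat P x) →+* ModelRing ε x :=
  Ideal.Quotient.mk (modelIdeal ε x)

/-- The structure map of `ModelRing` as an `A`-algebra. -/
def modelConst : A →+* ModelRing ε x := (modelMk ε x).comp (algebraMap A _)

/-- The monomials in `ModelRing`. -/
def modelMon : adjoinSat P x →* ModelRing ε x :=
  (modelMk ε x).toMonoidHom.comp (MonoidAlgebra.of A (adjoinSat P x))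

theorem modelMon_toAdjoinSat (p : P) : modelMon ε x (toAdjoinSat x p) = modelConst ε x (ε p) :=
  Ideal.Quotient.eq.2 (Ideal.subset_span ⟨p, rfl⟩)

theorem modelRing_hom_ext {B : Type u} [CommRing B] {f g : ModelRing ε x →+* B}
    (h : ∀ a, f (modelConst ε x a) = g (modelConst ε x a))
    (h' : ∀ m, f (modelMon ε x m) = g (modelMon ε x m)) : f = g := by
  have key : f.comp (modelMk ε x) = g.comp (modelMk ε x) :=
    MonoidAlgebra.ringHom_ext' (RingHom.ext h) (MonoidHom.ext h')
  refine RingHom.ext fun r => ?_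
  obtain ⟨r, rfl⟩ := Ideal.Quotient.mk_surjective r
  exact RingHom.congr_fun key r

theorem exists_modelRing_hom {B : Type u} [CommRing B] (ρ : A →+* B) (ψ : adjoinSat P x →* B)
    (h : ∀ p, ψ (toAdjoinSat x p) = ρ (ε p)) : ∃ f : ModelRing ε x →+* B,
      (∀ a, f (modelConst ε x a) = ρ a) ∧ ∀ m, f (modelMon ε x m) = ψ m := by
  have hI : modelIdeal ε x ≤
      RingHom.ker (MonoidAlgebra.liftNCRingHom ρ ψ fun _ _ => mul_comm _ _) := by
    refine Ideal.span_le.2 ?_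
    rintro _ ⟨p, rfl⟩
    refine (map_sub _ _ _).trans (sub_eq_zero.2 ?_)
    exact (liftNCRingHom_of _ _ _).trans ((h p).trans (liftNCRingHom_algebraMap _ _ _).symm)
  exact ⟨Ideal.Quotient.lift _ _ hI, liftNCRingHom_algebraMap ρ ψ, liftNCRingHom_of ρ ψ⟩

end Ring

/-- The ring of global functions of a logarithmic scheme. -/
abbrev Fun (U : LogScheme.{u}) : Type u := Γ(U.scheme, ⊤)

variable {P : Type u} [CommMonoid P] (θ : P →* U.GlobalSec) (x : GrothendieckGroup P)

/-- The functions given by sections of the logarithmic structure. -/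
def exFun : P →* Fun U := (U.ex (u := 𝟙 U.scheme)).comp θ

/-- The functions on the local model given by the elements of `Q`. -/
def modelFun : adjoinSat P x →* Γ(Spec (.of (ModelRing (exFun θ) x)), ⊤) :=
  (funHom (𝟙 (Spec (.of (ModelRing (exFun θ) x))))).toMonoidHom.comp (modelMon (exFun θ) x)

theorem modelFun_apply (q : adjoinSat P x) :
    modelFun θ x q = specFun (modelMon (exFun θ) x q) :=
  appTop_id_apply _

/-- The local model of the locus where `x` becomes a section of the logarithmic structure. -/
def model : LogScheme.{u} := ofChart (Spec (.of (ModelRing (exFun θ) x))) (modelFun θ x)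

instance : IsAffine (model θ x).scheme :=
  inferInstanceAs (IsAffine (Spec (.of (ModelRing (exFun θ) x))))

/-- The chart of the local model. -/
def modelSec : adjoinSat P x →* (model θ x).GlobalSec := ofChartSec _ (modelFun θ x)

/-- The pullback of a function to the local model. -/
def modelPull (c : Fun U) : Fun (model θ x) :=
  specFun (R := ModelRing (exFun θ) x) (modelConst (exFun θ) x c)

theorem chart_model : (model θ x).Chart (modelSec θ x) :=
  chartAt_id_iff.1 (chartAt_ofChartSec _ (modelFun θ x))

theorem ex_modelSec (q : adjoinSat P x) : (model θ x).ex (modelSec θ x q) =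
    specFun (modelMon (exFun θ) x q) :=
  (ex_ofChartSec _ (modelFun θ x) q).trans (modelFun_apply θ x q)

theorem isFs_model [Monoid.FG P] : IsFs (model θ x) :=
  isFs_iff.2 (EtLocally.of_self ⟨adjoinSat P x, inferInstance, modelSec θ x, fg_adjoinSat P x,
    inferInstance, isSaturatedMonoid_saturation _, chart_model θ x⟩)

theorem model_hom_ext {p q : T ⟶ model θ x}
    (h : ∀ c, p.f.appTop (modelPull θ x c) = q.f.appTop (modelPull θ x c))
    (h' : ∀ y, gsec p (modelSec θ x y) = gsec q (modelSec θ x y)) : p = q := by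
  refine hom_ext_of_chart (chart_model θ x) ?_ h'
  have h₁ (r : T ⟶ model θ x) (y) : funHom (R := ModelRing (exFun θ) x) r.f
      (modelMon (exFun θ) x y) = T.ex (gsec r (modelSec θ x y)) :=
    (congrArg r.f.appTop (ex_modelSec θ x y)).symm.trans (ex_gsec r _).symm
  have key : funHom (R := ModelRing (exFun θ) x) p.f = funHom (R := ModelRing (exFun θ) x) q.f :=
    modelRing_hom_ext (exFun θ) x h fun y =>
      (h₁ p y).trans ((congrArg T.ex (h' y)).trans (h₁ q y).symm)
  exact spec_hom_ext (R := ModelRing (exFun θ) x) fun r => RingHom.congr_fun key r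

/-- A morphism to the local model which on functions of `U` is a given ring homomorphism. -/
theorem exists_model_hom (ρ : Fun U →+* Fun T) (ψ : adjoinSat P x →* T.GlobalSec)
    (hψ : ∀ p, T.ex (ψ (toAdjoinSat x p)) = ρ (U.ex (θ p))) : ∃ p : T ⟶ model θ x,
      (∀ y, gsec p (modelSec θ x y) = ψ y) ∧ ∀ c, p.f.appTop (modelPull θ x c) = ρ c := by
  obtain ⟨φ, hφ, hφ'⟩ := exists_modelRing_hom (exFun θ) x ρ ((T.ex (u := 𝟙 T.scheme)).comp ψ) hψ
  obtain ⟨p, hp, hp'⟩ := exists_hom_of_chart (T := T) (chart_model θ x) (specHom φ) ψ fun y =>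
    ((specHom_appTop φ _).trans (hφ' y)).symm.trans
      (congrArg (specHom φ).appTop (ex_modelSec θ x y)).symm
  exact ⟨p, hp', fun c => (congrArg (fun g : T.scheme ⟶ Spec (.of (ModelRing (exFun θ) x)) =>
    g.appTop (specFun (modelConst (exFun θ) x c))) hp).trans ((specHom_appTop φ _).trans (hφ c))⟩

variable {θ} in
/-- The projection of the local model to `U`. -/
theorem exists_modelMap [IsAffine U.scheme] (hθ : U.Chart θ) : ∃ F : model θ x ⟶ U,
    (∀ p, gsec F (θ p) = modelSec θ x (toAdjoinSat x p)) ∧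
      ∀ a, F.f.appTop a = modelPull θ x a := by
  obtain ⟨f, hf⟩ := exists_hom_of_isAffine (X := (model θ x).scheme) (Y := U.scheme)
    ((funHom (R := ModelRing (exFun θ) x) (𝟙 (model θ x).scheme)).comp (modelConst (exFun θ) x))
  have hf' : ∀ a, f.appTop a = modelPull θ x a := fun a => (hf a).trans (appTop_id_apply _)
  obtain ⟨F, hF, hF'⟩ := exists_hom_of_chart (T := model θ x) hθ f
    ((modelSec θ x).comp (toAdjoinSat x)) fun p => (ex_modelSec θ x (toAdjoinSat x p)).trans
      ((congrArg specFun (modelMon_toAdjoinSat (exFun θ) x p)).trans (hf' _).symm)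
  exact ⟨F, hF', fun a => (congrArg (fun g : (model θ x).scheme ⟶ U.scheme => g.appTop a) hF).trans
    (hf' a)⟩

variable {θ x}

theorem model_qt_eq {F : model θ x ⟶ U}
    (hF : ∀ p, gsec F (θ p) = modelSec θ x (toAdjoinSat x p)) {β : U.GlobalGp} {p₁ p₂ : P}
    {e : U.GlobalSec} (hβ : β * qt U (θ p₂) = qt U e * qt U (θ p₁))
    (hgen : toAdjoinSat x p₂ * adjoinSatGen x = toAdjoinSat x p₁) :
    qt (model θ x) (gsec F e * modelSec θ x (adjoinSatGen x)) = ggp F β := by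
  have h := congrArg (ggpHom F) hβ
  rw [map_mul, map_mul] at h
  change ggp F β * ggp F (qt U (θ p₂)) = ggp F (qt U e) * ggp F (qt U (θ p₁)) at h
  rw [ggp_qt, ggp_qt, ggp_qt, hF, hF, ← hgen, map_mul, map_mul] at h
  rw [map_mul]
  refine mul_right_cancel (b := qt _ (modelSec θ x (toAdjoinSat x p₂))) (.trans ?_ h.symm)
  rw [mul_assoc, mul_comm (qt _ (modelSec θ x (adjoinSatGen x)))]

theorem exists_toAdjoinSat_mul_eq (y : adjoinSat P x) :
    ∃ b c : P, toAdjoinSat x b * y = toAdjoinSat x c := by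
  obtain ⟨b, c, h⟩ := exists_eq_of_div y.1
  refine ⟨b, c, Subtype.ext ?_⟩
  change GrothendieckGroup.of b * y.1 = GrothendieckGroup.of c
  rw [h, mul_inv_cancel_left]

/-- The local model is a subfunctor of `U` on fs logarithmic schemes: every element of the saturation of
`P[x]` is a quotient of elements of `P`. -/
theorem modelMap_hom_ext {F : model θ x ⟶ U}
    (hF : ∀ p, gsec F (θ p) = modelSec θ x (toAdjoinSat x p))
    (hFa : ∀ a, F.f.appTop a = modelPull θ x a)
    (hT : IsFs T) {p q : T ⟶ model θ x} (h : p ≫ F = q ≫ F) : p = q := by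
  refine model_hom_ext θ x (fun a => ?_) fun y => ?_
  · have h₁ (r : T ⟶ model θ x) : r.f.appTop (modelPull θ x a) = (r ≫ F).f.appTop a :=
      (congrArg r.f.appTop (hFa a)).symm.trans (appTop_comp_apply _ _ _).symm
    exact (h₁ p).trans ((congrArg (fun r : T ⟶ U => r.f.appTop a) h).trans (h₁ q).symm)
  · obtain ⟨b, c, hbc⟩ := exists_toAdjoinSat_mul_eq y
    have h₁ (r : T ⟶ model θ x) : gsec (r ≫ F) (θ b) * gsec r (modelSec θ x y) =
        gsec (r ≫ F) (θ c) := by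
      rw [gsec_comp, gsec_comp, hF, hF, ← map_mul, ← map_mul, hbc]
    exact eq_of_mul_eq hT ((h₁ p).trans ((congrArg (fun r : T ⟶ U => gsec r (θ c)) h).trans
      ((h₁ q).symm.trans (congrArg (fun r : T ⟶ U => gsec r (θ b) * _) h.symm))))

/-- A homomorphism on `P^gp` sending `P` and `x` to sections of an fs logarithmic structure sends the
saturation of `P[x]` to sections. -/
theorem exists_adjoinSat_hom (hT : IsFs T) (ψ : P →* T.GlobalSec) (n : T.GlobalSec)
    (hx : GrothendieckGroup.lift ((qt T).comp ψ) x = qt T n) :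
    ∃ ψ' : adjoinSat P x →* T.GlobalSec, ∀ p, ψ' (toAdjoinSat x p) = ψ p := by
  let Ψ : GrothendieckGroup P →* T.GlobalGp := GrothendieckGroup.lift ((qt T).comp ψ)
  have hΨ : ∀ p, Ψ (GrothendieckGroup.of p) = qt T (ψ p) := fun p => groupLift_of _ p
  have hrange : ∀ y : adjoinSat P x, ∃ t : T.GlobalSec, qt T t = Ψ y := fun y => by
    obtain ⟨k, hk, hy⟩ := y.2
    have hle : MonoidHom.mrange (GrothendieckGroup.of : P →* GrothendieckGroup P) ⊔
        Submonoid.powers x ≤ (MonoidHom.mrange (qt T)).comap Ψ := by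
      refine sup_le ?_ ((Submonoid.powers_le).2 ⟨_, hx.symm⟩)
      rintro _ ⟨p, rfl⟩
      exact ⟨_, (hΨ p).symm⟩
    refine mem_range_qt_of_pow hT hk ?_
    rw [← map_pow]
    exact hle hy
  choose φ hφ using hrange
  have hinj := qt_injective hT
  refine ⟨{ toFun := φ
            map_one' := hinj (by rw [hφ, map_one]; exact map_one Ψ)
            map_mul' := fun y z => hinj (by rw [hφ, map_mul, hφ, hφ]; exact map_mul Ψ _ _) },
    fun p => hinj ((hφ _).trans (hΨ p))⟩

variable (x) in
/-- The local model represents the effective locus of a quotient of sections of a chart. -/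
theorem exists_isEffectiveLocus [IsAffine U.scheme] [Monoid.FG P] (hθ : U.Chart θ) {β : U.GlobalGp}
    {p₁ p₂ : P} {e : U.GlobalSecˣ}
    (hβ : β * qt U (θ p₂) = qt U (e : U.GlobalSec) * qt U (θ p₁))
    (hx : x * GrothendieckGroup.of p₂ = GrothendieckGroup.of p₁) :
    ∃ (X : LogScheme.{u}) (F : X ⟶ U) (m : X.GlobalSec), IsAffine X.scheme ∧
      IsEffectiveLocus β F m := by
  obtain ⟨F, hF, hFa⟩ := exists_modelMap x hθ
  refine ⟨model θ x, F, gsec F e * modelSec θ x (adjoinSatGen x), inferInstance, isFs_model θ x,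
    model_qt_eq hF hβ (Subtype.ext ((mul_comm _ _).trans hx)),
    fun hT _ _ h => modelMap_hom_ext hF hFa hT h, ?_⟩
  intro T hT a n hn
  have hΨx : GrothendieckGroup.lift ((qt T).comp ((gsec a).comp θ)) x =
      qt T (n * gsec a (↑e⁻¹ : U.GlobalSec)) := by
    have h := congrArg (ggpHom a) hβ
    rw [map_mul, map_mul] at h
    change ggp a β * ggp a (qt U (θ p₂)) = ggp a (qt U (e : U.GlobalSec)) * ggp a (qt U (θ p₁)) at h
    rw [ggp_qt, ggp_qt, ggp_qt, ← hn] at h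
    have h' := congrArg (GrothendieckGroup.lift ((qt T).comp ((gsec a).comp θ))) hx
    rw [map_mul, groupLift_of, groupLift_of] at h'
    change _ * qt T (gsec a (θ p₂)) = qt T (gsec a (θ p₁)) at h'
    have he : qt T (gsec a (↑e⁻¹ : U.GlobalSec)) * qt T (gsec a (e : U.GlobalSec)) = 1 := by
      rw [← map_mul, ← map_mul, Units.inv_mul, map_one, map_one]
    refine mul_right_cancel (b := qt T (gsec a (θ p₂))) (h'.trans ?_)
    rw [map_mul, mul_right_comm, h, mul_right_comm, mul_comm (qt T (gsec a (e : U.GlobalSec))), he,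
      one_mul]
  obtain ⟨ψ, hψ⟩ := exists_adjoinSat_hom hT ((gsec a).comp θ) _ hΨx
  obtain ⟨p, hp, hp'⟩ := exists_model_hom θ x a.f.appTop.hom ψ fun p =>
    (congrArg T.ex (hψ p)).trans (ex_gsec a _)
  refine ⟨p, hom_ext_of_chart hθ (ext_of_isAffine ?_) fun p' => ?_⟩
  · ext c
    exact (appTop_comp_apply _ _ _).trans ((congrArg p.f.appTop (hFa c)).trans (hp' c))
  · rw [gsec_comp, hF, hp, hψ]
    rfl

end Model

theorem etLocally_isAffine (T : LogScheme.{u}) : EtLocally T fun U _ => IsAffine U.scheme :=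
  etLocally_of_cover fun t => by
    obtain ⟨V : T.scheme.Opens, hV, ht, -⟩ := TopologicalSpace.Opens.isBasis_iff_nbhd.1
      T.scheme.isBasis_affineOpens (show t ∈ (⊤ : T.scheme.Opens) from trivial)
    exact ⟨V, V.ι, inferInstance, ⟨t, ht⟩, rfl, hV⟩

/-- Étale locally `α` is, up to a unit, a quotient of sections of a chart, so that the local models
represent the effective loci of `α` and of its inverse. -/
theorem etLocally_effective (hS : IsFs S) (α : S.GlobalGp) : EtLocally S fun U a =>
    IsAffine U.scheme ∧ ∀ i, ∃ (X : LogScheme.{u}) (F : X ⟶ U) (m : X.GlobalSec),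
      IsAffine X.scheme ∧ IsEffectiveLocus (ggp a α ^ chartSign i) F m := by
  refine (etLocally_exists_div α).bind ?_
  rintro U₁ a₁ ha₁ ⟨β, γ, hα⟩
  refine (isFs_iff.1 (ha₁.isFs hS)).bind ?_
  rintro U₂ a₂ ha₂ ⟨P, _, θ, _, -, -, hθ⟩
  refine (hθ.exists_eq (gsec a₂ β)).bind ?_
  rintro U₃ a₃ ha₃ ⟨p, e, he, hp⟩
  refine ((hθ.comp ha₃).exists_eq (gsec a₃ (gsec a₂ γ))).bind ?_
  rintro U₄ a₄ ha₄ ⟨q, e', he', hq⟩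
  refine (etLocally_isAffine U₄).mono ?_
  intro U₅ a₅ ha₅ hU
  refine ⟨hU, ?_⟩
  have hθ' := ((hθ.comp ha₃).comp ha₄).comp ha₅
  have h : ggp (a₅ ≫ a₄ ≫ a₃ ≫ a₂ ≫ a₁) α * (qt U₅ (gsec a₅ (gsec a₄ e)) *
      qt U₅ (gsec a₅ (gsec a₄ (gsec a₃ (θ p))))) = qt U₅ (gsec a₅ e') *
      qt U₅ (gsec a₅ (gsec a₄ (gsec a₃ (θ q)))) := by
    have h₁ : ggp a₁ α * qt U₁ β = qt U₁ γ := by rw [hα, mul_comm, mul_inv_cancel_left]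
    have h₂ := congrArg (ggpHom (a₅ ≫ a₄ ≫ a₃ ≫ a₂)) h₁
    rw [map_mul] at h₂
    change ggp _ (ggp a₁ α) * ggp _ (qt U₁ β) = ggp _ (qt U₁ γ) at h₂
    rw [ggp_qt, ggp_qt, ← ggp_comp] at h₂
    simp only [gsec_comp, Category.assoc] at h₂
    rw [hp, hq, map_mul, map_mul, map_mul, map_mul, map_mul] at h₂
    exact h₂
  have hu := (he.map (gsec a₄)).map (gsec a₅)
  have hu' := he'.map (gsec a₅)
  obtain ⟨v, hv⟩ := hu
  obtain ⟨v', hv'⟩ := hu'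
  rw [← hv, ← hv'] at h
  have inv : ∀ w : U₅.GlobalSecˣ, qt U₅ (↑w⁻¹ : U₅.GlobalSec) = (qt U₅ w)⁻¹ := fun w =>
    eq_inv_of_mul_eq_one_left (by rw [← map_mul, Units.inv_mul, map_one])
  simp only [Category.assoc]
  intro i
  match i with
  | 0 =>
    refine exists_isEffectiveLocus (GrothendieckGroup.of q * (GrothendieckGroup.of p)⁻¹) hθ'
      (e := v⁻¹ * v') (p₁ := q) (p₂ := p) ?_ (inv_mul_cancel_right _ _)
    rw [Units.val_mul, map_mul, inv, mul_assoc, eq_inv_mul_iff_mul_eq, mul_left_comm]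
    refine Eq.trans ?_ h
    rw [chartSign, zpow_one]
    rfl
  | 1 =>
    refine exists_isEffectiveLocus (GrothendieckGroup.of p * (GrothendieckGroup.of q)⁻¹) hθ'
      (e := v'⁻¹ * v) (p₁ := p) (p₂ := q) ?_ (inv_mul_cancel_right _ _)
    rw [Units.val_mul, map_mul, inv, mul_assoc, eq_inv_mul_iff_mul_eq, mul_left_comm]
    refine Eq.trans (congrArg (_ * ·) h.symm) ?_
    rw [chartSign, zpow_neg_one]
    exact inv_mul_cancel_left _ _

theorem exists_comparableLocus (S : FsLogScheme.{u}) (α : S.obj.GlobalGp) :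
    ∃ (X : FsLogScheme.{u}) (p : X ⟶ S), IsComparableLocus α p.hom := by
  obtain ⟨X, F, hX, hF⟩ := exists_isComparableLocus α (etLocally_effective S.property α)
  exact ⟨⟨X, hX⟩, ⟨F⟩, hF⟩

end LogScheme
end
end LogGeometry

namespace LogGeometry
noncomputable section
namespace LogScheme

/-! ### The blowup of the plane is a toric modification -/

variable {S : Scheme.{u}} {Y : LogScheme.{u}}

theorem hom_ext_of_generated {G : Generators S} {F F' : ofGenerators G ⟶ Y} (h : F.f = F'.f) :
    F = F' :=
  Hom_ext h fun _ _ _ _ g w w' m => genEx_injective G ((F.ex_pl g w m).trans (F'.ex_pl g w' m).symm)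

section MonoidAlgebra

variable {P : Type} [AddCommMonoid P]

theorem chi_add (p q : P) : chi.{u} (p + q) = chi p * chi q := by
  simp [chi, AddMonoidAlgebra.single_mul_single]

theorem chi_zero : chi.{u} (0 : P) = 1 := rfl

theorem chi_nsmul (n : ℕ) (p : P) : chi.{u} (n • p) = chi p ^ n := by
  induction n with
  | zero => rw [zero_smul, pow_zero, chi_zero]
  | succ n ih => rw [succ_nsmul, chi_add, ih, pow_succ]

theorem toric_ringHom_ext {A : Type*} [CommRing A] {f g : AddMonoidAlgebra (ULift.{u} ℤ) P →+* A}
    (h : ∀ p, f (chi p) = g (chi p)) : f = g := by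
  refine AddMonoidAlgebra.ringHom_ext (fun r => ?_) h
  exact RingHom.congr_fun (uliftInt_hom_ext (f.comp AddMonoidAlgebra.singleZeroRingHom)
    (g.comp AddMonoidAlgebra.singleZeroRingHom)) r

/-- The ring homomorphism from `ℤ[P]` given by a homomorphism on `P`. -/
def toricEval {A : Type*} [CommRing A] (ψ : Multiplicative P →* A) :
    AddMonoidAlgebra (ULift.{u} ℤ) P →+* A :=
  AddMonoidAlgebra.liftNCRingHom (uliftIntHom A) ψ fun _ _ => mul_comm _ _

theorem toricEval_chi {A : Type*} [CommRing A] (ψ : Multiplicative P →* A) (p : P) :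
    toricEval.{u} ψ (chi p) = ψ (Multiplicative.ofAdd p) := by
  refine (AddMonoidAlgebra.liftNC_single _ _ _ _).trans ?_
  exact (congrArg (· * _) (map_one (uliftIntHom.{u} A))).trans (one_mul _)

theorem affineToric_ex_injective :
    Function.Injective ((affineToric.{u} P).ex (u := 𝟙 (affineToric.{u} P).scheme)) :=
  @genEx_injective _ _ _ (𝟙 (affineToric.{u} P).scheme)
    (inferInstanceAs (Etale (𝟙 (affineToric.{u} P).scheme)))

end MonoidAlgebra

section Cone

variable (g : (Fin 2 → ℤ) ≃+ (Fin 2 → ℤ))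

/-- The submonoid of the lattice of the vectors with non-negative coordinates with respect to `g`. -/
def quadrant : AddSubmonoid (Fin 2 → ℤ) where
  carrier := {m | ∀ k, 0 ≤ g m k}
  zero_mem' k := by simp
  add_mem' ha hb k := by
    rw [map_add]
    exact add_nonneg (ha k) (hb k)

/-- The generators of a quadrant. -/
def quadrantGen (k : Fin 2) : quadrant g :=
  ⟨g.symm (Pi.single k 1), fun l => by
    rw [AddEquiv.apply_symm_apply, Pi.single_apply]
    split_ifs <;> simp⟩

theorem apply_quadrantGen (k : Fin 2) : g (quadrantGen g k) = Pi.single k 1 :=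
  g.apply_symm_apply _

theorem eq_sum_symm_single (m : Fin 2 → ℤ) : m = ∑ k, g m k • g.symm (Pi.single k 1) := by
  apply g.injective
  rw [map_sum]
  refine (Finset.univ_sum_single (g m)).symm.trans (Finset.sum_congr rfl fun k _ => ?_)
  rw [map_zsmul, AddEquiv.apply_symm_apply, ← Pi.single_smul, smul_eq_mul, mul_one]

theorem eq_sum_quadrantGen (m : quadrant g) :
    m = ∑ k, (g m k).toNat • quadrantGen g k := by
  refine Subtype.ext ((eq_sum_symm_single g m).trans ?_)
  rw [AddSubmonoidClass.coe_finsetSum]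
  refine Finset.sum_congr rfl fun k _ => ?_
  change _ = (g m k).toNat • g.symm (Pi.single k 1)
  rw [← natCast_zsmul, Int.toNat_of_nonneg (m.2 k)]

theorem isToricMonoid_quadrant : IsToricMonoid (quadrant g) where
  fg := by
    refine ⟨Finset.univ.image fun k => (quadrantGen g k : Fin 2 → ℤ), le_antisymm ?_ ?_⟩
    · refine AddSubmonoid.closure_le.2 fun m hm => ?_
      obtain ⟨k, -, rfl⟩ := Finset.mem_image.1 hm
      exact (quadrantGen g k).2
    · intro m hm
      rw [show m = _ from congrArg Subtype.val (eq_sum_quadrantGen g ⟨m, hm⟩),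
        AddSubmonoidClass.coe_finsetSum]
      exact sum_mem fun k _ => nsmul_mem (AddSubmonoid.subset_closure
        (Finset.mem_image_of_mem _ (Finset.mem_univ k))) _
  saturated k m hk hm l := by
    have h := hm l
    rw [map_nsmul, Pi.smul_apply, nsmul_eq_mul] at h
    exact nonneg_of_mul_nonneg_right h (by exact_mod_cast hk)
  closure_eq_top := by
    refine eq_top_iff.2 fun m _ => ?_
    rw [eq_sum_symm_single g m]
    exact sum_mem fun k _ => zsmul_mem (AddSubgroup.subset_closure (quadrantGen g k).2) _

/-- The homomorphism sending a vector to the monomial with exponents its coordinates. -/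
def quadrantMonomial : Multiplicative (quadrant g) →* PlaneRing.{u} where
  toFun m := ∏ k, MvPolynomial.X k ^ (g m.toAdd k).toNat
  map_one' := by simp
  map_mul' m n := by
    rw [← Finset.prod_mul_distrib]
    refine Finset.prod_congr rfl fun k _ => ?_
    rw [← pow_add, ← Int.toNat_add (m.toAdd.2 k) (n.toAdd.2 k)]
    congr 2
    exact congrFun (map_add g (m.toAdd : Fin 2 → ℤ) n.toAdd) k

/-- The isomorphism `ℤ[Q] ≃ ℤ[x₀, x₁]` for a quadrant `Q`. -/
def quadrantToPlane : AddMonoidAlgebra (ULift.{u} ℤ) (quadrant g) →+* PlaneRing.{u} :=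
  toricEval (quadrantMonomial g)

theorem quadrantToPlane_chi (m : quadrant g) : quadrantToPlane.{u} g (chi m) =
    ∏ k, MvPolynomial.X k ^ (g m k).toNat :=
  toricEval_chi _ _

/-- The inverse of `quadrantToPlane`. -/
def planeToQuadrant : PlaneRing.{u} →+* AddMonoidAlgebra (ULift.{u} ℤ) (quadrant g) :=
  planeEval fun k => chi (quadrantGen g k)

theorem planeToQuadrant_X (k : Fin 2) :
    planeToQuadrant.{u} g (MvPolynomial.X k) = chi (quadrantGen g k) :=
  planeEval_X _ k

theorem quadrantToPlane_comp : (quadrantToPlane.{u} g).comp (planeToQuadrant g) = .id _ := by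
  have h : ∀ k, quadrantToPlane.{u} g (planeToQuadrant g (MvPolynomial.X k)) = MvPolynomial.X k :=
    fun k => by
      rw [planeToQuadrant_X, quadrantToPlane_chi, apply_quadrantGen, Finset.prod_eq_single k]
      · simp
      · intro l _ hl
        simp [hl]
      · exact fun h => absurd (Finset.mem_univ k) h
  exact plane_hom_ext zero_ne_one (h 0) (h 1)

theorem planeToQuadrant_comp : (planeToQuadrant.{u} g).comp (quadrantToPlane g) = .id _ := by
  refine toric_ringHom_ext fun m => ?_
  have h : ∀ n : Fin 2 → ℕ, chi.{u} (∑ k, n k • quadrantGen g k) =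
      ∏ k, chi (quadrantGen g k) ^ n k := fun n => by
    rw [Fin.sum_univ_two, Fin.prod_univ_two, chi_add, chi_nsmul, chi_nsmul]
  rw [RingHom.comp_apply, quadrantToPlane_chi, map_prod]
  refine .trans (Finset.prod_congr rfl fun k _ => ?_) ((h _).symm.trans
    (congrArg chi (eq_sum_quadrantGen g m).symm))
  rw [map_pow, planeToQuadrant_X]

/-- The affine toric variety of a quadrant is the plane. -/
def quadrantIso : A2.{u} ≅ affineToric.{u} (quadrant g) where
  hom := homOfGenerators (globalGenerators (Set.range fun i : Fin 2 =>
      specFun (MvPolynomial.X i : PlaneRing.{u})))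
    (Spec.map (CommRingCat.ofHom (quadrantToPlane g))) (by
      rintro _ ⟨m, rfl⟩
      rw [specFun_map, quadrantToPlane_chi, specFun, map_prod]
      refine Submonoid.prod_mem _ fun k _ => ?_
      rw [map_pow]
      exact Submonoid.pow_mem (genSections (globalGenerators (Set.range fun i : Fin 2 =>
        specFun (MvPolynomial.X i : PlaneRing.{u}))) _) (mem_genSections_global ⟨k, rfl⟩) _)
  inv := homOfGenerators (globalGenerators (Set.range fun p : quadrant g => specFun (chi p)))
    (Spec.map (CommRingCat.ofHom (planeToQuadrant g))) (by
      rintro _ ⟨k, rfl⟩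
      rw [specFun_map, planeToQuadrant_X]
      exact mem_genSections_global ⟨quadrantGen g k, rfl⟩)
  hom_inv_id := hom_ext_of_generated (spec_hom_ext fun r => by
    refine (appTop_comp_apply _ _ _).trans ((congrArg _ (specFun_map _ _)).trans
      ((specFun_map _ _).trans ?_))
    rw [← RingHom.comp_apply, quadrantToPlane_comp]
    exact (appTop_id_apply _).symm)
  inv_hom_id := hom_ext_of_generated (spec_hom_ext fun r => by
    refine (appTop_comp_apply _ _ _).trans ((congrArg _ (specFun_map _ _)).trans
      ((specFun_map _ _).trans ?_))
    rw [← RingHom.comp_apply, planeToQuadrant_comp]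
    exact (appTop_id_apply _).symm)

theorem ex_gsec_quadrantIso_inv (k : Fin 2) :
    (affineToric.{u} (quadrant g)).ex (gsec (quadrantIso g).inv (planeSec k)) =
      specFun (chi (quadrantGen g k)) :=
  (ex_gsec _ _).trans ((specFun_map _ _).trans (congrArg specFun (planeToQuadrant_X g k)))

theorem ex_gsec_affineToricMap {P Q : Type} [AddCommMonoid P] [AddCommMonoid Q] (φ : P →+ Q)
    {m : (affineToric.{u} P).GlobalSec} {p : P} (h : (affineToric.{u} P).ex m = specFun (chi p)) :
    (affineToric.{u} Q).ex (gsec (affineToricMap φ) m) = specFun (chi (φ p)) := by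
  refine (ex_gsec _ _).trans ((congrArg (affineToricMap.{u} φ).f.appTop h).trans
    ((specFun_map _ _).trans (congrArg specFun ?_)))
  simp [chi]

end Cone

/-- The change of coordinates with `eᵢ ↦ eᵢ` and `eⱼ - eᵢ ↦ eⱼ`, where `j = 1 - i`. -/
def shear (i : Fin 2) : (Fin 2 → ℤ) ≃+ (Fin 2 → ℤ) where
  toFun m k := if k = i then m i + m (1 - i) else m k
  invFun m k := if k = i then m i - m (1 - i) else m k
  left_inv m := by
    funext k
    by_cases hk : k = i
    · simp [hk, (ne_one_sub i).symm]
    · simp [hk]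
  right_inv m := by
    funext k
    by_cases hk : k = i
    · simp [hk, (ne_one_sub i).symm]
    · simp [hk]
  map_add' m n := by
    funext k
    by_cases hk : k = i
    · simp only [hk, if_true, Pi.add_apply]
      ring
    · simp only [hk, if_false, Pi.add_apply]

/-- The monoid of the plane. -/
abbrev planeCone : AddSubmonoid (Fin 2 → ℤ) := quadrant (AddEquiv.refl _)

/-- The monoid of the `i`-th chart of the blowup. -/
abbrev chartCone (i : Fin 2) : AddSubmonoid (Fin 2 → ℤ) := quadrant (shear i)

theorem planeCone_le (i : Fin 2) : planeCone ≤ chartCone i := fun m hm k => by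
  change 0 ≤ if k = i then m i + m (1 - i) else m k
  split_ifs
  · exact add_nonneg (hm _) (hm _)
  · exact hm k

theorem shear_symm_self (i : Fin 2) : (quadrantGen (shear i) i : Fin 2 → ℤ) = Pi.single i 1 := by
  funext k
  change (if k = i then (Pi.single i 1 : Fin 2 → ℤ) i - (Pi.single i 1 : Fin 2 → ℤ) (1 - i) else
    (Pi.single i 1 : Fin 2 → ℤ) k) = _
  by_cases hk : k = i
  · simp [hk, (ne_one_sub i).symm]
  · simp [hk]

theorem shear_symm_add (i : Fin 2) : (quadrantGen (shear i) i : Fin 2 → ℤ) +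
    (quadrantGen (shear i) (1 - i) : Fin 2 → ℤ) = Pi.single (1 - i) 1 := by
  rw [shear_symm_self]
  funext k
  change _ + (if k = i then (Pi.single (1 - i) 1 : Fin 2 → ℤ) i -
    (Pi.single (1 - i) 1 : Fin 2 → ℤ) (1 - i) else (Pi.single (1 - i) 1 : Fin 2 → ℤ) k) = _
  by_cases hk : k = i
  · simp [hk, ne_one_sub i]
  · simp [hk]

/-- The charts of the blowup as a toric variety. -/
def blPiece (i : Fin 2) : affineToric.{u} (chartCone i) ⟶ Bl.{u} :=
  (quadrantIso (shear i)).inv ≫ blIncl i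

/-- On the `i`-th chart the blowup is given by the inclusion of monoids. -/
theorem blPiece_blowupMap (i : Fin 2) : blPiece.{u} i ≫ blowupMap =
    affineToricMap (AddSubmonoid.inclusion (planeCone_le i)) ≫ (quadrantIso (.refl _)).inv := by
  have h (k : Fin 2) : (affineToric.{u} (chartCone i)).ex (gsec (affineToricMap
      (AddSubmonoid.inclusion (planeCone_le i)) ≫ (quadrantIso (.refl _)).inv) (planeSec k)) =
      specFun (chi (AddSubmonoid.inclusion (planeCone_le i) (quadrantGen _ k))) := by
    rw [gsec_comp]
    exact ex_gsec_affineToricMap _ (ex_gsec_quadrantIso_inv _ k)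
  refine A2_hom_ext (ne_one_sub i) (affineToric_ex_injective (.trans ?_ (h i).symm))
    (affineToric_ex_injective (.trans ?_ (h (1 - i)).symm))
  · rw [blPiece, Category.assoc, gsec_comp, gsec_blIncl_blowupMap_self, ex_gsec_quadrantIso_inv]
    exact congrArg (fun m => specFun (chi m)) (Subtype.ext (shear_symm_self i))
  · rw [blPiece, Category.assoc, gsec_comp, gsec_blIncl_blowupMap_other, map_mul, map_mul,
      ex_gsec_quadrantIso_inv, ex_gsec_quadrantIso_inv]
    refine (specFun_mul _ _).symm.trans ((congrArg specFun (chi_add _ _).symm).trans ?_)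
    exact congrArg (fun m => specFun (chi m)) (Subtype.ext (shear_symm_add i))

theorem isStrictOpenImmersion_blPiece (i : Fin 2) : IsStrictOpenImmersion (blPiece.{u} i) := by
  refine ⟨?_, (isStrictEtale_of_iso (quadrantIso (shear i)).symm).comp (isStrictEtale_blIncl i)⟩
  have h₁ : IsIso (quadrantIso.{u} (shear i)).inv.f :=
    ⟨(quadrantIso.{u} (shear i)).hom.f, congrArg Hom.f (quadrantIso.{u} (shear i)).inv_hom_id,
      congrArg Hom.f (quadrantIso.{u} (shear i)).hom_inv_id⟩
  have h₂ : IsOpenImmersion (blIncl.{u} i).f := by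
    rw [blIncl_f]
    exact inferInstanceAs (IsOpenImmersion (blChart.{u} (ne_one_sub i)))
  exact inferInstanceAs (IsOpenImmersion ((quadrantIso.{u} (shear i)).inv.f ≫ (blIncl.{u} i).f))

theorem blPiece_cover (x : Bl.{u}.scheme) :
    ∃ (i : Fin 2) (y : (affineToric.{u} (chartCone i)).scheme), (blPiece i).f y = x := by
  obtain ⟨i, y, hy⟩ := blCover x
  refine ⟨i, (quadrantIso (shear i)).hom.f y, Eq.trans ?_ hy⟩
  have h : (quadrantIso (shear i)).hom ≫ blPiece.{u} i = blIncl i := Iso.hom_inv_id_assoc _ _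
  exact congrArg (fun F : A2.{u} ⟶ Bl.{u} => F.f y) h

/-- All monomials are invertible on the torus, so its logarithmic structure is trivial. -/
theorem isFs_torus : IsFs (affineToric.{u} (Fin 2 → ℤ)) := by
  let R := AddMonoidAlgebra (ULift.{u} ℤ) (Fin 2 → ℤ)
  have hid : Etale (𝟙 (affineToric.{u} (Fin 2 → ℤ)).scheme) :=
    inferInstanceAs (Etale (𝟙 (Spec (.of R))))
  have h1 : (affineToric.{u} (Fin 2 → ℤ)).ex (u := 𝟙 (affineToric.{u} (Fin 2 → ℤ)).scheme) 1 =
      specFun (1 : R) := (map_one _).trans specFun_one.symm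
  have h : (affineToric.{u} (Fin 2 → ℤ)).Chart (pairHom 1 1) := by
    refine chartAt_id_iff.1 ?_
    refine @chartAt_ofGenerators _ _ R _ 1 1 (regPair_one fun x hx => (one_mul x).symm.trans hx)
      (𝟙 (affineToric.{u} (Fin 2 → ℤ)).scheme) hid (1 : (affineToric.{u} (Fin 2 → ℤ)).GlobalSec)
      (1 : (affineToric.{u} (Fin 2 → ℤ)).GlobalSec) h1 h1 ?_
    rintro _ ⟨_, ⟨p, rfl⟩, rfl⟩ V a b h
    have hp : IsUnit (chi.{u} p) := IsUnit.of_mul_eq_one (chi (-p)) (by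
      rw [← chi_add, add_neg_cancel, chi_zero])
    exact exists_monomial_unit _ _ ((hp.map (Scheme.ΓSpecIso (.of R)).inv.hom).map b.appTop.hom)
  exact isFs_iff.2 (EtLocally.of_self ⟨N2, inferInstance, _, fg_N2, inferInstance,
    isSaturatedMonoid_N2, h⟩)

/-- The charts of the blowup agree on the torus, because their compositions with the blowup do. -/
theorem torus_blPiece (i i' : Fin 2) : affineToricMap (chartCone i).subtype ≫ blPiece.{u} i =
    affineToricMap (chartCone i').subtype ≫ blPiece i' := by
  refine blowup_hom_ext isFs_torus ?_
  have h (i k : Fin 2) : (affineToric.{u} (Fin 2 → ℤ)).ex (gsec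
      ((affineToricMap (chartCone i).subtype ≫ blPiece.{u} i) ≫ blowupMap) (planeSec k)) =
      specFun (chi (quadrantGen (.refl _) k : Fin 2 → ℤ)) := by
    rw [Category.assoc, blPiece_blowupMap, gsec_comp, gsec_comp]
    exact ex_gsec_affineToricMap _ (ex_gsec_affineToricMap _ (ex_gsec_quadrantIso_inv _ k))
  exact A2_hom_ext zero_ne_one (affineToric_ex_injective ((h i 0).trans (h i' 0).symm))
    (affineToric_ex_injective ((h i 1).trans (h i' 1).symm))

/-- The Rees algebra is generated over its part of degree zero, which is the coordinate ring of the
plane, by the two elements `xᵢ T`. -/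
theorem isProper_blowupMap : IsProper blowupMap.{u}.f := by
  have h₁ : Algebra.FiniteType (blGrading.{u} 0) (reesAlgebra originIdeal.{u}) :=
    ⟨⟨Finset.univ.image blT.{u}, by
      rw [Finset.coe_image, Finset.coe_univ, Set.image_univ]
      exact adjoin_blT⟩⟩
  have h₂ : IsClosedImmersion (Spec.map (CommRingCat.ofHom
      (algebraMap PlaneRing.{u} (blGrading.{u} 0)))) :=
    IsClosedImmersion.spec_of_surjective _ fun z => ⟨_, Subtype.ext (blConst_coeff z.2).symm⟩
  have h₃ : IsProper (Proj.toSpecZero blGrading.{u}) := inferInstance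
  exact inferInstanceAs (IsProper (Proj.toSpecZero blGrading.{u} ≫ Spec.map (CommRingCat.ofHom
    (algebraMap PlaneRing.{u} (blGrading.{u} 0)))))

theorem isToricModification_blowupMap : IsToricModification blowupMap.{u} := by
  refine ⟨2, planeCone, isToricMonoid_quadrant _, quadrantIso (.refl _), 1, chartCone,
    fun i => isToricMonoid_quadrant _, planeCone_le, blPiece, isStrictOpenImmersion_blPiece,
    blPiece_cover, fun i => ?_, torus_blPiece, isProper_blowupMap⟩
  rw [← Category.assoc, blPiece_blowupMap, Category.assoc, Iso.inv_hom_id, Category.comp_id]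

end LogScheme
end
end LogGeometry

theorem mainTheorem8 :
    -- The map `P¹ → G_log` is representable by logarithmic modifications.
    IsLogModification.{u}.presheaf p1ToGlog ∧
    -- Étale locally, a section `α` of `Mᵍᵖ` is a quotient of sections `β`, `γ` of `M`.
    (∀ (S : FsLogScheme.{u}) (α : S.obj.gpSec S.obj.top) (s : S.obj.scheme),
      ∃ (U : FsLogScheme.{u}) (a : U ⟶ S) (y : U.obj.scheme) (β γ : U.obj.sec U.obj.top),
        IsStrictEtale a.hom ∧ a.hom.f y = s ∧
        gpPullback a.hom α = (U.obj.secToGp _ β)⁻¹ * U.obj.secToGp _ γ) ∧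
    -- Sections `β`, `γ` of `M` are the same as a map to the affine plane.
    (∀ (S : FsLogScheme.{u}) (β γ : S.obj.sec S.obj.top),
      ∃! h : S.obj ⟶ A2.{u}, pullSec h (A2.coord 0) = β ∧ pullSec h (A2.coord 1) = γ) ∧
    -- The base change of `P¹ → G_log` along `α = β⁻¹ γ` is the base change of the blowup of the
    -- affine plane at the origin along `(β, γ)`.
    (∀ (S : FsLogScheme.{u}) (α : S.obj.gpSec S.obj.top) (h : S.obj ⟶ A2.{u}),
      α = (S.obj.secToGp _ (pullSec h (A2.coord 0)))⁻¹ *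
        S.obj.secToGp _ (pullSec h (A2.coord 1)) →
      Nonempty (Over.mk (pullback.snd p1ToGlog (toGlog S α)) ≅
        Over.mk (pullback.snd (pointsMap blowupMap) (toPoints S h)))) := by
  refine ⟨presheaf_isLogModification isToricModification_blowupMap exists_comparableLocus,
    exists_quotient, fun S β γ => existsUnique_A2_hom β γ, fun S α h hα => ?_⟩
  refine nonempty_pullback_iso S α h (hα.trans ?_)
  rw [ggp_planeRatio h 0, chartSign, zpow_one]
  rfl
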